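/- Let $M$ be a smooth manifold and $n\ge 0$ (all vector bundles are smooth, real and of finite rank). A split Lie $n$-algebroid $A=A_1[1]\oplus\dots\oplus A_n[n]$ over $M$ is given by a homological vector field $\mathcal Q_A$, i.e. a degree $1$ graded derivation of $\Gamma(S(A^*))$ with $\mathcal Q_A^2=0$, where $\Gamma(A_i^*)$ sits in degree $i$. An $(n+1)$-representation of $A$ on a graded bundle $\mathcal E=E_0[0]\oplus E_1[1]\oplus\dots\oplus E_n[n]$ is a degree $1$ operator $\mathcal D$ on $\Gamma(S(A^*))\otimes\Gamma(\mathcal E)$ with $\mathcal D^2=0$ and $\mathcal D(\xi s)=\mathcal Q_A(\xi)s+(-1)^{|\xi|}\xi\,\mathcal D(s)$. An isomorphism of such representations is a degree-preserving $\Gamma(S(A^*))$-linear bijection that commutes with the differentials. **Decompositions of VB-Lie $n$-algebroids.** Let $(D_i,V,A_i,M)$, $i=1,\dots,n$, be double vector bundles with cores $C_i$. Let $D=D_1[1]\oplus\dots\oplus D_n[n]\to V$ carry a split Lie $n$-algebroid structure $\mathcal Q_D$ over $V$ that is linear over $A\to M$: the anchor $D_1\to TV$ and the maps $\partial\colon D_i\to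 D_{i-1}$ are morphisms of double vector bundles, brackets of linear sections are linear, brackets of linear sections with one core section are core sections, and brackets of linear sections with at least two core sections vanish (so $(D,V,A,M)$ is a VB-Lie $n$-algebroid). Then there is a unique split Lie $n$-algebroid structure $\mathcal Q_A$ on $A$ with $\mathcal Q_D\circ\pi_A^\star=\pi_A^\star\circ\mathcal Q_A$ for the projection $\pi_A\colon D\to A$. A decomposition of all the $D_i$ (isomorphisms $V\times_MA_i\times_MC_i\cong D_i$ of double vector bundles inducing the identity on $V$, $A_i$ and $C_i$; equivalently horizontal lifts $h_i\colon\Gamma(A_i)\to\Gamma^l_V(D_i)$) determines a unique $(n+1)$-representation $\mathcal D_h$ of $(A,\mathcal Q_A)$ on $V[0]\oplus C$, $C=C_1[1]\oplus\dots\oplus C_n[n]$, by the requirement that the dual representation satisfies $$\mathcal D_h^*(\psi)=\mathcal Q_D(\ell_\psi),\qquad \mathcal D_h^*(\gamma)=\mathcal Q_D(\gamma)\qquad(\psi\in\Gamma(V^*),\ \gamma\in\Gamma(C_i^*)),$$ where $\ell_\psi$ is the fibrewise linear function on $V$ defined by $\psi$, where $\gamma$ is seen as a form on $D_i$ through the decomposition,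 and where $\mathcal D_h,\mathcal D_h^*$ are dual in the sense that $\mathcal Q_A\langle\eta,\omega\rangle=\langle\mathcal D_h\eta,\omega\rangle+(-1)^{|\eta|}\langle\eta,\mathcal D_h^*\omega\rangle$, with $\langle\xi\otimes e,\zeta\otimes\varphi\rangle=(-1)^{|e||\zeta|}\varphi(e)\,\xi\zeta$. Let $h=(h_i)$ and $h'=(h_i')$ be two decompositions. Their difference $h_i-h_i'$ is given by a unique $\Delta^i\in\Gamma(A_i^*\otimes V^*\otimes C_i)$. The $\Gamma(S(A^*))$-linear map $\mu=\mathrm{id}\oplus\Delta$ of $\Gamma(S(A^*))\otimes\Gamma(V[0]\oplus C)$ with $$\mu(v)=v+\sum_{i=1}^n\Delta^i(\,\cdot\,,v)\in\Gamma(V)\oplus\bigoplus_i\Gamma(A_i^*)\otimes\Gamma(C_i),\qquad \mu(c)=c\qquad(v\in\Gamma(V),\ c\in\Gamma(C_i))$$ is an isomorphism of $(n+1)$-representations of $A$ from $\mathcal D_h$ to $\mathcal D_{h'}$, and $\mu^{-1}=\mathrm{id}\oplus(-\Delta)$. **Change of connections in the adjoint representation.** Let $(A,\mathcal Q)$ be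 a split Lie $n$-algebroid over $M$. For $TM$-connections $\nabla=(\nabla^{A_i})$ on the $A_i$, let $\mu_\nabla$ be the isomorphism of $\Gamma(S(A^*))$-modules from $\Gamma(S(A^*))\otimes\Gamma(TM[0]\oplus A_1[1]\oplus\dots\oplus A_n[n])$ to the graded derivations of $\Gamma(S(A^*))$ that maps a vector field $X$ to $(f\mapsto X(f),\ \varepsilon\mapsto\nabla^*_X\varepsilon)$ and $a\in\Gamma(A_i)$ to $(f\mapsto 0,\ \varepsilon\mapsto\varepsilon(a))$, for $f\in C^\infty(M)$ and forms $\varepsilon$ on the $A_j$. The adjoint representation $\mathrm{ad}_\nabla$ is the $(n+1)$-representation with differential $\mu_\nabla^{-1}\circ[\mathcal Q,\cdot\,]\circ\mu_\nabla$. For any two choices $\nabla,\nabla'$ of $TM$-connections, $\mathrm{id}\oplus(\nabla'-\nabla)$, i.e. $X\mapsto X+\sum_i(\nabla'^{A_i}_X-\nabla^{A_i}_X)$ with $\nabla'^{A_i}_X-\nabla^{A_i}_X\in\Gamma(A_i^*)\otimes\Gamma(A_i)$ and $a\mapsto a$, is an isomorphism of representations $\mathrm{ad}_\nabla\to\mathrm{ad}_{\nabla'}$,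 with inverse $\mathrm{id}\oplus(\nabla-\nabla')$. -/

import Mathlib

open scoped Manifold ContDiff Bundle Topology TensorProduct
open Bundle

namespace VBLie

noncomputable section

universe u v w

/-! ### Smooth real vector bundles, their sections and their forms -/

/-- A smooth real vector bundle of finite rank over `M`, with total space, fibres and topology
bundled together. -/
structure VB {EB : Type v} [NormedAddCommGroup EB] [NormedSpace ℝ EB] {HB : Type w}
    [TopologicalSpace HB] (I : ModelWithCorners ℝ EB HB)
    (M : Type u) [TopologicalSpace M] [ChartedSpace HB M] where
  F : Type u
  [normF : NormedAddCommGroup F]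
  [spaceF : NormedSpace ℝ F]
  [finF : FiniteDimensional ℝ F]
  E : M → Type u
  [groupE : ∀ x, AddCommGroup (E x)]
  [moduleE : ∀ x, Module ℝ (E x)]
  [topE : ∀ x, TopologicalSpace (E x)]
  [topGroupE : ∀ x, IsTopologicalAddGroup (E x)]
  [contSMulE : ∀ x, ContinuousSMul ℝ (E x)]
  [topTot : TopologicalSpace (TotalSpace F E)]
  [fiberBundle : FiberBundle F E]
  [vectorBundle : VectorBundle ℝ F E]
  [smoothBundle : ContMDiffVectorBundle ∞ F E I]

attribute [instance] VB.normF VB.spaceF VB.finF VB.groupE VB.moduleE VB.topE VB.topGroupE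
  VB.contSMulE VB.topTot VB.fiberBundle VB.vectorBundle VB.smoothBundle

/-- A family of real vector spaces over `M` together with the set of those of its sections that
count as smooth. -/
structure SmoothFamily (M : Type u) where
  W : M → Type v
  [groupW : ∀ x, AddCommGroup (W x)]
  [moduleW : ∀ x, Module ℝ (W x)]
  IsSmooth : (∀ x, W x) → Prop

attribute [instance] SmoothFamily.groupW SmoothFamily.moduleW

section Bundles

variable {EB : Type v} [NormedAddCommGroup EB] [NormedSpace ℝ EB] {HB : Type w}
  [TopologicalSpace HB] {I : ModelWithCorners ℝ EB HB}
  {M : Type u} [TopologicalSpace M] [ChartedSpace HB M]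

/-- The total space of a vector bundle. -/
abbrev VB.Tot (V : VB I M) : Type u := TotalSpace V.F V.E

/-- The model with corners of the total space of a vector bundle. -/
abbrev VB.model (V : VB I M) : ModelWithCorners ℝ (EB × V.F) (ModelProd HB V.F) :=
  I.prod 𝓘(ℝ, V.F)

instance (V : VB I M) (x : M) : FiniteDimensional ℝ (V.E x) :=
  VectorBundle.finiteDimensional ℝ V.F V.E x

instance (V : VB I M) : ContMDiffVectorBundle 1 V.F V.E I :=
  ContMDiffVectorBundle.of_le (n := ∞) (by norm_cast)

/-- Smooth sections. -/
def VB.IsSec (V : VB I M) (s : ∀ x, V.E x) : Prop :=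
  ContMDiff I V.model ∞ (fun x => (⟨x, s x⟩ : V.Tot))

/-- Smooth sections of the dual bundle: fibrewise linear functions that are smooth on the total
space. -/
def VB.IsForm (V : VB I M) (α : ∀ x, Module.Dual ℝ (V.E x)) : Prop :=
  ContMDiff V.model 𝓘(ℝ, ℝ) ∞ (fun p : V.Tot => α p.proj p.2)

/-- The fibres of a vector bundle with its smooth sections. -/
abbrev VB.sec (V : VB I M) : SmoothFamily.{u, u} M where
  W := V.E
  IsSmooth := V.IsSec

/-- The fibres of the dual bundle with its smooth sections. -/
abbrev VB.dual (V : VB I M) : SmoothFamily.{u, u} M where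
  W := fun x => Module.Dual ℝ (V.E x)
  IsSmooth := V.IsForm

end Bundles

/-! ### The graded symmetric algebra of `W 0 [-1] ⊕ W 1 [-2] ⊕ …` -/

section GradedSymmetric

variable {n : ℕ}

/-- The sign `(-1) ^ k` of an integer `k`. -/
def sgn (k : ℤ) : ℝ := (k.negOnePow : ℤ)

/-- Elements of `W i` have degree `i + 1`, and `x y = (-1) ^ (|x| |y|) y x`. -/
inductive GSym.Rel (W : Fin n → Type v) [∀ i, AddCommGroup (W i)] [∀ i, Module ℝ (W i)] :
    TensorAlgebra ℝ (∀ i, W i) → TensorAlgebra ℝ (∀ i, W i) → Prop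
  | comm (i j : Fin n) (x : W i) (y : W j) :
      GSym.Rel W
        (TensorAlgebra.ι ℝ (Pi.single i x) * TensorAlgebra.ι ℝ (Pi.single j y))
        ((-1 : ℝ) ^ ((i.val + 1) * (j.val + 1)) •
          (TensorAlgebra.ι ℝ (Pi.single j y) * TensorAlgebra.ι ℝ (Pi.single i x)))

/-- The graded symmetric algebra generated by the spaces `W i` in degrees `i + 1`. -/
def GSym (W : Fin n → Type v) [∀ i, AddCommGroup (W i)] [∀ i, Module ℝ (W i)] : Type v :=
  RingQuot (GSym.Rel W)

variable (W : Fin n → Type v) [∀ i, AddCommGroup (W i)] [∀ i, Module ℝ (W i)]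

instance : Ring (GSym W) := inferInstanceAs (Ring (RingQuot (GSym.Rel W)))

instance : Algebra ℝ (GSym W) := inferInstanceAs (Algebra ℝ (RingQuot (GSym.Rel W)))

namespace GSym

variable {W}

/-- The inclusion of the generators. -/
def ι (i : Fin n) : W i →ₗ[ℝ] GSym W :=
  (RingQuot.mkAlgHom ℝ (GSym.Rel W)).toLinearMap ∘ₗ TensorAlgebra.ι ℝ ∘ₗ LinearMap.single ℝ W i

lemma ι_comm (i j : Fin n) (x : W i) (y : W j) :
    ι i x * ι j y = (-1 : ℝ) ^ ((i.val + 1) * (j.val + 1)) • (ι j y * ι i x) := by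
  have h := RingQuot.mkAlgHom_rel ℝ (GSym.Rel.comm (W := W) i j x y)
  rw [map_mul, map_smul, map_mul] at h
  exact h

/-- Linear maps on the generators that respect the graded commutation rule extend to the graded
symmetric algebra. -/
def lift {B : Type*} [Ring B] [Algebra ℝ B] (f : ∀ i, W i →ₗ[ℝ] B)
    (hf : ∀ i j x y, f i x * f j y =
      (-1 : ℝ) ^ ((i.val + 1) * (j.val + 1)) • (f j y * f i x)) : GSym W →ₐ[ℝ] B :=
  RingQuot.liftAlgHom ℝ ⟨TensorAlgebra.lift ℝ (LinearMap.lsum ℝ W ℝ f), by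
    rintro _ _ ⟨i, j, x, y⟩
    simpa only [map_mul, map_smul, TensorAlgebra.lift_ι_apply, LinearMap.lsum_piSingle]
      using hf i j x y⟩

@[simp] lemma lift_ι {B : Type*} [Ring B] [Algebra ℝ B] (f : ∀ i, W i →ₗ[ℝ] B)
    (hf : ∀ i j x y, f i x * f j y =
      (-1 : ℝ) ^ ((i.val + 1) * (j.val + 1)) • (f j y * f i x)) (i : Fin n) (x : W i) :
    lift f hf (ι i x) = f i x := by
  refine (RingQuot.liftAlgHom_mkAlgHom_apply ℝ (TensorAlgebra.lift ℝ (LinearMap.lsum ℝ W ℝ f)) _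
    (TensorAlgebra.ι ℝ (Pi.single i x))).trans ?_
  rw [TensorAlgebra.lift_ι_apply, LinearMap.lsum_piSingle]

/-- Functoriality. -/
def map {W' : Fin n → Type*} [∀ i, AddCommGroup (W' i)] [∀ i, Module ℝ (W' i)]
    (f : ∀ i, W i →ₗ[ℝ] W' i) : GSym W →ₐ[ℝ] GSym W' :=
  lift (fun i => ι i ∘ₗ f i) (fun i j x y => by simpa using ι_comm i j (f i x) (f j y))

/-- The part of degree `k`: spanned by the products of generators whose degrees add up to `k`. -/
def piece (W : Fin n → Type v) [∀ i, AddCommGroup (W i)] [∀ i, Module ℝ (W i)] (k : ℤ) :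
    Submodule ℝ (GSym W) :=
  Submodule.span ℝ {ξ | ∃ l : List (Σ i, W i),
    (l.map (fun p => (p.1.val : ℤ) + 1)).sum = k ∧ ξ = (l.map (fun p => ι p.1 p.2)).prod}

/-- The projection to the part of degree `0`, that is, to the scalars. -/
def aug : GSym W →ₐ[ℝ] ℝ := lift (fun _ => 0) (by simp)

/-- Multiplication by `(-1) ^ k` in degree `k`. -/
def parity : GSym W →ₐ[ℝ] GSym W :=
  lift (fun i => (-1 : ℝ) ^ (i.val + 1) • ι i) (fun i j x y => by
    simp only [LinearMap.smul_apply, smul_mul_smul_comm]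
    rw [ι_comm i j, smul_comm, mul_comm ((-1 : ℝ) ^ (i.val + 1))])

/-- Auxiliary for `contract`: the generator `y` acts by the matrix with diagonal
`(±y, y)` and upper right entry `a y`. -/
def contractGen (i : Fin n) (a : Module.Dual ℝ (W i)) (j : Fin n) :
    W j →ₗ[ℝ] Matrix (Fin 2) (Fin 2) (GSym W) where
  toFun y := !![(-1 : ℝ) ^ ((i.val + 1) * (j.val + 1)) • ι j y,
    algebraMap ℝ _ ((Pi.single i a : ∀ j, Module.Dual ℝ (W j)) j y); 0, ι j y]
  map_add' x y := by ext p q; fin_cases p <;> fin_cases q <;> simp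
  map_smul' t x := by
    ext p q
    fin_cases p <;> fin_cases q <;> simp [smul_comm t, Algebra.algebraMap_eq_smul_one, mul_smul]

/-- Contraction with a functional `a` on the generators in degree `i + 1`: the derivation of degree
`-(i + 1)` with `contract a (x y) = (contract a x) y + (-1) ^ (|a| |x|) x (contract a y)` that maps a
generator `y` to `a y`. -/
def contract (i : Fin n) (a : Module.Dual ℝ (W i)) : GSym W →ₗ[ℝ] GSym W :=
  Matrix.entryLinearMap ℝ (GSym W) (0 : Fin 2) (1 : Fin 2) ∘ₗ
    (lift (contractGen i a) (by
      intro j k x y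
      have key : ∀ (j : Fin n) (x : W j), j ≠ i →
          (Pi.single i a : ∀ j, Module.Dual ℝ (W j)) j x = 0 := by
        intro j x h
        simp [Pi.single_eq_of_ne h]
      have sq1 : ∀ p q : ℕ, (-1 : ℝ) ^ (p * q) * (-1) ^ (p * q) = 1 := by
        intro p q
        rw [← mul_pow]
        simp
      ext p q
      fin_cases p <;> fin_cases q
      · simp only [contractGen, LinearMap.coe_mk, AddHom.coe_mk, Matrix.mul_apply, Fin.sum_univ_two,
          Matrix.smul_apply]
        simp [ι_comm j k x y, smul_smul]
        ring_nf
      · simp only [contractGen, LinearMap.coe_mk, AddHom.coe_mk, Matrix.mul_apply, Fin.sum_univ_two,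
          Matrix.smul_apply]
        simp only [Fin.zero_eta, Fin.mk_one, Matrix.of_apply, Matrix.cons_val', Matrix.cons_val_zero,
          Matrix.cons_val_one, Matrix.cons_val_fin_one,
          ← Algebra.commutes, ← Algebra.smul_def]
        by_cases hj : j = i <;> by_cases hk : k = i
        · subst hj
          subst hk
          simp only [Pi.single_eq_same, smul_smul, smul_add]
          have h := sq1 (k.val + 1) (k.val + 1)
          rw [show (-1 : ℝ) ^ ((k.val + 1) * (k.val + 1)) *
            (a x * (-1 : ℝ) ^ ((k.val + 1) * (k.val + 1))) = a x by
              rw [mul_left_comm, h, mul_one], mul_comm (a y)]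
          abel
        · subst hj
          simp [key k y hk]
          rw [smul_smul, smul_smul, mul_assoc, mul_left_comm, sq1, mul_one]
        · subst hk
          simp [key j x hj]
          rw [smul_comm, mul_comm (k.val + 1)]
        · simp [key j x hj, key k y hk]
      · simp [contractGen]
      · simpa [contractGen, Matrix.mul_apply] using ι_comm j k x y)).toLinearMap

end GSym
end GradedSymmetric

/-! ### Functions on a split graded manifold and split Lie `n`-algebroids -/

section Functions

variable {EB : Type v} [NormedAddCommGroup EB] [NormedSpace ℝ EB] {HB : Type w}
  [TopologicalSpace HB] {I : ModelWithCorners ℝ EB HB}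
  {M : Type u} [TopologicalSpace M] [ChartedSpace HB M] {n : ℕ}

/-- The fibre at `x` of the bundle `S(A*)`, for the graded vector bundle with `A i` placed in
degree `-(i + 1)`, so that the generators `(A i)*` of `S(A*)` have degree `i + 1`. -/
abbrev SymFib (A : Fin n → VB I M) (x : M) : Type u :=
  GSym (fun i => Module.Dual ℝ ((A i).E x))

/-- A function of the base, as a section of `S(A*)`. -/
def baseFun (A : Fin n → VB I M) (f : M → ℝ) : ∀ x, SymFib A x :=
  fun x => algebraMap ℝ _ (f x)

/-- A form on `A i`, as a section of `S(A*)`. -/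
def formFun (A : Fin n → VB I M) (i : Fin n) (α : ∀ x, Module.Dual ℝ ((A i).E x)) :
    ∀ x, SymFib A x :=
  fun x => GSym.ι i (α x)

/-- Polynomials in smooth functions and smooth forms. -/
def polyFun (A : Fin n → VB I M) : Subalgebra ℝ (∀ x, SymFib A x) :=
  Algebra.adjoin ℝ ({ξ | ∃ f, ContMDiff I 𝓘(ℝ, ℝ) ∞ f ∧ ξ = baseFun A f} ∪
    {ξ | ∃ i α, (A i).IsForm α ∧ ξ = formFun A i α})

/-- The algebra `Γ(S(A*))` of smooth sections of `S(A*)`: the sections that are, near every point,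
polynomials in smooth functions and smooth forms. -/
def Fun (A : Fin n → VB I M) : Subalgebra ℝ (∀ x, SymFib A x) where
  carrier := {ξ | ∀ x₀, ∃ p ∈ polyFun A, ∀ᶠ x in 𝓝 x₀, ξ x = p x}
  mul_mem' := by
    intro ξ η hξ hη x₀
    obtain ⟨p, hp, h⟩ := hξ x₀
    obtain ⟨q, hq, h'⟩ := hη x₀
    refine ⟨p * q, mul_mem hp hq, ?_⟩
    filter_upwards [h, h'] with x hx hx'
    simp [hx, hx']
  add_mem' := by
    intro ξ η hξ hη x₀
    obtain ⟨p, hp, h⟩ := hξ x₀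
    obtain ⟨q, hq, h'⟩ := hη x₀
    refine ⟨p + q, add_mem hp hq, ?_⟩
    filter_upwards [h, h'] with x hx hx'
    simp [hx, hx']
  algebraMap_mem' := by
    intro t x₀
    exact ⟨_, (polyFun A).algebraMap_mem t, Filter.Eventually.of_forall fun _ => rfl⟩

lemma polyFun_le_Fun (A : Fin n → VB I M) : polyFun A ≤ Fun A :=
  fun p hp _ => ⟨p, hp, Filter.Eventually.of_forall fun _ => rfl⟩

/-- A smooth function of the base as an element of `Γ(S(A*))`. -/
def ofFun (A : Fin n → VB I M) (f : M → ℝ) (hf : ContMDiff I 𝓘(ℝ, ℝ) ∞ f) : Fun A :=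
  ⟨baseFun A f, polyFun_le_Fun A (Algebra.subset_adjoin (Or.inl ⟨f, hf, rfl⟩))⟩

/-- A smooth form on `A i` as an element of `Γ(S(A*))`. -/
def ofForm (A : Fin n → VB I M) (i : Fin n) (α : ∀ x, Module.Dual ℝ ((A i).E x))
    (hα : (A i).IsForm α) : Fun A :=
  ⟨formFun A i α, polyFun_le_Fun A (Algebra.subset_adjoin (Or.inr ⟨i, α, hα, rfl⟩))⟩

/-- Homogeneous elements of degree `k` of `Γ(S(A*))`. -/
def HomFun {A : Fin n → VB I M} (k : ℤ) (ξ : Fun A) : Prop :=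
  ∀ x, ξ.1 x ∈ GSym.piece (fun i => Module.Dual ℝ ((A i).E x)) k

/-- `Y` is a graded derivation of degree `p` of `Γ(S(A*))`: a vector field of degree `p` on the
graded manifold. -/
structure IsDer {A : Fin n → VB I M} (p : ℤ) (Y : Fun A →ₗ[ℝ] Fun A) : Prop where
  deg : ∀ k ξ, HomFun k ξ → HomFun (k + p) (Y ξ)
  leibniz : ∀ k ξ η, HomFun k ξ → Y (ξ * η) = Y ξ * η + sgn (p * k) • (ξ * Y η)

/-- A split Lie `n`-algebroid structure on `A 0 [1] ⊕ … ⊕ A (n-1) [n]`: a homological vector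
field. -/
structure LieStr (A : Fin n → VB I M) where
  Q : Fun A →ₗ[ℝ] Fun A
  isDer : IsDer 1 Q
  sq : ∀ ξ, Q (Q ξ) = 0

end Functions

/-! ### Representations up to homotopy -/

section Representations

variable {EB : Type v} [NormedAddCommGroup EB] [NormedSpace ℝ EB] {HB : Type w}
  [TopologicalSpace HB] {I : ModelWithCorners ℝ EB HB}
  {M : Type u} [TopologicalSpace M] [ChartedSpace HB M] {n : ℕ}

set_option linter.checkUnivs false in
/-- A graded vector bundle with a part `zero` in degree `0` and parts `pos i` in degree
`dir * (i + 1)`. -/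
structure Graded (n : ℕ) (M : Type u) where
  zero : SmoothFamily.{u, v} M
  pos : Fin n → SmoothFamily.{u, w} M
  dir : ℤ

/-- The fibre of the direct sum of all the parts. -/
abbrev Graded.Fib (W : Graded.{u, v, w} n M) (x : M) : Type (max v w) :=
  W.zero.W x × (∀ i, (W.pos i).W x)

/-- The fibre of `S(A*) ⊗ W`. -/
abbrev ModFib (A : Fin n → VB I M) (W : Graded n M) (x : M) :=
  SymFib A x ⊗[ℝ] W.Fib x

/-- The part of degree `p` of the fibre of `S(A*) ⊗ W`. -/
def modPiece (A : Fin n → VB I M) (W : Graded n M) (x : M) (p : ℤ) :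
    Submodule ℝ (ModFib A W x) :=
  Submodule.span ℝ
    ({z | ∃ ξ ∈ GSym.piece (fun i => Module.Dual ℝ ((A i).E x)) p, ∃ w : W.zero.W x,
        z = ξ ⊗ₜ[ℝ] ((w, 0) : W.Fib x)} ∪
      {z | ∃ i, ∃ ξ ∈ GSym.piece (fun i => Module.Dual ℝ ((A i).E x)) (p - W.dir * (i.val + 1)),
        ∃ w : (W.pos i).W x, z = ξ ⊗ₜ[ℝ] ((0, Pi.single i w) : W.Fib x)})

/-- The section `1 ⊗ e` of `S(A*) ⊗ W`. -/
def genFun (A : Fin n → VB I M) (W : Graded n M) (e : ∀ x, W.Fib x) :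
    ∀ x, ModFib A W x :=
  fun x => 1 ⊗ₜ[ℝ] e x

/-- A section of `W` all of whose components are smooth. -/
def Graded.IsSmooth (W : Graded n M) (e : ∀ x, W.Fib x) : Prop :=
  W.zero.IsSmooth (fun x => (e x).1) ∧ ∀ i, (W.pos i).IsSmooth (fun x => (e x).2 i)

/-- Finite sums `∑ ξ ⊗ e` with `ξ ∈ Γ(S(A*))` and `e ∈ Γ(W)`. -/
def polyMod (A : Fin n → VB I M) (W : Graded n M) :
    Submodule (Fun A) (∀ x, ModFib A W x) :=
  Submodule.span (Fun A) {s | ∃ e, W.IsSmooth e ∧ s = genFun A W e}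

/-- The `Γ(S(A*))`-module `Γ(S(A*)) ⊗ Γ(W)` of smooth sections of `S(A*) ⊗ W`. -/
def SecMod (A : Fin n → VB I M) (W : Graded n M) :
    Submodule (Fun A) (∀ x, ModFib A W x) where
  carrier := {s | ∀ x₀, ∃ t ∈ polyMod A W, ∀ᶠ x in 𝓝 x₀, s x = t x}
  add_mem' := by
    intro s t hs ht x₀
    obtain ⟨p, hp, h⟩ := hs x₀
    obtain ⟨q, hq, h'⟩ := ht x₀
    refine ⟨p + q, add_mem hp hq, ?_⟩
    filter_upwards [h, h'] with x hx hx'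
    simp [hx, hx']
  zero_mem' := fun _ => ⟨0, zero_mem _, Filter.Eventually.of_forall fun _ => rfl⟩
  smul_mem' := by
    intro ξ s hs x₀
    obtain ⟨p, hp, h⟩ := hs x₀
    refine ⟨ξ • p, Submodule.smul_mem _ ξ hp, ?_⟩
    filter_upwards [h] with x hx
    change ξ.1 x • s x = ξ.1 x • p x
    rw [hx]

instance (A : Fin n → VB I M) (W : Graded n M) : AddCommGroup (SecMod A W) :=
  Submodule.addCommGroup (SecMod A W)

instance (A : Fin n → VB I M) (W : Graded n M) : Module (Fun A) (SecMod A W) :=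
  Submodule.module (SecMod A W)

instance (A : Fin n → VB I M) (W : Graded n M) : SMul (Fun A) (SecMod A W) :=
  Module.toDistribMulAction.toSMul

/-- The section `1 ⊗ e` as an element of `Γ(S(A*)) ⊗ Γ(W)`. -/
def gen (A : Fin n → VB I M) (W : Graded n M) (e : ∀ x, W.Fib x) (he : W.IsSmooth e) :
    SecMod A W :=
  ⟨genFun A W e, fun _ => ⟨_, Submodule.subset_span ⟨e, he, rfl⟩,
    Filter.Eventually.of_forall fun _ => rfl⟩⟩

/-- Homogeneous elements of degree `p` of `Γ(S(A*)) ⊗ Γ(W)`. -/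
def HomSec {A : Fin n → VB I M} {W : Graded n M} (p : ℤ) (s : SecMod A W) : Prop :=
  ∀ x, s.1 x ∈ modPiece A W x p

/-- A representation up to homotopy of the Lie `n`-algebroid `(A, Q)` on `W`. -/
@[ext]
structure Rep {A : Fin n → VB I M} (Q : LieStr A) (W : Graded n M) where
  D : SecMod A W →+ SecMod A W
  deg : ∀ p s, HomSec p s → HomSec (p + 1) (D s)
  leibniz : ∀ k ξ s, HomFun k ξ → D (ξ • s) = Q.Q ξ • s + (sgn k • ξ) • D s
  sq : ∀ s, D (D s) = 0

/-- An isomorphism of representations up to homotopy of `(A, Q)` on the same graded bundle. -/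
structure RepIso {A : Fin n → VB I M} {Q : LieStr A} {W : Graded n M} (R R' : Rep Q W) where
  μ : SecMod A W ≃ₗ[Fun A] SecMod A W
  deg : ∀ p s, HomSec p s ↔ HomSec p (μ s)
  comm : ∀ s, μ (R.D s) = R'.D (μ s)

/-- The graded bundle `V[0] ⊕ C 0 [1] ⊕ C 1 [2] ⊕ …`. -/
abbrev graded (V : VB I M) (C : Fin n → VB I M) : Graded n M where
  zero := V.sec
  pos := fun i => (C i).sec
  dir := -1

/-- The dual of `graded V C`. -/
abbrev gradedDual (V : VB I M) (C : Fin n → VB I M) : Graded n M where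
  zero := V.dual
  pos := fun i => (C i).dual
  dir := 1

/-- The `S`-linear extension `ξ ⊗ e ↦ ξ * L e`. -/
def extendMul {S B X : Type*} [Ring S] [Algebra ℝ S] [Ring B] [Algebra ℝ B] [AddCommGroup X]
    [Module ℝ X] (φ : S →ₐ[ℝ] B) (L : X →ₗ[ℝ] B) : S ⊗[ℝ] X →ₗ[ℝ] B :=
  TensorProduct.lift (((LinearMap.mul ℝ B) ∘ₗ φ.toLinearMap).compl₂ L)

/-- The pairing with `e` of elements of the fibre of `S(A*) ⊗ (V ⊕ C)*`:
`ζ ⊗ φ ↦ (-1) ^ (|e| |ζ|) φ(e) ζ` for `e` homogeneous. -/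
def pairGen {A : Fin n → VB I M} {V : VB I M} {C : Fin n → VB I M} (x : M)
    (e : (graded V C).Fib x) : ModFib A (gradedDual V C) x →ₗ[ℝ] SymFib A x :=
  extendMul (AlgHom.id ℝ _)
      (Algebra.linearMap ℝ (SymFib A x) ∘ₗ Module.Dual.eval ℝ (V.E x) e.1 ∘ₗ
        LinearMap.fst ℝ (Module.Dual ℝ (V.E x)) (∀ i, Module.Dual ℝ ((C i).E x))) +
    ∑ i : Fin n, extendMul (GSym.parity ^ (i.val + 1))
      (Algebra.linearMap ℝ (SymFib A x) ∘ₗ Module.Dual.eval ℝ ((C i).E x) (e.2 i) ∘ₗ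
        LinearMap.proj i ∘ₗ
        LinearMap.snd ℝ (Module.Dual ℝ (V.E x)) (∀ i, Module.Dual ℝ ((C i).E x)))

lemma pairGen_tmul {A : Fin n → VB I M} {V : VB I M} {C : Fin n → VB I M} (x : M)
    (e : (graded V C).Fib x) (ζ : SymFib A x) (φ : (gradedDual V C).Fib x) :
    pairGen x e (ζ ⊗ₜ[ℝ] φ) =
      φ.1 e.1 • ζ + ∑ i : Fin n, φ.2 i (e.2 i) • (GSym.parity ^ (i.val + 1)) ζ := by
  simp [pairGen, extendMul, Algebra.algebraMap_eq_smul_one]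

/-- The fibrewise pairing
`⟨ξ ⊗ e, ζ ⊗ φ⟩ = (-1) ^ (|e| |ζ|) φ(e) ξ ζ`. -/
def pair {A : Fin n → VB I M} {V : VB I M} {C : Fin n → VB I M} (x : M)
    (η : ModFib A (graded V C) x) (θ : ModFib A (gradedDual V C) x) : SymFib A x :=
  TensorProduct.lift (LinearMap.mk₂ ℝ
    (fun (ξ : SymFib A x) (e : (graded V C).Fib x) => ξ * pairGen x e θ)
    (fun ξ ξ' e => add_mul _ _ _) (fun t ξ e => smul_mul_assoc _ _ _)
    (fun ξ e e' => by
      rw [← mul_add]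
      congr 1
      induction θ using TensorProduct.induction_on with
      | zero => simp
      | tmul ζ φ =>
        simp only [pairGen_tmul, Prod.fst_add, Prod.snd_add, Pi.add_apply, map_add, add_smul,
          Finset.sum_add_distrib]
        abel
      | add a b ha hb =>
        simp only [map_add, ha, hb]
        abel)
    (fun t ξ e => by
      rw [← mul_smul_comm]
      congr 1
      induction θ using TensorProduct.induction_on with
      | zero => simp
      | tmul ζ φ =>
        simp only [pairGen_tmul, Prod.smul_fst, Prod.smul_snd, Pi.smul_apply, map_smul, smul_add,
          Finset.smul_sum, smul_assoc]
      | add a b ha hb => simp only [map_add, ha, hb, smul_add])) η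

/-- The representations `D` on `V ⊕ C` and `D'` on the dual bundle are dual to each other:
`Q⟨η, θ⟩ = ⟨D η, θ⟩ + (-1) ^ |η| ⟨η, D' θ⟩`. -/
def IsDual {A : Fin n → VB I M} {Q : LieStr A} {V : VB I M} {C : Fin n → VB I M}
    (R : Rep Q (graded V C)) (R' : Rep Q (gradedDual V C)) : Prop :=
  ∀ (p : ℤ) (η : SecMod A (graded V C)) (θ : SecMod A (gradedDual V C)), HomSec p η →
    ∃ ξ : Fun A, (∀ x, ξ.1 x = pair x (η.1 x) (θ.1 x)) ∧
      ∀ x, (Q.Q ξ).1 x =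
        pair x ((R.D η).1 x) (θ.1 x) + sgn p • pair x (η.1 x) ((R'.D θ).1 x)

/-- The `S(A*)`-linear map of the fibre of `S(A*) ⊗ W` to itself that maps `v` in degree `0` to
`v + ∑ i, Δ i v`, where `Δ i v : A i → W i` is seen as an element of `(A i)* ⊗ W i`, and that is the
identity on every `W i`. -/
def shear (A : Fin n → VB I M) (W : Graded n M) (x : M)
    (Δ : ∀ i, W.zero.W x →ₗ[ℝ] (A i).E x →ₗ[ℝ] (W.pos i).W x) :
    ModFib A W x →ₗ[ℝ] ModFib A W x :=
  LinearMap.id + ∑ i : Fin n, TensorProduct.lift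
    ((Algebra.lsmul ℝ ℝ (ModFib A W x)).toLinearMap.compl₂
      (TensorProduct.map (GSym.ι i)
          (LinearMap.inr ℝ (W.zero.W x) (∀ i, (W.pos i).W x) ∘ₗ
            LinearMap.single ℝ (fun i => (W.pos i).W x) i) ∘ₗ
        (dualTensorHomEquiv ℝ ((A i).E x) ((W.pos i).W x)).symm.toLinearMap ∘ₗ Δ i ∘ₗ
        LinearMap.fst ℝ (W.zero.W x) (∀ i, (W.pos i).W x)))

end Representations

/-! ### Double vector bundles -/

section Double

variable {EB : Type v} [NormedAddCommGroup EB] [NormedSpace ℝ EB] {HB : Type w}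
  [TopologicalSpace HB] {I : ModelWithCorners ℝ EB HB}
  {M : Type u} [TopologicalSpace M] [ChartedSpace HB M]

/-- The graph of the fibrewise addition of a vector bundle. -/
def VB.AddRel (V : VB I M) (p q r : V.Tot) : Prop :=
  ∃ (x : M) (a b : V.E x), p = ⟨x, a⟩ ∧ q = ⟨x, b⟩ ∧ r = ⟨x, a + b⟩

/-- The fibrewise scalar multiplication of a vector bundle. -/
def VB.smulTot (V : VB I M) (t : ℝ) (p : V.Tot) : V.Tot := ⟨p.proj, t • p.2⟩

/-- A double vector bundle `(D, V, A, M)` with core `C`. The manifold `D` is the total space of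
`overV`, and it is identified with the total space of `overA` by `flip`. -/
structure DVB (V A C : VB I M) where
  overV : VB V.model V.Tot
  overA : VB A.model A.Tot
  flip : overV.Tot ≃ overA.Tot
  contMDiff_flip : ContMDiff overV.model overA.model ∞ flip
  contMDiff_flip_symm : ContMDiff overA.model overV.model ∞ flip.symm
  /-- The projection `D → A` is a morphism of vector bundles over `V → M`. -/
  prA : ∀ v : V.Tot, overV.E v →ₗ[ℝ] A.E v.proj
  flip_proj : ∀ v d, (flip ⟨v, d⟩).proj = ⟨v.proj, prA v d⟩
  /-- The projection `D → V` is a morphism of vector bundles over `A → M`. -/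
  prV : ∀ a : A.Tot, overA.E a →ₗ[ℝ] V.E a.proj
  flip_symm_proj : ∀ a d, (flip.symm ⟨a, d⟩).proj = ⟨a.proj, prV a d⟩
  /-- The interchange law for the two additions. -/
  interchange : ∀ p₁ p₂ p₁₂ p₃ p₄ p₃₄ p₁₃ p₂₄,
    overV.AddRel p₁ p₂ p₁₂ → overV.AddRel p₃ p₄ p₃₄ →
    overA.AddRel (flip p₁) (flip p₃) (flip p₁₃) → overA.AddRel (flip p₂) (flip p₄) (flip p₂₄) →
    ∃ r, overA.AddRel (flip p₁₂) (flip p₃₄) (flip r) ∧ overV.AddRel p₁₃ p₂₄ r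
  /-- Scalar multiplication over `A` is additive over `V`. -/
  smulA_addV : ∀ t p q r, overV.AddRel p q r →
    overV.AddRel (flip.symm (overA.smulTot t (flip p))) (flip.symm (overA.smulTot t (flip q)))
      (flip.symm (overA.smulTot t (flip r)))
  /-- Scalar multiplication over `V` is additive over `A`. -/
  smulV_addA : ∀ t p q r, overA.AddRel (flip p) (flip q) (flip r) →
    overA.AddRel (flip (overV.smulTot t p)) (flip (overV.smulTot t q)) (flip (overV.smulTot t r))
  /-- The two scalar multiplications commute. -/
  smulV_smulA : ∀ s t p, overV.smulTot s (flip.symm (overA.smulTot t (flip p))) =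
    flip.symm (overA.smulTot t (flip (overV.smulTot s p)))
  /-- The inclusion of the core: it identifies `C` with the elements of `D` that lie over zero in
  both `V` and `A`. -/
  core : ∀ m, C.E m →ₗ[ℝ] overV.E ⟨m, 0⟩
  core_injective : ∀ m, Function.Injective (core m)
  core_range : ∀ m, LinearMap.range (core m) = LinearMap.ker (prA ⟨m, 0⟩)
  contMDiff_core : ContMDiff C.model overV.model ∞
    (fun c : C.Tot => (⟨⟨c.proj, 0⟩, core c.proj c.2⟩ : overV.Tot))

namespace DVB

variable {V A C : VB I M} (D : DVB V A C)

/-- The graph of the addition of `D → A`, on points of the total space of `D → V`. -/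
def AddA (p q r : D.overV.Tot) : Prop := D.overA.AddRel (D.flip p) (D.flip q) (D.flip r)

/-- The scalar multiplication of `D → A`, on points of the total space of `D → V`. -/
def smulA (t : ℝ) (p : D.overV.Tot) : D.overV.Tot := D.flip.symm (D.overA.smulTot t (D.flip p))

/-- `d = 0_v +_A c`: the element `d` of `D` over `v` is the one obtained from the core element
`c`. -/
def CoreLift (v : V.Tot) (c : C.E v.proj) (d : D.overV.E v) : Prop :=
  D.AddA ⟨v, 0⟩ ⟨⟨v.proj, 0⟩, D.core v.proj c⟩ ⟨v, d⟩

/-- Linear sections of `D → V`: morphisms of vector bundles from `V → M` to `D → A` over some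
section `a` of `A`. -/
def IsLinear (b : ∀ v, D.overV.E v) : Prop :=
  D.overV.IsSec b ∧ ∃ a, A.IsSec a ∧ (∀ v : V.Tot, D.prA v (b v) = a v.proj) ∧
    (∀ (m : M) (v w : V.E m), D.AddA ⟨⟨m, v⟩, b ⟨m, v⟩⟩ ⟨⟨m, w⟩, b ⟨m, w⟩⟩
      ⟨⟨m, v + w⟩, b ⟨m, v + w⟩⟩) ∧
    ∀ (m : M) (t : ℝ) (v : V.E m),
      D.smulA t ⟨⟨m, v⟩, b ⟨m, v⟩⟩ = ⟨⟨m, t • v⟩, b ⟨m, t • v⟩⟩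

/-- Core sections of `D → V`: those of the form `v ↦ 0_v +_A c(m)` for a section `c` of the
core. -/
def IsCore (b : ∀ v, D.overV.E v) : Prop :=
  ∃ c, C.IsSec c ∧ ∀ v : V.Tot, D.CoreLift v (c v.proj) (b v)

/-- A decomposition of `D`: an isomorphism of double vector bundles from the decomposed double
vector bundle `V ×_M A ×_M C` to `D` that induces the identity on `V`, `A` and `C`. -/
structure Decomposition where
  equiv : ∀ v : V.Tot, (A.E v.proj × C.E v.proj) ≃ₗ[ℝ] D.overV.E v
  prA_equiv : ∀ v a c, D.prA v (equiv v (a, c)) = a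
  equiv_core : ∀ m c, equiv ⟨m, 0⟩ (0, c) = D.core m c
  add : ∀ (m : M) (a : A.E m) (v v' : V.E m) (c c' : C.E m),
    D.AddA ⟨⟨m, v⟩, equiv ⟨m, v⟩ (a, c)⟩ ⟨⟨m, v'⟩, equiv ⟨m, v'⟩ (a, c')⟩
      ⟨⟨m, v + v'⟩, equiv ⟨m, v + v'⟩ (a, c + c')⟩
  smul : ∀ (m : M) (a : A.E m) (t : ℝ) (v : V.E m) (c : C.E m),
    D.smulA t ⟨⟨m, v⟩, equiv ⟨m, v⟩ (a, c)⟩ = ⟨⟨m, t • v⟩, equiv ⟨m, t • v⟩ (a, t • c)⟩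
  contMDiff_equiv : ContMDiff (I.prod 𝓘(ℝ, V.F × (A.F × C.F))) D.overV.model ∞
    (fun z : TotalSpace (V.F × (A.F × C.F)) (V.E ×ᵇ (A.E ×ᵇ C.E)) =>
      (⟨⟨z.proj, z.2.1⟩, equiv ⟨z.proj, z.2.1⟩ z.2.2⟩ : D.overV.Tot))
  contMDiff_symm : ContMDiff D.overV.model (I.prod 𝓘(ℝ, V.F × (A.F × C.F))) ∞
    (fun d : D.overV.Tot =>
      (⟨d.proj.proj, (d.proj.2, (equiv d.proj).symm d.2)⟩ :
        TotalSpace (V.F × (A.F × C.F)) (V.E ×ᵇ (A.E ×ᵇ C.E))))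

variable {D}

/-- The horizontal lift `h_a(v)` of a decomposition. -/
def Decomposition.lift (h : D.Decomposition) (v : V.Tot) : A.E v.proj →ₗ[ℝ] D.overV.E v :=
  (h.equiv v).toLinearMap ∘ₗ LinearMap.inl ℝ (A.E v.proj) (C.E v.proj)

/-- The core component of an element of `D` in a decomposition. -/
def Decomposition.corePart (h : D.Decomposition) (v : V.Tot) : D.overV.E v →ₗ[ℝ] C.E v.proj :=
  LinearMap.snd ℝ (A.E v.proj) (C.E v.proj) ∘ₗ (h.equiv v).symm.toLinearMap

/-- `Δ` is the difference of the horizontal lifts of two decompositions, as an element of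
`A* ⊗ V* ⊗ C`. -/
def IsDifference (h h' : D.Decomposition)
    (Δ : ∀ m, V.E m →ₗ[ℝ] A.E m →ₗ[ℝ] C.E m) : Prop :=
  ∀ (v : V.Tot) (a : A.E v.proj), D.CoreLift v (Δ v.proj v.2 a) (h.lift v a - h'.lift v a)

end DVB

/-- The graph of the addition of the prolonged vector bundle `TV → TM`, the tangent of the addition
of `V → M`. -/
def TangentAdd (V : VB I M) (p q r : TangentBundle V.model V.Tot) : Prop :=
  ∃ z : TangentBundle (I.prod 𝓘(ℝ, V.F × V.F)) (TotalSpace (V.F × V.F) (V.E ×ᵇ V.E)),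
    tangentMap (I.prod 𝓘(ℝ, V.F × V.F)) V.model
      (fun y : TotalSpace (V.F × V.F) (V.E ×ᵇ V.E) => (⟨y.proj, y.2.1⟩ : V.Tot)) z = p ∧
    tangentMap (I.prod 𝓘(ℝ, V.F × V.F)) V.model
      (fun y : TotalSpace (V.F × V.F) (V.E ×ᵇ V.E) => (⟨y.proj, y.2.2⟩ : V.Tot)) z = q ∧
    tangentMap (I.prod 𝓘(ℝ, V.F × V.F)) V.model
      (fun y : TotalSpace (V.F × V.F) (V.E ×ᵇ V.E) => (⟨y.proj, y.2.1 + y.2.2⟩ : V.Tot)) z = r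

/-- `ρ : D → TV` is a morphism of double vector bundles over the identity of `V` and over
`ρA : A → TM`. -/
structure IsAnchorMorphism {V A C : VB I M} (D : DVB V A C)
    (ρ : ∀ v : V.Tot, D.overV.E v →ₗ[ℝ] TangentSpace V.model v)
    (ρA : ∀ m, A.E m →ₗ[ℝ] TangentSpace I m) : Prop where
  proj : ∀ v d, tangentMap V.model I (fun p : V.Tot => p.proj) ⟨v, ρ v d⟩ =
    ⟨v.proj, ρA v.proj (D.prA v d)⟩
  add : ∀ p q r, D.AddA p q r →
    TangentAdd V ⟨p.proj, ρ p.proj p.2⟩ ⟨q.proj, ρ q.proj q.2⟩ ⟨r.proj, ρ r.proj r.2⟩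
  smul : ∀ t p, (⟨(D.smulA t p).proj, ρ _ (D.smulA t p).2⟩ : TangentBundle V.model V.Tot) =
    tangentMap V.model V.model (V.smulTot t) ⟨p.proj, ρ p.proj p.2⟩

/-- `δ : D → D'` is a morphism of double vector bundles over the identity of `V` and over
`δA : A → A'`. -/
structure IsMorphism {V A C A' C' : VB I M} (D : DVB V A C) (D' : DVB V A' C')
    (δ : ∀ v, D.overV.E v →ₗ[ℝ] D'.overV.E v) (δA : ∀ m, A.E m →ₗ[ℝ] A'.E m) : Prop where
  proj : ∀ v d, D'.prA v (δ v d) = δA v.proj (D.prA v d)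
  add : ∀ p q r, D.AddA p q r →
    D'.AddA ⟨p.proj, δ p.proj p.2⟩ ⟨q.proj, δ q.proj q.2⟩ ⟨r.proj, δ r.proj r.2⟩
  smul : ∀ t p, (⟨(D.smulA t p).proj, δ _ (D.smulA t p).2⟩ : D'.overV.Tot) =
    D'.smulA t ⟨p.proj, δ p.proj p.2⟩

end Double

/-! ### VB-Lie `n`-algebroids -/

section VBLieAlgebroids

variable {EB : Type v} [NormedAddCommGroup EB] [NormedSpace ℝ EB] {HB : Type w}
  [TopologicalSpace HB] {I : ModelWithCorners ℝ EB HB}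
  {M : Type u} [TopologicalSpace M] [ChartedSpace HB M] {n : ℕ}

/-- The value `ξ(a₁, …, a_j)` of an element of `S(A*)` on elements of the bundles `A i`; it is zero
if the degrees do not match. -/
def evalAt {A : Fin n → VB I M} {x : M} : List (Σ i, (A i).E x) → SymFib A x → ℝ
  | [], ξ => GSym.aug ξ
  | a :: l, ξ => evalAt l (GSym.contract a.1 (Module.Dual.eval ℝ _ a.2) ξ)

/-- The section `b` of `A k` is the component in `A k` of the bracket `⟦a 1, …, a j⟧` of the sections
`a p` of `A (i p)`. The bracket with one entry is the differential of the complex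
`A (n-1) → … → A 0`. For two entries
`⟨α, ⟦a₁, a₂⟧⟩ = Q⟨α, a₂⟩(a₁) + (-1) ^ (|a₁| |a₂|) Q⟨α, a₁⟩(a₂) - (Q α)(a₁, a₂)`
and otherwise `⟨α, ⟦a₁, …, a_j⟧⟩ = - (Q α)(a₁, …, a_j)`, for every form `α` on `A k`. -/
def IsBracket {A : Fin n → VB I M} (Q : LieStr A) {j : ℕ} (i : Fin j → Fin n)
    (a : ∀ p x, (A (i p)).E x) (k : Fin n) (b : ∀ x, (A k).E x) : Prop :=
  ∀ (α : ∀ x, Module.Dual ℝ ((A k).E x)) (hα : (A k).IsForm α),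
    ∃ g : Fin j → Fun A,
      (∀ p x, (g p).1 x = algebraMap ℝ _ (evalAt [⟨i p, a p x⟩] (GSym.ι k (α x)))) ∧
      ∀ x, α x (b x) =
        (if j = 2 then
          ∑ p, ∑ q, if p = q then 0 else
            (if p < q then 1 else (-1 : ℝ) ^ (((i p).val + 1) * ((i q).val + 1))) *
              evalAt [⟨i p, a p x⟩] ((Q.Q (g q)).1 x)
        else 0) -
        evalAt (List.ofFn fun p => (⟨i p, a p x⟩ : Σ i, (A i).E x))
          ((Q.Q (ofForm A k α hα)).1 x)

variable {V : VB I M} {A C : Fin n → VB I M}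

/-- A Lie `n`-algebroid structure on `D 0 [1] ⊕ … ⊕ D (n-1) [n]` over `V` is linear over `A`, so that
`(D, V, A, M)` is a VB-Lie `n`-algebroid. -/
structure IsVBLie (D : ∀ i, DVB V (A i) (C i)) (Q : LieStr (fun i => (D i).overV)) : Prop where
  /-- The anchor `ρ`, given by `(Q f)(d) = df(ρ d)`, is a morphism of double vector bundles. -/
  anchor : ∀ i : Fin n, i.val = 0 → ∃ ρ ρA,
    (∀ f hf v (d : (D i).overV.E v), evalAt [⟨i, d⟩] ((Q.Q (ofFun (fun i => (D i).overV) f hf)).1 v) =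
      mvfderiv V.model f v (ρ v d)) ∧ IsAnchorMorphism (D i) ρ ρA
  /-- The differential `δ`, given by `(Q α)(d) = -α(δ d)`, is a morphism of double vector
  bundles. -/
  differential : ∀ i j : Fin n, i.val = j.val + 1 → ∃ δ δA,
    (∀ α hα v (d : (D i).overV.E v),
      evalAt [⟨i, d⟩] ((Q.Q (ofForm (fun i => (D i).overV) j α hα)).1 v) = -α v (δ v d)) ∧
    IsMorphism (D i) (D j) δ δA
  /-- Brackets of linear sections are linear. -/
  bracket_linear : ∀ (j : ℕ) (i : Fin j → Fin n) (a : ∀ p v, (D (i p)).overV.E v), 0 < j →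
    (∀ p, (D (i p)).IsLinear (a p)) →
    ∀ k, ∃ b, (D k).IsLinear b ∧ IsBracket Q i a k b
  /-- Brackets of linear sections with one core section are core sections. -/
  bracket_core : ∀ (j : ℕ) (i : Fin j → Fin n) (a : ∀ p v, (D (i p)).overV.E v) (q : Fin j),
    (∀ p, p ≠ q → (D (i p)).IsLinear (a p)) → (D (i q)).IsCore (a q) →
    ∀ k, ∃ b, (D k).IsCore b ∧ IsBracket Q i a k b
  /-- Brackets of linear sections with at least two core sections vanish. -/
  bracket_zero : ∀ (j : ℕ) (i : Fin j → Fin n) (a : ∀ p v, (D (i p)).overV.E v)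
    (K : Finset (Fin j)), 2 ≤ K.card →
    (∀ p, p ∉ K → (D (i p)).IsLinear (a p)) → (∀ p ∈ K, (D (i p)).IsCore (a p)) →
    ∀ k, IsBracket Q i a k (fun _ => 0)

/-- The pullback of elements of `S(A*)` along the projection `D → A`. -/
def pull (D : ∀ i, DVB V (A i) (C i)) (v : V.Tot) :
    SymFib A v.proj →ₐ[ℝ] SymFib (fun i => (D i).overV) v :=
  GSym.map (fun i => ((D i).prA v).dualMap)

/-- `QA` is the Lie `n`-algebroid structure that the VB-Lie `n`-algebroid `D` induces on `A`: the
projection `D → A` pulls `QA` back to `QD`. -/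
def IsSide (D : ∀ i, DVB V (A i) (C i)) (QD : LieStr (fun i => (D i).overV))
    (QA : LieStr A) : Prop :=
  ∀ ξ : Fun A, ∃ ζ : Fun (fun i => (D i).overV), (∀ v, ζ.1 v = pull D v (ξ.1 v.proj)) ∧
    ∀ v, (QD.Q ζ).1 v = pull D v ((QA.Q ξ).1 v.proj)

/-- Given decompositions `h`, elements of `S(A*) ⊗ (V* ⊕ C*)` are functions on `D`: a form on `A` is
pulled back to `D`, a form on `V` is a fibrewise linear function of `V`, and a form on `C i` is
the form on `D i` given by the core component. -/
def toFun {D : ∀ i, DVB V (A i) (C i)} (h : ∀ i, (D i).Decomposition) (v : V.Tot) :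
    ModFib A (gradedDual V C) v.proj →ₗ[ℝ] SymFib (fun i => (D i).overV) v :=
  extendMul (pull D v)
    (Algebra.linearMap ℝ (SymFib (fun i => (D i).overV) v) ∘ₗ Module.Dual.eval ℝ (V.E v.proj) v.2 ∘ₗ
        LinearMap.fst ℝ (Module.Dual ℝ (V.E v.proj)) (∀ i, Module.Dual ℝ ((C i).E v.proj)) +
      ∑ i : Fin n, GSym.ι i ∘ₗ ((h i).corePart v).dualMap ∘ₗ LinearMap.proj i ∘ₗ
        LinearMap.snd ℝ (Module.Dual ℝ (V.E v.proj)) (∀ i, Module.Dual ℝ ((C i).E v.proj)))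

/-- The representation `R` on `V[0] ⊕ C` corresponds to the VB-Lie `n`-algebroid `D` with the
decompositions `h`: its dual `R'` is given on sections `ψ` of `V*` and `γ` of `(C i)*` by
`R'.D ψ = QD ℓ_ψ` and `R'.D γ = QD γ`. -/
def Corresponds {D : ∀ i, DVB V (A i) (C i)} (QD : LieStr (fun i => (D i).overV))
    {QA : LieStr A} (h : ∀ i, (D i).Decomposition) (R : Rep QA (graded V C)) : Prop :=
  ∃ R' : Rep QA (gradedDual V C),
    (∀ e he, ∃ ζ : Fun (fun i => (D i).overV),
      (∀ v, ζ.1 v = toFun h v ((gen A (gradedDual V C) e he).1 v.proj)) ∧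
      ∀ v, (QD.Q ζ).1 v = toFun h v ((R'.D (gen A (gradedDual V C) e he)).1 v.proj)) ∧
    IsDual R R'

end VBLieAlgebroids

/-! ### The adjoint representation -/

section Adjoint

variable {EB : Type v} [NormedAddCommGroup EB] [NormedSpace ℝ EB] {HB : Type w}
  [TopologicalSpace HB] {I : ModelWithCorners ℝ EB HB}
  {M : Type u} [TopologicalSpace M] [ChartedSpace HB M] [IsManifold I 1 M] {n : ℕ}

/-- The graded bundle `TM[0] ⊕ A 0 [1] ⊕ A 1 [2] ⊕ …`. -/
abbrev adjointBundle (A : Fin n → VB I M) : Graded n M where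
  zero := {
    W := fun x => TangentSpace I x
    IsSmooth := fun X => ContMDiff I I.tangent ∞ (fun x => (⟨x, X x⟩ : TangentBundle I M)) }
  pos := fun i => (A i).sec
  dir := -1

/-- `N X = ∇*_X ε` at the point `x`, for the connection dual to `∇`. -/
def IsDualDerivative {B : VB I M} (cov : CovariantDerivative I B.F B.E)
    (ε : ∀ x, Module.Dual ℝ (B.E x)) (x : M)
    (N : TangentSpace I x →ₗ[ℝ] Module.Dual ℝ (B.E x)) : Prop :=
  ∀ σ, B.IsSec σ → ∀ X : TangentSpace I x,
    N X (σ x) = mvfderiv I (fun y => ε y (σ y)) x X - ε x (cov σ x X)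

/-- The vector field `Y` on the graded manifold is the image of `s` under the isomorphism of
`Γ(S(A*))`-modules that maps a vector field `X` on `M` to the derivation `f ↦ X f`, `ε ↦ ∇*_X ε` and
a section `a` of `A i` to the derivation `f ↦ 0`, `ε ↦ ε(a)`. -/
structure Realises {A : Fin n → VB I M} (cov : ∀ i, CovariantDerivative I (A i).F (A i).E)
    (s : SecMod A (adjointBundle A)) (Y : Fun A →ₗ[ℝ] Fun A) : Prop where
  base : ∀ f hf x, (Y (ofFun A f hf)).1 x =
    extendMul (AlgHom.id ℝ _) (Algebra.linearMap ℝ (SymFib A x) ∘ₗ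
      (mvfderiv I f x).toLinearMap ∘ₗ
      LinearMap.fst ℝ (TangentSpace I x) (∀ i, (A i).E x)) (s.1 x)
  form : ∀ i ε hε x, ∃ N, IsDualDerivative (cov i) ε x N ∧ (Y (ofForm A i ε hε)).1 x =
    extendMul (AlgHom.id ℝ _)
      (GSym.ι i ∘ₗ N ∘ₗ LinearMap.fst ℝ (TangentSpace I x) (∀ i, (A i).E x) +
        Algebra.linearMap ℝ (SymFib A x) ∘ₗ ε x ∘ₗ LinearMap.proj i ∘ₗ
          LinearMap.snd ℝ (TangentSpace I x) (∀ i, (A i).E x)) (s.1 x)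

/-- `R` is the adjoint representation built from the connections `cov`: under the isomorphism with
the vector fields on the graded manifold its differential is the graded commutator with `Q`. -/
def IsAdjoint {A : Fin n → VB I M} {Q : LieStr A}
    (cov : ∀ i, CovariantDerivative I (A i).F (A i).E) (R : Rep Q (adjointBundle A)) : Prop :=
  ∀ p s, HomSec p s → ∃ Y, IsDer p Y ∧ Realises cov s Y ∧
    Realises cov (R.D s) (Q.Q ∘ₗ Y - sgn p • (Y ∘ₗ Q.Q))

end Adjoint

end

end VBLie

/-!
Both halves of the theorem rest on one observation: the object from which the representation is made
does not depend on the auxiliary choice, the choice only identifies it with a free module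
`S(A*) ⊗ W`, and two such identifications differ by a shear `id ⊕ Δ`. So the shear intertwines the two
differentials.

*Connections.* A family `∇` of connections identifies `S(A*) ⊗ (TM ⊕ A)` with the module of graded
derivations of `S(A*)`: the map is injective (`vecPt_injective`), and by Hadamard's lemma it reaches
every derivation (`exists_vecFun_eq`). The commutator with `Q` becomes a differential
(`exists_adjoint`). The shear by `∇' - ∇` turns one identification into the other
(`vecFun_connShear`), since the dual connections differ by the transpose of `∇' - ∇`.

*Decompositions.* Let `D` be a VB-Lie `n`-algebroid. The values of `Q α` for a form `α` are expressed
by the bracket and the anchor (`IsBracket.eval`), and there are enough linear and core sections to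
detect a form by its values on them (`DVB.exists_isLinear`, `span_linear_core`). So the axioms on
brackets of linear and core sections say two things. The field `Q` maps forms pulled back from `A` to
such forms, which gives the structure on `A` (`IsVBLie.Q_pull`, `IsVBLie.eq_side`). And it maps
functions that are linear along the fibres over `A` to such functions (`IsVBLie.isFibLinear_base`,
`IsVBLie.isFibLinear_core`), where linearity of a form of arbitrary degree means: with horizontal
arguments it is linear on the fibres of `V`, with one core argument it is constant on them, with two
core arguments it vanishes (`IsFibLinear`). A decomposition `h` identifies the fibrewise linear
functions with the sections of `S(A*) ⊗ (V* ⊕ C*)` (`exists_toFun`, `eq_of_toFun`), so that `Q` becomes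
a differential there (`IsVBLie.exists_dualRep`), and `D_h` is its dual (`Rep.exists_isDual`,
`IsDual.unique`). A linear function written by means of `h` and of `h'` gives two sections of
`S(A*) ⊗ (V* ⊕ C*)` that differ by the transpose of the shear by `Δ = h - h'` (`pair_shear_diffs`);
as the pairing is nondegenerate, the shear intertwines `D_h` and `D_h'` (`decShear_comm`).

The fibres of `S(A*)` are quotients of tensor algebras, and an element is recognised by its
contractions (`GSym.eq_zero_of_contract_stable`). Sections are families of elements of the fibres that
are locally polynomial in smooth functions and forms, hence derivations and representations are local
operators; a representation is constructed from a pointwise description of its values that determines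
them uniquely and is known to be solvable on generators (`exists_rep`).
-/

set_option linter.unusedSectionVars false

namespace VBLie

universe u v w

/-! ### Signs -/

lemma sgn_add (k l : ℤ) : sgn (k + l) = sgn k * sgn l := by
  simp [sgn, Int.negOnePow_add]

lemma sgn_neg (k : ℤ) : sgn (-k) = sgn k := by
  simp [sgn, Int.negOnePow_neg]

lemma sgn_mul_self (k : ℤ) : sgn k * sgn k = 1 := by
  rw [← sgn_add, sgn, Int.negOnePow_even _ ⟨k, rfl⟩]
  simp

@[simp] lemma sgn_zero : sgn 0 = 1 := by simp [sgn]

lemma sgn_natCast (k : ℕ) : sgn (k : ℤ) = (-1) ^ k := by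
  simp [sgn, Int.negOnePow_def]

lemma sgn_one : sgn 1 = -1 := by simp [sgn]

lemma sgn_mul_natAbs (p k : ℤ) : sgn (p * k) = sgn k ^ p.natAbs := by
  have h : ∀ (m : ℕ) (k : ℤ), sgn (m * k) = sgn k ^ m := by
    intro m k
    induction m with
    | zero => simp
    | succ m ih => rw [Nat.cast_succ, add_mul, sgn_add, ih, one_mul, pow_succ]
  rcases Int.natAbs_eq p with hp | hp
  · conv_lhs => rw [hp]
    exact h _ _
  · conv_lhs => rw [hp]
    rw [neg_mul, sgn_neg]
    exact h _ _

/-! ### The graded symmetric algebra -/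

namespace GSym

variable {n : ℕ} {W : Fin n → Type v} [∀ i, AddCommGroup (W i)] [∀ i, Module ℝ (W i)]

@[elab_as_elim]
theorem induction {p : GSym W → Prop} (halg : ∀ t : ℝ, p (algebraMap ℝ _ t))
    (hι : ∀ i x, p (ι i x)) (hmul : ∀ ξ η, p ξ → p η → p (ξ * η))
    (hadd : ∀ ξ η, p ξ → p η → p (ξ + η)) (ξ : GSym W) : p ξ := by
  obtain ⟨y, rfl⟩ := RingQuot.mkAlgHom_surjective ℝ (GSym.Rel W) ξ
  induction y using TensorAlgebra.induction with
  | algebraMap r => rw [AlgHom.commutes]; exact halg r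
  | ι x =>
    have : (RingQuot.mkAlgHom ℝ (GSym.Rel W)) (TensorAlgebra.ι ℝ x) = ∑ i, ι i (x i) := by
      conv_lhs => rw [← Finset.univ_sum_single x, map_sum, map_sum]
      rfl
    rw [this]
    exact Finset.sum_induction _ p hadd (by simpa using halg 0) (fun i _ => hι i _)
  | mul a b ha hb => rw [map_mul]; exact hmul _ _ ha hb
  | add a b ha hb => rw [map_add]; exact hadd _ _ ha hb

theorem hom_ext {B : Type*} [Ring B] [Algebra ℝ B] {f g : GSym W →ₐ[ℝ] B}
    (h : ∀ i x, f (ι i x) = g (ι i x)) : f = g := by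
  ext ξ
  induction ξ using GSym.induction with
  | halg t => simp
  | hι i x => exact h i x
  | hmul ξ η h1 h2 => simp [h1, h2]
  | hadd ξ η h1 h2 => simp [h1, h2]

section Map

variable {W' : Fin n → Type*} [∀ i, AddCommGroup (W' i)] [∀ i, Module ℝ (W' i)]
  {W'' : Fin n → Type*} [∀ i, AddCommGroup (W'' i)] [∀ i, Module ℝ (W'' i)]

@[simp] lemma map_ι (f : ∀ i, W i →ₗ[ℝ] W' i) (i : Fin n) (x : W i) :
    map f (ι i x) = ι i (f i x) := by simp [map]

lemma map_map (g : ∀ i, W' i →ₗ[ℝ] W'' i) (f : ∀ i, W i →ₗ[ℝ] W' i) (ξ : GSym W) :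
    map g (map f ξ) = map (fun i => g i ∘ₗ f i) ξ :=
  DFunLike.congr_fun (hom_ext (f := (map g).comp (map f)) (by simp)) ξ

lemma map_id (f : ∀ i, W i →ₗ[ℝ] W i) (hf : ∀ i x, f i x = x) (ξ : GSym W) : map f ξ = ξ :=
  DFunLike.congr_fun (hom_ext (f := map f) (g := AlgHom.id ℝ _) (by simp [hf])) ξ

end Map

@[simp] lemma aug_ι (i : Fin n) (x : W i) : aug (ι i x) = 0 := by simp [aug]

lemma aug_map {W' : Fin n → Type*} [∀ i, AddCommGroup (W' i)] [∀ i, Module ℝ (W' i)]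
    (f : ∀ i, W i →ₗ[ℝ] W' i) (ξ : GSym W) : aug (map f ξ) = aug ξ :=
  DFunLike.congr_fun (hom_ext (f := aug.comp (map f)) (by simp)) ξ

@[simp] lemma parity_ι (i : Fin n) (x : W i) :
    parity (ι i x) = (-1 : ℝ) ^ (i.val + 1) • ι i x := by simp [parity]

/-- The algebra endomorphism that multiplies the generators in degree `i + 1` by `c i`. -/
noncomputable def scale (c : Fin n → ℝ) : GSym W →ₐ[ℝ] GSym W := map (fun i => c i • LinearMap.id)

@[simp] lemma scale_ι (c : Fin n → ℝ) (i : Fin n) (x : W i) :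
    scale c (ι i x) = c i • ι i x := by simp [scale]

lemma parity_pow_eq_scale (k : ℕ) :
    (parity ^ k : GSym W →ₐ[ℝ] GSym W) = scale (fun i => ((-1 : ℝ) ^ (i.val + 1)) ^ k) := by
  refine hom_ext fun i x => ?_
  induction k with
  | zero => simp
  | succ k ih =>
    rw [pow_succ', AlgHom.mul_apply, ih]
    simp [smul_smul, pow_succ]

lemma map_scale {W' : Fin n → Type*} [∀ i, AddCommGroup (W' i)] [∀ i, Module ℝ (W' i)]
    (f : ∀ i, W i →ₗ[ℝ] W' i) (c : Fin n → ℝ) (ξ : GSym W) :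
    map f (scale c ξ) = scale c (map f ξ) :=
  DFunLike.congr_fun (hom_ext (f := (map f).comp (scale c)) (g := (scale c).comp (map f))
    (by simp)) ξ

lemma parity_parity (ξ : GSym W) : parity (parity ξ) = ξ := by
  refine DFunLike.congr_fun (hom_ext (f := parity.comp parity) (g := AlgHom.id ℝ _) ?_) ξ
  intro i x
  simp [smul_smul, ← mul_pow]

lemma parity_pow_parity_pow (k : ℕ) (ξ : GSym W) : (parity ^ k : GSym W →ₐ[ℝ] GSym W)
    ((parity ^ k : GSym W →ₐ[ℝ] GSym W) ξ) = ξ := by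
  rw [← AlgHom.mul_apply, ← pow_add, ← two_mul, pow_mul]
  have : (parity ^ 2 : GSym W →ₐ[ℝ] GSym W) = 1 := by
    ext ξ
    rw [pow_two, AlgHom.mul_apply, parity_parity]
    rfl
  rw [this, one_pow, AlgHom.one_apply]

lemma scale_apply_pow_parity (k : ℕ) (ξ : GSym W) :
    (parity ^ k : GSym W →ₐ[ℝ] GSym W) ξ = scale (fun i => ((-1 : ℝ) ^ (i.val + 1)) ^ k) ξ := by
  rw [parity_pow_eq_scale]

/-- Graded commutativity, with the sign hidden in the parity automorphism. -/
lemma ι_mul (i : Fin n) (x : W i) (ξ : GSym W) :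
    ι i x * ξ = (parity ^ (i.val + 1) : GSym W →ₐ[ℝ] GSym W) ξ * ι i x := by
  rw [scale_apply_pow_parity]
  induction ξ using GSym.induction with
  | halg t => simp [Algebra.commutes]
  | hι j y => rw [ι_comm, scale_ι, smul_mul_assoc, ← pow_mul, mul_comm (i.val + 1)]
  | hmul ξ η h1 h2 => rw [← mul_assoc, h1, mul_assoc, h2, map_mul, mul_assoc]
  | hadd ξ η h1 h2 => rw [mul_add, h1, h2, map_add, add_mul]

lemma ι_mul_parity (i : Fin n) (x : W i) (ξ : GSym W) :
    ι i x * (parity ^ (i.val + 1) : GSym W →ₐ[ℝ] GSym W) ξ = ξ * ι i x := by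
  rw [ι_mul, parity_pow_parity_pow]

/-! ### Contractions -/

lemma contract_eq (i : Fin n) (a : Module.Dual ℝ (W i)) :
    ∃ h, ∀ ξ, contract i a ξ = lift (contractGen i a) h ξ 0 1 := by
  refine ⟨?_, fun ξ => ?_⟩
  rotate_left
  · rfl

/-- A twisted derivation is the upper right entry of an algebra homomorphism to upper triangular
matrices, with the twist and the identity on the diagonal; for `contract i a` the twist is a power
of the parity. -/
lemma contract_matrix (i : Fin n) (a : Module.Dual ℝ (W i)) :
    ∃ φ : GSym W →ₐ[ℝ] Matrix (Fin 2) (Fin 2) (GSym W),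
      (∀ j y, φ (ι j y) = contractGen i a j y) ∧
      (∀ ξ, φ ξ 0 1 = contract i a ξ) ∧ (∀ ξ, φ ξ 1 0 = 0) ∧ (∀ ξ, φ ξ 1 1 = ξ) ∧
      ∀ ξ, φ ξ 0 0 = (parity ^ (i.val + 1) : GSym W →ₐ[ℝ] GSym W) ξ := by
  obtain ⟨h, hc⟩ := contract_eq i a
  have h10 : ∀ ξ, lift (contractGen i a) h ξ 1 0 = 0 := by
    intro ξ
    induction ξ using GSym.induction with
    | halg t => simp [Matrix.algebraMap_matrix_apply]
    | hι j y => simp [contractGen]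
    | hmul ξ η h1 h2 => simp [Matrix.mul_apply, h1, h2]
    | hadd ξ η h1 h2 => simp [h1, h2]
  refine ⟨lift (contractGen i a) h, fun j y => lift_ι _ _ _ _, fun ξ => (hc ξ).symm, h10, ?_, ?_⟩
  · intro ξ
    induction ξ using GSym.induction with
    | halg t => simp [Matrix.algebraMap_matrix_apply]
    | hι j y => simp [contractGen]
    | hmul ξ η h1 h2 => simp [Matrix.mul_apply, h10, h1, h2]
    | hadd ξ η h1 h2 => simp [h1, h2]
  · intro ξ
    rw [parity_pow_eq_scale]
    induction ξ using GSym.induction with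
    | halg t => simp [Matrix.algebraMap_matrix_apply]
    | hι j y => simp [contractGen, ← pow_mul, mul_comm (i.val + 1)]
    | hmul ξ η h1 h2 => simp [Matrix.mul_apply, h10, h1, h2]
    | hadd ξ η h1 h2 => simp [h1, h2]

lemma contract_mul (i : Fin n) (a : Module.Dual ℝ (W i)) (ξ η : GSym W) :
    contract i a (ξ * η) = contract i a ξ * η +
      (parity ^ (i.val + 1) : GSym W →ₐ[ℝ] GSym W) ξ * contract i a η := by
  obtain ⟨φ, -, h01, h10, h11, h00⟩ := contract_matrix i a
  rw [← h01, map_mul, Matrix.mul_apply, Fin.sum_univ_two, h01, h01, h11, h00, add_comm]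

@[simp] lemma contract_ι (i : Fin n) (a : Module.Dual ℝ (W i)) (j : Fin n) (y : W j) :
    contract i a (ι j y) = algebraMap ℝ _ ((Pi.single i a : ∀ j, Module.Dual ℝ (W j)) j y) := by
  obtain ⟨φ, hι, h01, -⟩ := contract_matrix i a
  rw [← h01, hι]
  simp [contractGen]

lemma contract_ι_self (i : Fin n) (a : Module.Dual ℝ (W i)) (y : W i) :
    contract i a (ι i y) = algebraMap ℝ _ (a y) := by simp

lemma contract_ι_of_ne {i j : Fin n} (h : j ≠ i) (a : Module.Dual ℝ (W i)) (y : W j) :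
    contract i a (ι j y) = 0 := by simp [Pi.single_eq_of_ne h]

@[simp] lemma contract_algebraMap (i : Fin n) (a : Module.Dual ℝ (W i)) (t : ℝ) :
    contract i a (algebraMap ℝ (GSym W) t) = 0 := by
  obtain ⟨φ, -, h01, -⟩ := contract_matrix i a
  rw [← h01]
  simp [Matrix.algebraMap_matrix_apply]

lemma contract_add_left (i : Fin n) (a b : Module.Dual ℝ (W i)) (ξ : GSym W) :
    contract i (a + b) ξ = contract i a ξ + contract i b ξ := by
  induction ξ using GSym.induction with
  | halg t => simp
  | hι j y =>
    by_cases h : j = i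
    · subst h
      simp
    · simp [contract_ι_of_ne h]
  | hmul ξ η h1 h2 => simp only [contract_mul, h1, h2, add_mul, mul_add]; abel
  | hadd ξ η h1 h2 => simp only [map_add, h1, h2]; abel

lemma contract_smul_left (i : Fin n) (t : ℝ) (a : Module.Dual ℝ (W i)) (ξ : GSym W) :
    contract i (t • a) ξ = t • contract i a ξ := by
  induction ξ using GSym.induction with
  | halg t => simp
  | hι j y =>
    by_cases h : j = i
    · subst h
      simp [Algebra.smul_def]
    · simp [contract_ι_of_ne h]
  | hmul ξ η h1 h2 => simp only [contract_mul, h1, h2, smul_mul_assoc, mul_smul_comm, smul_add]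
  | hadd ξ η h1 h2 => simp only [map_add, h1, h2, smul_add]

/-- The contraction as a bilinear map. -/
noncomputable def contractL (i : Fin n) : Module.Dual ℝ (W i) →ₗ[ℝ] GSym W →ₗ[ℝ] GSym W where
  toFun := contract i
  map_add' a b := LinearMap.ext (contract_add_left i a b)
  map_smul' t a := LinearMap.ext (contract_smul_left i t a)

@[simp] lemma contractL_apply (i : Fin n) (a : Module.Dual ℝ (W i)) (ξ : GSym W) :
    contractL i a ξ = contract i a ξ := rfl

@[simp] lemma contract_zero_left (i : Fin n) (ξ : GSym W) : contract i 0 ξ = 0 := by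
  simpa using contract_smul_left i 0 0 ξ

lemma contract_scale (i : Fin n) (a : Module.Dual ℝ (W i)) (c : Fin n → ℝ) (ξ : GSym W) :
    contract i a (scale c ξ) = c i • scale c (contract i a ξ) := by
  induction ξ using GSym.induction with
  | halg t => simp
  | hι j y =>
    by_cases h : j = i
    · subst h
      simp
    · simp [contract_ι_of_ne h]
  | hmul ξ η h1 h2 =>
    have hcomm : ∀ ζ : GSym W, (parity ^ (i.val + 1) : GSym W →ₐ[ℝ] GSym W) (scale c ζ) =
        scale c ((parity ^ (i.val + 1) : GSym W →ₐ[ℝ] GSym W) ζ) := by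
      intro ζ
      rw [scale_apply_pow_parity, scale_apply_pow_parity]
      exact (map_scale _ _ _)
    simp only [map_mul, contract_mul, h1, h2, smul_mul_assoc, mul_smul_comm, smul_add, map_add,
      hcomm]
  | hadd ξ η h1 h2 => simp only [map_add, h1, h2, smul_add]

lemma contract_parity_pow (i : Fin n) (a : Module.Dual ℝ (W i)) (k : ℕ) (ξ : GSym W) :
    contract i a ((parity ^ k : GSym W →ₐ[ℝ] GSym W) ξ) =
      ((-1 : ℝ) ^ (i.val + 1)) ^ k • (parity ^ k : GSym W →ₐ[ℝ] GSym W) (contract i a ξ) := by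
  rw [scale_apply_pow_parity, scale_apply_pow_parity, contract_scale]

lemma contract_map {W' : Fin n → Type*} [∀ i, AddCommGroup (W' i)] [∀ i, Module ℝ (W' i)]
    (f : ∀ i, W i →ₗ[ℝ] W' i) (i : Fin n) (a : Module.Dual ℝ (W' i)) (ξ : GSym W) :
    contract i a (map f ξ) = map f (contract i (a ∘ₗ f i) ξ) := by
  induction ξ using GSym.induction with
  | halg t => simp
  | hι j y =>
    by_cases h : j = i
    · subst h
      simp
    · simp [contract_ι_of_ne h]
  | hmul ξ η h1 h2 =>
    simp only [map_mul, contract_mul, h1, h2, map_add, scale_apply_pow_parity, map_scale]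
  | hadd ξ η h1 h2 => simp only [map_add, h1, h2]

/-- Contractions commute in the graded sense. -/
lemma contract_contract (i j : Fin n) (a : Module.Dual ℝ (W i)) (b : Module.Dual ℝ (W j))
    (ξ : GSym W) : contract i a (contract j b ξ) =
      ((-1 : ℝ) ^ (i.val + 1)) ^ (j.val + 1) • contract j b (contract i a ξ) := by
  have hs : ((-1 : ℝ) ^ (i.val + 1)) ^ (j.val + 1) * ((-1 : ℝ) ^ (j.val + 1)) ^ (i.val + 1) = 1 := by
    rw [← pow_mul, ← pow_mul, mul_comm (j.val + 1), ← mul_pow]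
    simp
  induction ξ using GSym.induction with
  | halg t => simp
  | hι j y => simp
  | hmul ξ η h1 h2 =>
    simp only [contract_mul, map_add, contract_parity_pow, h1, h2]
    have hcomm : (parity ^ (i.val + 1) : GSym W →ₐ[ℝ] GSym W)
        ((parity ^ (j.val + 1) : GSym W →ₐ[ℝ] GSym W) ξ) = (parity ^ (j.val + 1) : GSym W →ₐ[ℝ] GSym W)
        ((parity ^ (i.val + 1) : GSym W →ₐ[ℝ] GSym W) ξ) := by
      rw [← AlgHom.mul_apply, ← AlgHom.mul_apply, ← pow_add, ← pow_add, add_comm]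
    rw [hcomm]
    simp only [smul_mul_assoc, mul_smul_comm, smul_add, smul_smul, hs, one_smul]
    abel
  | hadd ξ η h1 h2 => simp only [map_add, h1, h2, smul_add]

/-! ### The grading -/

lemma one_mem_piece : (1 : GSym W) ∈ piece W 0 := Submodule.subset_span ⟨[], by simp⟩

lemma algebraMap_mem_piece (t : ℝ) : algebraMap ℝ (GSym W) t ∈ piece W 0 := by
  rw [Algebra.algebraMap_eq_smul_one]
  exact Submodule.smul_mem _ _ one_mem_piece

lemma ι_mem_piece (i : Fin n) (x : W i) : ι i x ∈ piece W ((i.val : ℤ) + 1) :=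
  Submodule.subset_span ⟨[⟨i, x⟩], by simp⟩

lemma mul_mem_piece {k l : ℤ} {ξ η : GSym W} (hξ : ξ ∈ piece W k) (hη : η ∈ piece W l) :
    ξ * η ∈ piece W (k + l) := by
  induction hξ using Submodule.span_induction with
  | mem x hx =>
    induction hη using Submodule.span_induction with
    | mem y hy =>
      obtain ⟨l1, h1, rfl⟩ := hx
      obtain ⟨l2, h2, rfl⟩ := hy
      exact Submodule.subset_span ⟨l1 ++ l2, by simp [h1, h2], by simp⟩
    | zero => simp
    | add y z _ _ h1 h2 => rw [mul_add]; exact add_mem h1 h2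
    | smul t y _ h => rw [mul_smul_comm]; exact Submodule.smul_mem _ _ h
  | zero => simp
  | add y z _ _ h1 h2 => rw [add_mul]; exact add_mem h1 h2
  | smul t y _ h => rw [smul_mul_assoc]; exact Submodule.smul_mem _ _ h

/-- Induction over the homogeneous elements. -/
lemma piece_induction {p : ℤ → GSym W → Prop} (h1 : p 0 1)
    (hι : ∀ i x k ξ, ξ ∈ piece W k → p k ξ → p (i.val + 1 + k) (ι i x * ξ))
    (h0 : ∀ k, p k 0) (hadd : ∀ k ξ η, p k ξ → p k η → p k (ξ + η))
    (hsmul : ∀ k (t : ℝ) ξ, p k ξ → p k (t • ξ)) {k : ℤ} {ξ : GSym W} (hξ : ξ ∈ piece W k) :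
    p k ξ := by
  induction hξ using Submodule.span_induction with
  | mem x hx =>
    obtain ⟨l, rfl, rfl⟩ := hx
    induction l with
    | nil => simpa using h1
    | cons a l ih =>
      simp only [List.map_cons, List.sum_cons, List.prod_cons]
      exact hι _ _ _ _ (Submodule.subset_span ⟨l, rfl, rfl⟩) ih
  | zero => exact h0 k
  | add x y _ _ h1 h2 => exact hadd _ _ _ h1 h2
  | smul t x _ h => exact hsmul _ _ _ h

lemma piece_eq_bot {k : ℤ} (hk : k < 0) : piece W k = ⊥ := by
  rw [piece, Submodule.span_eq_bot]
  rintro _ ⟨l, hl, -⟩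
  exfalso
  have : 0 ≤ (l.map (fun p : Σ i, W i => (p.1.val : ℤ) + 1)).sum :=
    List.sum_nonneg (by simp; intro a _ _ h; omega)
  omega

lemma map_mem_piece {W' : Fin n → Type*} [∀ i, AddCommGroup (W' i)] [∀ i, Module ℝ (W' i)]
    (f : ∀ i, W i →ₗ[ℝ] W' i) {k : ℤ} {ξ : GSym W} (hξ : ξ ∈ piece W k) :
    map f ξ ∈ piece W' k := by
  refine piece_induction (p := fun k ξ => map f ξ ∈ piece W' k) ?_ ?_ ?_ ?_ ?_ hξ
  · simpa using one_mem_piece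
  · intro i x k ξ _ h
    rw [map_mul, map_ι]
    exact mul_mem_piece (ι_mem_piece _ _) h
  · simp
  · intro k ξ η h1 h2
    rw [map_add]; exact add_mem h1 h2
  · intro k t ξ h
    rw [map_smul]; exact Submodule.smul_mem _ _ h

lemma parity_pow_of_mem_piece (m : ℕ) {k : ℤ} {ξ : GSym W} (hξ : ξ ∈ piece W k) :
    (parity ^ m : GSym W →ₐ[ℝ] GSym W) ξ = sgn k ^ m • ξ := by
  rw [scale_apply_pow_parity]
  refine piece_induction (p := fun k ξ => scale (fun i : Fin n => ((-1 : ℝ) ^ (i.val + 1)) ^ m) ξ =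
    sgn k ^ m • ξ) ?_ ?_ ?_ ?_ ?_ hξ
  · simp
  · intro i x k ξ _ h
    rw [map_mul, scale_ι, h, smul_mul_smul_comm, ← mul_pow, sgn_add, ← sgn_natCast]
    simp
  · simp
  · intro k ξ η h1 h2
    rw [map_add, h1, h2, smul_add]
  · intro k t ξ h
    rw [map_smul, h, smul_comm]

lemma parity_of_mem_piece {k : ℤ} {ξ : GSym W} (hξ : ξ ∈ piece W k) :
    parity ξ = sgn k • ξ := by
  simpa using parity_pow_of_mem_piece 1 hξ

lemma contract_mem_piece (i : Fin n) (a : Module.Dual ℝ (W i)) {k : ℤ} {ξ : GSym W}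
    (hξ : ξ ∈ piece W k) : contract i a ξ ∈ piece W (k - (i.val + 1)) := by
  refine piece_induction (p := fun k ξ => contract i a ξ ∈ piece W (k - (i.val + 1)))
    ?_ ?_ ?_ ?_ ?_ hξ
  · rw [← map_one (algebraMap ℝ (GSym W)), contract_algebraMap]
    exact zero_mem _
  · intro j x k ξ hk h
    rw [contract_mul]
    refine add_mem ?_ ?_
    · by_cases hj : j = i
      · subst hj
        rw [contract_ι_self, ← Algebra.smul_def]
        simpa using Submodule.smul_mem _ _ hk
      · rw [contract_ι_of_ne hj, zero_mul]
        exact zero_mem _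
    · rw [parity_pow_of_mem_piece _ (ι_mem_piece j x), smul_mul_assoc, add_sub_assoc]
      exact Submodule.smul_mem _ _ (mul_mem_piece (ι_mem_piece _ _) h)
  · simp
  · intro k ξ η h1 h2
    rw [map_add]; exact add_mem h1 h2
  · intro k t ξ h
    rw [map_smul]; exact Submodule.smul_mem _ _ h

lemma scale_of_mem_piece (k : ℕ) {ξ : GSym W} (hξ : ξ ∈ piece W k) :
    scale (fun i : Fin n => (2 : ℝ) ^ (i.val + 1)) ξ = (2 : ℝ) ^ k • ξ := by
  rw [← zpow_natCast]
  refine piece_induction (p := fun k ξ => scale (fun i : Fin n => (2 : ℝ) ^ (i.val + 1)) ξ =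
    (2 : ℝ) ^ k • ξ) ?_ ?_ ?_ ?_ ?_ hξ
  · simp
  · intro i x k ξ _ h
    rw [map_mul, scale_ι, h, smul_mul_smul_comm, ← zpow_natCast, ← zpow_add₀ two_ne_zero]
    norm_cast
  · simp
  · intro k ξ η h1 h2
    rw [map_add, h1, h2, smul_add]
  · intro k t ξ h
    rw [map_smul, h, smul_comm]

/-- Graded commutativity. -/
lemma mul_comm_of_mem_piece {k l : ℤ} {ξ η : GSym W} (hξ : ξ ∈ piece W k) (hη : η ∈ piece W l) :
    ξ * η = sgn (k * l) • (η * ξ) := by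
  have := piece_induction (p := fun k ξ => ξ * η = sgn (k * l) • (η * ξ)) ?_ ?_ ?_ ?_ ?_ hξ
  · exact this
  · simp
  · intro i x k ξ _ h
    rw [mul_assoc, h, mul_smul_comm, ← mul_assoc, ι_mul, parity_pow_of_mem_piece _ hη, add_mul,
      sgn_add, ← mul_assoc, smul_mul_assoc, smul_mul_assoc, smul_smul, mul_comm,
      sgn_mul_natAbs ((i.val : ℤ) + 1)]
    norm_cast
  · simp
  · intro k ξ η h1 h2
    rw [add_mul, h1, h2, mul_add, smul_add]
  · intro k t ξ h
    rw [smul_mul_assoc, h, mul_smul_comm, smul_comm]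

lemma iSup_piece : ⨆ k : ℕ, piece W k = ⊤ := by
  refine eq_top_iff.2 fun ξ _ => ?_
  have hle : ∀ k : ℕ, piece W k ≤ ⨆ k : ℕ, piece W k := fun k => le_iSup (fun k : ℕ => piece W k) k
  induction ξ using GSym.induction with
  | halg t => exact hle 0 (by simpa using algebraMap_mem_piece t)
  | hι i x => exact hle (i.val + 1) (by simpa using ι_mem_piece i x)
  | hmul ξ η h1 h2 =>
    have h1 := h1 trivial
    have h2 := h2 trivial
    clear * - h1 h2 hle
    induction h1 using Submodule.iSup_induction' with
    | mem k x hx =>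
      induction h2 using Submodule.iSup_induction' with
      | mem l y hy => exact hle (k + l) (by simpa using mul_mem_piece hx hy)
      | zero => simp
      | add y z _ _ h1 h2 => rw [mul_add]; exact add_mem h1 h2
    | zero => simp
    | add x y _ _ h1 h2 => rw [add_mul]; exact add_mem h1 h2
  | hadd ξ η h1 h2 => exact add_mem (h1 trivial) (h2 trivial)

lemma aug_of_mem_piece {k : ℤ} (hk : k ≠ 0) {ξ : GSym W} (hξ : ξ ∈ piece W k) : aug ξ = 0 := by
  have := piece_induction (p := fun k ξ => k ≠ 0 → aug ξ = 0) ?_ ?_ ?_ ?_ ?_ hξ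
  · exact this hk
  · simp
  · intro i x k ξ _ h _
    simp
  · simp
  · intro k ξ η h1 h2 hk
    simp [h1 hk, h2 hk]
  · intro k t ξ h hk
    simp [h hk]

end GSym

/-- If the submodules `p k` span everything and consist of eigenvectors of `T` for distinct
eigenvalues `μ k`, then every eigenvector for `μ k` lies in `p k`. -/
lemma mem_of_eigenvector {E : Type*} [AddCommGroup E] [Module ℝ E] (T : Module.End ℝ E)
    (p : ℕ → Submodule ℝ E) (μ : ℕ → ℝ) (hμ : Function.Injective μ) (hp : ⨆ k, p k = ⊤)
    (hT : ∀ k, ∀ x ∈ p k, T x = μ k • x) {k : ℕ} {x : E} (hx : T x = μ k • x) : x ∈ p k := by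
  have hx' : x ∈ ⨆ k, p k := hp ▸ Submodule.mem_top
  obtain ⟨f, hf, rfl⟩ := (Submodule.mem_iSup_iff_exists_finsupp _ _).1 hx'
  have hind : iSupIndep fun j => T.eigenspace (μ j) := T.eigenspaces_iSupIndep.comp hμ
  have hsum : ∑ j ∈ f.support, (μ j - μ k) • f j = 0 := by
    simp only [Finsupp.sum, map_sum, Finset.smul_sum] at hx
    simp only [sub_smul, Finset.sum_sub_distrib, ← hx]
    rw [sub_eq_zero]
    exact Finset.sum_congr rfl fun j _ => (hT j _ (hf j)).symm
  have h0 := (iSupIndep_iff_finsetSum_eq_zero_imp_eq_zero _).1 hind f.support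
    (fun j => (μ j - μ k) • f j) (fun j _ => Submodule.smul_mem _ _
      (Module.End.mem_eigenspace_iff.2 (hT j _ (hf j)))) hsum
  refine Submodule.sum_mem _ fun j hj => ?_
  rcases smul_eq_zero.1 (h0 j hj) with h | h
  · rw [← hμ (sub_eq_zero.1 h)]
    exact hf j
  · simp [h]

namespace GSym

variable {n : ℕ} {W : Fin n → Type v} [∀ i, AddCommGroup (W i)] [∀ i, Module ℝ (W i)]

/-- An element on which doubling in the sense of the grading acts as in degree `k` has
degree `k`. -/
lemma mem_piece_of_scale {k : ℕ} {ξ : GSym W}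
    (h : scale (fun i : Fin n => (2 : ℝ) ^ (i.val + 1)) ξ = (2 : ℝ) ^ k • ξ) : ξ ∈ piece W k := by
  refine mem_of_eigenvector (scale (fun i : Fin n => (2 : ℝ) ^ (i.val + 1))).toLinearMap
    (fun k : ℕ => piece W k) (fun k => 2 ^ k) (pow_right_injective₀ (by simp) (by simp))
    iSup_piece ?_ h
  intro k ξ hξ
  exact scale_of_mem_piece k hξ

/-- The span of the products of at most `m` generators. -/
def fil (W : Fin n → Type v) [∀ i, AddCommGroup (W i)] [∀ i, Module ℝ (W i)] (m : ℕ) :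
    Submodule ℝ (GSym W) :=
  Submodule.span ℝ {ξ | ∃ l : List (Σ i, W i), l.length ≤ m ∧
    ξ = (l.map (fun p => ι p.1 p.2)).prod}

lemma ι_mul_mem_fil (i : Fin n) (x : W i) {m : ℕ} {ξ : GSym W} (hξ : ξ ∈ fil W m) :
    ι i x * ξ ∈ fil W (m + 1) := by
  induction hξ using Submodule.span_induction with
  | mem y hy =>
    obtain ⟨l, hl, rfl⟩ := hy
    exact Submodule.subset_span ⟨⟨i, x⟩ :: l, by simpa using hl, by simp⟩
  | zero => simp
  | add y z _ _ h1 h2 => rw [mul_add]; exact add_mem h1 h2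
  | smul t y _ h => rw [mul_smul_comm]; exact Submodule.smul_mem _ _ h

lemma fil_mono {m m' : ℕ} (h : m ≤ m') : fil W m ≤ fil W m' :=
  Submodule.span_mono fun _ ⟨l, hl, e⟩ => ⟨l, hl.trans h, e⟩

lemma contract_mem_fil (i : Fin n) (a : Module.Dual ℝ (W i)) {m : ℕ} {ξ : GSym W}
    (hξ : ξ ∈ fil W (m + 1)) : contract i a ξ ∈ fil W m := by
  induction hξ using Submodule.span_induction with
  | mem y hy =>
    obtain ⟨l, hl, rfl⟩ := hy
    induction l generalizing m with
    | nil =>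
      simp only [List.map_nil, List.prod_nil]
      rw [← map_one (algebraMap ℝ (GSym W)), contract_algebraMap]
      exact zero_mem _
    | cons p l ih =>
      have hl' : l.length ≤ m := by simpa using hl
      simp only [List.map_cons, List.prod_cons, contract_mul, contract_ι, ← Algebra.smul_def]
      refine add_mem (Submodule.smul_mem _ _ (Submodule.subset_span ⟨l, hl', rfl⟩)) ?_
      rw [parity_pow_of_mem_piece _ (ι_mem_piece _ _), smul_mul_assoc]
      refine Submodule.smul_mem _ _ ?_
      cases m with
      | zero =>
        obtain rfl : l = [] := by simpa using hl'
        simp only [List.map_nil, List.prod_nil]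
        rw [← map_one (algebraMap ℝ (GSym W)), contract_algebraMap, mul_zero]
        exact zero_mem _
      | succ m => exact ι_mul_mem_fil _ _ (ih hl')
  | zero => simp
  | add y z _ _ h1 h2 => rw [map_add]; exact add_mem h1 h2
  | smul t y _ h => rw [map_smul]; exact Submodule.smul_mem _ _ h

lemma exists_mem_fil (ξ : GSym W) : ∃ m, ξ ∈ fil W m := by
  have hmul : ∀ {m m' : ℕ} {ξ η : GSym W}, ξ ∈ fil W m → η ∈ fil W m' → ξ * η ∈ fil W (m + m') := by
    intro m m' ξ η hξ hη
    induction hξ using Submodule.span_induction with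
    | mem x hx =>
      obtain ⟨l, hl, rfl⟩ := hx
      refine fil_mono (Nat.add_le_add_right hl m') ?_
      clear hl
      induction l with
      | nil => simpa using hη
      | cons a l ih =>
        simp only [List.map_cons, List.prod_cons, List.length_cons, mul_assoc]
        rw [add_right_comm]
        exact ι_mul_mem_fil _ _ ih
    | zero => simp
    | add y z _ _ h1 h2 => rw [add_mul]; exact add_mem h1 h2
    | smul t y _ h => rw [smul_mul_assoc]; exact Submodule.smul_mem _ _ h
  induction ξ using GSym.induction with
  | halg t =>
    refine ⟨0, ?_⟩
    rw [Algebra.algebraMap_eq_smul_one]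
    exact Submodule.smul_mem _ _ (Submodule.subset_span ⟨[], by simp⟩)
  | hι i x => exact ⟨1, Submodule.subset_span ⟨[⟨i, x⟩], by simp⟩⟩
  | hmul ξ η h1 h2 =>
    obtain ⟨m, h1⟩ := h1
    obtain ⟨m', h2⟩ := h2
    exact ⟨m + m', hmul h1 h2⟩
  | hadd ξ η h1 h2 =>
    obtain ⟨m, h1⟩ := h1
    obtain ⟨m', h2⟩ := h2
    exact ⟨m + m', add_mem (fil_mono (Nat.le_add_right _ _) h1) (fil_mono (Nat.le_add_left _ _) h2)⟩

/-- If all contractions of an element vanish, it is a scalar: the Euler operator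
`∑ e^b contract(e_b)` multiplies a product of `m` generators by `m`. -/
lemma eq_algebraMap_of_contract [∀ i, FiniteDimensional ℝ (W i)] {ξ : GSym W}
    (h : ∀ i a, contract i a ξ = 0) : ξ = algebraMap ℝ _ (aug ξ) := by
  let b := fun i => Module.finBasis ℝ (W i)
  -- The Euler operator; its eigenspaces are the spans `p m` of the products of `m` generators.
  let T : Module.End ℝ (GSym W) := ∑ i, ∑ k, LinearMap.mulLeft ℝ (ι i (b i k)) ∘ₗ
    contract i ((b i).coord k)
  have hT : ∀ ξ, T ξ = ∑ i, ∑ k, ι i (b i k) * contract i ((b i).coord k) ξ := by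
    intro ξ; simp [T]
  have hTι : ∀ i x, T (ι i x) = ι i x := by
    intro i x
    rw [hT, Finset.sum_eq_single i]
    · conv_rhs => rw [← (b i).sum_repr x, map_sum]
      refine Finset.sum_congr rfl fun k _ => ?_
      rw [contract_ι_self, ← Algebra.commutes, ← Algebra.smul_def, map_smul, Module.Basis.coord_apply]
    · intro j _ hj
      refine Finset.sum_eq_zero fun k _ => ?_
      rw [contract_ι_of_ne hj.symm, mul_zero]
    · simp
  have hTmul : ∀ ξ η, T (ξ * η) = T ξ * η + ξ * T η := by
    intro ξ η
    simp only [hT, contract_mul, mul_add, Finset.sum_add_distrib, Finset.sum_mul, Finset.mul_sum]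
    congr 1
    · simp only [mul_assoc]
    · simp only [← mul_assoc, ι_mul_parity]
  have hT1 : T 1 = 0 := by
    rw [hT]
    refine Finset.sum_eq_zero fun i _ => Finset.sum_eq_zero fun k _ => ?_
    rw [← map_one (algebraMap ℝ (GSym W)), contract_algebraMap, mul_zero]
  let p : ℕ → Submodule ℝ (GSym W) := fun m => Submodule.span ℝ {ξ | ∃ l : List (Σ i, W i),
    l.length = m ∧ ξ = (l.map (fun p => ι p.1 p.2)).prod}
  -- As all contractions of `ξ` vanish, `T ξ = 0`.
  have hmem : ξ ∈ p 0 := by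
    refine mem_of_eigenvector T p (fun m => m) Nat.cast_injective ?_ ?_ ?_
    · refine eq_top_iff.2 fun ξ _ => ?_
      obtain ⟨m, hm⟩ := exists_mem_fil ξ
      refine (Submodule.span_le.2 ?_ : fil W m ≤ _) hm
      rintro _ ⟨l, -, rfl⟩
      exact le_iSup p l.length (Submodule.subset_span ⟨l, rfl, rfl⟩)
    · intro m ξ hξ
      induction hξ using Submodule.span_induction with
      | mem y hy =>
        obtain ⟨l, rfl, rfl⟩ := hy
        induction l with
        | nil => simp [hT1]
        | cons a l ih =>
          simp only [List.map_cons, List.prod_cons, hTmul, hTι, ih, List.length_cons]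
          rw [mul_smul_comm]
          push_cast
          rw [add_smul, one_smul, add_comm]
      | zero => simp
      | add y z _ _ h1 h2 => rw [map_add, h1, h2, smul_add]
      | smul t y _ h => rw [map_smul, h, smul_comm]
    · rw [hT]
      simp [h]
  have : p 0 = Submodule.span ℝ {1} := by
    change Submodule.span ℝ _ = _
    congr 1
    ext ξ
    simp
  rw [this, Submodule.mem_span_singleton] at hmem
  obtain ⟨t, rfl⟩ := hmem
  simp [Algebra.algebraMap_eq_smul_one]

/-- A set of elements with vanishing scalar part that is stable under the contractions with enough
functionals contains only `0`. -/
theorem eq_zero_of_contract_stable [∀ i, FiniteDimensional ℝ (W i)] (Z : GSym W → Prop)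
    (S : ∀ i, Set (Module.Dual ℝ (W i))) (hS : ∀ i, Submodule.span ℝ (S i) = ⊤)
    (haug : ∀ ξ, Z ξ → aug ξ = 0) (hc : ∀ ξ, Z ξ → ∀ i, ∀ a ∈ S i, Z (contract i a ξ))
    {ξ : GSym W} (hξ : Z ξ) : ξ = 0 := by
  -- Contractions lower the number of generators, so that induction applies to them.
  have key : ∀ (m : ℕ) (ξ : GSym W), ξ ∈ fil W m → Z ξ → ξ = 0 := by
    intro m
    induction m with
    | zero =>
      intro ξ hm hξ
      have : fil W 0 = Submodule.span ℝ {1} := by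
        rw [fil]
        congr 1
        ext ξ
        simp
      rw [this, Submodule.mem_span_singleton] at hm
      obtain ⟨t, rfl⟩ := hm
      have := haug _ hξ
      simp only [map_smul, map_one, smul_eq_mul, mul_one] at this
      simp [this]
    | succ m ih =>
      intro ξ hm hξ
      have h0 : ∀ i a, contract i a ξ = 0 := by
        intro i a
        have ha : a ∈ Submodule.span ℝ (S i) := hS i ▸ Submodule.mem_top
        induction ha using Submodule.span_induction with
        | mem a ha => exact ih _ (contract_mem_fil i a hm) (hc ξ hξ i a ha)
        | zero => simp
        | add a b _ _ h1 h2 => rw [contract_add_left, h1, h2, add_zero]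
        | smul t a _ h => rw [contract_smul_left, h, smul_zero]
      rw [eq_algebraMap_of_contract h0, haug ξ hξ, map_zero]
  obtain ⟨m, hm⟩ := exists_mem_fil ξ
  exact key m ξ hm hξ

end GSym

/-! ### Bump functions, sections and forms -/

section Smooth

variable {EB : Type v} [NormedAddCommGroup EB] [NormedSpace ℝ EB] {HB : Type w}
  [TopologicalSpace HB] {I : ModelWithCorners ℝ EB HB}
  {M : Type u} [TopologicalSpace M] [ChartedSpace HB M]

lemma exists_bump [FiniteDimensional ℝ EB] [T2Space M] [IsManifold I ∞ M] {x₀ : M} {U : Set M}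
    (hU : U ∈ 𝓝 x₀) : ∃ χ : M → ℝ, ContMDiff I 𝓘(ℝ, ℝ) ∞ χ ∧ (∀ᶠ x in 𝓝 x₀, χ x = 1) ∧
      tsupport χ ⊆ U := by
  obtain ⟨f, -, hf⟩ := (SmoothBumpFunction.nhds_basis_tsupport (I := I) x₀).mem_iff.1 hU
  exact ⟨f, f.contMDiff, f.eventuallyEq_one, hf⟩

lemma VB.IsSec.add {V : VB I M} {s t : ∀ x, V.E x} (hs : V.IsSec s) (ht : V.IsSec t) :
    V.IsSec (fun x => s x + t x) := ContMDiff.add_section hs ht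

lemma VB.IsSec.zero (V : VB I M) : V.IsSec (fun x => (0 : V.E x)) :=
  contMDiff_zeroSection ℝ V.E

lemma VB.IsSec.smul {V : VB I M} {s : ∀ x, V.E x} {f : M → ℝ} (hf : ContMDiff I 𝓘(ℝ, ℝ) ∞ f)
    (hs : V.IsSec s) : V.IsSec (fun x => f x • s x) := ContMDiff.smul_section hf hs

lemma VB.IsSec.const_smul {V : VB I M} {s : ∀ x, V.E x} (t : ℝ)
    (hs : V.IsSec s) : V.IsSec (fun x => t • s x) := hs.smul contMDiff_const

lemma VB.IsSec.sum {V : VB I M} {ι : Type*} (k : Finset ι) {s : ι → ∀ x, V.E x}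
    (hs : ∀ b ∈ k, V.IsSec (s b)) : V.IsSec (fun x => ∑ b ∈ k, s b x) :=
  ContMDiff.sum_section hs

lemma VB.IsForm.add {V : VB I M} {α β : ∀ x, Module.Dual ℝ (V.E x)} (hα : V.IsForm α)
    (hβ : V.IsForm β) : V.IsForm (fun x => α x + β x) := ContMDiff.add hα hβ

lemma VB.IsForm.zero (V : VB I M) : V.IsForm (fun x => (0 : Module.Dual ℝ (V.E x))) :=
  contMDiff_const

lemma VB.IsForm.smul {V : VB I M} {α : ∀ x, Module.Dual ℝ (V.E x)} {f : M → ℝ}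
    (hf : ContMDiff I 𝓘(ℝ, ℝ) ∞ f) (hα : V.IsForm α) : V.IsForm (fun x => f x • α x) :=
  (hf.comp (contMDiff_proj V.E)).mul hα

lemma VB.IsForm.sum {V : VB I M} {ι : Type*} (k : Finset ι) {α : ι → ∀ x, Module.Dual ℝ (V.E x)}
    (hα : ∀ b ∈ k, V.IsForm (α b)) : V.IsForm (fun x => ∑ b ∈ k, α b x) := by
  classical
  induction k using Finset.induction_on with
  | empty => simpa using VB.IsForm.zero V
  | insert a k ha ih =>
    simp only [Finset.sum_insert ha]
    exact (hα _ (by simp)).add (ih fun b hb => hα b (by simp [hb]))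

/-- Forms applied to sections of the bundle along a map. -/
lemma VB.IsForm.comp_contMDiff {V : VB I M} {α : ∀ x, Module.Dual ℝ (V.E x)} (hα : V.IsForm α)
    {EN : Type*} [NormedAddCommGroup EN] [NormedSpace ℝ EN] {HN : Type*} [TopologicalSpace HN]
    {J : ModelWithCorners ℝ EN HN} {N : Type*} [TopologicalSpace N] [ChartedSpace HN N]
    {f : N → M} {s : ∀ y, V.E (f y)} (hs : ContMDiff J V.model ∞ (fun y => (⟨f y, s y⟩ : V.Tot))) :
    ContMDiff J 𝓘(ℝ, ℝ) ∞ (fun y => α (f y) (s y)) :=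
  ContMDiff.comp (g := fun p : V.Tot => α p.proj p.2) hα hs

lemma VB.IsForm.apply {V : VB I M} {α : ∀ x, Module.Dual ℝ (V.E x)} (hα : V.IsForm α)
    {s : ∀ x, V.E x} (hs : V.IsSec s) : ContMDiff I 𝓘(ℝ, ℝ) ∞ (fun x => α x (s x)) :=
  hα.comp_contMDiff (f := id) hs

variable [FiniteDimensional ℝ EB] [T2Space M] [IsManifold I ∞ M]

/-- Every vector bundle has, near every point, a dual basis made of global sections and global
forms. -/
theorem VB.exists_dualBasis (V : VB I M) (x₀ : M) : ∃ (r : ℕ) (s : Fin r → ∀ x, V.E x)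
    (σ : Fin r → ∀ x, Module.Dual ℝ (V.E x)), (∀ b, V.IsSec (s b)) ∧ (∀ b, V.IsForm (σ b)) ∧
      ∀ᶠ x in 𝓝 x₀, ∀ v : V.E x, v = ∑ b, σ b x v • s b x := by
  let e := trivializationAt V.F V.E x₀
  have hx₀ : x₀ ∈ e.baseSet := FiberBundle.mem_baseSet_trivializationAt' x₀
  obtain ⟨χ, hχ, hχ1, hχs⟩ := exists_bump (I := I) (e.open_baseSet.mem_nhds hx₀)
  -- The basis of the model fibre and its dual basis, cut off outside of a trivialising neighbourhood.
  let b := Module.finBasis ℝ V.F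
  refine ⟨_, fun i x => χ x • e.symm x (b i),
    fun i x => χ x • (b.coord i ∘ₗ (e.continuousLinearMapAt ℝ x : V.E x →ₗ[ℝ] V.F)), ?_, ?_, ?_⟩
  · intro i
    refine ContMDiffOn.smul_section_of_tsupport hχ.contMDiffOn e.open_baseSet hχs ?_
    refine (e.contMDiffOn_section_baseSet_iff (IB := I) (n := ∞)).2 ?_
    refine (contMDiffOn_const (c := b i)).congr fun x hx => ?_
    simp [e.apply_mk_symm hx]
  · intro i p
    by_cases hp : p.proj ∈ e.baseSet
    · have h1 : ContMDiffAt V.model 𝓘(ℝ, ℝ) ∞ (fun q : V.Tot => χ q.proj * b.coord i (e q).2) p := by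
        refine ((hχ.comp (contMDiff_proj V.E)) p).mul ?_
        have h2 := (e.contMDiffOn (IB := I) (n := ∞)).contMDiffAt
          (e.open_source.mem_nhds (e.mem_source.2 hp))
        have h3 : ContMDiff 𝓘(ℝ, V.F) 𝓘(ℝ, ℝ) ∞ (b.coord i).toContinuousLinearMap :=
          (b.coord i).toContinuousLinearMap.contMDiff
        exact h3.contMDiffAt.comp p (contMDiffAt_snd.comp p h2)
      refine h1.congr_of_eventuallyEq ?_
      filter_upwards [(e.open_source.mem_nhds (e.mem_source.2 hp))] with q hq
      have hq' := e.mem_source.1 hq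
      simp [Trivialization.continuousLinearMapAt_apply, hq']
    · have : p.proj ∉ tsupport χ := fun h => hp (hχs h)
      have h0 : ∀ᶠ q in 𝓝 p, χ q.proj = 0 :=
        ((FiberBundle.continuous_proj V.F V.E).continuousAt (x := p)).eventually
          (notMem_tsupport_iff_eventuallyEq.1 this)
      refine (contMDiffAt_const (c := (0 : ℝ))).congr_of_eventuallyEq ?_
      filter_upwards [h0] with q hq
      simp [hq]
  · filter_upwards [hχ1, e.open_baseSet.mem_nhds hx₀] with x hx hxe v
    simp only [hx, one_smul, LinearMap.comp_apply]
    have h1 := congrArg (e.symmL ℝ x) (b.sum_repr (e.continuousLinearMapAt ℝ x v))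
    rw [e.symmL_continuousLinearMapAt hxe] at h1
    refine h1.symm.trans ?_
    rw [map_sum]
    refine Finset.sum_congr rfl fun i _ => ?_
    rw [map_smul, e.symmL_apply hxe]
    rfl

/-- Every vector of a vector bundle is the value of a global section, in a linear way. -/
theorem VB.exists_extend (V : VB I M) (x₀ : M) : ∃ ext : V.E x₀ →ₗ[ℝ] (∀ x, V.E x),
    (∀ v, V.IsSec (ext v)) ∧ ∀ v, ext v x₀ = v := by
  obtain ⟨r, s, σ, hs, -, h⟩ := V.exists_dualBasis x₀
  refine ⟨∑ b, (σ b x₀).smulRight (s b), fun v => ?_, fun v => ?_⟩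
  · have := VB.IsSec.sum Finset.univ (fun b _ => (hs b).const_smul (σ b x₀ v))
    convert this using 2
    simp
  · conv_rhs => rw [h.self_of_nhds v]
    simp

/-- A fibrewise linear function is smooth if its values on smooth sections are. -/
lemma VB.isForm_of_apply {V : VB I M} {α : ∀ x, Module.Dual ℝ (V.E x)}
    (h : ∀ s, V.IsSec s → ContMDiff I 𝓘(ℝ, ℝ) ∞ (fun x => α x (s x))) : V.IsForm α := by
  intro p
  obtain ⟨r, s, σ, hs, hσ, hv⟩ := V.exists_dualBasis p.proj
  have h1 : V.IsForm (fun x => ∑ b, α x (s b x) • σ b x) :=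
    VB.IsForm.sum _ fun b _ => (hσ b).smul (h _ (hs b))
  refine (h1 p).congr_of_eventuallyEq ?_
  filter_upwards [((FiberBundle.continuous_proj V.F V.E).continuousAt (x := p)).eventually hv]
    with q hq
  conv_lhs => rw [hq q.2]
  simp [mul_comm]

end Smooth

/-! ### Smooth sections of `S(A*)` -/

section Functions

variable {EB : Type v} [NormedAddCommGroup EB] [NormedSpace ℝ EB] {HB : Type w}
  [TopologicalSpace HB] {I : ModelWithCorners ℝ EB HB}
  {M : Type u} [TopologicalSpace M] [ChartedSpace HB M] {n : ℕ} {A : Fin n → VB I M}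

@[elab_as_elim]
lemma polyFun_induction {p : ∀ ξ : ∀ x, SymFib A x, ξ ∈ polyFun A → Prop}
    (hf : ∀ f (h : ContMDiff I 𝓘(ℝ, ℝ) ∞ f),
      p (baseFun A f) (Algebra.subset_adjoin (Or.inl ⟨f, h, rfl⟩)))
    (hα : ∀ i α (h : (A i).IsForm α),
      p (formFun A i α) (Algebra.subset_adjoin (Or.inr ⟨i, α, h, rfl⟩)))
    (hadd : ∀ ξ η hξ hη, p ξ hξ → p η hη → p (ξ + η) (add_mem hξ hη))
    (hmul : ∀ ξ η hξ hη, p ξ hξ → p η hη → p (ξ * η) (mul_mem hξ hη))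
    {ξ : ∀ x, SymFib A x} (hξ : ξ ∈ polyFun A) : p ξ hξ := by
  induction hξ using Algebra.adjoin_induction with
  | mem x hx =>
    rcases hx with ⟨f, h, rfl⟩ | ⟨i, α, h, rfl⟩
    · exact hf f h
    · exact hα i α h
  | algebraMap r => exact hf (fun _ => r) contMDiff_const
  | add x y _ _ hx hy => exact hadd _ _ _ _ hx hy
  | mul x y _ _ hx hy => exact hmul _ _ _ _ hx hy

lemma mem_Fun_of_eventuallyEq {ξ : ∀ x, SymFib A x}
    (h : ∀ x₀, ∃ η ∈ Fun A, ∀ᶠ x in 𝓝 x₀, ξ x = η x) : ξ ∈ Fun A := by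
  intro x₀
  obtain ⟨η, hη, h1⟩ := h x₀
  obtain ⟨p, hp, h2⟩ := hη x₀
  refine ⟨p, hp, ?_⟩
  filter_upwards [h1, h2] with x h1 h2
  rw [h1, h2]

lemma baseFun_mem_Fun {f : M → ℝ} (hf : ContMDiff I 𝓘(ℝ, ℝ) ∞ f) : baseFun A f ∈ Fun A :=
  (ofFun A f hf).2

lemma formFun_mem_Fun {i : Fin n} {α : ∀ x, Module.Dual ℝ ((A i).E x)} (hα : (A i).IsForm α) :
    formFun A i α ∈ Fun A := (ofForm A i α hα).2

/-- A smooth operation on sections of `S(A*)` that is local may be checked on polynomials. -/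
lemma mem_Fun_of_local {EN : Type*} [NormedAddCommGroup EN] [NormedSpace ℝ EN] {HN : Type*}
    [TopologicalSpace HN] {J : ModelWithCorners ℝ EN HN} {N : Type*} [TopologicalSpace N]
    [ChartedSpace HN N] {B : Fin n → VB J N} (f : N → M) (hf : Continuous f)
    (T : ∀ y, SymFib A (f y) → SymFib B y)
    (hT : ∀ p ∈ polyFun A, (fun y => T y (p (f y))) ∈ Fun B) {ξ : ∀ x, SymFib A x}
    (hξ : ξ ∈ Fun A) : (fun y => T y (ξ (f y))) ∈ Fun B := by
  refine mem_Fun_of_eventuallyEq fun y₀ => ?_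
  obtain ⟨p, hp, h⟩ := hξ (f y₀)
  refine ⟨_, hT p hp, ?_⟩
  filter_upwards [hf.continuousAt.eventually h] with y hy
  rw [hy]

lemma mem_Fun_of_local_self (T : ∀ x, SymFib A x → SymFib A x)
    (hT : ∀ p ∈ polyFun A, (fun x => T x (p x)) ∈ Fun A) {ξ : ∀ x, SymFib A x}
    (hξ : ξ ∈ Fun A) : (fun x => T x (ξ x)) ∈ Fun A :=
  mem_Fun_of_local (f := fun x => x) continuous_id T hT hξ

variable (A) in
/-- The scalar part of a smooth section of `S(A*)` is a smooth function. -/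
lemma contMDiff_aug {ξ : ∀ x, SymFib A x} (hξ : ξ ∈ Fun A) :
    ContMDiff I 𝓘(ℝ, ℝ) ∞ (fun x => GSym.aug (ξ x)) := by
  intro x₀
  obtain ⟨p, hp, h⟩ := hξ x₀
  have hp' : ContMDiff I 𝓘(ℝ, ℝ) ∞ (fun x => GSym.aug (p x)) := by
    clear h
    induction hp using polyFun_induction with
    | hf f hf => simpa [baseFun] using hf
    | hα i α hα => simpa [formFun] using contMDiff_const
    | hadd ξ η _ _ h1 h2 => simp only [Pi.add_apply, map_add]; exact h1.add h2
    | hmul ξ η _ _ h1 h2 => simp only [Pi.mul_apply, map_mul]; exact h1.mul h2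
  refine (hp' x₀).congr_of_eventuallyEq ?_
  filter_upwards [h] with x hx
  rw [hx]

/-- Homogeneous rescaling of smooth sections of `S(A*)`. -/
noncomputable def scaleFun (A : Fin n → VB I M) (c : Fin n → ℝ) : Fun A →ₐ[ℝ] Fun A where
  toFun ξ := ⟨fun x => GSym.scale c (ξ.1 x), by
    refine mem_Fun_of_local_self (fun x => GSym.scale c) (fun p hp => ?_) ξ.2
    induction hp using polyFun_induction with
    | hf f hf => simp only [baseFun, AlgHom.commutes]; exact baseFun_mem_Fun hf
    | hα i α hα =>
      have := Subalgebra.smul_mem _ (formFun_mem_Fun hα) (c i)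
      convert this using 1
      ext x
      simp [formFun]
    | hadd ξ η _ _ h1 h2 => simp only [Pi.add_apply, map_add]; exact add_mem h1 h2
    | hmul ξ η _ _ h1 h2 => simp only [Pi.mul_apply, map_mul]; exact mul_mem h1 h2⟩
  map_one' := by ext x; simp
  map_mul' ξ η := by ext x; simp
  map_zero' := by ext x; simp
  map_add' ξ η := by ext x; simp
  commutes' t := by ext x; exact AlgHom.commutes (GSym.scale c) t

/-- The `k`-th power of the parity automorphism of `Γ(S(A*))`. -/
noncomputable def par (k : ℕ) : Fun A →ₐ[ℝ] Fun A := scaleFun A fun i => ((-1) ^ (i.val + 1)) ^ k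

lemma par_apply (k : ℕ) (ξ : Fun A) (x : M) :
    (par k ξ).1 x = (GSym.parity ^ k : SymFib A x →ₐ[ℝ] SymFib A x) (ξ.1 x) := by
  rw [GSym.scale_apply_pow_parity]
  rfl

lemma par_one_apply (ξ : Fun A) (x : M) : (par 1 ξ).1 x = GSym.parity (ξ.1 x) := by
  rw [par_apply, pow_one]

lemma contract_mem_Fun {i : Fin n} {a : ∀ x, (A i).E x} (ha : (A i).IsSec a)
    {ξ : ∀ x, SymFib A x} (hξ : ξ ∈ Fun A) :
    (fun x => GSym.contract i (Module.Dual.eval ℝ _ (a x)) (ξ x)) ∈ Fun A := by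
  refine mem_Fun_of_local_self (fun x ζ => GSym.contract
    (W := fun i => Module.Dual ℝ ((A i).E x)) i (Module.Dual.eval ℝ ((A i).E x) (a x)) ζ)
    (fun p hp => ?_) hξ
  clear hξ
  induction hp using polyFun_induction with
  | hf f hf =>
    simp only [baseFun, GSym.contract_algebraMap]
    exact zero_mem (Fun A)
  | hα j α hα =>
    by_cases h : j = i
    · subst h
      simp only [formFun, GSym.contract_ι_self]
      exact baseFun_mem_Fun (hα.apply ha)
    · simp only [formFun, GSym.contract_ι_of_ne h]
      exact zero_mem (Fun A)
  | hadd ξ η _ _ h1 h2 => simp only [Pi.add_apply, map_add]; exact add_mem h1 h2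
  | hmul ξ η hξ hη h1 h2 =>
    simp only [Pi.mul_apply, GSym.contract_mul]
    have e : (fun x => (GSym.parity ^ (i.val + 1) : SymFib A x →ₐ[ℝ] SymFib A x) (ξ x)) =
        (par (i.val + 1) (⟨ξ, polyFun_le_Fun A hξ⟩ : Fun A)).1 :=
      funext fun x => (par_apply (A := A) (i.val + 1) ⟨ξ, polyFun_le_Fun A hξ⟩ x).symm
    have h3 := (par (i.val + 1) (⟨ξ, polyFun_le_Fun A hξ⟩ : Fun A)).2
    rw [← e] at h3
    exact add_mem (mul_mem h1 (polyFun_le_Fun A hη)) (mul_mem h3 h2)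

/-- Contraction of a smooth section of `S(A*)` with a section. -/
noncomputable def contractFun (i : Fin n) (a : ∀ x, (A i).E x) (ha : (A i).IsSec a) (ξ : Fun A) :
    Fun A := ⟨_, contract_mem_Fun ha ξ.2⟩

/-- A morphism of graded vector bundles over a smooth map. -/
structure Mor {EN : Type*} [NormedAddCommGroup EN] [NormedSpace ℝ EN] {HN : Type*}
    [TopologicalSpace HN] {J : ModelWithCorners ℝ EN HN} {N : Type*} [TopologicalSpace N]
    [ChartedSpace HN N] (B : Fin n → VB J N) (A : Fin n → VB I M) where
  base : N → M
  contMDiff_base : ContMDiff J I ∞ base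
  fib : ∀ i y, (B i).E y →ₗ[ℝ] (A i).E (base y)
  contMDiff_fib : ∀ i, ContMDiff (B i).model (A i).model ∞
    (fun p : (B i).Tot => (⟨base p.proj, fib i p.proj p.2⟩ : (A i).Tot))

/-- The pullback of functions along a morphism of graded vector bundles. -/
noncomputable def Mor.pull {EN : Type*} [NormedAddCommGroup EN] [NormedSpace ℝ EN] {HN : Type*}
    [TopologicalSpace HN] {J : ModelWithCorners ℝ EN HN} {N : Type*} [TopologicalSpace N]
    [ChartedSpace HN N] {B : Fin n → VB J N} (φ : Mor B A) : Fun A →ₐ[ℝ] Fun B where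
  toFun ξ := ⟨fun y => GSym.map (fun i => (φ.fib i y).dualMap) (ξ.1 (φ.base y)), by
    refine mem_Fun_of_local φ.base φ.contMDiff_base.continuous
      (fun y => GSym.map (fun i => (φ.fib i y).dualMap)) (fun p hp => ?_) ξ.2
    induction hp using polyFun_induction with
    | hf f hf =>
      simp only [baseFun, AlgHom.commutes]
      exact baseFun_mem_Fun (hf.comp φ.contMDiff_base)
    | hα i α hα =>
      have : (B i).IsForm (fun y => (φ.fib i y).dualMap (α (φ.base y))) :=
        hα.comp_contMDiff (φ.contMDiff_fib i)
      simp only [formFun, GSym.map_ι]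
      exact formFun_mem_Fun this
    | hadd ξ η _ _ h1 h2 => simp only [Pi.add_apply, map_add]; exact add_mem h1 h2
    | hmul ξ η _ _ h1 h2 => simp only [Pi.mul_apply, map_mul]; exact mul_mem h1 h2⟩
  map_one' := by ext x; simp
  map_mul' ξ η := by ext x; simp
  map_zero' := by ext x; simp
  map_add' ξ η := by ext x; simp
  commutes' t := by ext x; exact AlgHom.commutes (GSym.map _) t

/-! ### Homogeneous elements -/

lemma HomFun.mul {k l : ℤ} {ξ η : Fun A} (hξ : HomFun k ξ) (hη : HomFun l η) :
    HomFun (k + l) (ξ * η) := fun x => GSym.mul_mem_piece (hξ x) (hη x)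

lemma HomFun.add {k : ℤ} {ξ η : Fun A} (hξ : HomFun k ξ) (hη : HomFun k η) :
    HomFun k (ξ + η) := fun x => add_mem (hξ x) (hη x)

lemma HomFun.smul {k : ℤ} {ξ : Fun A} (t : ℝ) (hξ : HomFun k ξ) :
    HomFun k (t • ξ) := fun x => Submodule.smul_mem _ t (hξ x)

lemma homFun_ofFun {f : M → ℝ} (hf : ContMDiff I 𝓘(ℝ, ℝ) ∞ f) : HomFun 0 (ofFun A f hf) :=
  fun _ => GSym.algebraMap_mem_piece _

lemma homFun_ofForm {i : Fin n} {α : ∀ x, Module.Dual ℝ ((A i).E x)} (hα : (A i).IsForm α) :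
    HomFun (i.val + 1) (ofForm A i α hα) := fun _ => GSym.ι_mem_piece _ _

lemma homFun_algebraMap (t : ℝ) : HomFun 0 (algebraMap ℝ (Fun A) t) :=
  fun _ => GSym.algebraMap_mem_piece _

lemma HomFun.par {k : ℤ} {ξ : Fun A} (hξ : HomFun k ξ) (m : ℕ) : par m ξ = sgn k ^ m • ξ := by
  ext x
  rw [par_apply, GSym.parity_pow_of_mem_piece _ (hξ x)]
  rfl

/-- Finite sums of homogeneous elements. -/
def homSpan (A : Fin n → VB I M) : Submodule ℝ (Fun A) :=
  Submodule.span ℝ {ξ | ∃ k, HomFun k ξ}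

lemma mul_mem_homSpan {ξ η : Fun A} (hξ : ξ ∈ homSpan A) (hη : η ∈ homSpan A) :
    ξ * η ∈ homSpan A := by
  induction hξ using Submodule.span_induction with
  | mem x hx =>
    induction hη using Submodule.span_induction with
    | mem y hy =>
      obtain ⟨k, hx⟩ := hx
      obtain ⟨l, hy⟩ := hy
      exact Submodule.subset_span ⟨k + l, hx.mul hy⟩
    | zero => simp
    | add y z _ _ h1 h2 => rw [mul_add]; exact add_mem h1 h2
    | smul t y _ h => rw [mul_smul_comm]; exact Submodule.smul_mem _ _ h
  | zero => simp
  | add y z _ _ h1 h2 => rw [add_mul]; exact add_mem h1 h2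
  | smul t y _ h => rw [smul_mul_assoc]; exact Submodule.smul_mem _ _ h

/-- Near every point, a smooth section of `S(A*)` is a finite sum of homogeneous ones. -/
lemma exists_homSpan (ξ : Fun A) (x₀ : M) : ∃ η ∈ homSpan A, ∀ᶠ x in 𝓝 x₀, ξ.1 x = η.1 x := by
  obtain ⟨p, hp, h⟩ := ξ.2 x₀
  have : ∃ hp : p ∈ Fun A, (⟨p, hp⟩ : Fun A) ∈ homSpan A := by
    clear h
    induction hp using polyFun_induction with
    | hf f hf => exact ⟨_, Submodule.subset_span ⟨_, homFun_ofFun hf⟩⟩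
    | hα i α hα => exact ⟨_, Submodule.subset_span ⟨_, homFun_ofForm hα⟩⟩
    | hadd ξ η _ _ h1 h2 =>
      obtain ⟨h1, h1'⟩ := h1
      obtain ⟨h2, h2'⟩ := h2
      exact ⟨add_mem h1 h2, add_mem h1' h2'⟩
    | hmul ξ η _ _ h1 h2 =>
      obtain ⟨h1, h1'⟩ := h1
      obtain ⟨h2, h2'⟩ := h2
      exact ⟨mul_mem h1 h2, mul_mem_homSpan h1' h2'⟩
  obtain ⟨hp, hp'⟩ := this
  exact ⟨_, hp', h⟩

/-! ### Derivations -/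

lemma IsDer.map_algebraMap {p : ℤ} {Y : Fun A →ₗ[ℝ] Fun A} (hY : IsDer p Y) (t : ℝ) :
    Y (algebraMap ℝ _ t) = 0 := by
  have h1 : Y 1 = 0 := by
    have := hY.leibniz 0 1 1 (by simpa using homFun_algebraMap (A := A) 1)
    simpa using this
  rw [Algebra.algebraMap_eq_smul_one, map_smul, h1, smul_zero]

lemma IsDer.leibniz_of_mem_homSpan {p : ℤ} {Y : Fun A →ₗ[ℝ] Fun A} (hY : IsDer p Y) {ξ : Fun A}
    (hξ : ξ ∈ homSpan A) (η : Fun A) : Y (ξ * η) = Y ξ * η + par p.natAbs ξ * Y η := by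
  induction hξ using Submodule.span_induction with
  | mem x hx =>
    obtain ⟨k, hx⟩ := hx
    rw [hY.leibniz k x η hx, hx.par, sgn_mul_natAbs, smul_mul_assoc]
  | zero => simp
  | add y z _ _ h1 h2 => simp only [add_mul, map_add, h1, h2]; abel
  | smul t y _ h => simp only [smul_mul_assoc, map_smul, h, smul_add]

/-- Derivations are local: it suffices that `ξ` is fixed under multiplication with a function that
vanishes at the given point. -/
lemma IsDer.apply_eq_zero {p : ℤ} {Y : Fun A →ₗ[ℝ] Fun A} (hY : IsDer p Y) {ξ : Fun A} {x₀ : M}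
    {g : M → ℝ} (hg : ContMDiff I 𝓘(ℝ, ℝ) ∞ g) (hg0 : g x₀ = 0) (h : ∀ x, g x • ξ.1 x = ξ.1 x) :
    (Y ξ).1 x₀ = 0 := by
  have h1 : ofFun A g hg * ξ = ξ := by
    ext x
    exact (Algebra.smul_def _ _).symm.trans (h x)
  have h2 : ξ.1 x₀ = 0 := by rw [← h x₀, hg0, zero_smul]
  rw [← h1, hY.leibniz 0 _ _ (homFun_ofFun hg)]
  change (Y (ofFun A g hg)).1 x₀ * ξ.1 x₀ + sgn (p * 0) • (algebraMap ℝ _ (g x₀) * (Y ξ).1 x₀) = 0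
  rw [h2, hg0]
  simp

variable [FiniteDimensional ℝ EB] [T2Space M] [IsManifold I ∞ M]

lemma exists_cutoff {x₀ : M} {U : Set M} (hU : U ∈ 𝓝 x₀) : ∃ g : M → ℝ,
    ContMDiff I 𝓘(ℝ, ℝ) ∞ g ∧ (∀ᶠ x in 𝓝 x₀, g x = 0) ∧ ∀ x, x ∉ U → g x = 1 := by
  obtain ⟨χ, hχ, h1, hs⟩ := exists_bump (I := I) hU
  refine ⟨fun x => 1 - χ x, contMDiff_const.sub hχ, ?_, fun x hx => ?_⟩
  · filter_upwards [h1] with x hx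
    simp [hx]
  · simp [image_eq_zero_of_notMem_tsupport fun h => hx (hs h)]

/-- Derivations are local operators. -/
lemma IsDer.congr {p : ℤ} {Y : Fun A →ₗ[ℝ] Fun A} (hY : IsDer p Y) {ξ η : Fun A} {x₀ : M}
    (h : ∀ᶠ x in 𝓝 x₀, ξ.1 x = η.1 x) : (Y ξ).1 x₀ = (Y η).1 x₀ := by
  obtain ⟨g, hg, hg0, hg1⟩ := exists_cutoff (I := I) h
  have := hY.apply_eq_zero (ξ := ξ - η) hg hg0.self_of_nhds fun x => ?_
  · rw [map_sub] at this
    exact sub_eq_zero.1 this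
  · change g x • (ξ.1 x - η.1 x) = ξ.1 x - η.1 x
    by_cases hx : ξ.1 x = η.1 x
    · simp [hx]
    · rw [hg1 x hx, one_smul]

/-- The Leibniz rule for the product with a section that need not be homogeneous: the sign becomes a
power of the parity. -/
lemma IsDer.leibniz_par {p : ℤ} {Y : Fun A →ₗ[ℝ] Fun A} (hY : IsDer p Y) (ξ η : Fun A) :
    Y (ξ * η) = Y ξ * η + par p.natAbs ξ * Y η := by
  ext x₀
  obtain ⟨ζ, hζ, h⟩ := exists_homSpan ξ x₀
  have h1 : (Y (ξ * η)).1 x₀ = (Y (ζ * η)).1 x₀ := by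
    refine hY.congr ?_
    filter_upwards [h] with x hx
    change ξ.1 x * η.1 x = ζ.1 x * η.1 x
    rw [hx]
  have h2 : (par p.natAbs ξ).1 x₀ = (par p.natAbs ζ).1 x₀ := by
    rw [par_apply, par_apply, h.self_of_nhds]
  change _ = (Y ξ).1 x₀ * η.1 x₀ + (par p.natAbs ξ).1 x₀ * (Y η).1 x₀
  rw [h1, h2, hY.congr h, hY.leibniz_of_mem_homSpan hζ]
  rfl

/-- The value of a derivation at a point is determined by its values there on functions and
forms. -/
lemma IsDer.ext_at {p : ℤ} {Y Z : Fun A →ₗ[ℝ] Fun A} (hY : IsDer p Y) (hZ : IsDer p Z) {x₀ : M}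
    (hf : ∀ f hf, (Y (ofFun A f hf)).1 x₀ = (Z (ofFun A f hf)).1 x₀)
    (hα : ∀ i α hα, (Y (ofForm A i α hα)).1 x₀ = (Z (ofForm A i α hα)).1 x₀) (ξ : Fun A) :
    (Y ξ).1 x₀ = (Z ξ).1 x₀ := by
  obtain ⟨q, hq, h⟩ := ξ.2 x₀
  have key : ∃ hq : q ∈ Fun A, (Y ⟨q, hq⟩).1 x₀ = (Z ⟨q, hq⟩).1 x₀ := by
    clear h
    induction hq using polyFun_induction with
    | hf f hf' => exact ⟨_, hf f hf'⟩
    | hα i α hα' => exact ⟨_, hα i α hα'⟩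
    | hadd ξ η _ _ h1 h2 =>
      obtain ⟨h1, h1'⟩ := h1
      obtain ⟨h2, h2'⟩ := h2
      refine ⟨add_mem h1 h2, ?_⟩
      have : (⟨ξ + η, add_mem h1 h2⟩ : Fun A) = ⟨ξ, h1⟩ + ⟨η, h2⟩ := rfl
      rw [this, map_add, map_add]
      change (Y _).1 x₀ + (Y _).1 x₀ = (Z _).1 x₀ + (Z _).1 x₀
      rw [h1', h2']
    | hmul ξ η _ _ h1 h2 =>
      obtain ⟨h1, h1'⟩ := h1
      obtain ⟨h2, h2'⟩ := h2
      refine ⟨mul_mem h1 h2, ?_⟩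
      have : (⟨ξ * η, mul_mem h1 h2⟩ : Fun A) = ⟨ξ, h1⟩ * ⟨η, h2⟩ := rfl
      rw [this, hY.leibniz_par, hZ.leibniz_par]
      change (Y _).1 x₀ * η x₀ + (par p.natAbs _).1 x₀ * (Y _).1 x₀ =
        (Z _).1 x₀ * η x₀ + (par p.natAbs _).1 x₀ * (Z _).1 x₀
      rw [h1', h2']
  obtain ⟨hq, hq'⟩ := key
  rw [hY.congr (η := ⟨q, hq⟩) h, hZ.congr (η := ⟨q, hq⟩) h, hq']

/-- A derivation is determined by its values on functions and forms. -/
lemma IsDer.ext {p : ℤ} {Y Z : Fun A →ₗ[ℝ] Fun A} (hY : IsDer p Y) (hZ : IsDer p Z)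
    (hf : ∀ f hf, Y (ofFun A f hf) = Z (ofFun A f hf))
    (hα : ∀ i α hα, Y (ofForm A i α hα) = Z (ofForm A i α hα)) : Y = Z := by
  ext ξ x₀
  exact hY.ext_at hZ (fun f h => by rw [hf f h]) (fun i α h => by rw [hα i α h]) ξ

/-- Derivations of degree `p` commute with the parity up to the sign of `p`. -/
lemma IsDer.par {p : ℤ} {Y : Fun A →ₗ[ℝ] Fun A} (hY : IsDer p Y) (ξ : Fun A) :
    Y (par 1 ξ) = sgn p • VBLie.par 1 (Y ξ) := by
  ext x₀
  obtain ⟨ζ, hζ, h⟩ := exists_homSpan ξ x₀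
  have h1 : (Y (VBLie.par 1 ξ)).1 x₀ = (Y (VBLie.par 1 ζ)).1 x₀ := by
    refine hY.congr ?_
    filter_upwards [h] with x hx
    rw [par_one_apply, par_one_apply, hx]
  have h2 : (VBLie.par 1 (Y ξ)).1 x₀ = (VBLie.par 1 (Y ζ)).1 x₀ := by
    rw [par_one_apply, par_one_apply, hY.congr h]
  change _ = sgn p • (VBLie.par 1 (Y ξ)).1 x₀
  rw [h1, h2]
  suffices Y (VBLie.par 1 ζ) = sgn p • VBLie.par 1 (Y ζ) by rw [this]; rfl
  clear h h1 h2
  induction hζ using Submodule.span_induction with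
  | mem y hy =>
    obtain ⟨k, hy⟩ := hy
    rw [hy.par, (hY.deg k y hy).par, map_smul, sgn_add, pow_one, pow_one, smul_smul, mul_left_comm,
      sgn_mul_self, mul_one]
  | zero => simp
  | add y z _ _ h3 h4 => rw [map_add, map_add, h3, h4, map_add, map_add, smul_add]
  | smul t y _ h3 => rw [map_smul, map_smul, h3, map_smul, map_smul, smul_comm]

lemma LieStr.Q_par (Q : LieStr A) (ξ : Fun A) : Q.Q (par 1 ξ) = - par 1 (Q.Q ξ) := by
  rw [Q.isDer.par, sgn_one, neg_one_smul]

lemma par_par (ξ : Fun A) : par 1 (par 1 ξ) = ξ := by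
  ext x
  rw [par_one_apply, par_one_apply, GSym.parity_parity]

end Functions

/-! ### Smooth sections of `S(A*) ⊗ W` -/

section Modules

variable {EB : Type v} [NormedAddCommGroup EB] [NormedSpace ℝ EB] {HB : Type w}
  [TopologicalSpace HB] {I : ModelWithCorners ℝ EB HB}
  {M : Type u} [TopologicalSpace M] [ChartedSpace HB M] {n : ℕ} {A : Fin n → VB I M}
  {W : Graded n M}

lemma extendMul_tmul {S B X : Type*} [Ring S] [Algebra ℝ S] [Ring B] [Algebra ℝ B]
    [AddCommGroup X] [Module ℝ X] (φ : S →ₐ[ℝ] B) (L : X →ₗ[ℝ] B) (ξ : S) (x : X) :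
    extendMul φ L (ξ ⊗ₜ[ℝ] x) = φ ξ * L x := by simp [extendMul]

lemma extendMul_smul {S B X : Type*} [Ring S] [Algebra ℝ S] [Ring B] [Algebra ℝ B]
    [AddCommGroup X] [Module ℝ X] (φ : S →ₐ[ℝ] B) (L : X →ₗ[ℝ] B) (ξ : S) (z : S ⊗[ℝ] X) :
    extendMul φ L (ξ • z) = φ ξ * extendMul φ L z := by
  induction z using TensorProduct.induction_on with
  | zero => simp
  | tmul η x => rw [TensorProduct.smul_tmul', smul_eq_mul, extendMul_tmul, extendMul_tmul, map_mul,
      mul_assoc]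
  | add y z h1 h2 => rw [smul_add, map_add, map_add, h1, h2, mul_add]

/-- The contraction of the second factor of `S(A*) ⊗ W` with a functional. -/
noncomputable def ct (A : Fin n → VB I M) (W : Graded n M) {x : M}
    (φ : Module.Dual ℝ (W.Fib x)) : ModFib A W x →ₗ[ℝ] SymFib A x :=
  extendMul (AlgHom.id ℝ _) (Algebra.linearMap ℝ (SymFib A x) ∘ₗ φ)

lemma ct_tmul {x : M} (φ : Module.Dual ℝ (W.Fib x)) (ξ : SymFib A x) (e : W.Fib x) :
    ct A W φ (ξ ⊗ₜ[ℝ] e) = φ e • ξ := by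
  rw [ct, extendMul_tmul, AlgHom.id_apply]
  change ξ * algebraMap ℝ _ (φ e) = _
  rw [← Algebra.commutes, Algebra.smul_def]

lemma ct_smul {x : M} (φ : Module.Dual ℝ (W.Fib x)) (ξ : SymFib A x) (z : ModFib A W x) :
    ct A W φ (ξ • z) = ξ * ct A W φ z := extendMul_smul _ _ _ _

lemma ct_genFun {x : M} (φ : Module.Dual ℝ (W.Fib x)) (e : ∀ x, W.Fib x) :
    ct A W φ (genFun A W e x) = algebraMap ℝ _ (φ (e x)) := by
  rw [genFun, ct_tmul, Algebra.algebraMap_eq_smul_one]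

/-- An element of `S(A*) ⊗ W` is recovered from a resolution of the identity of `W`. -/
lemma eq_sum_ct {x : M} {ι : Type*} [Fintype ι] {e : ι → W.Fib x} {φ : ι → Module.Dual ℝ (W.Fib x)}
    (h : ∀ w, w = ∑ b, φ b w • e b) (z : ModFib A W x) :
    z = ∑ b, ct A W (φ b) z • ((1 : SymFib A x) ⊗ₜ[ℝ] e b) := by
  induction z using TensorProduct.induction_on with
  | zero => simp
  | tmul ξ w =>
    conv_lhs => rw [h w, TensorProduct.tmul_sum]
    refine Finset.sum_congr rfl fun b _ => ?_
    rw [ct_tmul, TensorProduct.smul_tmul', smul_eq_mul, mul_one, TensorProduct.smul_tmul]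
  | add y z h1 h2 =>
    conv_lhs => rw [h1, h2]
    simp only [map_add, add_smul, Finset.sum_add_distrib]

/-! ### Parts and degrees -/

/-- The elements of the fibre that lie in the part `zero` (for `none`) or `pos i`
(for `some i`). -/
def Graded.part (W : Graded n M) (x : M) : Option (Fin n) → Submodule ℝ (W.Fib x)
  | none => LinearMap.range (LinearMap.inl ℝ (W.zero.W x) (∀ i, (W.pos i).W x))
  | some i => LinearMap.range (LinearMap.inr ℝ (W.zero.W x) (∀ i, (W.pos i).W x) ∘ₗ
      LinearMap.single ℝ (fun i => (W.pos i).W x) i)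

/-- The degrees of the parts. -/
def Graded.degree (W : Graded n M) : Option (Fin n) → ℤ
  | none => 0
  | some i => W.dir * (i.val + 1)

lemma tmul_mem_modPiece {x : M} {k : ℤ} {q : Option (Fin n)} {ξ : SymFib A x} {e : W.Fib x}
    (hξ : ξ ∈ GSym.piece (fun i => Module.Dual ℝ ((A i).E x)) k) (he : e ∈ W.part x q) :
    ξ ⊗ₜ[ℝ] e ∈ modPiece A W x (k + W.degree q) := by
  cases q with
  | none =>
    obtain ⟨w, rfl⟩ := he
    exact Submodule.subset_span (Or.inl ⟨ξ, by simpa [Graded.degree] using hξ, w, rfl⟩)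
  | some i =>
    obtain ⟨w, rfl⟩ := he
    exact Submodule.subset_span (Or.inr ⟨i, ξ, by simpa [Graded.degree] using hξ, w, rfl⟩)

lemma modPiece_induction {x : M} {p : ℤ} {P : ModFib A W x → Prop}
    (ht : ∀ (k : ℤ) (q : Option (Fin n)) (ξ : SymFib A x) (e : W.Fib x), k + W.degree q = p →
      ξ ∈ GSym.piece (fun i => Module.Dual ℝ ((A i).E x)) k → e ∈ W.part x q → P (ξ ⊗ₜ[ℝ] e))
    (h0 : P 0) (hadd : ∀ y z, P y → P z → P (y + z)) (hsmul : ∀ (t : ℝ) z, P z → P (t • z))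
    {z : ModFib A W x} (hz : z ∈ modPiece A W x p) : P z := by
  induction hz using Submodule.span_induction with
  | mem y hy =>
    rcases hy with ⟨ξ, hξ, w, rfl⟩ | ⟨i, ξ, hξ, w, rfl⟩
    · exact ht p none ξ _ (by simp [Graded.degree]) hξ ⟨w, rfl⟩
    · exact ht _ (some i) ξ _ (by simp [Graded.degree]) hξ ⟨w, rfl⟩
  | zero => exact h0
  | add y z _ _ h1 h2 => exact hadd _ _ h1 h2
  | smul t y _ h => exact hsmul _ _ h

lemma smul_mem_modPiece {x : M} {k p : ℤ} {ξ : SymFib A x} {z : ModFib A W x}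
    (hξ : ξ ∈ GSym.piece (fun i => Module.Dual ℝ ((A i).E x)) k) (hz : z ∈ modPiece A W x p) :
    ξ • z ∈ modPiece A W x (k + p) := by
  refine modPiece_induction (P := fun z => ξ • z ∈ modPiece A W x (k + p)) ?_ ?_ ?_ ?_ hz
  · intro l q η e hl hη he
    rw [TensorProduct.smul_tmul', smul_eq_mul, ← hl, ← add_assoc]
    exact tmul_mem_modPiece (GSym.mul_mem_piece hξ hη) he
  · simp
  · intro y z h1 h2
    rw [smul_add]; exact add_mem h1 h2
  · intro t z h
    rw [smul_comm]; exact Submodule.smul_mem _ _ h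

/-- A functional that vanishes on all parts but one lowers the degree by that of the part. -/
lemma ct_mem_piece {x : M} {p : ℤ} {q : Option (Fin n)} {φ : Module.Dual ℝ (W.Fib x)}
    (hφ : ∀ q' ≠ q, ∀ w ∈ W.part x q', φ w = 0) {z : ModFib A W x} (hz : z ∈ modPiece A W x p) :
    ct A W φ z ∈ GSym.piece (fun i => Module.Dual ℝ ((A i).E x)) (p - W.degree q) := by
  refine modPiece_induction (P := fun z => ct A W φ z ∈
    GSym.piece (fun i => Module.Dual ℝ ((A i).E x)) (p - W.degree q)) ?_ ?_ ?_ ?_ hz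
  · intro l q' η e hl hη he
    rw [ct_tmul]
    by_cases h : q' = q
    · subst h
      refine Submodule.smul_mem _ _ ?_
      rwa [← hl, add_sub_cancel_right]
    · rw [hφ q' h e he, zero_smul]
      exact zero_mem _
  · simp
  · intro y z h1 h2
    rw [map_add]; exact add_mem h1 h2
  · intro t z h
    rw [map_smul]; exact Submodule.smul_mem _ _ h

/-! ### Frames -/

/-- A homogeneous frame near `x₀`, made of global sections, together with the dual functionals. -/
structure Frame (I : ModelWithCorners ℝ EB HB) (W : Graded n M) (x₀ : M) where
  ι : Type
  [fintype : Fintype ι]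
  part : ι → Option (Fin n)
  e : ι → ∀ x, W.Fib x
  φ : ι → ∀ x, Module.Dual ℝ (W.Fib x)
  smooth_e : ∀ b, W.IsSmooth (e b)
  smooth_φ : ∀ b e', W.IsSmooth e' → ContMDiff I 𝓘(ℝ, ℝ) ∞ (fun x => φ b x (e' x))
  res : ∀ᶠ x in 𝓝 x₀, ∀ w, w = ∑ b, φ b x w • e b x
  hom_e : ∀ b x, e b x ∈ W.part x (part b)
  hom_φ : ∀ b x, ∀ q ≠ part b, ∀ w ∈ W.part x q, φ b x w = 0

attribute [instance] Frame.fintype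

/-- The zero section of `W` is smooth, and `W` has homogeneous local frames. -/
structure Graded.IsGood (I : ModelWithCorners ℝ EB HB) (W : Graded n M) : Prop where
  zero : W.IsSmooth (fun _ => 0)
  frame : ∀ x₀, Nonempty (Frame I W x₀)

lemma SecMod.smul_apply (ξ : Fun A) (s : SecMod A W) (x : M) : (ξ • s).1 x = ξ.1 x • s.1 x := rfl

lemma SecMod.add_apply (s t : SecMod A W) (x : M) : (s + t).1 x = s.1 x + t.1 x := rfl

lemma SecMod.sum_apply {ι : Type*} (k : Finset ι) (s : ι → SecMod A W) (x : M) :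
    (∑ b ∈ k, s b).1 x = ∑ b ∈ k, (s b).1 x := by
  rw [AddSubmonoidClass.coe_finsetSum, Finset.sum_apply]

lemma Fun.sum_apply {ι : Type*} (k : Finset ι) (s : ι → Fun A) (x : M) :
    (∑ b ∈ k, s b).1 x = ∑ b ∈ k, (s b).1 x := by
  rw [AddSubmonoidClass.coe_finsetSum, Finset.sum_apply]

lemma SecMod.ext {s t : SecMod A W} (h : ∀ x, s.1 x = t.1 x) : s = t := Subtype.ext (funext h)

lemma Fun.ext {s t : Fun A} (h : ∀ x, s.1 x = t.1 x) : s = t := Subtype.ext (funext h)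

lemma gen_apply (e : ∀ x, W.Fib x) (he : W.IsSmooth e) (x : M) :
    (gen A W e he).1 x = 1 ⊗ₜ[ℝ] e x := rfl

lemma mem_SecMod_of_eventuallyEq {s : ∀ x, ModFib A W x}
    (h : ∀ x₀, ∃ t ∈ SecMod A W, ∀ᶠ x in 𝓝 x₀, s x = t x) : s ∈ SecMod A W := by
  intro x₀
  obtain ⟨t, ht, h1⟩ := h x₀
  obtain ⟨p, hp, h2⟩ := ht x₀
  refine ⟨p, hp, ?_⟩
  filter_upwards [h1, h2] with x h1 h2
  rw [h1, h2]

/-- Smooth sections of `S(A*) ⊗ W` that are characterised pointwise can be constructed locally. -/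
lemma exists_secMod_of_local (P : ∀ x, ModFib A W x → Prop)
    (hP : ∀ x y z, P x y → P x z → y = z)
    (h : ∀ x₀, ∃ t : SecMod A W, ∀ᶠ x in 𝓝 x₀, P x (t.1 x)) : ∃ s : SecMod A W, ∀ x, P x (s.1 x) := by
  choose t ht using h
  refine ⟨⟨fun x => (t x).1 x, mem_SecMod_of_eventuallyEq fun x₀ => ⟨_, (t x₀).2, ?_⟩⟩,
    fun x => (ht x).self_of_nhds⟩
  filter_upwards [ht x₀] with x hx
  exact hP x _ _ (ht x).self_of_nhds hx

/-- An operation on sections of `S(A*) ⊗ W` with values in `S(B*)` yields smooth values if it does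
so on polynomials. -/
lemma mem_Fun_of_secMod {EN : Type*} [NormedAddCommGroup EN] [NormedSpace ℝ EN] {HN : Type*}
    [TopologicalSpace HN] {J : ModelWithCorners ℝ EN HN} {N : Type*} [TopologicalSpace N]
    [ChartedSpace HN N] {B : Fin n → VB J N} (f : N → M) (hf : Continuous f)
    (T : ∀ y, ModFib A W (f y) →ₗ[ℝ] SymFib B y)
    (hgen : ∀ e, W.IsSmooth e → (fun y => T y (1 ⊗ₜ[ℝ] e (f y))) ∈ Fun B)
    (hsmul : ∀ (ξ : Fun A) (t : ∀ x, ModFib A W x), (fun y => T y (t (f y))) ∈ Fun B →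
      (fun y => T y (ξ.1 (f y) • t (f y))) ∈ Fun B) (s : SecMod A W) :
    (fun y => T y (s.1 (f y))) ∈ Fun B := by
  refine mem_Fun_of_eventuallyEq fun y₀ => ?_
  obtain ⟨t, ht, h⟩ := s.2 (f y₀)
  refine ⟨fun y => T y (t (f y)), ?_, ?_⟩
  · clear h
    induction ht using Submodule.span_induction with
    | mem t ht =>
      obtain ⟨e, he, rfl⟩ := ht
      exact hgen e he
    | zero =>
      simp only [Pi.zero_apply, map_zero]
      exact zero_mem (Fun B)
    | add y z _ _ h1 h2 =>
      simp only [Pi.add_apply, map_add]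
      exact add_mem h1 h2
    | smul ξ t _ h => exact hsmul ξ t h
  · filter_upwards [hf.continuousAt.eventually h] with y hy
    rw [hy]

/-- Contraction of a section of `S(A*) ⊗ W` with a smooth functional. -/
noncomputable def ctFun (φ : ∀ x, Module.Dual ℝ (W.Fib x))
    (hφ : ∀ e, W.IsSmooth e → ContMDiff I 𝓘(ℝ, ℝ) ∞ (fun x => φ x (e x))) (s : SecMod A W) : Fun A :=
  ⟨fun x => ct A W (φ x) (s.1 x), by
    refine mem_Fun_of_secMod (f := fun x => x) continuous_id (fun x => ct A W (φ x)) ?_ ?_ s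
    · intro e he
      have : (fun x => ct A W (φ x) (1 ⊗ₜ[ℝ] e x)) = baseFun A (fun x => φ x (e x)) :=
        funext fun x => ct_genFun _ _
      rw [this]
      exact baseFun_mem_Fun (hφ e he)
    · intro ξ t ht
      simp only [ct_smul]
      exact mul_mem ξ.2 ht⟩

namespace Frame

variable {x₀ : M} (F : Frame I W x₀)

/-- The coefficients of a section of `S(A*) ⊗ W` with respect to a frame. -/
noncomputable def coeff (b : F.ι) (s : SecMod A W) : Fun A := ctFun (F.φ b) (F.smooth_φ b) s

lemma homFun_coeff {p : ℤ} {s : SecMod A W} (hs : HomSec p s) (b : F.ι) :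
    HomFun (p - W.degree (F.part b)) (F.coeff b s) :=
  fun x => ct_mem_piece (F.hom_φ b x) (hs x)

lemma eventually_eq (F : Frame I W x₀) (s : SecMod A W) : ∀ᶠ x in 𝓝 x₀,
    s.1 x = ∑ b, (F.coeff b s).1 x • (gen A W (F.e b) (F.smooth_e b)).1 x := by
  filter_upwards [F.res] with x hx
  exact eq_sum_ct hx (s.1 x)

end Frame

lemma homSec_gen {q : Option (Fin n)} {e : ∀ x, W.Fib x} (he : W.IsSmooth e)
    (hq : ∀ x, e x ∈ W.part x q) : HomSec (W.degree q) (gen A W e he) := fun x => by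
  have := tmul_mem_modPiece (A := A) (W := W) (x := x) GSym.one_mem_piece (hq x)
  rwa [zero_add] at this

lemma HomSec.smul {k p : ℤ} {ξ : Fun A} {s : SecMod A W} (hξ : HomFun k ξ) (hs : HomSec p s) :
    HomSec (k + p) (ξ • s) := fun x => smul_mem_modPiece (hξ x) (hs x)

lemma HomSec.add {p : ℤ} {s t : SecMod A W} (hs : HomSec p s) (ht : HomSec p t) :
    HomSec p (s + t) := fun x => add_mem (hs x) (ht x)

lemma HomSec.sum {p : ℤ} {ι : Type*} (k : Finset ι) {s : ι → SecMod A W}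
    (hs : ∀ b ∈ k, HomSec p (s b)) : HomSec p (∑ b ∈ k, s b) := fun x => by
  rw [SecMod.sum_apply]
  exact Submodule.sum_mem _ fun b hb => hs b hb x

/-! ### Operators with a Leibniz rule -/

variable [FiniteDimensional ℝ EB] [T2Space M] [IsManifold I ∞ M]

/-- The Leibniz rule makes an operator local. -/
lemma SecMod.local_of_leibniz {Q : Fun A → Fun A} {D : SecMod A W →+ SecMod A W}
    (hD : ∀ f hf (s : SecMod A W), D (ofFun A f hf • s) = Q (ofFun A f hf) • s + ofFun A f hf • D s)
    {s t : SecMod A W} {x₀ : M} (h : ∀ᶠ x in 𝓝 x₀, s.1 x = t.1 x) : (D s).1 x₀ = (D t).1 x₀ := by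
  obtain ⟨g, hg, hg0, hg1⟩ := exists_cutoff (I := I) h
  have h1 : ofFun A g hg • (s - t) = s - t := by
    refine SecMod.ext fun x => ?_
    change algebraMap ℝ (SymFib A x) (g x) • (s.1 x - t.1 x) = s.1 x - t.1 x
    by_cases hx : s.1 x = t.1 x
    · simp [hx]
    · rw [hg1 x hx, map_one, one_smul]
  have h2 : (D (s - t)).1 x₀ = 0 := by
    rw [← h1, hD]
    change (Q (ofFun A g hg)).1 x₀ • (s.1 x₀ - t.1 x₀) + algebraMap ℝ (SymFib A x₀) (g x₀) • _ = 0
    rw [hg0.self_of_nhds, h.self_of_nhds]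
    simp
  rw [map_sub] at h2
  exact sub_eq_zero.1 h2

lemma Rep.local {Q : LieStr A} (R : Rep Q W) {s t : SecMod A W} {x₀ : M}
    (h : ∀ᶠ x in 𝓝 x₀, s.1 x = t.1 x) : (R.D s).1 x₀ = (R.D t).1 x₀ := by
  refine SecMod.local_of_leibniz (Q := Q.Q) (fun f hf s => ?_) h
  rw [R.leibniz 0 _ _ (homFun_ofFun hf), sgn_zero, one_smul]

omit [FiniteDimensional ℝ EB] [T2Space M] [IsManifold I ∞ M] in
/-- Near every point, a smooth section of `S(A*) ⊗ W` is a finite sum of sections `ξ ⊗ e` with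
`ξ` homogeneous and `e` in one of the parts. -/
lemma exists_homogeneous_sum (hW : W.IsGood I) (s : SecMod A W) (x₀ : M) :
    ∃ t ∈ AddSubmonoid.closure {t : SecMod A W | ∃ p, HomSec p t}, ∀ᶠ x in 𝓝 x₀, s.1 x = t.1 x := by
  obtain ⟨F⟩ := hW.frame x₀
  choose c hc h using fun b => exists_homSpan (F.coeff b s) x₀
  refine ⟨∑ b, c b • gen A W (F.e b) (F.smooth_e b), ?_, ?_⟩
  · refine sum_mem fun b _ => ?_
    have hcb := hc b
    generalize c b = ξ at hcb
    induction hcb using Submodule.closure_induction with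
    | zero => rw [zero_smul]; exact zero_mem _
    | add ξ η _ _ h1 h2 => rw [add_smul]; exact add_mem h1 h2
    | smul_mem t ξ hξ =>
      obtain ⟨k, hξ⟩ := hξ
      exact AddSubmonoid.subset_closure
        ⟨_, HomSec.smul (hξ.smul t) (homSec_gen (F.smooth_e b) (F.hom_e b))⟩
  · filter_upwards [F.eventually_eq s, Filter.eventually_all.2 h] with x hx hx'
    rw [hx, SecMod.sum_apply]
    exact Finset.sum_congr rfl fun b _ => by rw [hx' b]; rfl

omit [FiniteDimensional ℝ EB] [T2Space M] [IsManifold I ∞ M] in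
/-- Local additive operators that agree on homogeneous sections agree. -/
lemma eq_of_homogeneous (hW : W.IsGood I) {W' : Graded n M} {D D' : SecMod A W →+ SecMod A W'}
    (hD : ∀ s t x₀, (∀ᶠ x in 𝓝 x₀, s.1 x = t.1 x) → (D s).1 x₀ = (D t).1 x₀)
    (hD' : ∀ s t x₀, (∀ᶠ x in 𝓝 x₀, s.1 x = t.1 x) → (D' s).1 x₀ = (D' t).1 x₀)
    (h : ∀ p s, HomSec p s → D s = D' s) : D = D' := by
  ext1 s
  refine SecMod.ext fun x => ?_
  obtain ⟨t, ht, hst⟩ := exists_homogeneous_sum hW s x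
  rw [hD _ _ _ hst, hD' _ _ _ hst]
  clear hst
  suffices D t = D' t by rw [this]
  induction ht using AddSubmonoid.closure_induction with
  | mem t ht => exact h _ _ ht.choose_spec
  | zero => rw [map_zero, map_zero]
  | add y z _ _ h1 h2 => rw [map_add, map_add, h1, h2]

omit [FiniteDimensional ℝ EB] [T2Space M] [IsManifold I ∞ M] in
/-- A section is homogeneous if it is so near every point. -/
lemma HomSec.of_eventually {p : ℤ} {s : SecMod A W}
    (h : ∀ x₀, ∃ t : SecMod A W, HomSec p t ∧ s.1 x₀ = t.1 x₀) : HomSec p s := fun x => by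
  obtain ⟨t, ht, hst⟩ := h x
  rw [hst]
  exact ht x

omit [FiniteDimensional ℝ EB] [T2Space M] [IsManifold I ∞ M] in
lemma eventually_apply_eq {D : SecMod A W →+ SecMod A W}
    (hD : ∀ s t x, (∀ᶠ x' in 𝓝 x, s.1 x' = t.1 x') → (D s).1 x = (D t).1 x) {x₀ : M}
    (F : Frame I W x₀) (s : SecMod A W) : ∀ᶠ x in 𝓝 x₀, (D s).1 x =
      (D (∑ b, F.coeff b s • gen A W (F.e b) (F.smooth_e b))).1 x := by
  filter_upwards [(F.eventually_eq s).eventually_nhds] with x hx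
  refine hD _ _ x ?_
  filter_upwards [hx] with y hy
  rw [hy, SecMod.sum_apply]
  rfl

/-- The square of an operator with a Leibniz rule is linear over `Γ(S(A*))`, so that it vanishes if
it vanishes on the sections of `W`. -/
lemma sq_eq_zero_of_gen (hW : W.IsGood I) (Q : LieStr A) {D : SecMod A W →+ SecMod A W}
    (hleib : ∀ (ξ : Fun A) s, D (ξ • s) = Q.Q ξ • s + par 1 ξ • D s)
    (hD : ∀ s t x, (∀ᶠ x' in 𝓝 x, s.1 x' = t.1 x') → (D s).1 x = (D t).1 x)
    (hsq : ∀ q e he, (∀ x, e x ∈ W.part x q) → D (D (gen A W e he)) = 0) (s : SecMod A W) :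
    D (D s) = 0 := by
  refine SecMod.ext fun x₀ => ?_
  obtain ⟨F⟩ := hW.frame x₀
  rw [hD _ _ x₀ (eventually_apply_eq hD F s)]
  refine congrArg (fun u : SecMod A W => u.1 x₀) ?_
  rw [map_sum, map_sum]
  refine Finset.sum_eq_zero fun b _ => ?_
  rw [hleib, map_add, hleib, hleib, Q.sq, Q.Q_par, hsq _ _ _ (F.hom_e b), neg_smul, zero_smul,
    smul_zero]
  abel

/-- Representations can be constructed from a pointwise characterisation `P s x y` of the value `y`
of `D s` at `x`: it has to determine `y`, to be local and compatible with sums and the Leibniz rule,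
and to be solvable on the sections of `W`. -/
theorem exists_rep (hW : W.IsGood I) (Q : LieStr A)
    (P : SecMod A W → ∀ x, ModFib A W x → Prop)
    (huniq : ∀ s x y z, P s x y → P s x z → y = z)
    (hloc : ∀ s t x y, (∀ᶠ x' in 𝓝 x, s.1 x' = t.1 x') → P s x y → P t x y)
    (hadd : ∀ s t x y z, P s x y → P t x z → P (s + t) x (y + z))
    (hleib : ∀ (ξ : Fun A) s x y, P s x y →
      P (ξ • s) x ((Q.Q ξ).1 x • s.1 x + (par 1 ξ).1 x • y))
    (hgen : ∀ q e he, (∀ x, e x ∈ W.part x q) →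
      ∃ t : SecMod A W, HomSec (W.degree q + 1) t ∧ ∀ x, P (gen A W e he) x (t.1 x))
    (hsq : ∀ q e he, (∀ x, e x ∈ W.part x q) → ∀ t u : SecMod A W, HomSec (W.degree q + 1) t →
      (∀ x, P (gen A W e he) x (t.1 x)) → (∀ x, P t x (u.1 x)) → u = 0) :
    ∃ R : Rep Q W, ∀ s x, P s x ((R.D s).1 x) := by
  have h0 : ∀ x, P 0 x 0 := fun x => by
    obtain ⟨t, -, ht⟩ := hgen none _ hW.zero fun x => zero_mem _
    have := hleib 0 _ x _ (ht x)
    rw [zero_smul] at this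
    simpa using this
  have hsum : ∀ {ι : Type} (k : Finset ι) (s : ι → SecMod A W) x (y : ι → ModFib A W x),
      (∀ b, P (s b) x (y b)) → P (∑ b ∈ k, s b) x (∑ b ∈ k, y b) := by
    intro ι k s x y h
    classical
    induction k using Finset.induction_on with
    | empty => simpa using h0 x
    | insert a k ha ih =>
      rw [Finset.sum_insert ha, Finset.sum_insert ha]
      exact hadd _ _ _ _ _ (h a) ih
  -- The local solutions, given by the Leibniz rule in a frame, are glued by uniqueness.
  have hex : ∀ s : SecMod A W, ∃ t : SecMod A W, ∀ x, P s x (t.1 x) := by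
    intro s
    refine exists_secMod_of_local (P s) (huniq s) fun x₀ => ?_
    obtain ⟨F⟩ := hW.frame x₀
    choose u _ hu using fun b => hgen (F.part b) (F.e b) (F.smooth_e b) (F.hom_e b)
    refine ⟨∑ b, (Q.Q (F.coeff b s) • gen A W (F.e b) (F.smooth_e b) + par 1 (F.coeff b s) • u b), ?_⟩
    filter_upwards [(F.eventually_eq s).eventually_nhds] with x hx
    refine hloc (∑ b, F.coeff b s • gen A W (F.e b) (F.smooth_e b)) _ x _ ?_ ?_
    · filter_upwards [hx] with y hy
      rw [hy, SecMod.sum_apply]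
      rfl
    · rw [SecMod.sum_apply]
      exact hsum _ _ x _ fun b => hleib _ _ x _ (hu b x)
  choose D hD using hex
  -- Uniqueness turns the properties of `P` into properties of the operator.
  let D' : SecMod A W →+ SecMod A W := AddMonoidHom.mk' D fun s t =>
    SecMod.ext fun x => huniq _ x _ _ (hD (s + t) x) (hadd _ _ _ _ _ (hD s x) (hD t x))
  have hleib' : ∀ (ξ : Fun A) s, D' (ξ • s) = Q.Q ξ • s + par 1 ξ • D' s := fun ξ s =>
    SecMod.ext fun x => huniq _ x _ _ (hD (ξ • s) x) (hleib ξ s x _ (hD s x))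
  have hlocal : ∀ s t x, (∀ᶠ x' in 𝓝 x, s.1 x' = t.1 x') → (D' s).1 x = (D' t).1 x :=
    fun s t x h => huniq _ x _ _ (hloc _ _ _ _ h (hD s x)) (hD t x)
  have hdeg' : ∀ q e he, (∀ x, e x ∈ W.part x q) →
      HomSec (W.degree q + 1) (D' (gen A W e he)) := by
    intro q e he hq
    obtain ⟨t, ht', ht⟩ := hgen q e he hq
    have : D' (gen A W e he) = t := SecMod.ext fun x => huniq _ x _ _ (hD _ x) (ht x)
    rw [this]
    exact ht'
  have hdeg : ∀ p s, HomSec p s → HomSec (p + 1) (D' s) := by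
    intro p s hs
    refine HomSec.of_eventually fun x₀ => ?_
    obtain ⟨F⟩ := hW.frame x₀
    refine ⟨∑ b, (Q.Q (F.coeff b s) • gen A W (F.e b) (F.smooth_e b) +
      par 1 (F.coeff b s) • D' (gen A W (F.e b) (F.smooth_e b))), ?_, ?_⟩
    · refine HomSec.sum _ fun b _ => ?_
      have h1 := F.homFun_coeff hs b
      have h2 := hdeg' _ (F.e b) (F.smooth_e b) (F.hom_e b)
      refine HomSec.add ?_ ?_
      · have := HomSec.smul (Q.isDer.deg _ _ h1) (homSec_gen (F.smooth_e b) (F.hom_e b))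
        convert this using 1
        ring
      · have h3 : HomFun (p - W.degree (F.part b)) (par 1 (F.coeff b s)) := by
          rw [h1.par]
          exact h1.smul _
        have := HomSec.smul h3 h2
        convert this using 1
        ring
    · rw [(eventually_apply_eq hlocal F s).self_of_nhds, map_sum]
      simp only [hleib']
  have hsq' : ∀ s, D' (D' s) = 0 := sq_eq_zero_of_gen hW Q hleib' hlocal fun q e he hq =>
    hsq q e he hq _ _ (hdeg' q e he hq) (hD _) (hD _)
  refine ⟨⟨D', hdeg, fun k ξ s hξ => ?_, hsq'⟩, hD⟩
  rw [hleib', hξ.par, pow_one]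

end Modules

/-! ### Hadamard's lemma and coordinates -/

section Hadamard

open MeasureTheory intervalIntegral

/-- Smoothness of `x ↦ ∫ t in 0..1, t ^ k • F (t • x)`. The derivative is an integral of the same
form, whence the auxiliary power of `t`. -/
lemma contDiff_integral_smul {E : Type u} [NormedAddCommGroup E] [NormedSpace ℝ E]
    [FiniteDimensional ℝ E] (m : ℕ) : ∀ {G : Type u} [NormedAddCommGroup G] [NormedSpace ℝ G]
    [CompleteSpace G] (F : E → G) (_ : ContDiff ℝ ∞ F) (k : ℕ),
    ContDiff ℝ m (fun x => ∫ t in (0 : ℝ)..1, t ^ k • F (t • x)) := by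
  have hder : ∀ {G : Type u} [NormedAddCommGroup G] [NormedSpace ℝ G] [CompleteSpace G] (F : E → G)
      (_ : ContDiff ℝ ∞ F) (k : ℕ) (x : E), HasFDerivAt (fun x => ∫ t in (0 : ℝ)..1, t ^ k • F (t • x))
        (∫ t in (0 : ℝ)..1, t ^ (k + 1) • fderiv ℝ F (t • x)) x := by
    intro G _ _ _ F hF k x
    have hF' : Continuous (fderiv ℝ F) := hF.continuous_fderiv (by simp)
    have hcont : ∀ x : E, Continuous fun t : ℝ => t ^ k • F (t • x) := fun x =>
      (continuous_id.pow k).smul (hF.continuous.comp (continuous_id.smul continuous_const))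
    have hcont' : Continuous fun p : E × ℝ => p.2 ^ (k + 1) • fderiv ℝ F (p.2 • p.1) :=
      (continuous_snd.pow _).smul (hF'.comp (continuous_snd.smul continuous_fst))
    obtain ⟨C, hC⟩ := ((isCompact_closedBall x 1).prod (isCompact_Icc (a := (0 : ℝ)) (b := 1))).exists_bound_of_continuousOn hcont'.continuousOn
    refine hasFDerivAt_integral_of_dominated_of_fderiv_le (bound := fun _ => C)
      (F := fun x t => t ^ k • F (t • x)) (F' := fun x t => t ^ (k + 1) • fderiv ℝ F (t • x))
      (Metric.closedBall_mem_nhds x one_pos) (Filter.Eventually.of_forall fun y =>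
        (hcont y).aestronglyMeasurable) ((hcont x).intervalIntegrable _ _)
      (hcont'.comp (Continuous.prodMk_right x)).aestronglyMeasurable
      (Filter.Eventually.of_forall fun t ht y hy => ?_) (by simp)
      (Filter.Eventually.of_forall fun t _ y _ => ?_)
    · rw [Set.uIoc_of_le zero_le_one] at ht
      exact hC (y, t) ⟨hy, ht.1.le, ht.2⟩
    · have h1 : HasFDerivAt F (fderiv ℝ F (t • y)) (t • y) :=
        ((hF.differentiable (by simp)) _).hasFDerivAt
      have h2 : HasFDerivAt (fun y : E => t • y) (t • ContinuousLinearMap.id ℝ E) y :=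
        (hasFDerivAt_id y).const_smul t
      have h3 := (h1.comp y h2).const_smul (t ^ k)
      rwa [ContinuousLinearMap.comp_smul, ContinuousLinearMap.comp_id, smul_smul,
        ← pow_succ] at h3
  induction m with
  | zero =>
    intro G _ _ _ F hF k
    exact contDiff_zero.2 (continuous_iff_continuousAt.2 fun x => (hder F hF k x).continuousAt)
  | succ m ih =>
    intro G _ _ _ F hF k
    rw [show ((m + 1 : ℕ) : WithTop ℕ∞) = (m : WithTop ℕ∞) + 1 by norm_cast,
      contDiff_succ_iff_fderiv]
    refine ⟨fun x => (hder F hF k x).differentiableAt, by simp, ?_⟩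
    have : fderiv ℝ (fun x => ∫ t in (0 : ℝ)..1, t ^ k • F (t • x)) =
        fun x => ∫ t in (0 : ℝ)..1, t ^ (k + 1) • fderiv ℝ F (t • x) :=
      funext fun x => (hder F hF k x).fderiv
    rw [this]
    exact ih (fderiv ℝ F) (hF.fderiv_right (by simp)) (k + 1)

/-- Hadamard's lemma: `f` differs from its value at `a` by a smooth family of linear functionals
applied to the displacement. -/
lemma exists_hadamard {E : Type u} [NormedAddCommGroup E] [NormedSpace ℝ E]
    [FiniteDimensional ℝ E] {f : E → ℝ} (hf : ContDiff ℝ ∞ f) (a : E) :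
    ∃ g : E → E →L[ℝ] ℝ, ContDiff ℝ ∞ g ∧ ∀ x, f x = f a + g x (x - a) := by
  let F' : E → (E →L[ℝ] ℝ) := fun x => fderiv ℝ f (a + x)
  have hF' : ContDiff ℝ ∞ F' :=
    (hf.fderiv_right (by simp)).comp (contDiff_const.add contDiff_id)
  have hc : ∀ x, Continuous fun t : ℝ => F' (t • x) := fun x =>
    hF'.continuous.comp (continuous_id.smul continuous_const)
  refine ⟨fun x => ∫ t in (0 : ℝ)..1, F' (t • (x - a)), ?_, fun x => ?_⟩
  · have h : ContDiff ℝ ∞ fun x => ∫ t in (0 : ℝ)..1, F' (t • x) := by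
      rw [contDiff_infty]
      intro m
      simpa using contDiff_integral_smul m F' hF' 0
    exact h.comp (contDiff_id.sub contDiff_const)
  · rw [ContinuousLinearMap.intervalIntegral_apply ((hc _).intervalIntegrable _ _)]
    have h := integral_eq_sub_of_hasDerivAt (a := 0) (b := 1)
      (f := fun t : ℝ => f (a + t • (x - a))) (f' := fun t => F' (t • (x - a)) (x - a))
      (fun t _ => ?_) (((hc (x - a)).clm_apply continuous_const).intervalIntegrable _ _)
    · rw [h]
      simp
    · have h1 : HasFDerivAt f (F' (t • (x - a))) (a + t • (x - a)) :=
        ((hf.differentiable (by simp)) _).hasFDerivAt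
      have h2 : HasDerivAt (fun t : ℝ => a + t • (x - a)) (x - a) t := by
        simpa using ((hasDerivAt_id t).smul_const (x - a)).const_add a
      exact h1.comp_hasDerivAt t h2

end Hadamard

section Coordinates

variable {d : ℕ} {M : Type u} [TopologicalSpace M] [ChartedSpace (EuclideanSpace ℝ (Fin d)) M]
  [IsManifold (𝓡 d) ∞ M]

/-- Smooth functions `y` that are coordinates near `x₀`, with the coordinate vector fields `E`. -/
structure Coord (d : ℕ) {M : Type u} [TopologicalSpace M]
    [ChartedSpace (EuclideanSpace ℝ (Fin d)) M] [IsManifold (𝓡 d) ∞ M] (x₀ : M) where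
  y : Fin d → M → ℝ
  E : Fin d → ∀ x : M, TangentSpace (𝓡 d) x
  smooth_y : ∀ i, ContMDiff (𝓡 d) 𝓘(ℝ, ℝ) ∞ (y i)
  smooth_E : ∀ i, ContMDiff (𝓡 d) (𝓡 d).tangent ∞ (fun x => (⟨x, E i x⟩ : TangentBundle (𝓡 d) M))
  res : ∀ᶠ x in 𝓝 x₀, ∀ v : TangentSpace (𝓡 d) x, v = ∑ i, mvfderiv (𝓡 d) (y i) x v • E i x
  dual : ∀ᶠ x in 𝓝 x₀, ∀ i j, mvfderiv (𝓡 d) (y i) x (E j x) = if i = j then 1 else 0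
  hadamard : ∀ᶠ x in 𝓝 x₀, ∀ f : M → ℝ, ContMDiff (𝓡 d) 𝓘(ℝ, ℝ) ∞ f → ∃ g : Fin d → M → ℝ,
    (∀ i, ContMDiff (𝓡 d) 𝓘(ℝ, ℝ) ∞ (g i)) ∧
    ∀ᶠ x' in 𝓝 x, f x' = f x + ∑ i, (y i x' - y i x) * g i x'

/-- Coordinates of a chart, cut off outside of its domain. -/
theorem nonempty_coord [T2Space M] (x₀ : M) : Nonempty (Coord d x₀) := by
  let φ := extChartAt (𝓡 d) x₀
  let e := trivializationAt (EuclideanSpace ℝ (Fin d)) (TangentSpace (𝓡 d) : M → Type _) x₀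
  have hbase : e.baseSet = (chartAt (EuclideanSpace ℝ (Fin d)) x₀).source := rfl
  have hsrc : φ.source = e.baseSet := by rw [hbase, extChartAt_source]
  have hx₀ : x₀ ∈ e.baseSet := FiberBundle.mem_baseSet_trivializationAt' x₀
  obtain ⟨χ, hχ, hχ1, hχs⟩ := exists_bump (I := 𝓡 d) (e.open_baseSet.mem_nhds hx₀)
  have hφ : ContMDiffOn (𝓡 d) 𝓘(ℝ, EuclideanSpace ℝ (Fin d)) ∞ φ e.baseSet := by
    rw [hbase]; exact contMDiffOn_extChartAt
  have hφi : ∀ i, ContMDiffOn (𝓡 d) 𝓘(ℝ, ℝ) ∞ (fun x => φ x i) e.baseSet := fun i =>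
    (EuclideanSpace.proj (𝕜 := ℝ) i).contMDiff.comp_contMDiffOn hφ
  have hcut : ∀ {g : M → ℝ}, ContMDiffOn (𝓡 d) 𝓘(ℝ, ℝ) ∞ g e.baseSet →
      ContMDiff (𝓡 d) 𝓘(ℝ, ℝ) ∞ (fun x => χ x * g x) := by
    intro g hg
    refine contMDiff_of_tsupport fun x hx => ?_
    have hx' : x ∈ e.baseSet := hχs (tsupport_mul_subset_left hx)
    exact (hχ x).mul (hg.contMDiffAt (e.open_baseSet.mem_nhds hx'))
  let b : Fin d → EuclideanSpace ℝ (Fin d) := fun i => EuclideanSpace.basisFun (Fin d) ℝ i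
  have hb : ∀ v : EuclideanSpace ℝ (Fin d), v = ∑ i, v i • b i := by
    intro v
    have := (EuclideanSpace.basisFun (Fin d) ℝ).sum_repr v
    simpa [b] using this.symm
  have hχ' : ∀ᶠ x in 𝓝 x₀, (∀ᶠ x' in 𝓝 x, χ x' = 1) ∧ x ∈ e.baseSet :=
    hχ1.eventually_nhds.and (e.open_baseSet.mem_nhds hx₀)
  have hdy : ∀ x, (∀ᶠ x' in 𝓝 x, χ x' = 1) → x ∈ e.baseSet → ∀ i v,
      mvfderiv (𝓡 d) (fun x => χ x * φ x i) x v = e.continuousLinearMapAt ℝ x v i := by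
    intro x hx hxe i v
    have h1 : (fun x => χ x * φ x i) =ᶠ[𝓝 x] (EuclideanSpace.proj (𝕜 := ℝ) i) ∘ φ := by
      filter_upwards [hx] with x' hx'
      simp [hx']
    have h2 : MDifferentiableAt (𝓡 d) 𝓘(ℝ, EuclideanSpace ℝ (Fin d)) φ x :=
      (hφ.contMDiffAt (e.open_baseSet.mem_nhds hxe)).mdifferentiableAt (by simp)
    rw [TangentBundle.continuousLinearMapAt_trivializationAt (by rwa [hbase] at hxe)]
    change mfderiv (𝓡 d) 𝓘(ℝ, ℝ) (fun x => χ x * φ x i) x v = _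
    rw [h1.mfderiv_eq, mfderiv_comp x
      ((EuclideanSpace.proj (𝕜 := ℝ) i).contMDiff.mdifferentiableAt one_ne_zero) h2,
      ContinuousLinearMap.mfderiv_eq]
    rfl
  refine ⟨⟨fun i x => χ x * φ x i, fun i x => χ x • e.symm x (b i), fun i => ?_, fun i => ?_,
    ?_, ?_, ?_⟩⟩
  · exact hcut (hφi i)
  · refine ContMDiffOn.smul_section_of_tsupport hχ.contMDiffOn e.open_baseSet hχs ?_
    refine (e.contMDiffOn_section_baseSet_iff (IB := 𝓡 d) (n := ∞)).2 ?_
    refine (contMDiffOn_const (c := b i)).congr fun x hx => ?_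
    simp [e.apply_mk_symm hx]
  · filter_upwards [hχ'] with x hx v
    simp only [hdy x hx.1 hx.2, hx.1.self_of_nhds, one_smul]
    have h1 := congrArg (e.symmL ℝ x) (hb (e.continuousLinearMapAt ℝ x v))
    rw [e.symmL_continuousLinearMapAt hx.2] at h1
    refine h1.trans ?_
    rw [map_sum]
    refine Finset.sum_congr rfl fun i _ => ?_
    rw [map_smul, e.symmL_apply hx.2]
  · filter_upwards [hχ'] with x hx i j
    rw [hdy x hx.1 hx.2, hx.1.self_of_nhds, one_smul, ← e.symmL_apply (R := ℝ) hx.2,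
      e.continuousLinearMapAt_symmL hx.2]
    simp [b]
  -- Hadamard's lemma for `f` in the chart, cut off by `ψ` to make it globally defined.
  · filter_upwards [hχ'] with x hx f hf
    have hxs : x ∈ φ.source := hsrc ▸ hx.2
    have htgt : IsOpen φ.target := isOpen_extChartAt_target x₀
    obtain ⟨ψ, hψ, hψ1, hψs⟩ := exists_bump (I := 𝓘(ℝ, EuclideanSpace ℝ (Fin d)))
      (htgt.mem_nhds (φ.map_source hxs))
    have hF : ContDiff ℝ ∞ (fun z => ψ z * f (φ.symm z)) := by
      rw [← contMDiff_iff_contDiff]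
      refine contMDiff_of_tsupport fun z hz => ?_
      have hz' : z ∈ φ.target := hψs (tsupport_mul_subset_left hz)
      exact (hψ z).mul (hf.contMDiffAt.comp z
        ((contMDiffOn_extChartAt_symm x₀).contMDiffAt (htgt.mem_nhds hz')))
    obtain ⟨g, hg, hFg⟩ := exists_hadamard hF (φ x)
    refine ⟨fun i x' => χ x' * g (φ x') (b i), fun i => hcut ?_, ?_⟩
    · exact ((hg.clm_apply contDiff_const).contMDiff).comp_contMDiffOn hφ
    · have hcont : ContinuousAt φ x := (hφ.continuousOn).continuousAt (e.open_baseSet.mem_nhds hx.2)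
      filter_upwards [hx.1, e.open_baseSet.mem_nhds hx.2, hcont.eventually hψ1] with x' h1 h2 h3
      have h4 := hFg (φ x')
      rw [h3, hψ1.self_of_nhds, φ.left_inv hxs, φ.left_inv (hsrc ▸ h2), one_mul, one_mul,
        hb (φ x' - φ x), map_sum] at h4
      rw [h4, h1, hx.1.self_of_nhds]
      simp

end Coordinates

/-! ### Extension of connections to `Γ(S(A*))` -/

section Connections

variable {EB : Type v} [NormedAddCommGroup EB] [NormedSpace ℝ EB] {HB : Type w}
  [TopologicalSpace HB] {I : ModelWithCorners ℝ EB HB}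
  {M : Type u} [TopologicalSpace M] [ChartedSpace HB M] [IsManifold I ∞ M] {n : ℕ}
  {A : Fin n → VB I M}

lemma contMDiff_mvfderiv {f : M → ℝ} (hf : ContMDiff I 𝓘(ℝ, ℝ) ∞ f) {X : ∀ x : M, TangentSpace I x}
    (hX : ContMDiff I I.tangent ∞ (fun x => (⟨x, X x⟩ : TangentBundle I M))) :
    ContMDiff I 𝓘(ℝ, ℝ) ∞ (fun x => mvfderiv I f x (X x)) :=
  (contMDiff_snd_tangentBundle_modelSpace ℝ 𝓘(ℝ, ℝ)).comp
    ((hf.contMDiff_tangentMap (m := ∞) (by simp)).comp hX)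

omit [IsManifold I ∞ M] in
lemma mvfderiv_congr {f g : M → ℝ} {x : M} (h : f =ᶠ[𝓝 x] g) : mvfderiv I f x = mvfderiv I g x := by
  ext X
  change mfderiv I 𝓘(ℝ, ℝ) f x X = mfderiv I 𝓘(ℝ, ℝ) g x X
  rw [h.mfderiv_eq]
  rfl

omit [IsManifold I ∞ M] in
lemma mdifferentiableAt_form {B : VB I M} {ε : ∀ x, Module.Dual ℝ (B.E x)} (hε : B.IsForm ε)
    {σ : ∀ x, B.E x} {x : M}
    (hσ : MDifferentiableAt I B.model (fun x => (⟨x, σ x⟩ : B.Tot)) x) :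
    MDifferentiableAt I 𝓘(ℝ, ℝ) (fun y => ε y (σ y)) x :=
  MDifferentiableAt.comp (g := fun p : B.Tot => ε p.proj p.2) x
    (ContMDiff.mdifferentiableAt hε (by simp)) hσ

/-- The dual of a connection exists: `X (ε σ) - ε (∇_X σ)` is tensorial in `σ`. -/
lemma exists_isDualDerivative {B : VB I M} (cov : CovariantDerivative I B.F B.E)
    {ε : ∀ x, Module.Dual ℝ (B.E x)} (hε : B.IsForm ε) (x : M) :
    ∃ N, IsDualDerivative cov ε x N := by
  let Φ : TangentSpace I x → (∀ x, B.E x) → ℝ := fun X σ =>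
    mvfderiv I (fun y => ε y (σ y)) x X - ε x (cov σ x X)
  have hΦ : ∀ X, TensorialAt I B.F (Φ X) x := by
    intro X
    refine ⟨?_, ?_⟩
    · intro f σ hf hσ
      have h1 := mvfderiv_mul (hf) (mdifferentiableAt_form hε hσ)
      have h2 : (fun y => ε y ((f • σ) y)) = f * fun y => ε y (σ y) := by
        ext y; simp
      simp only [Φ, h2]
      have h3 := cov.isCovariantDerivativeOnUniv.leibniz (x := x) hσ hf
      have h4 : cov (f • σ) x = _ := h3
      rw [h4, h1]
      simp
      ring
    · intro σ σ' hσ hσ'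
      have h1 := mvfderiv_add (mdifferentiableAt_form hε hσ) (mdifferentiableAt_form hε hσ')
      have h2 : (fun y => ε y ((σ + σ') y)) = (fun y => ε y (σ y)) + fun y => ε y (σ' y) := by
        ext y; simp
      simp only [Φ, h2]
      have h4 : cov (σ + σ') x = _ := cov.isCovariantDerivativeOnUniv.add (x := x) hσ hσ'
      rw [h4, h1]
      simp
      ring
  refine ⟨⟨⟨fun X => (TensorialAt.mkHom (Φ X) x (hΦ X)).toLinearMap, ?_⟩, ?_⟩, fun σ hσ X => ?_⟩
  · intro X Y
    ext v
    change Φ _ _ = Φ _ _ + Φ _ _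
    simp only [Φ, map_add]
    ring
  · intro t X
    ext v
    change Φ _ _ = t • Φ _ _
    simp only [Φ, map_smul, smul_sub]
  · exact TensorialAt.mkHom_apply (hΦ X) (ContMDiff.mdifferentiableAt hσ (by simp))

/-- The graph at `x` of the extension of the duals of the connections `cov` to `Γ(S(A*))`: the
smallest relation that contains the differentials of functions and the dual derivatives of forms, is
closed under sums and satisfies the Leibniz rule, and only depends on germs. It is functional by
`CovGraph.unique`. -/
inductive CovGraph (cov : ∀ i, CovariantDerivative I (A i).F (A i).E) (x : M) :
    (∀ y, SymFib A y) → (TangentSpace I x →ₗ[ℝ] SymFib A x) → Prop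
  | base (f) (hf : ContMDiff I 𝓘(ℝ, ℝ) ∞ f) :
    CovGraph cov x (baseFun A f) (Algebra.linearMap ℝ (SymFib A x) ∘ₗ (mvfderiv I f x).toLinearMap)
  | form (i) (α) (hα : (A i).IsForm α) (N) (hN : IsDualDerivative (cov i) α x N) :
    CovGraph cov x (formFun A i α) (GSym.ι i ∘ₗ N)
  | add (ξ η N N') : CovGraph cov x ξ N → CovGraph cov x η N' → CovGraph cov x (ξ + η) (N + N')
  | mul (ξ η N N') : CovGraph cov x ξ N → CovGraph cov x η N' →
    CovGraph cov x (ξ * η) (LinearMap.mulRight ℝ (η x) ∘ₗ N + LinearMap.mulLeft ℝ (ξ x) ∘ₗ N')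
  | germ (ξ η N) : (∀ᶠ y in 𝓝 x, ξ y = η y) → CovGraph cov x ξ N → CovGraph cov x η N

namespace CovGraph

variable {cov : ∀ i, CovariantDerivative I (A i).F (A i).E} {x : M} {ξ η : ∀ y, SymFib A y}
  {N N' : TangentSpace I x →ₗ[ℝ] SymFib A x}

lemma exists_of_mem (cov : ∀ i, CovariantDerivative I (A i).F (A i).E) (x : M) (hξ : ξ ∈ Fun A) :
    ∃ N, CovGraph cov x ξ N := by
  obtain ⟨p, hp, h⟩ := hξ x
  suffices ∃ N, CovGraph cov x p N by
    obtain ⟨N, hN⟩ := this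
    exact ⟨N, .germ p ξ N (h.mono fun _ h => h.symm) hN⟩
  clear h
  induction hp using polyFun_induction with
  | hf f hf => exact ⟨_, .base f hf⟩
  | hα i α hα =>
    obtain ⟨N, hN⟩ := exists_isDualDerivative (cov i) hα x
    exact ⟨_, .form i α hα N hN⟩
  | hadd ξ η _ _ h1 h2 => exact ⟨_, .add _ _ _ _ h1.choose_spec h2.choose_spec⟩
  | hmul ξ η _ _ h1 h2 => exact ⟨_, .mul _ _ _ _ h1.choose_spec h2.choose_spec⟩

omit [IsManifold I ∞ M] in
lemma congr_right (h : CovGraph cov x ξ N) (hN : ∀ X, N X = N' X) : CovGraph cov x ξ N' := by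
  rwa [← LinearMap.ext hN]

lemma zero : CovGraph cov x 0 0 := by
  have := base (A := A) (cov := cov) (x := x) (fun _ => (0 : ℝ)) contMDiff_const
  refine .germ _ _ _ (Filter.Eventually.of_forall fun y => by simp [baseFun]) (this.congr_right ?_)
  intro X
  simp [mvfderiv_const]

lemma smul (t : ℝ) (h : CovGraph cov x ξ N) : CovGraph cov x (t • ξ) (t • N) := by
  have h1 := mul _ _ _ _ (base (A := A) (cov := cov) (x := x) (fun _ => t) contMDiff_const) h
  refine .germ _ _ _ (Filter.Eventually.of_forall fun y => ?_) (h1.congr_right ?_)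
  · exact (Algebra.smul_def t (ξ y)).symm
  · intro X
    simp [mvfderiv_const, baseFun, Algebra.smul_def]

lemma scale (c : Fin n → ℝ) (h : CovGraph cov x ξ N) :
    CovGraph cov x (fun y => GSym.scale c (ξ y)) ((GSym.scale c).toLinearMap ∘ₗ N) := by
  induction h with
  | base f hf =>
    refine .germ _ _ _ (Filter.Eventually.of_forall fun y => ?_) ((base f hf).congr_right fun X => ?_)
    · simp [baseFun]
    · simp
  | form i α hα N hN =>
    refine .germ _ _ _ (Filter.Eventually.of_forall fun y => ?_)
      ((smul (c i) (form i α hα N hN)).congr_right fun X => ?_)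
    · simp [formFun]
    · simp
  | add ξ η N N' _ _ h1 h2 =>
    refine .germ _ _ _ (Filter.Eventually.of_forall fun y => ?_)
      ((add _ _ _ _ h1 h2).congr_right fun X => ?_)
    · simp
    · simp
  | mul ξ η N N' _ _ h1 h2 =>
    refine .germ _ _ _ (Filter.Eventually.of_forall fun y => ?_)
      ((mul _ _ _ _ h1 h2).congr_right fun X => ?_)
    · simp
    · simp
  | germ ξ η N h _ h1 =>
    exact .germ _ _ _ (h.mono fun y hy => by rw [hy]) h1

/-- The scalar part of the covariant derivative is the derivative of the scalar part. -/
lemma aug (h : CovGraph cov x ξ N) :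
    MDifferentiableAt I 𝓘(ℝ, ℝ) (fun y => GSym.aug (ξ y)) x ∧
      ∀ X, GSym.aug (N X) = mvfderiv I (fun y => GSym.aug (ξ y)) x X := by
  induction h with
  | base f hf =>
    simp only [baseFun, AlgHom.commutes, Algebra.algebraMap_self, RingHom.id_apply]
    exact ⟨hf.mdifferentiableAt (by simp), fun X => by simp⟩
  | form i α hα N hN =>
    simp only [formFun, GSym.aug_ι]
    exact ⟨mdifferentiableAt_const, fun X => by simp [mvfderiv_const]⟩
  | add ξ η N N' _ _ h1 h2 =>
    have e : (fun y => GSym.aug ((ξ + η) y)) =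
      (fun y => GSym.aug (ξ y)) + fun y => GSym.aug (η y) := by ext y; simp
    rw [e]
    refine ⟨h1.1.add h2.1, fun X => ?_⟩
    rw [mvfderiv_add h1.1 h2.1]
    simp [h1.2, h2.2]
  | mul ξ η N N' _ _ h1 h2 =>
    have e : (fun y => GSym.aug ((ξ * η) y)) =
      (fun y => GSym.aug (ξ y)) * fun y => GSym.aug (η y) := by ext y; simp
    rw [e]
    refine ⟨h1.1.mul h2.1, fun X => ?_⟩
    rw [mvfderiv_mul h1.1 h2.1]
    simp [h1.2, h2.2]
    ring
  | germ ξ η N h _ h1 =>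
    have e : (fun y => GSym.aug (ξ y)) =ᶠ[𝓝 x] fun y => GSym.aug (η y) := by
      filter_upwards [h] with y hy
      rw [hy]
    exact ⟨h1.1.congr_of_eventuallyEq e.symm, fun X => by rw [h1.2, mvfderiv_congr e]⟩

/-- The extended connection is compatible with contractions. -/
lemma contract {i : Fin n} {a : ∀ x, (A i).E x} (ha : (A i).IsSec a) (h : CovGraph cov x ξ N) :
    CovGraph cov x (fun y => GSym.contract i (Module.Dual.eval ℝ _ (a y)) (ξ y))
      (GSym.contract i (Module.Dual.eval ℝ _ (a x)) ∘ₗ N +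
        (GSym.contractL (W := fun i => Module.Dual ℝ ((A i).E x)) i ∘ₗ
          Module.Dual.eval ℝ _ ∘ₗ (cov i a x).toLinearMap).flip (ξ x)) := by
  induction h with
  | base f hf =>
    refine .germ _ _ _ (Filter.Eventually.of_forall fun y => ?_) (zero.congr_right fun X => ?_)
    · simp [baseFun]
    · simp [baseFun]
  | form j α hα N hN =>
    by_cases hj : j = i
    · subst hj
      refine .germ _ _ _ (Filter.Eventually.of_forall fun y => ?_)
        ((base _ (hα.apply ha)).congr_right fun X => ?_)
      · simp only [baseFun, formFun, GSym.contract_ι_self]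
        rfl
      · have := hN a ha X
        simp only [formFun, LinearMap.add_apply, LinearMap.comp_apply, LinearMap.flip_apply,
          GSym.contractL_apply, GSym.contract_ι_self, ← map_add]
        simp only [Algebra.linearMap_apply]
        congr 1
        simp only [Module.Dual.eval_apply]
        rw [this]
        simp
    · refine .germ _ _ _ (Filter.Eventually.of_forall fun y => ?_) (zero.congr_right fun X => ?_)
      · simp [formFun, GSym.contract_ι_of_ne hj]
      · simp only [formFun, LinearMap.add_apply, LinearMap.comp_apply, LinearMap.flip_apply,
          GSym.contractL_apply, GSym.contract_ι_of_ne hj]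
        simp
  | add ξ η N N' _ _ h1 h2 =>
    refine .germ _ _ _ (Filter.Eventually.of_forall fun y => ?_)
      ((add _ _ _ _ h1 h2).congr_right fun X => ?_)
    · simp
    · simp only [LinearMap.add_apply, LinearMap.comp_apply, LinearMap.flip_apply,
        GSym.contractL_apply, Pi.add_apply, map_add]
      abel
  | mul ξ η N N' hξ hη h1 h2 =>
    have h3 := scale (fun j : Fin n => ((-1 : ℝ) ^ (j.val + 1)) ^ (i.val + 1)) hξ
    refine .germ _ _ _ (Filter.Eventually.of_forall fun y => ?_)
      ((add _ _ _ _ (mul _ _ _ _ h1 hη) (mul _ _ _ _ h3 h2)).congr_right fun X => ?_)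
    · simp only [Pi.mul_apply, Pi.add_apply, GSym.contract_mul, GSym.scale_apply_pow_parity]
    · simp only [LinearMap.add_apply, LinearMap.comp_apply, LinearMap.flip_apply,
        GSym.contractL_apply, Pi.mul_apply, map_add, GSym.contract_mul, LinearMap.mulLeft_apply,
        LinearMap.mulRight_apply, GSym.scale_apply_pow_parity,
        AlgHom.toLinearMap_apply]
      abel
  | germ ξ η N h _ h1 =>
    rw [← h.self_of_nhds]
    exact .germ _ _ _ (h.mono fun y hy => by rw [hy]) h1

variable [FiniteDimensional ℝ EB] [T2Space M]

/-- The derivative of a section that vanishes near `x` vanishes: the values of such derivatives are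
stable under contractions and have no scalar part. -/
lemma eq_zero (h : CovGraph cov x ξ N) (h0 : ∀ᶠ y in 𝓝 x, ξ y = 0) (X : TangentSpace I x) :
    N X = 0 := by
  refine GSym.eq_zero_of_contract_stable (W := fun i => Module.Dual ℝ ((A i).E x))
    (fun ζ => ∃ ξ N, CovGraph cov x ξ N ∧ (∀ᶠ y in 𝓝 x, ξ y = 0) ∧ N X = ζ) (fun _ => Set.univ)
    (fun _ => Submodule.span_univ) ?_ ?_ ⟨ξ, N, h, h0, rfl⟩
  · rintro _ ⟨ξ, N, h, h0, rfl⟩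
    rw [h.aug.2]
    have e : (fun y => GSym.aug (ξ y)) =ᶠ[𝓝 x] fun _ => 0 := by
      filter_upwards [h0] with y hy
      rw [hy, map_zero]
    rw [mvfderiv_congr e, mvfderiv_const]
    rfl
  · rintro _ ⟨ξ, N, h, h0, rfl⟩ i a -
    obtain ⟨a, rfl⟩ := (Module.evalEquiv ℝ ((A i).E x)).surjective a
    obtain ⟨ext, hext, hext'⟩ := (A i).exists_extend x
    refine ⟨_, _, h.contract (hext a), ?_, ?_⟩
    · filter_upwards [h0] with y hy
      rw [hy, map_zero]
    · simp only [LinearMap.comp_apply, h0.self_of_nhds, hext', map_zero, add_zero]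
      rfl

lemma unique (h : CovGraph cov x ξ N) (h' : CovGraph cov x η N') (he : ∀ᶠ y in 𝓝 x, ξ y = η y) :
    N = N' := by
  refine LinearMap.ext fun X => ?_
  have := (add _ _ _ _ h (h'.smul (-1))).eq_zero ?_ X
  · simpa [← sub_eq_add_neg, sub_eq_zero] using this
  · filter_upwards [he] with y hy
    simp [hy]

end CovGraph

variable [FiniteDimensional ℝ EB] [T2Space M]

/-- The extension to `Γ(S(A*))` of the duals of the connections `cov`. -/
noncomputable def nabla (cov : ∀ i, CovariantDerivative I (A i).F (A i).E) (ξ : Fun A) (x : M) :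
    TangentSpace I x →ₗ[ℝ] SymFib A x := (CovGraph.exists_of_mem cov x ξ.2).choose

section

variable (cov : ∀ i, CovariantDerivative I (A i).F (A i).E)

lemma covGraph_nabla (ξ : Fun A) (x : M) : CovGraph cov x ξ.1 (nabla cov ξ x) :=
  (CovGraph.exists_of_mem cov x ξ.2).choose_spec

lemma nabla_eq {ξ : Fun A} {x : M} {N : TangentSpace I x →ₗ[ℝ] SymFib A x}
    (h : CovGraph cov x ξ.1 N) : nabla cov ξ x = N :=
  (covGraph_nabla cov ξ x).unique h (Filter.Eventually.of_forall fun _ => rfl)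

lemma nabla_congr {ξ η : Fun A} {x : M} (h : ∀ᶠ y in 𝓝 x, ξ.1 y = η.1 y) :
    nabla cov ξ x = nabla cov η x :=
  (covGraph_nabla cov ξ x).unique (covGraph_nabla cov η x) h

lemma nabla_ofFun (f : M → ℝ) (hf : ContMDiff I 𝓘(ℝ, ℝ) ∞ f) (x : M) :
    nabla cov (ofFun A f hf) x =
      Algebra.linearMap ℝ (SymFib A x) ∘ₗ (mvfderiv I f x).toLinearMap :=
  nabla_eq cov (.base f hf)

lemma nabla_ofForm {i : Fin n} {α : ∀ x, Module.Dual ℝ ((A i).E x)} (hα : (A i).IsForm α) {x : M}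
    {N : TangentSpace I x →ₗ[ℝ] Module.Dual ℝ ((A i).E x)} (hN : IsDualDerivative (cov i) α x N) :
    nabla cov (ofForm A i α hα) x = GSym.ι i ∘ₗ N :=
  nabla_eq cov (.form i α hα N hN)

lemma nabla_add (ξ η : Fun A) (x : M) : nabla cov (ξ + η) x = nabla cov ξ x + nabla cov η x :=
  nabla_eq cov (.add _ _ _ _ (covGraph_nabla cov ξ x) (covGraph_nabla cov η x))

lemma nabla_smul (t : ℝ) (ξ : Fun A) (x : M) : nabla cov (t • ξ) x = t • nabla cov ξ x :=
  nabla_eq cov ((covGraph_nabla cov ξ x).smul t)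

lemma nabla_mul (ξ η : Fun A) (x : M) (X : TangentSpace I x) :
    nabla cov (ξ * η) x X = nabla cov ξ x X * η.1 x + ξ.1 x * nabla cov η x X := by
  rw [nabla_eq cov (.mul _ _ _ _ (covGraph_nabla cov ξ x) (covGraph_nabla cov η x))]
  rfl

lemma nabla_scaleFun (c : Fin n → ℝ) (ξ : Fun A) (x : M) (X : TangentSpace I x) :
    nabla cov (scaleFun A c ξ) x X = GSym.scale c (nabla cov ξ x X) := by
  rw [nabla_eq cov ((covGraph_nabla cov ξ x).scale c)]
  rfl

lemma nabla_mem_piece {k : ℤ} {ξ : Fun A} (hξ : HomFun k ξ) (x : M) (X : TangentSpace I x) :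
    nabla cov ξ x X ∈ GSym.piece (fun i => Module.Dual ℝ ((A i).E x)) k := by
  rcases lt_or_ge k 0 with hk | hk
  · have : ξ = 0 := by
      refine Fun.ext fun x => ?_
      have := hξ x
      rwa [GSym.piece_eq_bot hk, Submodule.mem_bot] at this
    rw [this, nabla_eq cov .zero]
    exact zero_mem _
  -- The covariant derivative commutes with rescalings, whose eigenspaces are the degrees.
  · lift k to ℕ using hk
    refine GSym.mem_piece_of_scale ?_
    rw [← nabla_scaleFun, ← LinearMap.smul_apply, ← nabla_smul]
    congr 2
    exact Fun.ext fun x => GSym.scale_of_mem_piece k (hξ x)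

variable {cov}

/-- Covariant derivatives of smooth sections of `S(A*)` are smooth. -/
lemma nabla_mem_Fun (hcov : ∀ i, (cov i).ContMDiffCovariantDerivative ∞) (ξ : Fun A)
    {X : ∀ x : M, TangentSpace I x}
    (hX : ContMDiff I I.tangent ∞ (fun x => (⟨x, X x⟩ : TangentBundle I M))) :
    (fun x => nabla cov ξ x (X x)) ∈ Fun A := by
  refine mem_Fun_of_eventuallyEq fun x₀ => ?_
  obtain ⟨p, hp, h⟩ := ξ.2 x₀
  suffices ∃ hp : p ∈ Fun A, (fun x => nabla cov ⟨p, hp⟩ x (X x)) ∈ Fun A by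
    obtain ⟨hp, hp'⟩ := this
    refine ⟨_, hp', ?_⟩
    filter_upwards [h.eventually_nhds] with x hx
    rw [nabla_congr cov (η := ⟨p, hp⟩) hx]
  clear h
  induction hp using polyFun_induction with
  | hf f hf =>
    refine ⟨(ofFun A f hf).2, ?_⟩
    have : (fun x => nabla cov ⟨baseFun A f, (ofFun A f hf).2⟩ x (X x)) =
        baseFun A (fun x => mvfderiv I f x (X x)) := by
      ext x
      exact congrArg (fun L => L (X x)) (nabla_ofFun cov f hf x)
    rw [this]
    exact baseFun_mem_Fun (contMDiff_mvfderiv hf hX)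
  | hα i α hα =>
    refine ⟨(ofForm A i α hα).2, ?_⟩
    choose N hN using exists_isDualDerivative (cov i) hα
    have h1 : (fun x => nabla cov ⟨formFun A i α, (ofForm A i α hα).2⟩ x (X x)) =
        formFun A i (fun x => N x (X x)) := by
      ext x
      exact congrArg (fun L => L (X x)) (nabla_ofForm cov hα (hN x))
    rw [h1]
    refine formFun_mem_Fun (VB.isForm_of_apply fun s hs => ?_)
    simp only [hN _ s hs]
    refine (contMDiff_mvfderiv (hα.apply hs) hX).sub (hα.apply ?_)
    have h2 := (hcov i).contMDiff.contMDiff (σ := s) (by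
      have : (∞ : WithTop ℕ∞) + 1 = ∞ := rfl
      rw [this]
      exact ContMDiff.contMDiffOn hs)
    exact (contMDiffOn_univ.1 h2).clm_bundle_apply hX
  | hadd ξ η _ _ h1 h2 =>
    obtain ⟨h1, h1'⟩ := h1
    obtain ⟨h2, h2'⟩ := h2
    refine ⟨add_mem h1 h2, ?_⟩
    have := add_mem h1' h2'
    convert this using 1
    ext x
    exact congrArg (fun L => L (X x)) (nabla_add cov ⟨ξ, h1⟩ ⟨η, h2⟩ x)
  | hmul ξ η _ _ h1 h2 =>
    obtain ⟨h1, h1'⟩ := h1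
    obtain ⟨h2, h2'⟩ := h2
    refine ⟨mul_mem h1 h2, ?_⟩
    have := add_mem (mul_mem h1' h2) (mul_mem h1 h2')
    convert this using 1
    ext x
    exact nabla_mul cov ⟨ξ, h1⟩ ⟨η, h2⟩ x (X x)

end

end Connections

/-! ### Local frames of the graded bundles -/

section Good

variable {EB : Type v} [NormedAddCommGroup EB] [NormedSpace ℝ EB] {HB : Type w}
  [TopologicalSpace HB] {I : ModelWithCorners ℝ EB HB}
  {M : Type u} [TopologicalSpace M] [ChartedSpace HB M] {n : ℕ}

/-- The zero section of the family is smooth, and there are local frames. -/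
structure SmoothFamily.IsGood (I : ModelWithCorners ℝ EB HB) (W : SmoothFamily M) : Prop where
  zero : W.IsSmooth (fun _ => 0)
  frame : ∀ x₀, ∃ (r : ℕ) (e : Fin r → ∀ x, W.W x) (φ : Fin r → ∀ x, Module.Dual ℝ (W.W x)),
    (∀ b, W.IsSmooth (e b)) ∧
    (∀ b e', W.IsSmooth e' → ContMDiff I 𝓘(ℝ, ℝ) ∞ (fun x => φ b x (e' x))) ∧
    ∀ᶠ x in 𝓝 x₀, ∀ w, w = ∑ b, φ b x w • e b x

/-- Resolutions of the identity of the parts give one of the sum. -/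
lemma Graded.eq_sum_of_parts {W : Graded n M} {x : M} {ι : Type*} [Fintype ι] {κ : Fin n → Type*}
    [∀ i, Fintype (κ i)] {e : ι → W.zero.W x} {φ : ι → Module.Dual ℝ (W.zero.W x)}
    {e' : ∀ i, κ i → (W.pos i).W x} {φ' : ∀ i, κ i → Module.Dual ℝ ((W.pos i).W x)}
    (h : ∀ w, w = ∑ b, φ b w • e b) (h' : ∀ i w, w = ∑ b, φ' i b w • e' i b) (w : W.Fib x) :
    w = ∑ b : ι ⊕ (Σ i, κ i), (Sum.elim (fun b => φ b ∘ₗ LinearMap.fst ℝ _ _)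
        (fun b => φ' b.1 b.2 ∘ₗ LinearMap.proj b.1 ∘ₗ LinearMap.snd ℝ _ _) b :
          Module.Dual ℝ (W.Fib x)) w •
      (Sum.elim (fun b => (e b, 0)) (fun b => (0, Pi.single b.1 (e' b.1 b.2))) b : W.Fib x) := by
  rw [Fintype.sum_sum_type, Fintype.sum_sigma]
  ext j
  · simp only [Sum.elim_inl, Sum.elim_inr, Prod.fst_add, Prod.fst_sum, Prod.smul_fst, smul_zero,
      Finset.sum_const_zero, add_zero]
    exact h w.1
  · simp only [Sum.elim_inl, Sum.elim_inr, Prod.snd_add, Prod.snd_sum, Prod.smul_snd, smul_zero,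
      Finset.sum_const_zero, zero_add, Finset.sum_apply, Pi.smul_apply]
    rw [Finset.sum_eq_single j]
    · simp only [Pi.single_eq_same]
      exact h' j (w.2 j)
    · intro i _ hi
      simp [Pi.single_eq_of_ne hi.symm]
    · simp

theorem Graded.isGood_of {W : Graded n M} (h0 : W.zero.IsGood I) (h : ∀ i, (W.pos i).IsGood I) :
    W.IsGood I where
  zero := ⟨h0.zero, fun i => (h i).zero⟩
  frame x₀ := by
    obtain ⟨r, e, φ, he, hφ, hr⟩ := h0.frame x₀
    choose r' e' φ' he' hφ' hr' using fun i => (h i).frame x₀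
    refine ⟨{
      ι := Fin r ⊕ (Σ i, Fin (r' i))
      part := Sum.elim (fun _ => none) (fun b => some b.1)
      e := Sum.elim (fun b x => (e b x, 0)) (fun b x => (0, Pi.single b.1 (e' b.1 b.2 x)))
      φ := Sum.elim (fun b x => φ b x ∘ₗ LinearMap.fst ℝ _ _)
        (fun b x => φ' b.1 b.2 x ∘ₗ LinearMap.proj b.1 ∘ₗ LinearMap.snd ℝ _ _)
      smooth_e := ?_, smooth_φ := ?_, res := ?_, hom_e := ?_, hom_φ := ?_ }⟩
    · rintro (b | ⟨i, b⟩)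
      · exact ⟨he b, fun i => (h i).zero⟩
      · refine ⟨h0.zero, fun j => ?_⟩
        by_cases hj : j = i
        · subst hj
          simpa using he' j b
        · simpa [Pi.single_eq_of_ne hj] using (h j).zero
    · rintro (b | ⟨i, b⟩) e₁ he₁
      · exact hφ b _ he₁.1
      · exact hφ' i b _ (he₁.2 i)
    · filter_upwards [hr, Filter.eventually_all.2 hr'] with x hx hx' w
      refine (Graded.eq_sum_of_parts hx hx' w).trans (Finset.sum_congr rfl fun b _ => ?_)
      rcases b with b | b <;> rfl
    · rintro (b | ⟨i, b⟩) x
      · exact ⟨e b x, rfl⟩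
      · exact ⟨e' i b x, rfl⟩
    · rintro (b | ⟨i, b⟩) x q hq w hw
      · cases q with
        | none => exact (hq rfl).elim
        | some j =>
          obtain ⟨w, rfl⟩ := hw
          simp
      · cases q with
        | none =>
          obtain ⟨w, rfl⟩ := hw
          simp
        | some j =>
          obtain ⟨w, rfl⟩ := hw
          have hj : i ≠ j := fun h => hq (congrArg some h.symm)
          simp [Pi.single_eq_of_ne hj]

variable [FiniteDimensional ℝ EB] [T2Space M] [IsManifold I ∞ M]

lemma VB.isGood_sec (V : VB I M) : V.sec.IsGood I where
  zero := VB.IsSec.zero V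
  frame x₀ := by
    obtain ⟨r, s, σ, hs, hσ, h⟩ := V.exists_dualBasis x₀
    exact ⟨r, s, σ, hs, fun b e he => (hσ b).apply he, h⟩

lemma VB.isGood_dual (V : VB I M) : V.dual.IsGood I where
  zero := VB.IsForm.zero V
  frame x₀ := by
    obtain ⟨r, s, σ, hs, hσ, h⟩ := V.exists_dualBasis x₀
    refine ⟨r, σ, fun b x => Module.Dual.eval ℝ _ (s b x), hσ, fun b e he => VB.IsForm.apply he (hs b),
      h.mono fun x hx α => ?_⟩
    ext v
    conv_lhs => rw [hx v]
    simp [mul_comm]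

lemma isGood_graded (V : VB I M) (C : Fin n → VB I M) : (graded V C).IsGood I :=
  Graded.isGood_of V.isGood_sec fun i => (C i).isGood_sec

lemma isGood_gradedDual (V : VB I M) (C : Fin n → VB I M) : (gradedDual V C).IsGood I :=
  Graded.isGood_of V.isGood_dual fun i => (C i).isGood_dual

lemma isGood_adjointBundle {d : ℕ} {M : Type u} [TopologicalSpace M]
    [ChartedSpace (EuclideanSpace ℝ (Fin d)) M] [IsManifold (𝓡 d) ∞ M] [T2Space M]
    (A : Fin n → VB (𝓡 d) M) : (adjointBundle A).IsGood (𝓡 d) := by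
  refine Graded.isGood_of ⟨?_, ?_⟩ fun i => (A i).isGood_sec
  · exact contMDiff_zeroSection ℝ (TangentSpace (𝓡 d) : M → Type _)
  · intro x₀
    obtain ⟨F⟩ := nonempty_coord (d := d) x₀
    exact ⟨d, F.E, fun i x => (mvfderiv (𝓡 d) (F.y i) x).toLinearMap, F.smooth_E,
      fun i X hX => contMDiff_mvfderiv (F.smooth_y i) hX, F.res⟩

end Good

/-! ### Shears -/

section Shear

variable {EB : Type v} [NormedAddCommGroup EB] [NormedSpace ℝ EB] {HB : Type w}
  [TopologicalSpace HB] {I : ModelWithCorners ℝ EB HB}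
  {M : Type u} [TopologicalSpace M] [ChartedSpace HB M] {n : ℕ} {A : Fin n → VB I M}
  {W : Graded n M} {x : M}

/-- A linear map `A i → W i` as an element of `(A i)* ⊗ W i`. -/
noncomputable def homTensor (A : Fin n → VB I M) (W : Graded n M) (x : M) (i : Fin n) :
    ((A i).E x →ₗ[ℝ] (W.pos i).W x) →ₗ[ℝ] ModFib A W x :=
  TensorProduct.map (GSym.ι i)
    (LinearMap.inr ℝ (W.zero.W x) (∀ i, (W.pos i).W x) ∘ₗ
      LinearMap.single ℝ (fun i => (W.pos i).W x) i) ∘ₗ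
    (dualTensorHomEquiv ℝ ((A i).E x) ((W.pos i).W x)).symm.toLinearMap

lemma homTensor_eq_sum (i : Fin n) {ι : Type*} [Fintype ι] {s : ι → (A i).E x}
    {σ : ι → Module.Dual ℝ ((A i).E x)} (h : ∀ v, v = ∑ b, σ b v • s b)
    (L : (A i).E x →ₗ[ℝ] (W.pos i).W x) : homTensor A W x i L =
      ∑ b, GSym.ι i (σ b) ⊗ₜ[ℝ] ((0, Pi.single i (L (s b))) : W.Fib x) := by
  have h1 : (dualTensorHomEquiv ℝ ((A i).E x) ((W.pos i).W x)).symm L =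
      ∑ b, σ b ⊗ₜ[ℝ] L (s b) := by
    rw [LinearEquiv.symm_apply_eq, map_sum]
    ext v
    conv_lhs => rw [h v]
    simp
  rw [homTensor, LinearMap.comp_apply, LinearEquiv.coe_coe, h1, map_sum]
  rfl

lemma shear_tmul (Δ : ∀ i, W.zero.W x →ₗ[ℝ] (A i).E x →ₗ[ℝ] (W.pos i).W x) (ξ : SymFib A x)
    (e : W.Fib x) :
    shear A W x Δ (ξ ⊗ₜ[ℝ] e) = ξ ⊗ₜ[ℝ] e + ∑ i, ξ • homTensor A W x i (Δ i e.1) := by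
  simp [shear, homTensor]

lemma shear_smul (Δ : ∀ i, W.zero.W x →ₗ[ℝ] (A i).E x →ₗ[ℝ] (W.pos i).W x) (ξ : SymFib A x)
    (z : ModFib A W x) : shear A W x Δ (ξ • z) = ξ • shear A W x Δ z := by
  induction z using TensorProduct.induction_on with
  | zero => simp
  | tmul η e =>
    rw [TensorProduct.smul_tmul', shear_tmul, shear_tmul, smul_add, TensorProduct.smul_tmul',
      Finset.smul_sum]
    simp only [smul_eq_mul, mul_smul]
  | add y z h1 h2 => rw [smul_add, map_add, map_add, h1, h2, smul_add]

lemma shear_homTensor (Δ : ∀ i, W.zero.W x →ₗ[ℝ] (A i).E x →ₗ[ℝ] (W.pos i).W x) (i : Fin n)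
    (L : (A i).E x →ₗ[ℝ] (W.pos i).W x) :
    shear A W x Δ (homTensor A W x i L) = homTensor A W x i L := by
  let b := Module.finBasis ℝ ((A i).E x)
  rw [homTensor_eq_sum (s := b) (σ := b.coord) i (fun v => (b.sum_repr v).symm), map_sum]
  refine Finset.sum_congr rfl fun c _ => ?_
  rw [shear_tmul]
  simp

lemma shear_shear (Δ Δ' : ∀ i, W.zero.W x →ₗ[ℝ] (A i).E x →ₗ[ℝ] (W.pos i).W x)
    (z : ModFib A W x) : shear A W x Δ (shear A W x Δ' z) = shear A W x (fun i => Δ i + Δ' i) z := by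
  induction z using TensorProduct.induction_on with
  | zero => simp
  | tmul ξ e =>
    rw [shear_tmul, shear_tmul, map_add, map_sum, shear_tmul]
    simp only [shear_smul, shear_homTensor, LinearMap.add_apply, map_add, smul_add,
      Finset.sum_add_distrib]
    abel
  | add y z h1 h2 => simp only [map_add, h1, h2]

lemma shear_zero (z : ModFib A W x) : shear A W x (fun _ => 0) z = z := by
  induction z using TensorProduct.induction_on with
  | zero => simp
  | tmul ξ e =>
    rw [shear_tmul]
    simp
  | add y z h1 h2 => rw [map_add, h1, h2]

lemma homTensor_mem_modPiece (hW : W.dir = -1) (i : Fin n)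
    (L : (A i).E x →ₗ[ℝ] (W.pos i).W x) : homTensor A W x i L ∈ modPiece A W x 0 := by
  let b := Module.finBasis ℝ ((A i).E x)
  rw [homTensor_eq_sum (s := b) (σ := b.coord) i (fun v => (b.sum_repr v).symm)]
  refine Submodule.sum_mem _ fun c _ => ?_
  have := tmul_mem_modPiece (A := A) (W := W) (q := some i)
    (e := (0, Pi.single i (L (b c)))) (GSym.ι_mem_piece i (b.coord c)) ⟨L (b c), rfl⟩
  have h0 : ((i.val : ℤ) + 1) + W.degree (some i) = 0 := by
    rw [Graded.degree, hW]
    ring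
  rwa [h0] at this

lemma shear_mem_modPiece (hW : W.dir = -1)
    (Δ : ∀ i, W.zero.W x →ₗ[ℝ] (A i).E x →ₗ[ℝ] (W.pos i).W x) {p : ℤ} {z : ModFib A W x}
    (hz : z ∈ modPiece A W x p) : shear A W x Δ z ∈ modPiece A W x p := by
  refine modPiece_induction (P := fun z => shear A W x Δ z ∈ modPiece A W x p) ?_ ?_ ?_ ?_ hz
  · intro k q ξ e hk hξ he
    rw [shear_tmul]
    refine add_mem (hk ▸ tmul_mem_modPiece hξ he) (Submodule.sum_mem _ fun i _ => ?_)
    cases q with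
    | none =>
      have := smul_mem_modPiece hξ (homTensor_mem_modPiece hW i (Δ i e.1))
      rwa [← hk]
    | some j =>
      obtain ⟨w, rfl⟩ := he
      simp
  · simp
  · intro y z h1 h2
    rw [map_add]; exact add_mem h1 h2
  · intro t z h
    rw [map_smul]; exact Submodule.smul_mem _ _ h

/-- `Δ` maps smooth sections to smooth sections. -/
def SmoothShear (A : Fin n → VB I M) (W : Graded n M)
    (Δ : ∀ i x, W.zero.W x →ₗ[ℝ] (A i).E x →ₗ[ℝ] (W.pos i).W x) : Prop :=
  ∀ i e a, W.zero.IsSmooth e → (A i).IsSec a → (W.pos i).IsSmooth (fun x => Δ i x (e x) (a x))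

variable [FiniteDimensional ℝ EB] [T2Space M] [IsManifold I ∞ M]

lemma shear_mem_SecMod (hW : W.IsGood I)
    {Δ : ∀ i x, W.zero.W x →ₗ[ℝ] (A i).E x →ₗ[ℝ] (W.pos i).W x} (hΔ : SmoothShear A W Δ)
    (s : SecMod A W) : (fun x => shear A W x (fun i => Δ i x) (s.1 x)) ∈ SecMod A W := by
  refine mem_SecMod_of_eventuallyEq fun x₀ => ?_
  obtain ⟨t, ht, h⟩ := s.2 x₀
  refine ⟨fun x => shear A W x (fun i => Δ i x) (t x), ?_, h.mono fun x hx => by rw [hx]⟩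
  clear h
  induction ht using Submodule.span_induction with
  | mem t ht =>
    obtain ⟨e, he, rfl⟩ := ht
    refine mem_SecMod_of_eventuallyEq fun x₀ => ?_
    choose r s σ hs hσ hres using fun i => (A i).exists_dualBasis x₀
    have hg : ∀ i b, W.IsSmooth (fun x => ((0, Pi.single i (Δ i x (e x).1 (s i b x))) : W.Fib x)) := by
      intro i b
      refine ⟨hW.zero.1, fun j => ?_⟩
      by_cases hj : j = i
      · subst hj
        simpa using hΔ j _ _ he.1 (hs j b)
      · simpa [Pi.single_eq_of_ne hj] using hW.zero.2 j
    refine ⟨_, (gen A W e he + ∑ i, ∑ b, ofForm A i (σ i b) (hσ i b) • gen A W _ (hg i b)).2, ?_⟩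
    filter_upwards [Filter.eventually_all.2 hres] with x hx
    rw [SecMod.add_apply, SecMod.sum_apply, genFun, shear_tmul, gen_apply]
    congr 1
    refine Finset.sum_congr rfl fun i _ => ?_
    rw [SecMod.sum_apply, one_smul, homTensor_eq_sum i (hx i)]
    refine Finset.sum_congr rfl fun b _ => ?_
    rw [SecMod.smul_apply, gen_apply, TensorProduct.smul_tmul', smul_eq_mul, mul_one]
    rfl
  | zero =>
    simp only [Pi.zero_apply, map_zero]
    exact zero_mem (SecMod A W)
  | add y z _ _ h1 h2 =>
    simp only [Pi.add_apply, map_add]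
    exact add_mem h1 h2
  | smul ξ t _ h =>
    have h1 := Submodule.smul_mem _ ξ h
    convert h1 using 1
    ext x
    exact shear_smul _ (ξ.1 x) (t x)

/-- The shear by a smooth `Δ` as an automorphism of `Γ(S(A*)) ⊗ Γ(W)`. -/
noncomputable def shearEquiv (hW : W.IsGood I)
    (Δ : ∀ i x, W.zero.W x →ₗ[ℝ] (A i).E x →ₗ[ℝ] (W.pos i).W x) (hΔ : SmoothShear A W Δ)
    (hΔ' : SmoothShear A W fun i x => -Δ i x) : SecMod A W ≃ₗ[Fun A] SecMod A W where
  toFun s := ⟨_, shear_mem_SecMod hW hΔ s⟩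
  map_add' s t := SecMod.ext fun x => map_add _ _ _
  map_smul' ξ s := SecMod.ext fun x => shear_smul _ (ξ.1 x) (s.1 x)
  invFun s := ⟨_, shear_mem_SecMod hW hΔ' s⟩
  left_inv s := SecMod.ext fun x => by
    change shear A W x _ (shear A W x _ _) = _
    rw [shear_shear]
    simpa using shear_zero (s.1 x)
  right_inv s := SecMod.ext fun x => by
    change shear A W x _ (shear A W x _ _) = _
    rw [shear_shear]
    simpa using shear_zero (s.1 x)

/-- A shear that intertwines two differentials is an isomorphism of representations. -/
noncomputable def shearIso {Q : LieStr A} {R R' : Rep Q W} (hW : W.IsGood I) (hdir : W.dir = -1)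
    (Δ : ∀ i x, W.zero.W x →ₗ[ℝ] (A i).E x →ₗ[ℝ] (W.pos i).W x) (hΔ : SmoothShear A W Δ)
    (hΔ' : SmoothShear A W fun i x => -Δ i x)
    (h : ∀ s, shearEquiv hW Δ hΔ hΔ' (R.D s) = R'.D (shearEquiv hW Δ hΔ hΔ' s)) : RepIso R R' where
  μ := shearEquiv hW Δ hΔ hΔ'
  deg p s := by
    refine ⟨fun hs x => shear_mem_modPiece hdir _ (hs x), fun hs x => ?_⟩
    have h1 := shear_mem_modPiece hdir (fun i => -Δ i x) (hs x)
    have h2 : ((shearEquiv hW Δ hΔ hΔ').symm (shearEquiv hW Δ hΔ hΔ' s)).1 x ∈ modPiece A W x p := h1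
    rwa [LinearEquiv.symm_apply_apply] at h2
  comm := h

lemma shearIso_apply {Q : LieStr A} {R R' : Rep Q W} (hW : W.IsGood I) (hdir : W.dir = -1)
    (Δ : ∀ i x, W.zero.W x →ₗ[ℝ] (A i).E x →ₗ[ℝ] (W.pos i).W x) (hΔ : SmoothShear A W Δ)
    (hΔ' : SmoothShear A W fun i x => -Δ i x)
    (h : ∀ s, shearEquiv hW Δ hΔ hΔ' (R.D s) = R'.D (shearEquiv hW Δ hΔ hΔ' s))
    (s : SecMod A W) (x : M) :
    ((shearIso hW hdir Δ hΔ hΔ' h).μ s).1 x = shear A W x (fun i => Δ i x) (s.1 x) := rfl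

lemma shearIso_symm_apply {Q : LieStr A} {R R' : Rep Q W} (hW : W.IsGood I) (hdir : W.dir = -1)
    (Δ : ∀ i x, W.zero.W x →ₗ[ℝ] (A i).E x →ₗ[ℝ] (W.pos i).W x) (hΔ : SmoothShear A W Δ)
    (hΔ' : SmoothShear A W fun i x => -Δ i x)
    (h : ∀ s, shearEquiv hW Δ hΔ hΔ' (R.D s) = R'.D (shearEquiv hW Δ hΔ hΔ' s))
    (s : SecMod A W) (x : M) :
    ((shearIso hW hdir Δ hΔ hΔ' h).μ.symm s).1 x = shear A W x (fun i => -Δ i x) (s.1 x) := rfl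

end Shear

/-! ### Vector fields on a split graded manifold -/

section VectorFields

variable {EB : Type v} [NormedAddCommGroup EB] [NormedSpace ℝ EB] {HB : Type w}
  [TopologicalSpace HB] {I : ModelWithCorners ℝ EB HB}
  {M : Type u} [TopologicalSpace M] [ChartedSpace HB M] {n : ℕ} {A : Fin n → VB I M}

/-- The commutator of a homological vector field with a derivation is a derivation. -/
lemma IsDer.commutator (Q : LieStr A) {p : ℤ} {Y : Fun A →ₗ[ℝ] Fun A} (hY : IsDer p Y) :
    IsDer (p + 1) (Q.Q ∘ₗ Y - sgn p • (Y ∘ₗ Q.Q)) where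
  deg k ξ hξ := by
    have h1 := Q.isDer.deg _ _ (hY.deg _ _ hξ)
    have h2 := (hY.deg _ _ (Q.isDer.deg _ _ hξ)).smul (-sgn p)
    rw [show k + p + 1 = k + (p + 1) by ring] at h1
    rw [show k + 1 + p = k + (p + 1) by ring] at h2
    have := h1.add h2
    convert this using 1
    simp [sub_eq_add_neg]
  leibniz k ξ η hξ := by
    have h1 := hY.leibniz k ξ η hξ
    have h2 := Q.isDer.leibniz k ξ η hξ
    have h3 := Q.isDer.leibniz _ (Y ξ) η (hY.deg _ _ hξ)
    have h4 := Q.isDer.leibniz k ξ (Y η) hξ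
    have h5 := hY.leibniz _ (Q.Q ξ) η (Q.isDer.deg _ _ hξ)
    have h6 := hY.leibniz k ξ (Q.Q η) hξ
    simp only [LinearMap.sub_apply, LinearMap.smul_apply, LinearMap.comp_apply]
    rw [h1, h2, map_add, map_add, map_smul, map_smul, h3, h4, h5, h6]
    have e1 : sgn (1 * (k + p)) = sgn k * sgn p := by rw [one_mul, sgn_add]
    have e2 : sgn (p * (k + 1)) = sgn (p * k) * sgn p := by rw [mul_add, sgn_add, mul_one]
    have e3 : sgn ((p + 1) * k) = sgn (p * k) * sgn k := by rw [add_mul, sgn_add, one_mul]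
    have e4 := sgn_mul_self p
    rw [e1, e2, e3, one_mul]
    simp only [smul_add, smul_sub, smul_smul, mul_sub, sub_mul, smul_mul_assoc, mul_smul_comm]
    rw [show sgn p * (sgn (p * k) * sgn p) = sgn (p * k) by rw [mul_left_comm, e4, mul_one],
      show sgn p * sgn k = sgn k * sgn p from mul_comm _ _,
      show sgn (p * k) * sgn k * sgn p = sgn p * (sgn k * sgn (p * k)) by ring]
    abel

variable [IsManifold I ∞ M] [FiniteDimensional ℝ EB] [T2Space M]

/-- The value at `x` of the vector field with value `(X, a)` on the function `ξ`. -/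
noncomputable def vecAt (cov : ∀ i, CovariantDerivative I (A i).F (A i).E) (ξ : Fun A) (x : M) :
    (adjointBundle A).Fib x →ₗ[ℝ] SymFib A x :=
  nabla cov ξ x ∘ₗ LinearMap.fst ℝ (TangentSpace I x) (∀ i, (A i).E x) +
    ∑ i, (GSym.contractL (W := fun i => Module.Dual ℝ ((A i).E x)) i ∘ₗ
      Module.Dual.eval ℝ _ ∘ₗ LinearMap.proj i ∘ₗ
        LinearMap.snd ℝ (TangentSpace I x) (∀ i, (A i).E x)).flip (ξ.1 x)

variable {cov cov' : ∀ i, CovariantDerivative I (A i).F (A i).E}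

lemma vecAt_apply (ξ : Fun A) (x : M) (e : (adjointBundle A).Fib x) :
    vecAt cov ξ x e = nabla cov ξ x e.1 +
      ∑ i, GSym.contract i (Module.Dual.eval ℝ ((A i).E x) (e.2 i)) (ξ.1 x) := by
  simp [vecAt]

lemma vecAt_inl (ξ : Fun A) (x : M) (X : TangentSpace I x) :
    vecAt cov ξ x (LinearMap.inl ℝ (TangentSpace I x) (∀ i, (A i).E x) X) = nabla cov ξ x X := by
  rw [vecAt_apply]
  simp [← GSym.contractL_apply]

lemma vecAt_single (ξ : Fun A) (x : M) (i : Fin n) (a : (A i).E x) :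
    vecAt cov ξ x (LinearMap.inr ℝ (TangentSpace I x) (∀ i, (A i).E x) (Pi.single i a)) =
      GSym.contract i (Module.Dual.eval ℝ ((A i).E x) a) (ξ.1 x) := by
  rw [vecAt_apply, Finset.sum_eq_single i]
  · simp
  · intro j _ hj
    simp [← GSym.contractL_apply, Pi.single_eq_of_ne hj]
  · simp

lemma vecAt_add (ξ η : Fun A) (x : M) : vecAt cov (ξ + η) x = vecAt cov ξ x + vecAt cov η x := by
  refine LinearMap.ext fun e => ?_
  have : (ξ + η).1 x = ξ.1 x + η.1 x := rfl
  simp only [vecAt_apply, LinearMap.add_apply, nabla_add, this, map_add, Finset.sum_add_distrib]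
  abel

lemma vecAt_smul (t : ℝ) (ξ : Fun A) (x : M) : vecAt cov (t • ξ) x = t • vecAt cov ξ x := by
  refine LinearMap.ext fun e => ?_
  have : (t • ξ).1 x = t • ξ.1 x := rfl
  simp only [vecAt_apply, LinearMap.smul_apply, nabla_smul, this, map_smul, smul_add,
    Finset.smul_sum]

lemma vecAt_mem_piece {q : Option (Fin n)} {x : M} {e : (adjointBundle A).Fib x}
    (he : e ∈ (adjointBundle A).part x q) {k : ℤ} {ξ : Fun A} (hξ : HomFun k ξ) :
    vecAt cov ξ x e ∈ GSym.piece (fun i => Module.Dual ℝ ((A i).E x))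
      (k + (adjointBundle A).degree q) := by
  cases q with
  | none =>
    obtain ⟨X, rfl⟩ := he
    rw [vecAt_inl, Graded.degree, add_zero]
    exact nabla_mem_piece cov hξ x X
  | some i =>
    obtain ⟨a, rfl⟩ := he
    have := GSym.contract_mem_piece i (Module.Dual.eval ℝ ((A i).E x) a) (hξ x)
    rw [LinearMap.comp_apply, LinearMap.single_apply, vecAt_single, Graded.degree]
    convert this using 2
    ring

lemma vecAt_mul {q : Option (Fin n)} {x : M} {e : (adjointBundle A).Fib x}
    (he : e ∈ (adjointBundle A).part x q) {k : ℤ} {ξ η : Fun A} (hξ : HomFun k ξ) :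
    vecAt cov (ξ * η) x e = vecAt cov ξ x e * η.1 x +
      sgn ((adjointBundle A).degree q * k) • (ξ.1 x * vecAt cov η x e) := by
  cases q with
  | none =>
    obtain ⟨X, rfl⟩ := he
    rw [vecAt_inl, vecAt_inl, vecAt_inl, nabla_mul, Graded.degree, zero_mul, sgn_zero, one_smul]
  | some i =>
    obtain ⟨a, rfl⟩ := he
    rw [LinearMap.comp_apply, LinearMap.single_apply, vecAt_single, vecAt_single, vecAt_single]
    change GSym.contract i _ (ξ.1 x * η.1 x) = _
    rw [GSym.contract_mul, GSym.parity_pow_of_mem_piece _ (hξ x), smul_mul_assoc, Graded.degree,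
      sgn_mul_natAbs]
    congr 3
    change i.val + 1 = (-1 * ((i.val : ℤ) + 1)).natAbs
    omega

lemma vecAt_ofFun (f : M → ℝ) (hf : ContMDiff I 𝓘(ℝ, ℝ) ∞ f) (x : M) :
    vecAt cov (ofFun A f hf) x = Algebra.linearMap ℝ (SymFib A x) ∘ₗ
      (mvfderiv I f x).toLinearMap ∘ₗ LinearMap.fst ℝ (TangentSpace I x) (∀ i, (A i).E x) := by
  refine LinearMap.ext fun e => ?_
  rw [vecAt_apply, nabla_ofFun]
  change _ + ∑ i, GSym.contract i _ (algebraMap ℝ _ (f x)) = _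
  simp

lemma vecAt_ofForm {i : Fin n} {ε : ∀ x, Module.Dual ℝ ((A i).E x)} (hε : (A i).IsForm ε) {x : M}
    {N : TangentSpace I x →ₗ[ℝ] Module.Dual ℝ ((A i).E x)} (hN : IsDualDerivative (cov i) ε x N) :
    vecAt cov (ofForm A i ε hε) x =
      GSym.ι i ∘ₗ N ∘ₗ LinearMap.fst ℝ (TangentSpace I x) (∀ i, (A i).E x) +
        Algebra.linearMap ℝ (SymFib A x) ∘ₗ ε x ∘ₗ LinearMap.proj i ∘ₗ
          LinearMap.snd ℝ (TangentSpace I x) (∀ i, (A i).E x) := by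
  refine LinearMap.ext fun e => ?_
  have h : ∑ j, GSym.contract j (Module.Dual.eval ℝ ((A j).E x) (e.2 j))
      ((ofForm A i ε hε).1 x) = algebraMap ℝ (SymFib A x) (ε x (e.2 i)) := by
    rw [Finset.sum_eq_single i]
    · exact GSym.contract_ι_self i _ _
    · exact fun j _ hj => GSym.contract_ι_of_ne hj.symm _ _
    · exact fun h => (h (Finset.mem_univ i)).elim
  rw [vecAt_apply, nabla_ofForm cov hε hN, h]
  rfl

/-- The value at `x` of the vector field with value `z` on the function `ξ`. -/
noncomputable def vecPt (cov : ∀ i, CovariantDerivative I (A i).F (A i).E) (ξ : Fun A) (x : M) :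
    ModFib A (adjointBundle A) x →ₗ[ℝ] SymFib A x :=
  extendMul (AlgHom.id ℝ _) (vecAt cov ξ x)

lemma vecPt_tmul (ξ : Fun A) (x : M) (ζ : SymFib A x) (e : (adjointBundle A).Fib x) :
    vecPt cov ξ x (ζ ⊗ₜ[ℝ] e) = ζ * vecAt cov ξ x e := extendMul_tmul _ _ _ _

lemma vecPt_smul (ξ : Fun A) (x : M) (ζ : SymFib A x) (z : ModFib A (adjointBundle A) x) :
    vecPt cov ξ x (ζ • z) = ζ * vecPt cov ξ x z := extendMul_smul _ _ _ _

lemma vecPt_add (ξ η : Fun A) (x : M) (z : ModFib A (adjointBundle A) x) :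
    vecPt cov (ξ + η) x z = vecPt cov ξ x z + vecPt cov η x z := by
  induction z using TensorProduct.induction_on with
  | zero => simp
  | tmul ζ e => rw [vecPt_tmul, vecPt_tmul, vecPt_tmul, vecAt_add, LinearMap.add_apply, mul_add]
  | add y z h1 h2 =>
    simp only [map_add, h1, h2]
    abel

lemma vecPt_const_smul (t : ℝ) (ξ : Fun A) (x : M) (z : ModFib A (adjointBundle A) x) :
    vecPt cov (t • ξ) x z = t • vecPt cov ξ x z := by
  induction z using TensorProduct.induction_on with
  | zero => simp
  | tmul ζ e => rw [vecPt_tmul, vecPt_tmul, vecAt_smul, LinearMap.smul_apply, mul_smul_comm]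
  | add y z h1 h2 => simp only [map_add, h1, h2, smul_add]

lemma vecPt_mem_Fun (hcov : ∀ i, (cov i).ContMDiffCovariantDerivative ∞)
    (s : SecMod A (adjointBundle A)) (ξ : Fun A) : (fun x => vecPt cov ξ x (s.1 x)) ∈ Fun A := by
  refine mem_Fun_of_secMod (f := fun x => x) continuous_id (fun x => vecPt cov ξ x) ?_ ?_ s
  · intro e he
    simp only [vecPt_tmul, one_mul, vecAt_apply]
    have h1 : (fun x => ∑ i, GSym.contract i (Module.Dual.eval ℝ ((A i).E x) ((e x).2 i)) (ξ.1 x)) ∈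
        Fun A := by
      have := (∑ i, contractFun i _ (he.2 i) ξ).2
      convert this using 1
      ext x
      rw [Fun.sum_apply]
      rfl
    exact add_mem (nabla_mem_Fun hcov ξ he.1) h1
  · intro ζ t ht
    simp only [vecPt_smul]
    exact mul_mem ζ.2 ht

/-- The vector field on the graded manifold that corresponds to a section. -/
noncomputable def vecFun (hcov : ∀ i, (cov i).ContMDiffCovariantDerivative ∞)
    (s : SecMod A (adjointBundle A)) : Fun A →ₗ[ℝ] Fun A where
  toFun ξ := ⟨_, vecPt_mem_Fun hcov s ξ⟩
  map_add' ξ η := Fun.ext fun x => vecPt_add ξ η x _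
  map_smul' t ξ := Fun.ext fun x => vecPt_const_smul t ξ x _

variable (hcov : ∀ i, (cov i).ContMDiffCovariantDerivative ∞)

lemma vecFun_apply (s : SecMod A (adjointBundle A)) (ξ : Fun A) (x : M) :
    (vecFun hcov s ξ).1 x = vecPt cov ξ x (s.1 x) := rfl

lemma vecFun_add (s t : SecMod A (adjointBundle A)) (ξ : Fun A) :
    vecFun hcov (s + t) ξ = vecFun hcov s ξ + vecFun hcov t ξ :=
  Fun.ext fun _ => map_add _ _ _

lemma vecFun_smul (ζ : Fun A) (s : SecMod A (adjointBundle A)) (ξ : Fun A) :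
    vecFun hcov (ζ • s) ξ = ζ * vecFun hcov s ξ :=
  Fun.ext fun _ => vecPt_smul _ _ _ _

lemma vecFun_sum {ι : Type*} (k : Finset ι) (s : ι → SecMod A (adjointBundle A)) (ξ : Fun A) :
    vecFun hcov (∑ b ∈ k, s b) ξ = ∑ b ∈ k, vecFun hcov (s b) ξ := by
  refine Fun.ext fun x => ?_
  rw [vecFun_apply, SecMod.sum_apply, map_sum, Fun.sum_apply]
  rfl

lemma isDer_vecFun {p : ℤ} {s : SecMod A (adjointBundle A)} (hs : HomSec p s) :
    IsDer p (vecFun hcov s) where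
  deg k ξ hξ x := by
    rw [vecFun_apply]
    refine modPiece_induction (P := fun z => vecPt cov ξ x z ∈
      GSym.piece (fun i => Module.Dual ℝ ((A i).E x)) (k + p)) ?_ ?_ ?_ ?_ (hs x)
    · intro l q ζ e hl hζ he
      rw [vecPt_tmul]
      have := GSym.mul_mem_piece hζ (vecAt_mem_piece (cov := cov) he hξ)
      rwa [← hl, show k + (l + (adjointBundle A).degree q) = l + (k + (adjointBundle A).degree q) by
        ring]
    · rw [map_zero]; exact zero_mem _
    · intro y z h1 h2
      rw [map_add]; exact add_mem h1 h2
    · intro t z h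
      rw [map_smul]; exact Submodule.smul_mem _ _ h
  leibniz k ξ η hξ := by
    refine Fun.ext fun x => ?_
    change vecPt cov (ξ * η) x (s.1 x) = vecPt cov ξ x (s.1 x) * η.1 x +
      sgn (p * k) • (ξ.1 x * vecPt cov η x (s.1 x))
    refine modPiece_induction (P := fun z => vecPt cov (ξ * η) x z = vecPt cov ξ x z * η.1 x +
      sgn (p * k) • (ξ.1 x * vecPt cov η x z)) ?_ ?_ ?_ ?_ (hs x)
    · intro l q ζ e hl hζ he
      rw [vecPt_tmul, vecPt_tmul, vecPt_tmul, vecAt_mul he hξ, mul_add, ← mul_assoc, mul_smul_comm,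
        ← mul_assoc ζ, GSym.mul_comm_of_mem_piece hζ (hξ x), smul_mul_assoc, smul_smul, ← mul_assoc]
      congr 2
      rw [← hl, add_mul, sgn_add, mul_comm]
    · simp
    · intro y z h1 h2
      rw [map_add, map_add, map_add, h1, h2, add_mul, mul_add, smul_add]
      abel
    · intro t z h
      rw [map_smul, map_smul, map_smul, h, smul_add, smul_mul_assoc, mul_smul_comm,
        smul_comm t (sgn (p * k))]

lemma realises_vecFun (s : SecMod A (adjointBundle A)) : Realises cov s (vecFun hcov s) where
  base f hf x := by
    rw [vecFun_apply, vecPt, vecAt_ofFun]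
  form i ε hε x := by
    obtain ⟨N, hN⟩ := exists_isDualDerivative (cov i) hε x
    refine ⟨N, hN, ?_⟩
    rw [vecFun_apply, vecPt, vecAt_ofForm hε hN]

lemma IsDualDerivative.unique {B : VB I M} {c : CovariantDerivative I B.F B.E}
    {ε : ∀ x, Module.Dual ℝ (B.E x)} {x : M}
    {N N' : TangentSpace I x →ₗ[ℝ] Module.Dual ℝ (B.E x)} (h : IsDualDerivative c ε x N)
    (h' : IsDualDerivative c ε x N') : N = N' := by
  ext X v
  obtain ⟨ext, hext, hv⟩ := B.exists_extend x
  rw [← hv v, h _ (hext v), h' _ (hext v)]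

/-- The vector field realised by a section is the one constructed from it. -/
lemma Realises.eq_vecFun {p : ℤ} {s : SecMod A (adjointBundle A)} (hs : HomSec p s)
    {Y : Fun A →ₗ[ℝ] Fun A} (hY : IsDer p Y) (h : Realises cov s Y) : Y = vecFun hcov s := by
  refine hY.ext (isDer_vecFun hcov hs) (fun f hf => Fun.ext fun x => ?_)
    fun i α hα => Fun.ext fun x => ?_
  · rw [h.base, (realises_vecFun hcov s).base]
  · obtain ⟨N, hN, e⟩ := h.form i α hα x
    obtain ⟨N', hN', e'⟩ := (realises_vecFun hcov s).form i α hα x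
    rw [e, e', hN.unique hN']

end VectorFields

/-! ### The adjoint representation -/

section Adjoint

variable {d : ℕ} {M : Type u} [TopologicalSpace M] [ChartedSpace (EuclideanSpace ℝ (Fin d)) M]
  [IsManifold (𝓡 d) ∞ M] [T2Space M] {n : ℕ} {A : Fin n → VB (𝓡 d) M}
  {cov cov' : ∀ i, CovariantDerivative (𝓡 d) (A i).F (A i).E}

lemma extendMul_comp {x : M} {W : Graded n M}
    (φ : Module.Dual ℝ (W.Fib x)) (c : SymFib A x) (z : ModFib A W x) :
    extendMul (AlgHom.id ℝ (SymFib A x)) (φ.smulRight c) z = ct A W φ z * c := by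
  induction z using TensorProduct.induction_on with
  | zero => simp
  | tmul ξ e =>
    rw [extendMul_tmul, ct_tmul]
    simp
  | add y z h1 h2 => rw [map_add, map_add, h1, h2, add_mul]

end Adjoint

section Adjoint

variable {d : ℕ} {M : Type u} [TopologicalSpace M] [ChartedSpace (EuclideanSpace ℝ (Fin d)) M]
  [IsManifold (𝓡 d) ∞ M] [T2Space M] {n : ℕ} {A : Fin n → VB (𝓡 d) M}
  {cov cov' : ∀ i, CovariantDerivative (𝓡 d) (A i).F (A i).E}

lemma extendMul_add_right {S B X : Type*} [Ring S] [Algebra ℝ S] [Ring B] [Algebra ℝ B]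
    [AddCommGroup X] [Module ℝ X] (φ : S →ₐ[ℝ] B) (L L' : X →ₗ[ℝ] B) (z : S ⊗[ℝ] X) :
    extendMul φ (L + L') z = extendMul φ L z + extendMul φ L' z := by
  induction z using TensorProduct.induction_on with
  | zero => simp
  | tmul ξ e => rw [extendMul_tmul, extendMul_tmul, extendMul_tmul, LinearMap.add_apply, mul_add]
  | add y z h1 h2 =>
    simp only [map_add, h1, h2]
    abel

lemma extendMul_sum_right {S B X : Type*} [Ring S] [Algebra ℝ S] [Ring B] [Algebra ℝ B]
    [AddCommGroup X] [Module ℝ X] (φ : S →ₐ[ℝ] B) {ι : Type*} (k : Finset ι) (L : ι → X →ₗ[ℝ] B)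
    (z : S ⊗[ℝ] X) : extendMul φ (∑ b ∈ k, L b) z = ∑ b ∈ k, extendMul φ (L b) z := by
  classical
  induction k using Finset.induction_on with
  | empty =>
    rw [Finset.sum_empty, Finset.sum_empty]
    induction z using TensorProduct.induction_on with
    | zero => simp
    | tmul ξ e => rw [extendMul_tmul, LinearMap.zero_apply, mul_zero]
    | add y z h1 h2 => rw [map_add, h1, h2, add_zero]
  | insert a k ha ih => rw [Finset.sum_insert ha, Finset.sum_insert ha, extendMul_add_right, ih]

/-- A tangent vector of the graded manifold is determined by its action on functions. -/
lemma vecPt_injective {x : M} {y z : ModFib A (adjointBundle A) x}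
    (h : ∀ ξ : Fun A, vecPt cov ξ x y = vecPt cov ξ x z) : y = z := by
  rw [← sub_eq_zero]
  have hw : ∀ ξ : Fun A, vecPt cov ξ x (y - z) = 0 := fun ξ => by rw [map_sub, h, sub_self]
  generalize y - z = w at hw
  obtain ⟨F⟩ := nonempty_coord (d := d) x
  choose r s σ hs hσ hres using fun i => (A i).exists_dualBasis x
  -- The coordinate functions detect the components in `TM`, and modulo these, the forms of a dual
  -- basis detect the components in the bundles `A i`.
  have h1 : ∀ i, ct A (adjointBundle A) ((mvfderiv (𝓡 d) (F.y i) x).toLinearMap ∘ₗ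
      LinearMap.fst ℝ (TangentSpace (𝓡 d) x) (∀ i, (A i).E x)) w = 0 := by
    intro i
    have := hw (ofFun A (F.y i) (F.smooth_y i))
    rwa [vecPt, vecAt_ofFun] at this
  have h2 : ∀ L : TangentSpace (𝓡 d) x →ₗ[ℝ] SymFib A x, extendMul (AlgHom.id ℝ (SymFib A x))
      (L ∘ₗ LinearMap.fst ℝ (TangentSpace (𝓡 d) x) (∀ i, (A i).E x)) w = 0 := by
    intro L
    have hL : L ∘ₗ LinearMap.fst ℝ (TangentSpace (𝓡 d) x) (∀ i, (A i).E x) =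
        ∑ i, ((mvfderiv (𝓡 d) (F.y i) x).toLinearMap ∘ₗ
          LinearMap.fst ℝ (TangentSpace (𝓡 d) x) (∀ i, (A i).E x)).smulRight (L (F.E i x)) := by
      refine LinearMap.ext fun e => ?_
      rw [LinearMap.comp_apply, LinearMap.fst_apply, F.res.self_of_nhds e.1, map_sum,
        LinearMap.sum_apply]
      refine Finset.sum_congr rfl fun i _ => ?_
      rw [map_smul]
      conv_rhs => rw [LinearMap.smulRight_apply]
      rfl
    rw [hL, extendMul_sum_right]
    refine Finset.sum_eq_zero fun i _ => ?_
    have := extendMul_comp (A := A) (W := adjointBundle A)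
      ((mvfderiv (𝓡 d) (F.y i) x).toLinearMap ∘ₗ
          LinearMap.fst ℝ (TangentSpace (𝓡 d) x) (∀ i, (A i).E x)) (L (F.E i x)) w
    rw [this, h1, zero_mul]
  have h3 : ∀ i b, ct A (adjointBundle A) (σ i b x ∘ₗ LinearMap.proj i ∘ₗ
      LinearMap.snd ℝ (TangentSpace (𝓡 d) x) (∀ i, (A i).E x)) w = 0 := by
    intro i b
    obtain ⟨N, hN⟩ := exists_isDualDerivative (cov i) (hσ i b) x
    have := hw (ofForm A i (σ i b) (hσ i b))
    rw [vecPt, vecAt_ofForm (hσ i b) hN, extendMul_add_right] at this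
    have h4 := h2 (GSym.ι i ∘ₗ N)
    rw [LinearMap.comp_assoc] at h4
    rw [h4, zero_add] at this
    exact this
  rw [eq_sum_ct (Graded.eq_sum_of_parts (W := adjointBundle A)
    (φ := fun i => (mvfderiv (𝓡 d) (F.y i) x).toLinearMap)
    F.res.self_of_nhds fun i => (hres i).self_of_nhds) w]
  refine Finset.sum_eq_zero fun b _ => ?_
  rcases b with b | b
  · rw [Sum.elim_inl, h1, zero_smul]
  · rw [Sum.elim_inr, h3, zero_smul]

/-- A derivation acts on functions as a first order operator, by Hadamard's lemma. -/
lemma IsDer.apply_fun_eq {p : ℤ} {Y : Fun A →ₗ[ℝ] Fun A} (hY : IsDer p Y) {x : M} {f : M → ℝ}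
    (hf : ContMDiff (𝓡 d) 𝓘(ℝ, ℝ) ∞ f) {y g : Fin d → M → ℝ}
    (hy : ∀ i, ContMDiff (𝓡 d) 𝓘(ℝ, ℝ) ∞ (y i)) (hg : ∀ i, ContMDiff (𝓡 d) 𝓘(ℝ, ℝ) ∞ (g i))
    (h : ∀ᶠ x' in 𝓝 x, f x' = f x + ∑ i, (y i x' - y i x) * g i x') :
    (Y (ofFun A f hf)).1 x = ∑ i, g i x • (Y (ofFun A (y i) (hy i))).1 x := by
  have h1 : (Y (ofFun A f hf)).1 x = (Y (algebraMap ℝ _ (f x) + ∑ i, ofFun A (g i) (hg i) *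
      (ofFun A (y i) (hy i) - algebraMap ℝ _ (y i x)))).1 x := by
    refine hY.congr ?_
    filter_upwards [h] with x' hx'
    change algebraMap ℝ (SymFib A x') (f x') = algebraMap ℝ (SymFib A x') (f x) + _
    rw [hx', Fun.sum_apply, map_add, map_sum]
    congr 1
    refine Finset.sum_congr rfl fun i _ => ?_
    rw [mul_comm, map_mul, map_sub]
    rfl
  rw [h1, map_add, hY.map_algebraMap, zero_add, map_sum, Fun.sum_apply]
  refine Finset.sum_congr rfl fun i _ => ?_
  rw [hY.leibniz 0 _ _ (homFun_ofFun (hg i)), mul_zero, sgn_zero, one_smul, map_sub,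
    hY.map_algebraMap, sub_zero]
  change _ * (algebraMap ℝ (SymFib A x) (y i x) - algebraMap ℝ (SymFib A x) (y i x)) +
    algebraMap ℝ (SymFib A x) (g i x) * _ = _
  rw [sub_self, mul_zero, zero_add, ← Algebra.smul_def]

/-- Two derivations that agree on functions at `x` differ on forms by an operator that is linear over
the functions. -/
lemma IsDer.sub_apply_form {p : ℤ} {Y Z : Fun A →ₗ[ℝ] Fun A} (hY : IsDer p Y) (hZ : IsDer p Z)
    {x : M} (hf : ∀ f hf, (Y (ofFun A f hf)).1 x = (Z (ofFun A f hf)).1 x) {i : Fin n} {r : ℕ}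
    {s : Fin r → ∀ x, (A i).E x} {σ : Fin r → ∀ x, Module.Dual ℝ ((A i).E x)}
    (hs : ∀ b, (A i).IsSec (s b)) (hσ : ∀ b, (A i).IsForm (σ b))
    (hres : ∀ᶠ x in 𝓝 x, ∀ v, v = ∑ b, σ b x v • s b x)
    {α : ∀ x, Module.Dual ℝ ((A i).E x)} (hα : (A i).IsForm α) :
    (Y (ofForm A i α hα)).1 x - (Z (ofForm A i α hα)).1 x =
      ∑ b, α x (s b x) • ((Y (ofForm A i (σ b) (hσ b))).1 x - (Z (ofForm A i (σ b) (hσ b))).1 x) := by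
  have key : ∀ {Y : Fun A →ₗ[ℝ] Fun A}, IsDer p Y → (Y (ofForm A i α hα)).1 x =
      ∑ b, ((Y (ofFun A _ (hα.apply (hs b)))).1 x * (ofForm A i (σ b) (hσ b)).1 x +
        α x (s b x) • (Y (ofForm A i (σ b) (hσ b))).1 x) := by
    intro Y hY
    have h1 : (Y (ofForm A i α hα)).1 x =
        (Y (∑ b, ofFun A _ (hα.apply (hs b)) * ofForm A i (σ b) (hσ b))).1 x := by
      refine hY.congr ?_
      filter_upwards [hres] with x' hx'
      rw [Fun.sum_apply]
      have : α x' = ∑ b, α x' (s b x') • σ b x' := by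
        ext v
        conv_lhs => rw [hx' v]
        simp [mul_comm]
      change GSym.ι (W := fun i => Module.Dual ℝ ((A i).E x')) i (α x') = _
      conv_lhs => rw [this, map_sum]
      refine Finset.sum_congr rfl fun b _ => ?_
      rw [map_smul, Algebra.smul_def]
      rfl
    rw [h1, map_sum, Fun.sum_apply]
    refine Finset.sum_congr rfl fun b _ => ?_
    rw [hY.leibniz 0 _ _ (homFun_ofFun (hα.apply (hs b))), mul_zero, sgn_zero, one_smul,
      Algebra.smul_def]
    rfl
  rw [key hY, key hZ, ← Finset.sum_sub_distrib]
  refine Finset.sum_congr rfl fun b _ => ?_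
  rw [hf, add_sub_add_left_eq_sub, smul_sub]

/-- A vector field on the base, as a section of the adjoint bundle. -/
noncomputable def fieldSec (A : Fin n → VB (𝓡 d) M) (X : ∀ x, TangentSpace (𝓡 d) x)
    (hX : ContMDiff (𝓡 d) (𝓡 d).tangent ∞ (fun x => (⟨x, X x⟩ : TangentBundle (𝓡 d) M))) :
    SecMod A (adjointBundle A) :=
  gen A (adjointBundle A) (fun x => (X x, 0)) ⟨hX, fun j => (isGood_adjointBundle A).zero.2 j⟩

/-- A section of one of the bundles `A i`, as a section of the adjoint bundle. -/
noncomputable def bundleSec (A : Fin n → VB (𝓡 d) M) (i : Fin n) (a : ∀ x, (A i).E x)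
    (ha : (A i).IsSec a) : SecMod A (adjointBundle A) :=
  gen A (adjointBundle A) (fun x => (0, Pi.single i (a x)))
    ⟨(isGood_adjointBundle A).zero.1, fun j => by
      by_cases hj : j = i
      · subst hj
        simpa using ha
      · simpa [Pi.single_eq_of_ne hj] using (isGood_adjointBundle A).zero.2 j⟩

lemma homSec_fieldSec (X : ∀ x, TangentSpace (𝓡 d) x)
    (hX : ContMDiff (𝓡 d) (𝓡 d).tangent ∞ (fun x => (⟨x, X x⟩ : TangentBundle (𝓡 d) M))) :
    HomSec 0 (fieldSec A X hX) :=
  homSec_gen (A := A) (W := adjointBundle A) (q := none) _ fun x => LinearMap.mem_range.2 ⟨X x, rfl⟩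

lemma homSec_bundleSec {i : Fin n} {a : ∀ x, (A i).E x} (ha : (A i).IsSec a) :
    HomSec (-1 * (i.val + 1)) (bundleSec A i a ha) :=
  homSec_gen (A := A) (W := adjointBundle A) (q := some i) _
    fun x => LinearMap.mem_range.2 ⟨a x, rfl⟩

lemma vecPt_fieldSec (X : ∀ x, TangentSpace (𝓡 d) x)
    (hX : ContMDiff (𝓡 d) (𝓡 d).tangent ∞ (fun x => (⟨x, X x⟩ : TangentBundle (𝓡 d) M)))
    (ξ : Fun A) (x : M) : vecPt cov ξ x ((fieldSec A X hX).1 x) = nabla cov ξ x (X x) := by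
  change vecPt cov ξ x (1 ⊗ₜ[ℝ] _) = _
  rw [vecPt_tmul, one_mul]
  exact vecAt_inl ξ x (X x)

lemma vecPt_bundleSec {i : Fin n} {a : ∀ x, (A i).E x} (ha : (A i).IsSec a) (ξ : Fun A) (x : M) :
    vecPt cov ξ x ((bundleSec A i a ha).1 x) =
      GSym.contract i (Module.Dual.eval ℝ ((A i).E x) (a x)) (ξ.1 x) := by
  change vecPt cov ξ x (1 ⊗ₜ[ℝ] _) = _
  rw [vecPt_tmul, one_mul]
  exact vecAt_single ξ x i (a x)

/-- Near every point there is a vector field realised by a section that agrees with a given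
derivation on functions: by Hadamard's lemma a derivation is a first order operator on them. -/
lemma exists_secMod_eq_on_functions (hcov : ∀ i, (cov i).ContMDiffCovariantDerivative ∞) {p : ℤ}
    {Y : Fun A →ₗ[ℝ] Fun A} (hY : IsDer p Y) (x₀ : M) :
    ∃ t : SecMod A (adjointBundle A), HomSec p t ∧
      ∀ᶠ x in 𝓝 x₀, ∀ f hf, (Y (ofFun A f hf)).1 x = (vecFun hcov t (ofFun A f hf)).1 x := by
  obtain ⟨F⟩ := nonempty_coord (d := d) x₀
  -- The coefficients of the coordinate vector fields are the values on the coordinates.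
  let c : Fin d → Fun A := fun i => Y (ofFun A (F.y i) (F.smooth_y i))
  have ht : HomSec p (∑ i, c i • fieldSec A (F.E i) (F.smooth_E i)) := by
    refine HomSec.sum _ fun i _ => ?_
    have := HomSec.smul (hY.deg 0 _ (homFun_ofFun (F.smooth_y i)))
      (homSec_fieldSec (A := A) (F.E i) (F.smooth_E i))
    rwa [add_zero, zero_add] at this
  refine ⟨_, ht, ?_⟩
  filter_upwards [F.dual, F.hadamard] with x hdual hhad
  have hcoord : ∀ j, (vecFun hcov (∑ i, c i • fieldSec A (F.E i) (F.smooth_E i))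
      (ofFun A (F.y j) (F.smooth_y j))).1 x = (c j).1 x := by
    intro j
    rw [vecFun_sum, Fun.sum_apply, Finset.sum_eq_single j]
    · rw [vecFun_smul]
      change (c j).1 x * vecPt cov _ x _ = _
      rw [vecPt_fieldSec, nabla_ofFun]
      change _ * algebraMap ℝ (SymFib A x) (mvfderiv (𝓡 d) (F.y j) x (F.E j x)) = _
      rw [hdual j j, if_pos rfl, map_one, mul_one]
    · intro i _ hi
      rw [vecFun_smul]
      change (c i).1 x * vecPt cov _ x _ = _
      rw [vecPt_fieldSec, nabla_ofFun]
      change _ * algebraMap ℝ (SymFib A x) (mvfderiv (𝓡 d) (F.y j) x (F.E i x)) = _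
      rw [hdual j i, if_neg hi.symm, map_zero, mul_zero]
    · exact fun h => (h (Finset.mem_univ j)).elim
  intro f hf
  obtain ⟨g, hg, he⟩ := hhad f hf
  rw [hY.apply_fun_eq hf F.smooth_y hg he,
    (isDer_vecFun hcov ht).apply_fun_eq hf F.smooth_y hg he]
  simp only [hcoord, c]

/-- Every derivation comes from a section near every point: what is left after adjusting the values
on functions is a tensor, that is, a combination of contractions. -/
lemma exists_local_vecFun_eq (hcov : ∀ i, (cov i).ContMDiffCovariantDerivative ∞) {p : ℤ}
    {Y : Fun A →ₗ[ℝ] Fun A} (hY : IsDer p Y) (x₀ : M) :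
    ∃ t : SecMod A (adjointBundle A), HomSec p t ∧
      ∀ᶠ x in 𝓝 x₀, ∀ ξ, vecPt cov ξ x (t.1 x) = (Y ξ).1 x := by
  obtain ⟨t₁, ht₁, hf₁⟩ := exists_secMod_eq_on_functions hcov hY x₀
  choose r s σ hs hσ hres using fun i => (A i).exists_dualBasis x₀
  let c : ∀ i, Fin (r i) → Fun A := fun i b => Y (ofForm A i (σ i b) (hσ i b)) -
    vecFun hcov t₁ (ofForm A i (σ i b) (hσ i b))
  have hc : ∀ i b, HomFun (i.val + 1 + p) (c i b) := by
    intro i b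
    have h2 := hY.deg _ _ (homFun_ofForm (A := A) (hσ i b))
    have h3 := ((isDer_vecFun hcov ht₁).deg _ _ (homFun_ofForm (A := A) (hσ i b))).smul (-1)
    have h4 : c i b = Y (ofForm A i (σ i b) (hσ i b)) +
        (-1 : ℝ) • vecFun hcov t₁ (ofForm A i (σ i b) (hσ i b)) := by
      rw [neg_one_smul, ← sub_eq_add_neg]
    rw [h4]
    exact h2.add h3
  have ht : HomSec p (t₁ + ∑ i, ∑ b, c i b • bundleSec A i (s i b) (hs i b)) := by
    refine ht₁.add (HomSec.sum _ fun i _ => HomSec.sum _ fun b _ => ?_)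
    have := HomSec.smul (hc i b) (homSec_bundleSec (A := A) (hs i b))
    have e : ((i.val : ℤ) + 1 + p) + -1 * (i.val + 1) = p := by ring
    rwa [e] at this
  have hval : ∀ (ξ : Fun A) x,
      vecPt cov ξ x ((t₁ + ∑ i, ∑ b, c i b • bundleSec A i (s i b) (hs i b) :
        SecMod A (adjointBundle A)).1 x) = (vecFun hcov t₁ ξ).1 x +
      ∑ i, ∑ b, (c i b).1 x * GSym.contract i (Module.Dual.eval ℝ ((A i).E x) (s i b x)) (ξ.1 x) := by
    intro ξ x
    rw [SecMod.add_apply, map_add, SecMod.sum_apply, map_sum, vecFun_apply]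
    congr 1
    refine Finset.sum_congr rfl fun i _ => ?_
    rw [SecMod.sum_apply, map_sum]
    refine Finset.sum_congr rfl fun b _ => ?_
    rw [SecMod.smul_apply, vecPt_smul, vecPt_bundleSec]
  refine ⟨_, ht, ?_⟩
  have hres' := (Filter.eventually_all.2 hres).eventually_nhds
  filter_upwards [hf₁, hres'] with x hf hx ξ
  rw [← vecFun_apply hcov]
  refine (isDer_vecFun hcov ht).ext_at hY (fun f hf' => ?_) (fun i α hα => ?_) ξ
  · rw [vecFun_apply, hval, hf, add_eq_left]
    refine Finset.sum_eq_zero fun i _ => Finset.sum_eq_zero fun b _ => ?_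
    have h0 : GSym.contract i (Module.Dual.eval ℝ ((A i).E x) (s i b x))
        ((ofFun A f hf').1 x) = 0 := GSym.contract_algebraMap _ _ _
    rw [h0, mul_zero]
  · rw [vecFun_apply, hval, Finset.sum_eq_single i]
    · have h1 := hY.sub_apply_form (isDer_vecFun hcov ht₁) hf (hs i) (hσ i)
        (hx.mono fun x' hx' => hx' i) hα
      refine Eq.trans (congrArg _ ?_) (add_sub_cancel _ _)
      rw [h1]
      refine Finset.sum_congr rfl fun b _ => ?_
      have h2 : GSym.contract i (Module.Dual.eval ℝ ((A i).E x) (s i b x))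
        ((ofForm A i α hα).1 x) = algebraMap ℝ _ (α x (s i b x)) := GSym.contract_ι_self _ _ _
      rw [h2, ← Algebra.commutes, ← Algebra.smul_def]
      rfl
    · intro j _ hj
      refine Finset.sum_eq_zero fun b _ => ?_
      have h2 : GSym.contract j (Module.Dual.eval ℝ ((A j).E x) (s j b x))
        ((ofForm A i α hα).1 x) = 0 := GSym.contract_ι_of_ne hj.symm _ _
      rw [h2, mul_zero]
    · exact fun h => (h (Finset.mem_univ i)).elim

/-- Every derivation comes from a section. -/
theorem exists_vecFun_eq (hcov : ∀ i, (cov i).ContMDiffCovariantDerivative ∞) {p : ℤ}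
    {Y : Fun A →ₗ[ℝ] Fun A} (hY : IsDer p Y) :
    ∃ s : SecMod A (adjointBundle A), HomSec p s ∧ vecFun hcov s = Y := by
  obtain ⟨s, hs⟩ := exists_secMod_of_local (A := A) (W := adjointBundle A)
    (fun x z => ∀ ξ, vecPt cov ξ x z = (Y ξ).1 x)
    (fun x y z hy hz => vecPt_injective fun ξ => by rw [hy, hz])
    fun x₀ => ⟨(exists_local_vecFun_eq hcov hY x₀).choose,
      (exists_local_vecFun_eq hcov hY x₀).choose_spec.2⟩
  refine ⟨s, HomSec.of_eventually fun x₀ => ?_, LinearMap.ext fun ξ => Fun.ext fun x => hs x ξ⟩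
  obtain ⟨t, ht, h⟩ := exists_local_vecFun_eq hcov hY x₀
  exact ⟨t, ht, vecPt_injective (cov := cov) fun ξ => by rw [hs, h.self_of_nhds]⟩

end Adjoint

section Adjoint

variable {d : ℕ} {M : Type u} [TopologicalSpace M] [ChartedSpace (EuclideanSpace ℝ (Fin d)) M]
  [IsManifold (𝓡 d) ∞ M] [T2Space M] {n : ℕ} {A : Fin n → VB (𝓡 d) M}
  {cov cov' : ∀ i, CovariantDerivative (𝓡 d) (A i).F (A i).E}

/-- The graded commutator with `Q` of the vector field given by a section. The sign of the second
term is expressed by parities, so that the section need not be homogeneous. -/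
noncomputable def commFun (Q : LieStr A) (hcov : ∀ i, (cov i).ContMDiffCovariantDerivative ∞)
    (s : SecMod A (adjointBundle A)) (ζ : Fun A) : Fun A :=
  Q.Q (vecFun hcov s ζ) - par 1 (vecFun hcov s (par 1 (Q.Q ζ)))

lemma commFun_eq (Q : LieStr A) (hcov : ∀ i, (cov i).ContMDiffCovariantDerivative ∞) {p : ℤ}
    {s : SecMod A (adjointBundle A)} (hs : HomSec p s) (ζ : Fun A) :
    commFun Q hcov s ζ = (Q.Q ∘ₗ vecFun hcov s - sgn p • (vecFun hcov s ∘ₗ Q.Q)) ζ := by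
  rw [commFun, (isDer_vecFun hcov hs).par, map_smul, par_par]
  rfl

lemma vecFun_injective (hcov : ∀ i, (cov i).ContMDiffCovariantDerivative ∞)
    {s t : SecMod A (adjointBundle A)} (h : vecFun hcov s = vecFun hcov t) : s = t :=
  SecMod.ext fun x => vecPt_injective (cov := cov) fun ζ =>
    congrArg (fun Y : Fun A →ₗ[ℝ] Fun A => (Y ζ).1 x) h

lemma vecFun_zero (hcov : ∀ i, (cov i).ContMDiffCovariantDerivative ∞) :
    vecFun (A := A) hcov 0 = 0 := LinearMap.ext fun _ => Fun.ext fun _ => map_zero _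

lemma commFun_add (Q : LieStr A) (hcov : ∀ i, (cov i).ContMDiffCovariantDerivative ∞)
    (s t : SecMod A (adjointBundle A)) (ζ : Fun A) :
    commFun Q hcov (s + t) ζ = commFun Q hcov s ζ + commFun Q hcov t ζ := by
  simp only [commFun, vecFun_add, map_add]
  exact add_sub_add_comm _ _ _ _

lemma commFun_smul (Q : LieStr A) (hcov : ∀ i, (cov i).ContMDiffCovariantDerivative ∞)
    (ξ : Fun A) (s : SecMod A (adjointBundle A)) (ζ : Fun A) :
    commFun Q hcov (ξ • s) ζ = Q.Q ξ * vecFun hcov s ζ + par 1 ξ * commFun Q hcov s ζ := by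
  simp only [commFun, vecFun_smul, Q.isDer.leibniz_par, map_mul, mul_sub]
  exact add_sub_assoc _ _ _

lemma commFun_local (Q : LieStr A) (hcov : ∀ i, (cov i).ContMDiffCovariantDerivative ∞)
    {s t : SecMod A (adjointBundle A)} {x : M} (h : ∀ᶠ x' in 𝓝 x, s.1 x' = t.1 x') (ζ : Fun A) :
    (commFun Q hcov s ζ).1 x = (commFun Q hcov t ζ).1 x := by
  change (Q.Q (vecFun hcov s ζ)).1 x - (par 1 (vecFun hcov s (par 1 (Q.Q ζ)))).1 x =
    (Q.Q (vecFun hcov t ζ)).1 x - (par 1 (vecFun hcov t (par 1 (Q.Q ζ)))).1 x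
  rw [par_one_apply, par_one_apply, vecFun_apply, vecFun_apply, h.self_of_nhds]
  congr 1
  refine Q.isDer.congr ?_
  filter_upwards [h] with x' hx'
  rw [vecFun_apply, vecFun_apply, hx']

/-- The iterated commutator with a homological vector field vanishes. -/
lemma commFun_commFun (Q : LieStr A) (hcov : ∀ i, (cov i).ContMDiffCovariantDerivative ∞)
    {s t : SecMod A (adjointBundle A)} (h : ∀ ζ, vecFun hcov t ζ = commFun Q hcov s ζ) (ζ : Fun A) :
    commFun Q hcov t ζ = 0 := by
  simp only [commFun, h, map_sub, Q.sq, Q.Q_par, map_neg, map_zero]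
  simp

/-- The adjoint representation on not necessarily homogeneous sections. -/
theorem exists_adjoint (Q : LieStr A) (hcov : ∀ i, (cov i).ContMDiffCovariantDerivative ∞) :
    ∃ R : Rep Q (adjointBundle A), ∀ s ζ, vecFun hcov (R.D s) ζ = commFun Q hcov s ζ := by
  suffices h : ∃ R : Rep Q (adjointBundle A), ∀ s x ζ,
      vecPt cov ζ x ((R.D s).1 x) = (commFun Q hcov s ζ).1 x by
    obtain ⟨R, hR⟩ := h
    exact ⟨R, fun s ζ => Fun.ext fun x => hR s x ζ⟩
  refine exists_rep (isGood_adjointBundle A) Q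
    (fun s x y => ∀ ζ, vecPt cov ζ x y = (commFun Q hcov s ζ).1 x)
    (fun s x y z hy hz => vecPt_injective (cov := cov) fun ζ => (hy ζ).trans (hz ζ).symm)
    (fun s t x y h hs ζ => (hs ζ).trans (commFun_local Q hcov h ζ)) ?_ ?_ ?_ ?_
  · intro s t x y z hs ht ζ
    have h1 := congrArg (fun ξ : Fun A => ξ.1 x) (commFun_add Q hcov s t ζ)
    refine Eq.trans ?_ h1.symm
    exact (map_add _ _ _).trans (congrArg₂ _ (hs ζ) (ht ζ))
  · intro ξ s x y hs ζ
    have h1 := congrArg (fun ξ : Fun A => ξ.1 x) (commFun_smul Q hcov ξ s ζ)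
    refine Eq.trans ?_ h1.symm
    refine (map_add _ _ _).trans (congrArg₂ _ (vecPt_smul _ _ _ _) ((vecPt_smul _ _ _ _).trans ?_))
    exact congrArg _ (hs ζ)
  · intro q e he hq
    obtain ⟨t, ht, h⟩ := exists_vecFun_eq hcov
      (IsDer.commutator Q (isDer_vecFun hcov (homSec_gen (A := A) he hq)))
    refine ⟨t, ht, fun x ζ => ?_⟩
    have h1 := commFun_eq Q hcov (homSec_gen (A := A) he hq) ζ
    rw [← h] at h1
    exact congrArg (fun ξ : Fun A => ξ.1 x) h1.symm
  · intro q e he _ t u _ ht hu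
    have ht' : ∀ ζ, vecFun hcov t ζ = commFun Q hcov (gen A _ e he) ζ := fun ζ => Fun.ext fun x => ht x ζ
    have hu' : ∀ ζ, vecFun hcov u ζ = 0 := fun ζ =>
      (Fun.ext fun x => hu x ζ : vecFun hcov u ζ = commFun Q hcov t ζ).trans
        (commFun_commFun Q hcov ht' ζ)
    exact vecFun_injective hcov ((LinearMap.ext hu').trans (vecFun_zero hcov).symm)

/-- A representation that realises the commutator with `Q` on all sections is an adjoint
representation. -/
theorem isAdjoint_of_commFun {Q : LieStr A} (hcov : ∀ i, (cov i).ContMDiffCovariantDerivative ∞)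
    {R : Rep Q (adjointBundle A)} (hR : ∀ s ζ, vecFun hcov (R.D s) ζ = commFun Q hcov s ζ) :
    IsAdjoint cov R := by
  intro p s hs
  refine ⟨_, isDer_vecFun hcov hs, realises_vecFun hcov s, ?_⟩
  have : Q.Q ∘ₗ vecFun hcov s - sgn p • (vecFun hcov s ∘ₗ Q.Q) = vecFun hcov (R.D s) :=
    LinearMap.ext fun ζ => by rw [hR, commFun_eq Q hcov hs]
  rw [this]
  exact realises_vecFun hcov _

theorem IsAdjoint.unique {Q : LieStr A} (hcov : ∀ i, (cov i).ContMDiffCovariantDerivative ∞)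
    {R S : Rep Q (adjointBundle A)} (hR : IsAdjoint cov R) (hS : IsAdjoint cov S) : S = R := by
  have key : ∀ {R : Rep Q (adjointBundle A)}, IsAdjoint cov R → ∀ p s, HomSec p s →
      vecFun hcov (R.D s) = Q.Q ∘ₗ vecFun hcov s - sgn p • (vecFun hcov s ∘ₗ Q.Q) := by
    intro R hR p s hs
    obtain ⟨Y, hY, h1, h2⟩ := hR p s hs
    rw [← h2.eq_vecFun hcov (R.deg p s hs) (IsDer.commutator Q hY), h1.eq_vecFun hcov hs hY]
  have h : S.D = R.D := eq_of_homogeneous (W := adjointBundle A) (W' := adjointBundle A) (D := S.D)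
    (D' := R.D) (isGood_adjointBundle A) (fun _ _ _ => S.local) (fun _ _ _ => R.local)
    fun p s hs => vecFun_injective hcov ((key hS p s hs).trans (key hR p s hs).symm)
  exact Rep.ext h

/-- The difference of two families of connections, as the tensor that defines a shear. -/
noncomputable abbrev connDiff (cov cov' : ∀ i, CovariantDerivative (𝓡 d) (A i).F (A i).E)
    (i : Fin n) (m : M) : TangentSpace (𝓡 d) m →ₗ[ℝ] (A i).E m →ₗ[ℝ] (A i).E m :=
  ((cov' i).difference (cov i) m).toLinearMap₁₂.flip

lemma connDiff_apply {i : Fin n} {a : ∀ x, (A i).E x} (ha : (A i).IsSec a) (m : M)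
    (X : TangentSpace (𝓡 d) m) : connDiff cov cov' i m X (a m) = cov' i a m X - cov i a m X := by
  have h : MDifferentiableAt (𝓡 d) (A i).model (fun x => (⟨x, a x⟩ : (A i).Tot)) m :=
    ContMDiff.mdifferentiableAt ha (by simp)
  have := IsCovariantDerivativeOn.difference_apply (cov' i).isCovariantDerivativeOnUniv
    (cov i).isCovariantDerivativeOnUniv (x := m) (hx := trivial) h
  exact congrArg (fun L => L X) this

lemma connDiff_swap (i : Fin n) (m : M) : connDiff cov' cov i m = -connDiff cov cov' i m := by
  refine LinearMap.ext fun X => LinearMap.ext fun v => ?_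
  obtain ⟨ext, hext, hv⟩ := (A i).exists_extend m
  rw [← hv v, connDiff_apply (hext v)]
  change _ = -(connDiff cov cov' i m X (ext v m))
  rw [connDiff_apply (hext v), neg_sub]

lemma contMDiff_cov {B : VB (𝓡 d) M} {c : CovariantDerivative (𝓡 d) B.F B.E}
    (hc : c.ContMDiffCovariantDerivative ∞) {X : ∀ x : M, TangentSpace (𝓡 d) x}
    (hX : ContMDiff (𝓡 d) (𝓡 d).tangent ∞ (fun x => (⟨x, X x⟩ : TangentBundle (𝓡 d) M)))
    {s : ∀ x, B.E x} (hs : B.IsSec s) : B.IsSec (fun x => c s x (X x)) := by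
  have h2 := hc.contMDiff.contMDiff (σ := s) (by
    have : (∞ : WithTop ℕ∞) + 1 = ∞ := rfl
    rw [this]
    exact ContMDiff.contMDiffOn hs)
  exact (contMDiffOn_univ.1 h2).clm_bundle_apply hX

lemma smoothShear_connDiff (hcov : ∀ i, (cov i).ContMDiffCovariantDerivative ∞)
    (hcov' : ∀ i, (cov' i).ContMDiffCovariantDerivative ∞) :
    SmoothShear A (adjointBundle A) (connDiff cov cov') := by
  intro i X a hX ha
  have h : (A i).IsSec (fun x => cov' i a x (X x) + (-1 : ℝ) • cov i a x (X x)) :=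
    (contMDiff_cov (hcov' i) hX ha).add ((contMDiff_cov (hcov i) hX ha).const_smul (-1))
  convert h using 2 with x
  refine (connDiff_apply ha x (X x)).trans ?_
  rw [neg_one_smul, sub_eq_add_neg]

lemma vecPt_homTensor (ξ : Fun A) (x : M) (i : Fin n) (L : (A i).E x →ₗ[ℝ] (A i).E x)
    {ι : Type*} [Fintype ι] {s : ι → (A i).E x}
    {σ : ι → Module.Dual ℝ ((A i).E x)} (h : ∀ v, v = ∑ b, σ b v • s b) :
    vecPt cov ξ x (homTensor A (adjointBundle A) x i L) =
      ∑ b, GSym.ι i (σ b) * GSym.contract i (Module.Dual.eval ℝ ((A i).E x) (L (s b))) (ξ.1 x) := by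
  rw [homTensor_eq_sum (W := adjointBundle A) i h L, map_sum]
  refine Finset.sum_congr rfl fun b _ => ?_
  rw [vecPt_tmul]
  exact congrArg _ (vecAt_single ξ x i (L (s b)))

lemma vecPt_ofFun_homTensor {f : M → ℝ} (hf : ContMDiff (𝓡 d) 𝓘(ℝ, ℝ) ∞ f) (x : M) (i : Fin n)
    (L : (A i).E x →ₗ[ℝ] (A i).E x) :
    vecPt cov (ofFun A f hf) x (homTensor A (adjointBundle A) x i L) = 0 := by
  let b := Module.finBasis ℝ ((A i).E x)
  rw [vecPt_homTensor _ x i L (s := b) (σ := b.coord) fun v => (b.sum_repr v).symm]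
  refine Finset.sum_eq_zero fun c _ => ?_
  have : GSym.contract i (Module.Dual.eval ℝ ((A i).E x) (L (b c))) ((ofFun A f hf).1 x) = 0 :=
    GSym.contract_algebraMap _ _ _
  rw [this, mul_zero]

lemma vecPt_ofForm_homTensor {i : Fin n} {ε : ∀ x, Module.Dual ℝ ((A i).E x)}
    (hε : (A i).IsForm ε) (x : M) (L : (A i).E x →ₗ[ℝ] (A i).E x) :
    vecPt cov (ofForm A i ε hε) x (homTensor A (adjointBundle A) x i L) =
      GSym.ι (W := fun i => Module.Dual ℝ ((A i).E x)) i (ε x ∘ₗ L) := by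
  let b := Module.finBasis ℝ ((A i).E x)
  rw [vecPt_homTensor _ x i L (s := b) (σ := b.coord) fun v => (b.sum_repr v).symm]
  have h : ε x ∘ₗ L = ∑ c, ε x (L (b c)) • b.coord c := by
    refine LinearMap.ext fun v => ?_
    conv_lhs => rw [← b.sum_repr v]
    rw [LinearMap.comp_apply, map_sum, map_sum, LinearMap.sum_apply]
    refine Finset.sum_congr rfl fun c _ => ?_
    rw [map_smul, map_smul, LinearMap.smul_apply, smul_eq_mul, smul_eq_mul, mul_comm]
    rfl
  rw [h, map_sum]
  refine Finset.sum_congr rfl fun c _ => ?_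
  have : GSym.contract i (Module.Dual.eval ℝ ((A i).E x) (L (b c))) ((ofForm A i ε hε).1 x) =
    algebraMap ℝ _ (ε x (L (b c))) := GSym.contract_ι_self _ _ _
  rw [this, ← Algebra.commutes, ← Algebra.smul_def, map_smul]

lemma vecPt_ofForm_homTensor_of_ne {i j : Fin n} (hj : i ≠ j) {ε : ∀ x, Module.Dual ℝ ((A i).E x)}
    (hε : (A i).IsForm ε) (x : M) (L : (A j).E x →ₗ[ℝ] (A j).E x) :
    vecPt cov (ofForm A i ε hε) x (homTensor A (adjointBundle A) x j L) = 0 := by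
  let b := Module.finBasis ℝ ((A j).E x)
  rw [vecPt_homTensor _ x j L (s := b) (σ := b.coord) fun v => (b.sum_repr v).symm]
  refine Finset.sum_eq_zero fun c _ => ?_
  have : GSym.contract j (Module.Dual.eval ℝ ((A j).E x) (L (b c))) ((ofForm A i ε hε).1 x) = 0 :=
    GSym.contract_ι_of_ne hj _ _
  rw [this, mul_zero]

lemma IsDualDerivative.eq_add_connDiff {i : Fin n} {ε : ∀ x, Module.Dual ℝ ((A i).E x)} {x : M}
    {N N' : TangentSpace (𝓡 d) x →ₗ[ℝ] Module.Dual ℝ ((A i).E x)}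
    (h : IsDualDerivative (cov i) ε x N) (h' : IsDualDerivative (cov' i) ε x N')
    (X : TangentSpace (𝓡 d) x) : N X = N' X + ε x ∘ₗ connDiff cov cov' i x X := by
  refine LinearMap.ext fun v => ?_
  obtain ⟨ext, hext, hv⟩ := (A i).exists_extend x
  rw [← hv v, h _ (hext v), LinearMap.add_apply, h' _ (hext v), LinearMap.comp_apply,
    connDiff_apply (hext v), map_sub]
  ring

lemma vecPt_shear_ofFun {f : M → ℝ} (hf : ContMDiff (𝓡 d) 𝓘(ℝ, ℝ) ∞ f) (x : M)
    (z : ModFib A (adjointBundle A) x) : vecPt cov' (ofFun A f hf) x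
      (shear A (adjointBundle A) x (fun i => connDiff cov cov' i x) z) =
      vecPt cov (ofFun A f hf) x z := by
  induction z using TensorProduct.induction_on with
  | zero => simp
  | add y z h1 h2 => rw [map_add, map_add, map_add, h1, h2]
  | tmul ξ e =>
    rw [shear_tmul, map_add, map_sum, vecPt_tmul, vecPt_tmul, vecAt_ofFun, vecAt_ofFun,
      add_eq_left]
    refine Finset.sum_eq_zero fun i _ => ?_
    rw [vecPt_smul]
    exact (congrArg _ (vecPt_ofFun_homTensor hf x i _)).trans (mul_zero _)

/-- The two connections give dual derivatives of `ε` that differ by the contraction of `ε` with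
`∇' - ∇`; this is the derivative of `ε` along the vertical part of the shear. -/
lemma vecPt_shear_ofForm {i : Fin n} {ε : ∀ x, Module.Dual ℝ ((A i).E x)}
    (hε : (A i).IsForm ε) (x : M) (z : ModFib A (adjointBundle A) x) :
    vecPt cov' (ofForm A i ε hε) x
      (shear A (adjointBundle A) x (fun i => connDiff cov cov' i x) z) =
      vecPt cov (ofForm A i ε hε) x z := by
  obtain ⟨N, hN⟩ := exists_isDualDerivative (cov i) hε x
  obtain ⟨N', hN'⟩ := exists_isDualDerivative (cov' i) hε x
  induction z using TensorProduct.induction_on with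
  | zero => simp
  | add y z h1 h2 => rw [map_add, map_add, map_add, h1, h2]
  | tmul ξ e =>
    rw [shear_tmul, map_add, map_sum, vecPt_tmul, vecPt_tmul, Finset.sum_eq_single i]
    · rw [vecPt_smul]
      refine (congrArg _ (congrArg _ (vecPt_ofForm_homTensor hε x _))).trans ?_
      rw [← mul_add, vecAt_ofForm hε hN, vecAt_ofForm hε hN']
      change ξ * (GSym.ι i (N' e.1) + _ + _) = ξ * (GSym.ι i (N e.1) + _)
      rw [hN.eq_add_connDiff hN' e.1, map_add]
      congr 1
      abel
    · intro j _ hj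
      rw [vecPt_smul]
      exact (congrArg _ (vecPt_ofForm_homTensor_of_ne hj.symm hε x _)).trans (mul_zero _)
    · exact fun h => (h (Finset.mem_univ i)).elim

lemma smoothShear_neg_connDiff (hcov : ∀ i, (cov i).ContMDiffCovariantDerivative ∞)
    (hcov' : ∀ i, (cov' i).ContMDiffCovariantDerivative ∞) :
    SmoothShear A (adjointBundle A) (fun i x => -connDiff cov cov' i x) := by
  have e : connDiff cov' cov = fun i x => -connDiff cov cov' i x :=
    funext fun i => funext fun x => connDiff_swap i x
  exact e ▸ smoothShear_connDiff hcov' hcov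

/-- The automorphism of the adjoint bundle given by the difference of two families of
connections. -/
noncomputable def connShear (hcov : ∀ i, (cov i).ContMDiffCovariantDerivative ∞)
    (hcov' : ∀ i, (cov' i).ContMDiffCovariantDerivative ∞) :
    SecMod A (adjointBundle A) ≃ₗ[Fun A] SecMod A (adjointBundle A) :=
  shearEquiv (isGood_adjointBundle A) (connDiff cov cov') (smoothShear_connDiff hcov hcov')
    (smoothShear_neg_connDiff hcov hcov')

lemma connShear_apply (hcov : ∀ i, (cov i).ContMDiffCovariantDerivative ∞)
    (hcov' : ∀ i, (cov' i).ContMDiffCovariantDerivative ∞) (s : SecMod A (adjointBundle A)) (x : M) :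
    (connShear hcov hcov' s).1 x =
      shear A (adjointBundle A) x (fun i => connDiff cov cov' i x) (s.1 x) := rfl

lemma HomSec.connShear (hcov : ∀ i, (cov i).ContMDiffCovariantDerivative ∞)
    (hcov' : ∀ i, (cov' i).ContMDiffCovariantDerivative ∞) {p : ℤ} {s : SecMod A (adjointBundle A)}
    (hs : HomSec p s) : HomSec p (connShear hcov hcov' s) :=
  fun x => shear_mem_modPiece rfl _ (hs x)

/-- A section and its image under the shear define the same vector field, by means of the two
families of connections. -/
lemma vecFun_connShear (hcov : ∀ i, (cov i).ContMDiffCovariantDerivative ∞)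
    (hcov' : ∀ i, (cov' i).ContMDiffCovariantDerivative ∞) {p : ℤ} {s : SecMod A (adjointBundle A)}
    (hs : HomSec p s) : vecFun hcov' (connShear hcov hcov' s) = vecFun hcov s := by
  refine (isDer_vecFun hcov' (hs.connShear hcov hcov')).ext (isDer_vecFun hcov hs)
    (fun f hf => Fun.ext fun x => ?_) fun i α hα => Fun.ext fun x => ?_
  · rw [vecFun_apply, vecFun_apply, connShear_apply, vecPt_shear_ofFun]
  · rw [vecFun_apply, vecFun_apply, connShear_apply, vecPt_shear_ofForm]

/-- Both differentials are the commutator with `Q`, seen through identifications that the shear turns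
into each other. -/
lemma connShear_comm {Q : LieStr A} (hcov : ∀ i, (cov i).ContMDiffCovariantDerivative ∞)
    (hcov' : ∀ i, (cov' i).ContMDiffCovariantDerivative ∞) {R R' : Rep Q (adjointBundle A)}
    (hR : ∀ s ζ, vecFun hcov (R.D s) ζ = commFun Q hcov s ζ)
    (hR' : ∀ s ζ, vecFun hcov' (R'.D s) ζ = commFun Q hcov' s ζ) (s : SecMod A (adjointBundle A)) :
    connShear hcov hcov' (R.D s) = R'.D (connShear hcov hcov' s) := by
  let μ : SecMod A (adjointBundle A) →+ SecMod A (adjointBundle A) :=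
    (connShear hcov hcov').toAddEquiv.toAddMonoidHom
  have h : μ.comp R.D = R'.D.comp μ := by
    refine eq_of_homogeneous (W := adjointBundle A) (W' := adjointBundle A) (D := μ.comp R.D)
      (D' := R'.D.comp μ) (isGood_adjointBundle A) ?_ ?_ fun p s hs => ?_
    · intro s t x h
      exact congrArg (shear A (adjointBundle A) x fun i => connDiff cov cov' i x) (R.local h)
    · intro s t x h
      refine R'.local ?_
      filter_upwards [h] with x' hx'
      exact congrArg (shear A (adjointBundle A) x' fun i => connDiff cov cov' i x') hx'
    · refine vecFun_injective hcov' ((vecFun_connShear hcov hcov' (R.deg p s hs)).trans ?_)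
      refine LinearMap.ext fun ζ => (hR s ζ).trans (Eq.trans ?_ (hR' (connShear hcov hcov' s) ζ).symm)
      rw [commFun, commFun, vecFun_connShear hcov hcov' hs]
  exact DFunLike.congr_fun h s

theorem exists_iso_adjoint {Q : LieStr A} (hcov : ∀ i, (cov i).ContMDiffCovariantDerivative ∞)
    (hcov' : ∀ i, (cov' i).ContMDiffCovariantDerivative ∞) {R R' : Rep Q (adjointBundle A)}
    (hR : ∀ s ζ, vecFun hcov (R.D s) ζ = commFun Q hcov s ζ)
    (hR' : ∀ s ζ, vecFun hcov' (R'.D s) ζ = commFun Q hcov' s ζ) :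
    ∃ iso : RepIso R R', ∀ s m,
      (iso.μ s).1 m = shear A (adjointBundle A) m (fun i => connDiff cov cov' i m) (s.1 m) ∧
      (iso.μ.symm s).1 m =
        shear A (adjointBundle A) m (fun i => connDiff cov' cov i m) (s.1 m) := by
  refine ⟨shearIso (isGood_adjointBundle A) rfl (connDiff cov cov')
    (smoothShear_connDiff hcov hcov') (smoothShear_neg_connDiff hcov hcov')
    (connShear_comm hcov hcov' hR hR'), fun s m =>
      ⟨shearIso_apply _ _ _ _ _ _ s m, (shearIso_symm_apply _ _ _ _ _ _ s m).trans ?_⟩⟩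
  have : (fun i => connDiff cov' cov i m) = fun i => -connDiff cov cov' i m :=
    funext fun i => connDiff_swap i m
  exact congrArg (fun Δ => shear A (adjointBundle A) m Δ (s.1 m)) this.symm

theorem exists_adjoint_iso (Q : LieStr A) (hcov : ∀ i, (cov i).ContMDiffCovariantDerivative ∞)
    (hcov' : ∀ i, (cov' i).ContMDiffCovariantDerivative ∞) :
    ∃ R R' : Rep Q (adjointBundle A),
      (IsAdjoint cov R ∧ ∀ S, IsAdjoint cov S → S = R) ∧
      (IsAdjoint cov' R' ∧ ∀ S, IsAdjoint cov' S → S = R') ∧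
      ∃ iso : RepIso R R', ∀ s m,
        (iso.μ s).1 m = shear A (adjointBundle A) m (fun i => connDiff cov cov' i m) (s.1 m) ∧
        (iso.μ.symm s).1 m =
          shear A (adjointBundle A) m (fun i => connDiff cov' cov i m) (s.1 m) :=
  (exists_adjoint Q hcov).elim fun R hR => (exists_adjoint Q hcov').elim fun R' hR' =>
    ⟨R, R', ⟨isAdjoint_of_commFun hcov hR, fun _ => (isAdjoint_of_commFun hcov hR).unique hcov⟩,
      ⟨isAdjoint_of_commFun hcov' hR', fun _ => (isAdjoint_of_commFun hcov' hR').unique hcov'⟩,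
      exists_iso_adjoint hcov hcov' hR hR'⟩

end Adjoint

/-! ### The algebra of double vector bundles -/

section Double

variable {EB : Type v} [NormedAddCommGroup EB] [NormedSpace ℝ EB] {HB : Type w}
  [TopologicalSpace HB] {I : ModelWithCorners ℝ EB HB}
  {M : Type u} [TopologicalSpace M] [ChartedSpace HB M]

instance VB.t2Space_tot [T2Space M] (V : VB I M) : T2Space V.Tot := by
  refine ⟨fun p q hpq => ?_⟩
  have hc := FiberBundle.continuous_proj V.F V.E
  by_cases h : p.proj = q.proj
  · let e := trivializationAt V.F V.E p.proj
    have hp : p ∈ e.source := e.mem_source.2 (FiberBundle.mem_baseSet_trivializationAt' _)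
    have hq : q ∈ e.source :=
      e.mem_source.2 (h ▸ FiberBundle.mem_baseSet_trivializationAt' (F := V.F) p.proj)
    obtain ⟨s, t, hs, ht, hps, hqt, hd⟩ := t2_separation fun hpq' => hpq (e.injOn hp hq hpq')
    exact ⟨_, _, e.isOpen_inter_preimage hs, e.isOpen_inter_preimage ht, ⟨hp, hps⟩, ⟨hq, hqt⟩,
      (hd.preimage _).mono Set.inter_subset_right Set.inter_subset_right⟩
  · obtain ⟨s, t, hs, ht, hps, hqt, hd⟩ := t2_separation h
    exact ⟨_, _, hs.preimage hc, ht.preimage hc, hps, hqt, hd.preimage _⟩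

lemma VB.AddRel.unique {V : VB I M} {p q r r' : V.Tot} (h : V.AddRel p q r) (h' : V.AddRel p q r') :
    r = r' := by
  obtain ⟨x, a, b, rfl, rfl, rfl⟩ := h
  obtain ⟨x', a', b', h1, h2, rfl⟩ := h'
  cases h1
  cases h2
  rfl

lemma VB.addRel_mk_iff {V : VB I M} {x : M} {a b c : V.E x} :
    V.AddRel ⟨x, a⟩ ⟨x, b⟩ ⟨x, c⟩ ↔ c = a + b := by
  constructor
  · rintro ⟨x', a', b', h1, h2, h3⟩
    cases h1
    cases h2
    cases h3
    rfl
  · rintro rfl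
    exact ⟨x, a, b, rfl, rfl, rfl⟩

namespace DVB

variable {V A C : VB I M} (D : DVB V A C)

/-- An element of `D` over `v ∈ V` and `a ∈ A`, seen in the fibre of `D → A` over `a`. -/
lemma exists_flip {m : M} {v : V.E m} (d : D.overV.E ⟨m, v⟩) {a : A.E m}
    (h : D.prA ⟨m, v⟩ d = a) :
    ∃ d' : D.overA.E ⟨m, a⟩, D.flip ⟨⟨m, v⟩, d⟩ = ⟨⟨m, a⟩, d'⟩ ∧ D.prV ⟨m, a⟩ d' = v := by
  subst h
  have h1 := D.flip_proj ⟨m, v⟩ d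
  rcases e : D.flip ⟨⟨m, v⟩, d⟩ with ⟨a', d'⟩
  rw [e] at h1
  change a' = _ at h1
  subst h1
  refine ⟨d', rfl, ?_⟩
  have h2 := D.flip_symm_proj _ d'
  rw [← e, Equiv.symm_apply_apply] at h2
  exact (eq_of_heq (TotalSpace.mk.inj h2).2).symm

/-- An element of `D` over `a ∈ A` and `v ∈ V`, seen in the fibre of `D → V` over `v`. -/
lemma exists_flip_symm {m : M} {a : A.E m} (d' : D.overA.E ⟨m, a⟩) {v : V.E m}
    (h : D.prV ⟨m, a⟩ d' = v) :
    ∃ d : D.overV.E ⟨m, v⟩, D.flip ⟨⟨m, v⟩, d⟩ = ⟨⟨m, a⟩, d'⟩ ∧ D.prA ⟨m, v⟩ d = a := by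
  subst h
  have h1 := D.flip_symm_proj ⟨m, a⟩ d'
  rcases e : D.flip.symm ⟨⟨m, a⟩, d'⟩ with ⟨v', d⟩
  rw [e] at h1
  change v' = _ at h1
  subst h1
  rw [Equiv.symm_apply_eq] at e
  refine ⟨d, e.symm, ?_⟩
  have h2 := D.flip_proj _ d
  rw [← e] at h2
  exact (eq_of_heq (TotalSpace.mk.inj h2).2).symm

/-- The zero vector over `a ∈ A` of the vector bundle `D → A`, as a point of `D → V` over zero. -/
noncomputable def zero (m : M) (a : A.E m) : D.overV.E ⟨m, 0⟩ :=
  (D.exists_flip_symm (0 : D.overA.E ⟨m, a⟩) (map_zero _)).choose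

lemma flip_zero (m : M) (a : A.E m) : D.flip ⟨⟨m, 0⟩, D.zero m a⟩ = ⟨⟨m, a⟩, 0⟩ :=
  (D.exists_flip_symm (0 : D.overA.E ⟨m, a⟩) (map_zero _)).choose_spec.1

lemma prA_zero (m : M) (a : A.E m) : D.prA ⟨m, 0⟩ (D.zero m a) = a :=
  (D.exists_flip_symm (0 : D.overA.E ⟨m, a⟩) (map_zero _)).choose_spec.2

lemma smulA_zero (m : M) (v : V.E m) (d : D.overV.E ⟨m, v⟩) :
    D.smulA 0 ⟨⟨m, v⟩, d⟩ = ⟨⟨m, 0⟩, D.zero m (D.prA ⟨m, v⟩ d)⟩ := by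
  obtain ⟨d', h, -⟩ := D.exists_flip d rfl
  rw [smulA, Equiv.symm_apply_eq, flip_zero, h, VB.smulTot, zero_smul]

/-- The zero section of `D → A` is a linear map from `A` to the fibres of `D → V` over zero. -/
noncomputable def zeroL (m : M) : A.E m →ₗ[ℝ] D.overV.E ⟨m, 0⟩ where
  toFun := D.zero m
  map_add' a b := by
    have h := D.smulA_addV 0 _ _ _ (VB.addRel_mk_iff.2 rfl :
      D.overV.AddRel ⟨⟨m, 0⟩, D.zero m a⟩ ⟨⟨m, 0⟩, D.zero m b⟩ ⟨⟨m, 0⟩, D.zero m a + D.zero m b⟩)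
    change D.overV.AddRel (D.smulA 0 _) (D.smulA 0 _) (D.smulA 0 _) at h
    rw [smulA_zero, smulA_zero, smulA_zero, map_add, prA_zero, prA_zero] at h
    exact VB.addRel_mk_iff.1 h
  map_smul' t a := by
    have h := D.smulV_smulA t 0 ⟨⟨m, 0⟩, D.zero m a⟩
    change D.overV.smulTot t (D.smulA 0 _) = D.smulA 0 ⟨⟨m, 0⟩, t • D.zero m a⟩ at h
    rw [smulA_zero, smulA_zero, map_smul, prA_zero] at h
    exact (eq_of_heq (TotalSpace.mk.inj h).2).symm

@[simp] lemma prA_zeroL (m : M) (a : A.E m) : D.prA ⟨m, 0⟩ (D.zeroL m a) = a := D.prA_zero m a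

lemma contMDiff_zeroL : ContMDiff A.model D.overV.model ∞
    (fun a : A.Tot => (⟨⟨a.proj, 0⟩, D.zeroL a.proj a.2⟩ : D.overV.Tot)) := by
  have h : (fun a : A.Tot => (⟨⟨a.proj, 0⟩, D.zeroL a.proj a.2⟩ : D.overV.Tot)) =
      D.flip.symm ∘ fun a : A.Tot => (⟨a, 0⟩ : D.overA.Tot) := by
    ext1 a
    exact ((Equiv.symm_apply_eq _).2 (D.flip_zero a.proj a.2).symm).symm
  rw [h]
  exact D.contMDiff_flip_symm.comp (contMDiff_zeroSection ℝ D.overA.E)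

variable {D}

lemma AddA.unique {p q r r' : D.overV.Tot} (h : D.AddA p q r) (h' : D.AddA p q r') : r = r' :=
  D.flip.injective (VB.AddRel.unique h h')

lemma AddA.prA_eq {m : M} {v w u : V.E m} {d : D.overV.E ⟨m, v⟩} {e : D.overV.E ⟨m, w⟩}
    {f : D.overV.E ⟨m, u⟩} (h : D.AddA ⟨⟨m, v⟩, d⟩ ⟨⟨m, w⟩, e⟩ ⟨⟨m, u⟩, f⟩) :
    D.prA ⟨m, u⟩ f = D.prA ⟨m, v⟩ d := by
  obtain ⟨x, a, b, h1, -, h3⟩ := h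
  have e1 := D.flip_proj _ d
  have e3 := D.flip_proj _ f
  rw [h1] at e1
  rw [h3] at e3
  exact (eq_of_heq (TotalSpace.mk.inj (e1.symm.trans e3)).2).symm

variable (D)

lemma exists_addA {m : M} {v w : V.E m} {d : D.overV.E ⟨m, v⟩} {e : D.overV.E ⟨m, w⟩}
    (h : D.prA ⟨m, v⟩ d = D.prA ⟨m, w⟩ e) :
    ∃ f, D.AddA ⟨⟨m, v⟩, d⟩ ⟨⟨m, w⟩, e⟩ ⟨⟨m, v + w⟩, f⟩ := by
  obtain ⟨d', hd, hdv⟩ := D.exists_flip d h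
  obtain ⟨e', he, hev⟩ := D.exists_flip e rfl
  obtain ⟨f, hf, -⟩ := D.exists_flip_symm (d' + e') (v := v + w) (by rw [map_add, hdv, hev])
  refine ⟨f, ?_⟩
  rw [AddA, hd, he, hf]
  exact VB.addRel_mk_iff.2 rfl

lemma prA_core (m : M) (c : C.E m) : D.prA ⟨m, 0⟩ (D.core m c) = 0 :=
  LinearMap.mem_ker.1 (D.core_range m ▸ LinearMap.mem_range_self (D.core m) c)

lemma exists_coreLift (v : V.Tot) (c : C.E v.proj) : ∃ d, D.CoreLift v c d := by
  obtain ⟨m, v⟩ := v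
  have key : ∀ w, w = v + 0 → ∃ d : D.overV.E ⟨m, w⟩,
      D.AddA ⟨⟨m, v⟩, 0⟩ ⟨⟨m, 0⟩, D.core m c⟩ ⟨⟨m, w⟩, d⟩ := by
    rintro _ rfl
    exact D.exists_addA (by rw [map_zero, prA_core])
  exact key v (add_zero v).symm

variable {D}

lemma CoreLift.unique {v : V.Tot} {c : C.E v.proj} {d d' : D.overV.E v} (h : D.CoreLift v c d)
    (h' : D.CoreLift v c d') : d = d' :=
  eq_of_heq (TotalSpace.mk.inj (AddA.unique h h')).2

lemma CoreLift.prA_eq {v : V.Tot} {c : C.E v.proj} {d : D.overV.E v} (h : D.CoreLift v c d) :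
    D.prA v d = 0 :=
  (AddA.prA_eq (m := v.proj) (v := v.2) (w := 0) (u := v.2) h).trans (map_zero _)

variable (D)

/-- The kernel of `D → A` consists of the elements obtained from the core. -/
lemma exists_coreLift_of_prA_eq_zero {v : V.Tot} {d : D.overV.E v} (h : D.prA v d = 0) :
    ∃ c, D.CoreLift v c d := by
  obtain ⟨m, v⟩ := v
  obtain ⟨d', hd, hdv⟩ := D.exists_flip d h
  obtain ⟨e', he, hev⟩ := D.exists_flip (0 : D.overV.E ⟨m, v⟩) (a := 0) (map_zero _)
  obtain ⟨k, hk, hka⟩ := D.exists_flip_symm (d' - e') (v := 0) (by rw [map_sub, hdv, hev, sub_self])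
  obtain ⟨c, rfl⟩ : k ∈ LinearMap.range (D.core m) := D.core_range m ▸ LinearMap.mem_ker.2 hka
  refine ⟨c, ?_⟩
  change D.overA.AddRel (D.flip _) (D.flip ⟨⟨m, 0⟩, D.core m c⟩) (D.flip _)
  rw [hd, he, hk]
  exact VB.addRel_mk_iff.2 (by abel)

variable {D}

lemma IsCore.prA_eq {b : ∀ v, D.overV.E v} (h : D.IsCore b) (v : V.Tot) : D.prA v (b v) = 0 := by
  obtain ⟨c, -, h⟩ := h
  exact (h v).prA_eq

/-- Through every element obtained from the core passes a core section. -/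
lemma exists_isCore {v : V.Tot} [FiniteDimensional ℝ EB] [T2Space M] [IsManifold I ∞ M]
    {d : D.overV.E v} (h : D.prA v d = 0) : ∃ b, D.IsCore b ∧ b v = d := by
  obtain ⟨c, hc⟩ := D.exists_coreLift_of_prA_eq_zero h
  obtain ⟨ext, hext, he⟩ := C.exists_extend v.proj
  choose b hb using fun w : V.Tot => D.exists_coreLift w (ext c w.proj)
  refine ⟨b, ⟨ext c, hext c, hb⟩, (hb v).unique ?_⟩
  rwa [he]

lemma IsLinear.eq_zero {b : ∀ v, D.overV.E v} (h : D.IsLinear b) (m : M) :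
    b ⟨m, 0⟩ = D.zeroL m (D.prA ⟨m, 0⟩ (b ⟨m, 0⟩)) := by
  obtain ⟨-, a, -, -, -, hs⟩ := h
  have := hs m 0 0
  rw [smulA_zero, smul_zero] at this
  exact (eq_of_heq (TotalSpace.mk.inj this).2).symm

namespace Decomposition

variable (h : D.Decomposition)

lemma equiv_apply (v : V.Tot) (a : A.E v.proj) (c : C.E v.proj) :
    h.equiv v (a, c) = h.lift v a + h.equiv v (0, c) := by
  rw [lift, LinearMap.comp_apply, LinearMap.inl_apply]
  change _ = h.equiv v (a, 0) + _
  rw [← map_add, Prod.mk_add_mk, add_zero, zero_add]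

lemma equiv_prA_corePart (v : V.Tot) (d : D.overV.E v) :
    h.equiv v (D.prA v d, h.corePart v d) = d := by
  obtain ⟨⟨a, c⟩, rfl⟩ := (h.equiv v).surjective d
  rw [h.prA_equiv]
  simp [corePart]

@[simp] lemma corePart_equiv (v : V.Tot) (a : A.E v.proj) (c : C.E v.proj) :
    h.corePart v (h.equiv v (a, c)) = c := by simp [corePart]

@[simp] lemma corePart_lift (v : V.Tot) (a : A.E v.proj) : h.corePart v (h.lift v a) = 0 :=
  h.corePart_equiv v a 0

@[simp] lemma prA_lift (v : V.Tot) (a : A.E v.proj) : D.prA v (h.lift v a) = a :=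
  h.prA_equiv v a 0

lemma coreLift_equiv (v : V.Tot) (c : C.E v.proj) : D.CoreLift v c (h.equiv v (0, c)) := by
  obtain ⟨m, v⟩ := v
  have h1 := h.add m 0 v 0 0 c
  have h2 : h.equiv ⟨m, v⟩ (0, 0) = 0 := map_zero _
  rw [h2, h.equiv_core, add_zero, zero_add] at h1
  exact h1

lemma eq_of_coreLift {v : V.Tot} {c : C.E v.proj} {d : D.overV.E v} (hd : D.CoreLift v c d) :
    d = h.equiv v (0, c) := hd.unique (h.coreLift_equiv v c)

lemma corePart_of_coreLift {v : V.Tot} {c : C.E v.proj} {d : D.overV.E v} (hd : D.CoreLift v c d) :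
    h.corePart v d = c := by rw [h.eq_of_coreLift hd, corePart_equiv]

/-- The core component of a linear section is additive along the fibres of `V`. -/
lemma corePart_add {b : ∀ v, D.overV.E v} (hb : D.IsLinear b) (m : M) (v w : V.E m) :
    h.corePart ⟨m, v + w⟩ (b ⟨m, v + w⟩) =
      h.corePart ⟨m, v⟩ (b ⟨m, v⟩) + h.corePart ⟨m, w⟩ (b ⟨m, w⟩) := by
  obtain ⟨-, a, -, ha, hadd, -⟩ := hb
  have h1 := h.add m (a m) v w (h.corePart ⟨m, v⟩ (b ⟨m, v⟩)) (h.corePart ⟨m, w⟩ (b ⟨m, w⟩))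
  have e : ∀ u, h.equiv ⟨m, u⟩ (a m, h.corePart ⟨m, u⟩ (b ⟨m, u⟩)) = b ⟨m, u⟩ := fun u => by
    conv_rhs => rw [← h.equiv_prA_corePart ⟨m, u⟩ (b ⟨m, u⟩), ha]
  rw [e, e] at h1
  have h2 := eq_of_heq (TotalSpace.mk.inj (AddA.unique (hadd m v w) h1)).2
  rw [h2, corePart_equiv]

/-- The core component of a linear section is homogeneous along the fibres of `V`. -/
lemma corePart_smul {b : ∀ v, D.overV.E v} (hb : D.IsLinear b) (m : M) (t : ℝ) (v : V.E m) :
    h.corePart ⟨m, t • v⟩ (b ⟨m, t • v⟩) = t • h.corePart ⟨m, v⟩ (b ⟨m, v⟩) := by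
  obtain ⟨-, a, -, ha, -, hs⟩ := hb
  have h1 := h.smul m (a m) t v (h.corePart ⟨m, v⟩ (b ⟨m, v⟩))
  have e : h.equiv ⟨m, v⟩ (a m, h.corePart ⟨m, v⟩ (b ⟨m, v⟩)) = b ⟨m, v⟩ := by
    conv_rhs => rw [← h.equiv_prA_corePart ⟨m, v⟩ (b ⟨m, v⟩), ha]
  rw [e] at h1
  have h2 := eq_of_heq (TotalSpace.mk.inj ((hs m t v).symm.trans h1)).2
  rw [h2, corePart_equiv]

end Decomposition

end DVB

end Double

/-! ### Existence of linear sections -/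

section Double

variable {EB : Type v} [NormedAddCommGroup EB] [NormedSpace ℝ EB] {HB : Type w}
  [TopologicalSpace HB] {I : ModelWithCorners ℝ EB HB}
  {M : Type u} [TopologicalSpace M] [ChartedSpace HB M]
  {EN : Type*} [NormedAddCommGroup EN] [NormedSpace ℝ EN] {HN : Type*}
  [TopologicalSpace HN] {J : ModelWithCorners ℝ EN HN} {N : Type*} [TopologicalSpace N]
  [ChartedSpace HN N]

/-- Linear combinations of sections along a map are smooth. -/
lemma VB.contMDiffAt_sum_along [IsManifold I ∞ M] {V : VB I M} {p : N → M} {r : ℕ}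
    {f : Fin r → ∀ y, V.E (p y)} {c : Fin r → N → ℝ} {y₀ : N} (hp : ContMDiffAt J I ∞ p y₀)
    (hf : ∀ j, ContMDiffAt J V.model ∞ (fun y => (⟨p y, f j y⟩ : V.Tot)) y₀)
    (hc : ∀ j, ContMDiffAt J 𝓘(ℝ, ℝ) ∞ (c j) y₀) :
    ContMDiffAt J V.model ∞ (fun y => (⟨p y, ∑ j, c j y • f j y⟩ : V.Tot)) y₀ := by
  let e := trivializationAt V.F V.E (p y₀)
  refine contMDiffAt_totalSpace.2 ⟨hp, ?_⟩
  have h1 : ContMDiffAt J 𝓘(ℝ, V.F) ∞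
      (fun y => ∑ j, c j y • (e (⟨p y, f j y⟩ : V.Tot)).2) y₀ :=
    contMDiffAt_finsetSum fun j _ => (hc j).smul (contMDiffAt_totalSpace.1 (hf j)).2
  refine h1.congr_of_eventuallyEq ?_
  filter_upwards [hp.continuousAt.eventually
    (e.open_baseSet.mem_nhds (FiberBundle.mem_baseSet_trivializationAt' (p y₀)))] with y hy
  have h2 : ∀ v : V.E (p y), (e (⟨p y, v⟩ : V.Tot)).2 = e.continuousLinearMapAt ℝ (p y) v :=
    fun v => by rw [Trivialization.continuousLinearMapAt_apply, e.coe_linearMapAt_of_mem hy]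
  change (e _).2 = _
  simp only [h2, map_sum, map_smul]

namespace DVB

variable {V A C : VB I M} (D : DVB V A C) [FiniteDimensional ℝ EB] [T2Space M] [IsManifold I ∞ M]

/-- A section of `D → A` along a section `a` of `A` that projects to a given section `s` of `V`, near
a given point. A section `S` of `D → V` with `S 0 = 0_a` projects in `D → A` to a curve
`t ↦ S (t s)` through the zero vector over `a`; its fibre derivative at `t = 0` projects to
`s`. -/
lemma exists_lift_along {a : ∀ m, A.E m} (ha : A.IsSec a) {s : ∀ m, V.E m} (hs : V.IsSec s)
    (m₀ : M) : ∃ d : ∀ m, D.overA.E ⟨m, a m⟩, ∀ᶠ m in 𝓝 m₀,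
      ContMDiffAt I D.overA.model ∞ (fun m => (⟨⟨m, a m⟩, d m⟩ : D.overA.Tot)) m ∧
      D.prV ⟨m, a m⟩ (d m) = s m := by
  obtain ⟨r, t, τ, ht, hτ, hd⟩ := D.overV.exists_dualBasis ⟨m₀, 0⟩
  have hz : ContMDiff I V.model ∞ (fun m => (⟨m, 0⟩ : V.Tot)) := contMDiff_zeroSection ℝ V.E
  -- The components of `S` in a local frame of `D → V` are constant along the fibres of `V`.
  let S : ∀ v, D.overV.E v := fun v => ∑ b, τ b ⟨v.proj, 0⟩ (D.zeroL v.proj (a v.proj)) • t b v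
  have hSs : D.overV.IsSec S := by
    refine VB.IsSec.sum _ fun b _ => (ht b).smul ?_
    have h1 : ContMDiff I 𝓘(ℝ, ℝ) ∞ fun m => τ b ⟨m, 0⟩ (D.zeroL m (a m)) :=
      (hτ b).comp (D.contMDiff_zeroL.comp ha)
    exact h1.comp (contMDiff_proj V.E)
  let e := trivializationAt D.overA.F D.overA.E ⟨m₀, a m₀⟩
  let w : M × ℝ → V.Tot := fun z => ⟨z.1, z.2 • s z.1⟩
  have hw : ContMDiff (I.prod 𝓘(ℝ, ℝ)) V.model ∞ w := fun z => by
    have := VB.contMDiffAt_sum_along (V := V) (J := I.prod 𝓘(ℝ, ℝ)) (p := fun z : M × ℝ => z.1)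
      (r := 1) (f := fun _ z => s z.1) (c := fun _ z => z.2) (y₀ := z) contMDiffAt_fst
      (fun _ => (hs.comp contMDiff_fst) z) (fun _ => contMDiffAt_snd)
    simpa using this
  let P : M × ℝ → D.overA.Tot := fun z => D.flip ⟨w z, S (w z)⟩
  have hP : ContMDiff (I.prod 𝓘(ℝ, ℝ)) D.overA.model ∞ P :=
    D.contMDiff_flip.comp (hSs.comp hw)
  -- `G` is the fibre component of `P` in a trivialisation of `D → A`. The base point of `P (m, t)`
  -- also moves, but `G` has a derivative at `t = 0` in the fibre over `a m`, as `P (m, 0)` is zero.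
  let G : M → ℝ → D.overA.F := fun m t => (e (P (m, t))).2
  let dG : M → D.overA.F := fun m => deriv (G m) 0
  refine ⟨fun m => e.symm ⟨m, a m⟩ (dG m), ?_⟩
  filter_upwards [(hz.continuous.continuousAt (x := m₀)).eventually hd.eventually_nhds,
    (ha.continuous.continuousAt (x := m₀)).eventually
    (e.open_baseSet.mem_nhds (FiberBundle.mem_baseSet_trivializationAt' (⟨m₀, a m₀⟩ : A.Tot)))]
    with m hm (hme : (⟨m, a m⟩ : A.Tot) ∈ e.baseSet)
  have hP0 : P (m, 0) = ⟨⟨m, a m⟩, 0⟩ := by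
    have h0 : w (m, 0) = ⟨m, 0⟩ := by simp [w]
    change D.flip ⟨w (m, 0), S (w (m, 0))⟩ = _
    rw [h0, ← D.flip_zero]
    exact congrArg (fun d => D.flip ⟨⟨m, 0⟩, d⟩) (hm.self_of_nhds (D.zeroL m (a m))).symm
  have hsrc : P (m, 0) ∈ e.source := by
    rw [hP0]
    exact e.mem_source.2 hme
  have hG : ContMDiffAt (I.prod 𝓘(ℝ, ℝ)) 𝓘(ℝ, D.overA.F) ∞ (Function.uncurry G) (m, 0) := by
    have h1 := (e.contMDiffOn (IB := A.model) (n := ∞)).contMDiffAt (e.open_source.mem_nhds hsrc)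
    exact contMDiffAt_snd.comp (m, (0 : ℝ)) (h1.comp (m, (0 : ℝ)) (hP (m, 0)))
  have hG' := ContMDiffAt.mfderiv (m := ∞) G (fun _ => (0 : ℝ)) hG contMDiffAt_const (by simp)
  have hG1 : ContMDiffAt I 𝓘(ℝ, D.overA.F) ∞
      dG m := by
    have h1 : ContMDiffAt I 𝓘(ℝ, ℝ →L[ℝ] D.overA.F) ∞ (fun m => fderiv ℝ (G m) 0) m :=
      hG'.congr_of_eventuallyEq (.of_forall fun m' => mfderiv_eq_fderiv.symm.trans (congrFun
        (inTangentCoordinates_model_space (I := 𝓘(ℝ, ℝ)) (I' := 𝓘(ℝ, D.overA.F)) (fun _ => (0 : ℝ))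
        (fun x => G x 0) (fun x => mfderiv 𝓘(ℝ, ℝ) 𝓘(ℝ, D.overA.F) (G x) 0) m) m').symm)
    exact h1.clm_apply contMDiffAt_const
  constructor
  · have h2 : ContMDiffAt I (A.model.prod 𝓘(ℝ, D.overA.F)) ∞ (fun m' => ((⟨m', a m'⟩ : A.Tot),
        dG m')) m := (ha m).prodMk hG1
    have h3 := ((e.contMDiffOn_symm (IB := A.model) (n := ∞)).contMDiffAt
      (e.open_target.mem_nhds (e.mem_target.2 hme))).comp m h2
    refine h3.congr_of_eventuallyEq ?_
    filter_upwards [(ha.continuous.continuousAt (x := m)).eventually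
      (e.open_baseSet.mem_nhds hme)] with m' hm'
    exact e.mk_symm hm' _
  · have hd0 : HasDerivAt (G m) (dG m) 0 := by
      have h1 : MDifferentiableAt 𝓘(ℝ, ℝ) 𝓘(ℝ, D.overA.F) (G m) 0 :=
        (hG.comp (0 : ℝ) (contMDiffAt_const.prodMk contMDiffAt_id) :
          ContMDiffAt 𝓘(ℝ, ℝ) 𝓘(ℝ, D.overA.F) ∞ (G m) 0).mdifferentiableAt (by simp)
      exact (mdifferentiableAt_iff_differentiableAt.1 h1).hasDerivAt
    have hG0 : G m 0 = 0 := by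
      change (e (P (m, 0))).2 = 0
      rw [hP0]
      exact congrArg Prod.snd (e.zeroSection ℝ hme)
    -- The projection to `V` is linear on the fibres of `D → A`, hence that of the difference
    -- quotient of `G` is `t⁻¹ • t • s m = s m` for `t ≠ 0`, and so is that of its limit.
    have hlim := hasDerivAt_iff_tendsto_slope.1 hd0
    have hα : Filter.Tendsto (fun t => P (m, t)) (𝓝[≠] 0) (𝓝 (P (m, 0))) :=
      ((hP.continuous.comp (by fun_prop : Continuous fun t : ℝ => (m, t))).tendsto 0).mono_left
        nhdsWithin_le_nhds
    let Φ : A.Tot × D.overA.F → V.Tot := fun z =>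
      (D.flip.symm (e.toOpenPartialHomeomorph.symm z)).proj
    have hΦ : ContinuousAt Φ (⟨m, a m⟩, dG m) := by
      have h1 := e.toOpenPartialHomeomorph.symm.continuousAt (e.mem_target.2 hme :
        ((⟨m, a m⟩ : A.Tot), dG m) ∈ e.target)
      exact ((FiberBundle.continuous_proj D.overV.F D.overV.E).comp
        D.contMDiff_flip_symm.continuous).continuousAt.comp h1
    have hp : Filter.Tendsto (fun t => (P (m, t)).proj) (𝓝[≠] 0) (𝓝 ⟨m, a m⟩) := by
      have := ((FiberBundle.continuous_proj D.overA.F D.overA.E).tendsto _).comp hα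
      rwa [hP0] at this
    have hl := hΦ.tendsto.comp (hp.prodMk_nhds hlim)
    have hc : ∀ᶠ t in 𝓝[≠] (0 : ℝ), (Φ ∘ fun t => ((P (m, t)).proj, slope (G m) 0 t)) t =
        ⟨m, s m⟩ := by
      filter_upwards [hp.eventually (e.open_baseSet.mem_nhds hme), self_mem_nhdsWithin] with t h1 h2
      obtain ⟨x', hx, hx'⟩ := D.exists_flip (S (w (m, t))) rfl
      have hx1 : P (m, t) = ⟨⟨m, D.prA _ (S (w (m, t)))⟩, x'⟩ := hx
      rw [hx1] at h1
      change (D.flip.symm (e.toOpenPartialHomeomorph.symm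
        ((P (m, t)).proj, slope (G m) 0 t))).proj = _
      have h3 : slope (G m) 0 t = (e (⟨⟨m, D.prA _ (S (w (m, t)))⟩, t⁻¹ • x'⟩ : D.overA.Tot)).2 := by
        rw [slope, hG0, vsub_eq_sub, sub_zero, sub_zero]
        change t⁻¹ • (e (P (m, t))).2 = _
        rw [hx1]
        have h2 : ∀ v, (e (⟨⟨m, D.prA _ (S (w (m, t)))⟩, v⟩ : D.overA.Tot)).2 =
            e.continuousLinearMapAt ℝ _ v :=
          fun v => by rw [Trivialization.continuousLinearMapAt_apply, e.coe_linearMapAt_of_mem h1]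
        rw [h2, h2, map_smul]
      have h4 : e.toOpenPartialHomeomorph.symm ((P (m, t)).proj, slope (G m) 0 t) =
          ⟨⟨m, D.prA _ (S (w (m, t)))⟩, t⁻¹ • x'⟩ := by
        rw [h3, hx1]
        refine Eq.trans ?_ (e.toOpenPartialHomeomorph.left_inv (e.mem_source.2 h1))
        congr 1
        exact e.mk_proj_snd' (x := ⟨⟨m, D.prA _ (S (w (m, t)))⟩, t⁻¹ • x'⟩) h1
      rw [h4, D.flip_symm_proj, map_smul, hx']
      have h5 : t ≠ 0 := h2
      change (⟨m, t⁻¹ • t • s m⟩ : V.Tot) = _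
      rw [inv_smul_smul₀ h5]
    have huniq := tendsto_nhds_unique (hl.congr' hc) tendsto_const_nhds
    change (D.flip.symm (e.toOpenPartialHomeomorph.symm _)).proj = _ at huniq
    rw [← e.mk_symm hme, D.flip_symm_proj] at huniq
    exact eq_of_heq (TotalSpace.mk.inj huniq).2

lemma addA_zero {m : M} (v w : V.E m) : D.AddA ⟨⟨m, v⟩, 0⟩ ⟨⟨m, w⟩, 0⟩ ⟨⟨m, v + w⟩, 0⟩ := by
  obtain ⟨f, hf⟩ := D.exists_addA (d := (0 : D.overV.E ⟨m, v⟩)) (e := (0 : D.overV.E ⟨m, w⟩))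
    (by rw [map_zero, map_zero])
  have := D.smulV_addA 0 _ _ _ hf
  simpa [AddA, VB.smulTot] using this

lemma exists_smulA {m : M} (t : ℝ) (v : V.E m) (d : D.overV.E ⟨m, v⟩) :
    ∃ f, D.smulA t ⟨⟨m, v⟩, d⟩ = ⟨⟨m, t • v⟩, f⟩ := by
  obtain ⟨d', hd, hdv⟩ := D.exists_flip d rfl
  obtain ⟨f, hf, -⟩ := D.exists_flip_symm (t • d') (v := t • v) (by rw [map_smul, hdv])
  refine ⟨f, ?_⟩
  rw [smulA, Equiv.symm_apply_eq, hf, hd, VB.smulTot]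

lemma smulA_zero_right {m : M} (t : ℝ) (v : V.E m) :
    D.smulA t ⟨⟨m, v⟩, 0⟩ = ⟨⟨m, t • v⟩, 0⟩ := by
  obtain ⟨f, hf⟩ := D.exists_smulA t v 0
  have := D.smulV_smulA 0 t ⟨⟨m, v⟩, 0⟩
  change D.overV.smulTot 0 (D.smulA t _) = D.smulA t _ at this
  rw [hf] at this
  simpa [VB.smulTot] using this.symm

/-- There is a linear section over a section of `A` with a prescribed value. -/
theorem exists_isLinear (m₀ : M) (a₀ : A.E m₀) :
    ∃ b, D.IsLinear b ∧ ∀ v : V.E m₀, D.prA ⟨m₀, v⟩ (b ⟨m₀, v⟩) = a₀ := by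
  classical
  obtain ⟨ext, hext, hext'⟩ := A.exists_extend m₀
  obtain ⟨r, s, σ, hs, hσ, hd⟩ := V.exists_dualBasis m₀
  set a := ext a₀ with ha
  choose d hd' using fun j => D.exists_lift_along (hext a₀) (hs j) m₀
  obtain ⟨U, hU, hUo, hmU⟩ := eventually_nhds_iff.1 (hd.and (Filter.eventually_all.2 hd'))
  obtain ⟨χ, hχ, hχ1, hχU⟩ := exists_bump (I := I) (hUo.mem_nhds hmU)
  -- `β` is a right inverse of the projection to `V`; its image over `A`, seen over `V`, is the
  -- section near `m₀`, which is then cut off by `χ` along `M`.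
  let β : ∀ m, V.E m →ₗ[ℝ] D.overA.E ⟨m, a m⟩ := fun m => ∑ j, (σ j m).smulRight (d j m)
  have hβ : ∀ m ∈ U, ∀ v, D.prV ⟨m, a m⟩ (β m v) = v := fun m hm v => by
    have h1 : D.prV ⟨m, a m⟩ (β m v) = ∑ j, σ j m v • D.prV ⟨m, a m⟩ (d j m) := by simp [β]
    rw [h1]
    conv_rhs => rw [(hU m hm).1 v]
    exact Finset.sum_congr rfl fun j _ => by rw [((hU m hm).2 j).2]
  have hc : ∀ v : V.Tot, ∃ c : D.overV.E v, v.proj ∈ U →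
      D.flip ⟨v, c⟩ = ⟨⟨v.proj, a v.proj⟩, β v.proj v.2⟩ ∧ D.prA v c = a v.proj := by
    rintro ⟨m, v⟩
    by_cases hm : m ∈ U
    · obtain ⟨c, h1, h2⟩ := D.exists_flip_symm (β m v) (hβ m hm v)
      exact ⟨c, fun _ => ⟨h1, h2⟩⟩
    · exact ⟨0, fun h => absurd h hm⟩
  choose c hc using hc
  have hχ0 : ∀ m ∉ U, χ m = 0 := fun m hm => image_eq_zero_of_notMem_tsupport fun h => hm (hχU h)
  refine ⟨fun v => χ v.proj • c v, ⟨?_, fun m => χ m • a m, ?_, ?_, ?_, ?_⟩, ?_⟩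
  · refine ContMDiffOn.smul_section_of_tsupport (u := TotalSpace.proj ⁻¹' U)
      (hχ.comp (contMDiff_proj V.E)).contMDiffOn
      (hUo.preimage (FiberBundle.continuous_proj V.F V.E))
      ((tsupport_comp_subset_preimage χ (FiberBundle.continuous_proj V.F V.E)).trans
        (Set.preimage_mono hχU)) ?_
    have h1 : ContMDiffOn V.model D.overV.model ∞ (fun v : V.Tot => D.flip.symm
        (⟨⟨v.proj, a v.proj⟩, β v.proj v.2⟩ : D.overA.Tot)) (TotalSpace.proj ⁻¹' U) := by
      refine fun v hv => (ContMDiffAt.comp v D.contMDiff_flip_symm.contMDiffAt ?_).contMDiffWithinAt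
      have h2 := VB.contMDiffAt_sum_along (V := D.overA) (J := V.model) (y₀ := v)
        (p := fun v : V.Tot => (⟨v.proj, a v.proj⟩ : A.Tot)) (f := fun j v => d j v.proj)
        (c := fun j v => σ j v.proj v.2) (((hext a₀).comp (contMDiff_proj V.E)) v)
        (fun j => ContMDiffAt.comp v ((hU _ hv).2 j).1 (contMDiff_proj V.E v)) (fun j => hσ j v)
      refine h2.congr_of_eventuallyEq (.of_forall fun w => ?_)
      simp [β]
    exact h1.congr fun v hv => (D.flip.symm_apply_eq.2 (hc v hv).1.symm).symm
  · exact (hext a₀).smul hχ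
  · intro v
    by_cases hv : v.proj ∈ U
    · rw [map_smul, (hc v hv).2]
    · simp [hχ0 _ hv]
  · intro m v w
    by_cases hm : m ∈ U
    · refine D.smulV_addA (χ m) ⟨_, c ⟨m, v⟩⟩ ⟨_, c ⟨m, w⟩⟩ ⟨_, c ⟨m, v + w⟩⟩ ?_
      rw [(hc ⟨m, v⟩ hm).1, (hc ⟨m, w⟩ hm).1, (hc ⟨m, v + w⟩ hm).1]
      exact VB.addRel_mk_iff.2 (map_add _ _ _)
    · simp only [hχ0 _ hm, zero_smul]
      exact D.addA_zero v w
  · intro m t v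
    by_cases hm : m ∈ U
    · refine (D.smulV_smulA (χ m) t ⟨_, c ⟨m, v⟩⟩).symm.trans ?_
      have h1 : D.flip.symm (D.overA.smulTot t (D.flip ⟨⟨m, v⟩, c ⟨m, v⟩⟩)) =
          ⟨⟨m, t • v⟩, c ⟨m, t • v⟩⟩ := by
        rw [Equiv.symm_apply_eq, (hc ⟨m, v⟩ hm).1, (hc ⟨m, t • v⟩ hm).1]
        exact congrArg (TotalSpace.mk _) (map_smul _ _ _).symm
      rw [h1]
      rfl
    · simp only [hχ0 _ hm, zero_smul]
      exact D.smulA_zero_right t v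
  · intro v
    rw [map_smul, (hc ⟨m₀, v⟩ hmU).2, hχ1.self_of_nhds, one_smul]
    exact hext' a₀

end DVB
end Double

/-! ### Values of forms -/

section Values

variable {EB : Type v} [NormedAddCommGroup EB] [NormedSpace ℝ EB] {HB : Type w}
  [TopologicalSpace HB] {I : ModelWithCorners ℝ EB HB}
  {M : Type u} [TopologicalSpace M] [ChartedSpace HB M] {n : ℕ} {A : Fin n → VB I M}
  {EN : Type*} [NormedAddCommGroup EN] [NormedSpace ℝ EN] {HN : Type*}
  [TopologicalSpace HN] {J : ModelWithCorners ℝ EN HN} {N : Type*} [TopologicalSpace N]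
  [ChartedSpace HN N] {B : Fin n → VB J N}

/-- `evalAt l` as a linear map. -/
noncomputable def evalL {x : M} : List (Σ i, (A i).E x) → SymFib A x →ₗ[ℝ] ℝ
  | [] => (GSym.aug : SymFib A x →ₐ[ℝ] ℝ).toLinearMap
  | a :: l => evalL l ∘ₗ GSym.contract a.1 (Module.Dual.eval ℝ _ a.2)

lemma evalL_apply {x : M} (l : List (Σ i, (A i).E x)) (ξ : SymFib A x) : evalL l ξ = evalAt l ξ := by
  induction l generalizing ξ with
  | nil => rfl
  | cons a l ih => exact ih _

lemma evalAt_add {x : M} (l : List (Σ i, (A i).E x)) (ξ η : SymFib A x) :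
    evalAt l (ξ + η) = evalAt l ξ + evalAt l η := by
  simp only [← evalL_apply, map_add]

lemma evalAt_sub {x : M} (l : List (Σ i, (A i).E x)) (ξ η : SymFib A x) :
    evalAt l (ξ - η) = evalAt l ξ - evalAt l η := by
  simp only [← evalL_apply, map_sub]

lemma evalAt_smul {x : M} (l : List (Σ i, (A i).E x)) (t : ℝ) (ξ : SymFib A x) :
    evalAt l (t • ξ) = t * evalAt l ξ := by
  simp only [← evalL_apply, map_smul, smul_eq_mul]

@[simp] lemma evalAt_zero {x : M} (l : List (Σ i, (A i).E x)) : evalAt l (0 : SymFib A x) = 0 := by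
  simp only [← evalL_apply, map_zero]

/-- The values of a pulled back form. -/
lemma evalAt_map {x : M} {y : N} (f : ∀ i, (B i).E y →ₗ[ℝ] (A i).E x) (l : List (Σ i, (B i).E y))
    (ξ : SymFib A x) : evalAt l (GSym.map (fun i => (f i).dualMap) ξ : SymFib B y) =
      evalAt (l.map fun p => ⟨p.1, f p.1 p.2⟩) ξ := by
  induction l generalizing ξ with
  | nil => exact GSym.aug_map _ _
  | cons a l ih =>
    change evalAt l (GSym.contract a.1 _ _) = _
    rw [GSym.contract_map, ih]
    rfl

lemma evalAt_eq_zero_of_mem {x : M} {i : Fin n} {l : List (Σ i, (A i).E x)}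
    (h : (⟨i, 0⟩ : Σ i, (A i).E x) ∈ l) (ξ : SymFib A x) : evalAt l ξ = 0 := by
  induction l generalizing ξ with
  | nil => simp at h
  | cons a l ih =>
    rcases List.mem_cons.1 h with rfl | h
    · change evalAt l (GSym.contract i _ ξ) = 0
      rw [map_zero, GSym.contract_zero_left, evalAt_zero]
    · exact ih h _

/-- The values on a list of vectors whose total degree is not the degree of the form vanish. -/
lemma evalAt_eq_zero_of_mem_piece {x : M} {l : List (Σ i, (A i).E x)} {k : ℤ} {ξ : SymFib A x}
    (hξ : ξ ∈ GSym.piece _ k) (h : (l.map fun p => (p.1.val : ℤ) + 1).sum ≠ k) :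
    evalAt l ξ = 0 := by
  induction l generalizing ξ k with
  | nil => exact GSym.aug_of_mem_piece (fun hk => h (by simp [hk])) hξ
  | cons a l ih =>
    refine ih (GSym.contract_mem_piece _ _ hξ) fun h' => h ?_
    simp [h']

/-- A form is zero if its values on the elements of spanning sets vanish. -/
lemma eq_zero_of_evalAt {x : M} (S : ∀ i, Set ((A i).E x)) (hS : ∀ i, Submodule.span ℝ (S i) = ⊤)
    {ξ : SymFib A x}
    (h : ∀ l : List (Σ i, (A i).E x), (∀ p ∈ l, p.2 ∈ S p.1) → evalAt l ξ = 0) : ξ = 0 := by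
  refine GSym.eq_zero_of_contract_stable
    (fun ξ : SymFib A x => ∀ l : List (Σ i, (A i).E x), (∀ p ∈ l, p.2 ∈ S p.1) → evalAt l ξ = 0)
    (fun i => Module.Dual.eval ℝ _ '' S i) (fun i => ?_) (fun ξ hξ => hξ [] (by simp)) ?_ h
  · rw [← Submodule.map_span, hS, Submodule.map_top]
    exact (LinearMap.range_eq_top.2 (Module.evalEquiv ℝ ((A i).E x)).surjective)
  · rintro ξ hξ i _ ⟨a, ha, rfl⟩ l hl
    exact hξ (⟨i, a⟩ :: l) (by simpa using ⟨ha, hl⟩)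

lemma eq_of_evalAt {x : M} (S : ∀ i, Set ((A i).E x)) (hS : ∀ i, Submodule.span ℝ (S i) = ⊤)
    {ξ η : SymFib A x}
    (h : ∀ l : List (Σ i, (A i).E x), (∀ p ∈ l, p.2 ∈ S p.1) → evalAt l ξ = evalAt l η) :
    ξ = η :=
  sub_eq_zero.1 (eq_zero_of_evalAt S hS fun l hl => by rw [evalAt_sub, h l hl, sub_self])

lemma Mor.pull_par [FiniteDimensional ℝ EB] [T2Space M] [IsManifold I ∞ M] (φ : Mor B A)
    (ξ : Fun A) : φ.pull (par 1 ξ) = par 1 (φ.pull ξ) := by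
  ext y
  exact GSym.map_scale _ _ _

end Values

section Side

variable {EB : Type v} [NormedAddCommGroup EB] [NormedSpace ℝ EB] {HB : Type w}
  [TopologicalSpace HB] {I : ModelWithCorners ℝ EB HB}
  {M : Type u} [TopologicalSpace M] [ChartedSpace HB M] {n : ℕ}
  {V : VB I M} {A C : Fin n → VB I M} (D : ∀ i, DVB V (A i) (C i))

/-- The projection of `D → V` to `A → M`. -/
def projMor : Mor (fun i => (D i).overV) A where
  base := TotalSpace.proj
  contMDiff_base := contMDiff_proj V.E
  fib i v := (D i).prA v
  contMDiff_fib i := by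
    have h : (fun p : (D i).overV.Tot => (⟨p.proj.proj, (D i).prA p.proj p.2⟩ : (A i).Tot)) =
        TotalSpace.proj ∘ (D i).flip := funext fun p => ((D i).flip_proj p.proj p.2).symm
    rw [h]
    exact (contMDiff_proj (D i).overA.E).comp (D i).contMDiff_flip

/-- The zero section of `D → A`. -/
noncomputable def zeroMor : Mor A (fun i => (D i).overV) where
  base m := ⟨m, 0⟩
  contMDiff_base := contMDiff_zeroSection ℝ V.E
  fib i m := (D i).zeroL m
  contMDiff_fib i := (D i).contMDiff_zeroL

lemma projMor_pull_apply (ξ : Fun A) (v : V.Tot) :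
    ((projMor D).pull ξ).1 v = pull D v (ξ.1 v.proj) := rfl

lemma zeroMor_pull_apply (ξ : Fun fun i => (D i).overV) (m : M) : ((zeroMor D).pull ξ).1 m =
    (GSym.map (fun i => ((D i).zeroL m).dualMap) (ξ.1 ⟨m, 0⟩) : SymFib A m) := rfl

lemma map_zeroL_pull (m : M) (ξ : SymFib A m) :
    (GSym.map (fun i => ((D i).zeroL m).dualMap) (pull D ⟨m, 0⟩ ξ) : SymFib A m) = ξ := by
  rw [pull, GSym.map_map]
  exact GSym.map_id _ (fun i α => LinearMap.ext fun a => congrArg α ((D i).prA_zeroL m a)) _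

lemma zeroMor_projMor (ξ : Fun A) : (zeroMor D).pull ((projMor D).pull ξ) = ξ := by
  ext m
  rw [zeroMor_pull_apply, projMor_pull_apply]
  exact map_zeroL_pull D m _

end Side

/-! ### The Lie `n`-algebroid on the side bundle -/

section Side

variable {EB : Type v} [NormedAddCommGroup EB] [NormedSpace ℝ EB] {HB : Type w}
  [TopologicalSpace HB] {I : ModelWithCorners ℝ EB HB}
  {M : Type u} [TopologicalSpace M] [ChartedSpace HB M] {n : ℕ}
  {EN : Type*} [NormedAddCommGroup EN] [NormedSpace ℝ EN] {HN : Type*}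
  [TopologicalSpace HN] {J : ModelWithCorners ℝ EN HN} {N : Type*} [TopologicalSpace N]
  [ChartedSpace HN N]
  {V : VB I M} {A C : Fin n → VB I M} {D : ∀ i, DVB V (A i) (C i)}

lemma mvfderiv_comp_tangentMap {f : N → M} {g : M → ℝ} (z : TangentBundle J N)
    (hg : MDifferentiableAt I 𝓘(ℝ, ℝ) g (f z.proj)) (hf : MDifferentiableAt J I f z.proj) :
    mvfderiv J (fun y => g (f y)) z.proj z.2 =
      mvfderiv I g (tangentMap J I f z).proj (tangentMap J I f z).2 := by
  have := mvfderiv_comp z.proj hg hf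
  exact DFunLike.congr_fun this z.2

variable [FiniteDimensional ℝ EB] [T2Space M] [IsManifold I ∞ M]
  {QD : LieStr (fun i => (D i).overV)}

/-- The fibres of `D → V` are spanned by the values of linear sections and core sections. -/
lemma span_linear_core (D : ∀ i, DVB V (A i) (C i)) (v : V.Tot) (i : Fin n) : Submodule.span ℝ
    {d : (D i).overV.E v | ∃ b, ((D i).IsLinear b ∨ (D i).IsCore b) ∧ b v = d} = ⊤ := by
  refine eq_top_iff.2 fun d _ => ?_
  obtain ⟨b, hb, hb'⟩ := (D i).exists_isLinear v.proj ((D i).prA v d)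
  obtain ⟨c, hc, hc'⟩ := DVB.exists_isCore (D := D i) (v := v) (d := d - b v)
    (by rw [map_sub, sub_eq_zero]; exact (hb' v.2).symm)
  rw [← add_sub_cancel (b v) d, ← hc']
  exact add_mem (Submodule.subset_span ⟨b, Or.inl hb, rfl⟩)
    (Submodule.subset_span ⟨c, Or.inr hc, rfl⟩)

/-- A form of degree one takes exactly one vector, as the vectors have degree at least one. -/
lemma evalAt_eq_zero_of_length {A : Fin n → VB I M} {x : M} {ξ : SymFib A x}
    (hξ : ξ ∈ GSym.piece (fun i => Module.Dual ℝ ((A i).E x)) (0 + 1)) (l : List (Σ i, (A i).E x))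
    (hl : l.length ≠ 1) : evalAt l ξ = 0 := by
  have h : ∀ l : List ℤ, l.length ≠ 1 → (∀ x ∈ l, 1 ≤ x) → l.sum ≠ 0 + 1 := by
    rintro (- | ⟨x, - | ⟨y, l⟩⟩) h1 h2
    · simp
    · simp at h1
    · have : 0 ≤ l.sum := List.sum_nonneg fun z hz => by
        have := h2 z (by simp [hz])
        omega
      have := h2 x (by simp)
      have := h2 y (by simp)
      simp only [List.sum_cons]
      omega
  refine evalAt_eq_zero_of_mem_piece hξ (h _ (by simpa using hl) fun x hx => ?_)
  obtain ⟨p, -, rfl⟩ := List.mem_map.1 hx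
  omega

/-- The differential of a function that is constant along the fibres of `V` is given by the anchor
of `A`. -/
lemma IsVBLie.exists_anchor (hD : IsVBLie D QD) {f : M → ℝ} (hf : ContMDiff I 𝓘(ℝ, ℝ) ∞ f)
    (hf' : ContMDiff V.model 𝓘(ℝ, ℝ) ∞ fun v : V.Tot => f v.proj) :
    ∃ L : ∀ i m, (A i).E m → ℝ, (∀ i m, L i m 0 = 0) ∧ ∀ i v (d : (D i).overV.E v),
      evalAt [⟨i, d⟩] ((QD.Q (ofFun (fun i => (D i).overV) _ hf')).1 v) =
        L i v.proj ((D i).prA v d) := by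
  have key : ∀ i, ∃ L : ∀ m, (A i).E m → ℝ, (∀ m, L m 0 = 0) ∧ ∀ v (d : (D i).overV.E v),
      evalAt [⟨i, d⟩] ((QD.Q (ofFun (fun i => (D i).overV) _ hf')).1 v) =
        L v.proj ((D i).prA v d) := by
    intro i
    -- Only vectors in the bundle of degree one pair with a form of degree one.
    by_cases hi : i.val = 0
    · obtain ⟨ρ, ρA, h1, h2⟩ := hD.anchor i hi
      refine ⟨fun m a => mvfderiv I f m (ρA m a), fun m => by simp,
        fun v d => ?_⟩
      rw [h1]
      refine (mvfderiv_comp_tangentMap (f := fun v : V.Tot => v.proj) (g := f)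
        (⟨v, ρ v d⟩ : TangentBundle V.model V.Tot) (hf.mdifferentiableAt (by simp))
        ((contMDiff_proj V.E).contMDiffAt.mdifferentiableAt (n := ∞) (by simp))).trans ?_
      rw [h2.proj]
    · refine ⟨fun _ _ => 0, fun _ => rfl, fun v d => ?_⟩
      refine evalAt_eq_zero_of_mem_piece (QD.isDer.deg 0 _ (homFun_ofFun hf') v) ?_
      simpa using hi
  choose L h1 h2 using key
  exact ⟨L, h1, h2⟩

/-- The values of `Q α` on sections of `D` that project to `A`, in terms of their bracket. The
correction terms of the bracket of two sections are constant along the fibres of `V`. -/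
lemma IsBracket.eval (hD : IsVBLie D QD) {j : ℕ} {i : Fin j → Fin n}
    {a : ∀ p v, (D (i p)).overV.E v} {a' : ∀ p m, (A (i p)).E m}
    (ha' : ∀ p v, (D (i p)).prA v (a p v) = a' p v.proj) {k : Fin n} {b : ∀ v, (D k).overV.E v}
    (hb : IsBracket QD i a k b) {α : ∀ v, Module.Dual ℝ ((D k).overV.E v)}
    (hα : (D k).overV.IsForm α) {φ : Fin j → M → ℝ}
    (hφ : ∀ p v, evalAt (A := fun i => (D i).overV) [⟨i p, a p v⟩] (GSym.ι k (α v)) =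
      φ p v.proj) :
    ∃ c : M → ℝ, (∀ v, evalAt (List.ofFn fun p => (⟨i p, a p v⟩ : Σ i, (D i).overV.E v))
        ((QD.Q (ofForm (fun i => (D i).overV) k α hα)).1 v) = c v.proj - α v (b v)) ∧
      ((∀ p q, j = 2 → p ≠ q → (∀ m, a' p m = 0) ∨ ∀ m, φ q m = 0) → ∀ m, c m = 0) := by
  obtain ⟨g, hg, h⟩ := hb α hα
  have hφs : ∀ p, ContMDiff I 𝓘(ℝ, ℝ) ∞ (φ p) := fun p => by
    have h1 := (contMDiff_aug _ (g p).2).comp (contMDiff_zeroSection ℝ V.E (n := ∞) (IB := I))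
    convert h1 using 1
    ext m
    change _ = GSym.aug ((g p).1 ⟨m, 0⟩)
    rw [hg, AlgHom.commutes]
    exact (hφ p ⟨m, 0⟩).symm
  have hφ' : ∀ p, ContMDiff V.model 𝓘(ℝ, ℝ) ∞ fun v : V.Tot => φ p v.proj := fun p =>
    (hφs p).comp (contMDiff_proj V.E)
  have hg' : ∀ p, g p = ofFun (fun i => (D i).overV) _ (hφ' p) := fun p => by
    ext v
    rw [hg, hφ]
    rfl
  choose L hL0 hL using fun p => hD.exists_anchor (hφs p) (hφ' p)
  -- For `j = 2` the anchor of one of the two sections differentiates the value of `α` on the other;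
  -- for all other arities there is no such term.
  refine ⟨fun m => if j = 2 then ∑ p, ∑ q, if p = q then 0 else
    (if p < q then 1 else (-1 : ℝ) ^ (((i p).val + 1) * ((i q).val + 1))) *
      L q (i p) m (a' p m) else 0, fun v => ?_, fun h0 m => ?_⟩
  · have h1 := h v
    simp only [hg', hL, ha'] at h1
    linarith
  · have h1 : ∀ p q, j = 2 → p ≠ q → L q (i p) m (a' p m) = 0 := fun p q hj hpq => by
      rcases h0 p q hj hpq with h2 | h2
      · rw [h2, hL0]
      · have h3 : g q = 0 := by
          ext v
          rw [hg', ofFun]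
          change algebraMap ℝ _ (φ q v.proj) = 0
          rw [h2, map_zero]
        have h4 := hL q (i p) ⟨m, 0⟩ ((D (i p)).zeroL m (a' p m))
        rw [← hg', h3, map_zero, DVB.prA_zeroL] at h4
        rw [← h4]
        exact evalAt_zero _
    dsimp only
    split_ifs with hj
    · refine Finset.sum_eq_zero fun p _ => Finset.sum_eq_zero fun q _ => ?_
      split_ifs with hpq
      · rfl
      · rw [h1 p q hj hpq, mul_zero]
      · rw [h1 p q hj hpq, mul_zero]
    · rfl

/-- The values of a form pulled back from the side bundle. -/
lemma evalAt_pull (v : V.Tot) (l : List (Σ i, (D i).overV.E v)) (ξ : SymFib A v.proj) :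
    evalAt l (pull D v ξ) = evalAt (l.map fun p => ⟨p.1, (D p.1).prA v p.2⟩) ξ :=
  evalAt_map (fun i => (D i).prA v) l ξ

/-- A form on `D` is pulled back from the side bundle if its values depend only on the projections
to `A`. -/
lemma eq_pull_of_evalAt {v : V.Tot} {θ : SymFib (fun i => (D i).overV) v}
    {θ₀ : SymFib (fun i => (D i).overV) ⟨v.proj, 0⟩}
    (h : ∀ (j : ℕ) (i : Fin j → Fin n) (a : ∀ p v, (D (i p)).overV.E v),
      (∀ p, (D (i p)).IsLinear (a p) ∨ (D (i p)).IsCore (a p)) →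
      evalAt (List.ofFn fun p => (⟨i p, a p v⟩ : Σ i, (D i).overV.E v)) θ =
        evalAt (List.ofFn fun p => (⟨i p, (D (i p)).zeroL v.proj ((D (i p)).prA v (a p v))⟩ :
          Σ i, (D i).overV.E ⟨v.proj, 0⟩)) θ₀) :
    θ = pull D v (GSym.map (fun i => ((D i).zeroL v.proj).dualMap) θ₀) := by
  refine eq_of_evalAt _ (span_linear_core D v) fun l hl => ?_
  choose! b hb hb' using fun p : Fin l.length => hl (l.get p) (l.get_mem p)
  have h1 := h l.length (fun p => (l.get p).1) b hb
  have h2 : (List.ofFn fun p => (⟨(l.get p).1, b p v⟩ : Σ i, (D i).overV.E v)) = l := by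
    simp only [hb']
    exact List.ofFn_get l
  rw [h2] at h1
  rw [h1, evalAt_pull, evalAt_map (fun i => (D i).zeroL v.proj), List.map_map]
  congr 1
  conv_rhs => rw [← h2, List.map_ofFn]
  rfl

/-- Brackets of linear sections and at least one core section project to zero in `A`. -/
lemma IsVBLie.exists_bracket (hD : IsVBLie D QD) {j : ℕ} (i : Fin j → Fin n)
    (a : ∀ p v, (D (i p)).overV.E v) (ha : ∀ p, (D (i p)).IsLinear (a p) ∨ (D (i p)).IsCore (a p))
    {q : Fin j} (hq : (D (i q)).IsCore (a q)) (k : Fin n) :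
    ∃ b, (∀ v, (D k).prA v (b v) = 0) ∧ IsBracket QD i a k b := by
  classical
  let K : Finset (Fin j) := Finset.univ.filter fun p => (D (i p)).IsCore (a p)
  have hK : ∀ p, p ∉ K → (D (i p)).IsLinear (a p) := fun p hp =>
    (ha p).resolve_right fun h => hp (by simpa [K] using h)
  by_cases h2 : 2 ≤ K.card
  · exact ⟨_, fun v => map_zero _,
      hD.bracket_zero j i a K h2 hK (fun p hp => by simpa [K] using hp) k⟩
  · obtain ⟨b, hb, hb'⟩ := hD.bracket_core j i a q (fun p hp => hK p fun hpK =>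
      h2 (Finset.one_lt_card.2 ⟨p, hpK, q, by simpa [K] using hq, hp⟩)) hq k
    exact ⟨b, hb.prA_eq, hb'⟩

/-- The homological vector field of `D` maps forms that are pulled back from `A` to such forms. -/
lemma IsVBLie.Q_form (hD : IsVBLie D QD) {k : Fin n} {α : ∀ m, Module.Dual ℝ ((A k).E m)}
    (hα : (A k).IsForm α) (v : V.Tot) :
    (QD.Q ((projMor D).pull (ofForm A k α hα))).1 v =
      pull D v (((zeroMor D).pull (QD.Q ((projMor D).pull (ofForm A k α hα)))).1 v.proj) := by
  have hα' : (D k).overV.IsForm fun v => α v.proj ∘ₗ (D k).prA v :=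
    hα.comp_contMDiff ((projMor D).contMDiff_fib k)
  have e : (projMor D).pull (ofForm A k α hα) =
      ofForm (fun i => (D i).overV) k (fun v => α v.proj ∘ₗ (D k).prA v) hα' := by
    ext v
    exact GSym.map_ι _ _ _
  rw [e, zeroMor_pull_apply]
  refine eq_pull_of_evalAt fun j i a ha => ?_
  have hdeg : HomFun (k.val + 1 + 1) (QD.Q (ofForm (fun i => (D i).overV) k
      (fun v => α v.proj ∘ₗ (D k).prA v) hα')) := QD.isDer.deg _ _ (homFun_ofForm hα')
  rcases Nat.eq_zero_or_pos j with rfl | hj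
  · rw [List.ofFn_zero, List.ofFn_zero,
      evalAt_eq_zero_of_mem_piece (hdeg v) (by simp; omega),
      evalAt_eq_zero_of_mem_piece (hdeg _) (by simp; omega)]
  have ha' : ∀ p, ∃ a' : ∀ m, (A (i p)).E m, (∀ v, (D (i p)).prA v (a p v) = a' v.proj) ∧
      ((D (i p)).IsCore (a p) → ∀ m, a' m = 0) := fun p => by
    rcases ha p with h | h
    · obtain ⟨-, a', -, h1, -⟩ := h
      refine ⟨a', h1, fun h2 m => ?_⟩
      rw [← h1 ⟨m, 0⟩]
      exact h2.prA_eq _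
    · exact ⟨fun _ => 0, h.prA_eq, fun _ _ => rfl⟩
  choose a' ha1 ha0 using ha'
  have hφ : ∀ p v, evalAt (A := fun i => (D i).overV) [⟨i p, a p v⟩]
      (GSym.ι k (α v.proj ∘ₗ (D k).prA v)) = evalAt [⟨i p, a' p v.proj⟩] (GSym.ι k (α v.proj)) := by
    intro p v
    have h1 := evalAt_pull (D := D) v [⟨i p, a p v⟩] (GSym.ι k (α v.proj))
    rw [pull, GSym.map_ι] at h1
    refine h1.trans ?_
    rw [List.map_singleton, ha1]
  -- The bracket of linear sections projects to a section of `A`, on which `α` does not depend on the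
  -- point in the fibre of `V`. With a core section among the arguments both sides vanish.
  by_cases hlin : ∀ p, (D (i p)).IsLinear (a p)
  · obtain ⟨b, hb, hb'⟩ := hD.bracket_linear j i a hj hlin k
    obtain ⟨c, hc, -⟩ := hb'.eval hD ha1 hα'
      (φ := fun p m => evalAt [⟨i p, a' p m⟩] (GSym.ι k (α m))) hφ
    obtain ⟨-, b', -, hb2, -⟩ := hb
    have h1 : ∀ p, (D (i p)).zeroL v.proj ((D (i p)).prA v (a p v)) = a p ⟨v.proj, 0⟩ := fun p => by
      rw [(hlin p).eq_zero, ha1, ha1]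
    simp only [h1]
    rw [hc, hc, LinearMap.comp_apply, LinearMap.comp_apply, hb2, hb2]
  · obtain ⟨q, hq⟩ := not_forall.1 hlin
    have hq := (ha q).resolve_left hq
    obtain ⟨b, hb, hb'⟩ := hD.exists_bracket i a ha hq k
    obtain ⟨c, hc, hc0⟩ := hb'.eval hD ha1 hα'
      (φ := fun p m => evalAt [⟨i p, a' p m⟩] (GSym.ι k (α m))) hφ
    rw [hc, hc0, LinearMap.comp_apply, hb, map_zero, sub_zero,
      evalAt_eq_zero_of_mem (i := i q)]
    · refine List.mem_ofFn.2 ⟨q, ?_⟩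
      rw [hq.prA_eq, map_zero]
    -- For `j = 2` the core section is one of the two: its anchor term vanishes as it projects to
    -- zero in `A`, and `α` vanishes on it.
    · intro p r h2 hpr
      have : q = p ∨ q = r := by
        have := p.2
        have := q.2
        have := r.2
        simp only [Fin.ext_iff, ne_eq] at hpr ⊢
        omega
      rcases this with rfl | rfl
      · exact Or.inl (ha0 q hq)
      · refine Or.inr fun m => evalAt_eq_zero_of_mem (i := i q) ?_ _
        rw [ha0 q hq]
        exact List.mem_singleton_self _

/-- The homological vector field of `D` maps functions on `M` to forms pulled back from `A`, because
the anchor is a morphism over the anchor of `A`. -/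
lemma IsVBLie.Q_fun (hD : IsVBLie D QD) {f : M → ℝ} (hf : ContMDiff I 𝓘(ℝ, ℝ) ∞ f) (v : V.Tot) :
    (QD.Q ((projMor D).pull (ofFun A f hf))).1 v =
      pull D v (((zeroMor D).pull (QD.Q ((projMor D).pull (ofFun A f hf)))).1 v.proj) := by
  have hf' : ContMDiff V.model 𝓘(ℝ, ℝ) ∞ fun v : V.Tot => f v.proj := hf.comp (contMDiff_proj V.E)
  have e : (projMor D).pull (ofFun A f hf) = ofFun (fun i => (D i).overV) _ hf' := by
    ext v
    exact AlgHom.commutes (GSym.map _) _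
  rw [e, zeroMor_pull_apply]
  obtain ⟨L, -, hL⟩ := hD.exists_anchor hf hf'
  have hdeg := QD.isDer.deg _ _ (homFun_ofFun (A := fun i => (D i).overV) hf')
  refine eq_pull_of_evalAt fun j i a ha => ?_
  by_cases hj : j = 1
  · subst hj
    rw [List.ofFn_succ, List.ofFn_zero, List.ofFn_succ, List.ofFn_zero, hL, hL, DVB.prA_zeroL]
  · rw [evalAt_eq_zero_of_length (hdeg v) _ (by simpa using hj),
      evalAt_eq_zero_of_length (hdeg _) _ (by simpa using hj)]

lemma Mor.homFun_pull (φ : Mor (fun i => (D i).overV) A) {k : ℤ} {ξ : Fun A} (hξ : HomFun k ξ) :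
    HomFun k (φ.pull ξ) := fun v => GSym.map_mem_piece _ (hξ (φ.base v))

/-- The derivation of `Γ(S(A*))` induced by the homological vector field of `D`. -/
noncomputable def sideQ (QD : LieStr (fun i => (D i).overV)) : Fun A →ₗ[ℝ] Fun A :=
  (zeroMor D).pull.toLinearMap ∘ₗ QD.Q ∘ₗ (projMor D).pull.toLinearMap

lemma sideQ_apply (ξ : Fun A) :
    sideQ QD ξ = (zeroMor D).pull (QD.Q ((projMor D).pull ξ)) := rfl

/-- The pullbacks are morphisms of algebras, and `zeroMor` is a section of `projMor`. -/
lemma isDer_sideQ : IsDer 1 (sideQ QD) where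
  deg k ξ hξ m := GSym.map_mem_piece _
    (QD.isDer.deg k _ ((projMor D).homFun_pull hξ) ⟨m, 0⟩)
  leibniz k ξ η hξ := by
    rw [sideQ_apply, map_mul, QD.isDer.leibniz k _ _ ((projMor D).homFun_pull hξ), map_add,
      map_smul, map_mul, map_mul, zeroMor_projMor, zeroMor_projMor]
    rfl

lemma Q_pull_mul {ξ η : Fun A} {v : V.Tot}
    (hξ : (QD.Q ((projMor D).pull ξ)).1 v = ((projMor D).pull (sideQ QD ξ)).1 v)
    (hη : (QD.Q ((projMor D).pull η)).1 v = ((projMor D).pull (sideQ QD η)).1 v) :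
    (QD.Q ((projMor D).pull (ξ * η))).1 v = ((projMor D).pull (sideQ QD (ξ * η))).1 v := by
  have h1 : QD.Q ((projMor D).pull (ξ * η)) = QD.Q ((projMor D).pull ξ) * (projMor D).pull η +
      par 1 ((projMor D).pull ξ) * QD.Q ((projMor D).pull η) := by
    rw [map_mul]
    exact QD.isDer.leibniz_par _ _
  have h2 : (projMor D).pull (sideQ QD (ξ * η)) =
      (projMor D).pull (sideQ QD ξ) * (projMor D).pull η +
        par 1 ((projMor D).pull ξ) * (projMor D).pull (sideQ QD η) := by
    rw [(isDer_sideQ (QD := QD)).leibniz_par, map_add, map_mul, map_mul]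
    exact congrArg (fun x => _ + x * _) (Mor.pull_par _ _)
  rw [h1, h2]
  exact congrArg₂ (· + ·) (congrArg (· * _) hξ) (congrArg (_ * ·) hη)

/-- Both sides are local and satisfy the same Leibniz rule, hence it suffices to compare them on
functions and forms. -/
lemma IsVBLie.Q_pull_apply (hD : IsVBLie D QD) (ξ : Fun A) (v : V.Tot) :
    (QD.Q ((projMor D).pull ξ)).1 v = ((projMor D).pull (sideQ QD ξ)).1 v := by
  obtain ⟨p, hp, h⟩ := ξ.2 v.proj
  have key : ∃ hp : p ∈ Fun A,
      (QD.Q ((projMor D).pull ⟨p, hp⟩)).1 v = ((projMor D).pull (sideQ QD ⟨p, hp⟩)).1 v := by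
    clear h
    induction hp using polyFun_induction with
    | hf f hf => exact ⟨baseFun_mem_Fun hf, hD.Q_fun hf v⟩
    | hα i α hα => exact ⟨formFun_mem_Fun hα, hD.Q_form hα v⟩
    | hadd ξ η _ _ h1 h2 =>
      obtain ⟨h1, h1'⟩ := h1
      obtain ⟨h2, h2'⟩ := h2
      refine ⟨add_mem h1 h2, ?_⟩
      have : (⟨ξ + η, add_mem h1 h2⟩ : Fun A) = ⟨ξ, h1⟩ + ⟨η, h2⟩ := rfl
      rw [this, map_add, map_add, map_add, map_add]
      exact congrArg₂ (· + ·) h1' h2'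
    | hmul ξ η _ _ h1 h2 =>
      obtain ⟨h1, h1'⟩ := h1
      obtain ⟨h2, h2'⟩ := h2
      refine ⟨mul_mem h1 h2, ?_⟩
      have : (⟨ξ * η, mul_mem h1 h2⟩ : Fun A) = ⟨ξ, h1⟩ * ⟨η, h2⟩ := rfl
      rw [this]
      exact Q_pull_mul h1' h2'
  obtain ⟨hp, hp'⟩ := key
  have h1 : ∀ᶠ w : V.Tot in 𝓝 v, ((projMor D).pull ξ).1 w = ((projMor D).pull ⟨p, hp⟩).1 w := by
    filter_upwards [(FiberBundle.continuous_proj V.F V.E).continuousAt.eventually h] with w hw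
    rw [projMor_pull_apply, projMor_pull_apply, hw]
  rw [QD.isDer.congr h1, hp', projMor_pull_apply, projMor_pull_apply,
    (isDer_sideQ (QD := QD)).congr (η := ⟨p, hp⟩) h]

/-- The Lie `n`-algebroid on the side bundle of a VB-Lie `n`-algebroid. -/
noncomputable def IsVBLie.side (hD : IsVBLie D QD) : LieStr A where
  Q := sideQ QD
  isDer := isDer_sideQ
  sq ξ := by
    have h : (projMor D).pull (sideQ QD ξ) = QD.Q ((projMor D).pull ξ) :=
      Fun.ext fun v => (hD.Q_pull_apply ξ v).symm
    rw [sideQ_apply, h, QD.sq, map_zero]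

lemma IsVBLie.Q_pull (hD : IsVBLie D QD) (ξ : Fun A) :
    QD.Q ((projMor D).pull ξ) = (projMor D).pull (hD.side.Q ξ) :=
  Fun.ext (hD.Q_pull_apply ξ)

lemma IsVBLie.isSide (hD : IsVBLie D QD) : IsSide D QD hD.side := fun ξ =>
  ⟨(projMor D).pull ξ, fun _ => rfl, hD.Q_pull_apply ξ⟩

/-- The structure on the side bundle is unique, because the zero section makes the pullback along the
projection injective. -/
lemma IsVBLie.eq_side (hD : IsVBLie D QD) {QA : LieStr A} (h : IsSide D QD QA) : QA = hD.side := by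
  have h1 : QA.Q = hD.side.Q := by
    ext1 ξ
    obtain ⟨ζ, h1, h2⟩ := h ξ
    have e : ζ = (projMor D).pull ξ := Fun.ext h1
    have h3 : (projMor D).pull (QA.Q ξ) = (projMor D).pull (hD.side.Q ξ) := by
      rw [← hD.Q_pull, ← e]
      exact Fun.ext fun v => (h2 v).symm
    rw [← zeroMor_projMor D (QA.Q ξ), h3, zeroMor_projMor]
  rcases QA with ⟨Q, h2, h3⟩
  dsimp only at h1
  subst h1
  rfl

end Side

/-! ### Smoothness of decompositions -/

section Double

variable {EB : Type v} [NormedAddCommGroup EB] [NormedSpace ℝ EB] {HB : Type w}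
  [TopologicalSpace HB] {I : ModelWithCorners ℝ EB HB}
  {M : Type u} [TopologicalSpace M] [ChartedSpace HB M]
  {EN : Type*} [NormedAddCommGroup EN] [NormedSpace ℝ EN] {HN : Type*}
  [TopologicalSpace HN] {J : ModelWithCorners ℝ EN HN} {N : Type*} [TopologicalSpace N]
  [ChartedSpace HN N]

section Prod

variable {F₁ F₂ : Type*} [NormedAddCommGroup F₁] [NormedSpace ℝ F₁] [NormedAddCommGroup F₂]
  [NormedSpace ℝ F₂] {E₁ E₂ : M → Type*} [∀ x, AddCommGroup (E₁ x)] [∀ x, Module ℝ (E₁ x)]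
  [∀ x, AddCommGroup (E₂ x)] [∀ x, Module ℝ (E₂ x)]
  [∀ x, TopologicalSpace (E₁ x)] [∀ x, TopologicalSpace (E₂ x)]
  [TopologicalSpace (TotalSpace F₁ E₁)] [TopologicalSpace (TotalSpace F₂ E₂)]
  [FiberBundle F₁ E₁] [FiberBundle F₂ E₂] [VectorBundle ℝ F₁ E₁] [VectorBundle ℝ F₂ E₂]
  [ContMDiffVectorBundle ∞ F₁ E₁ I] [ContMDiffVectorBundle ∞ F₂ E₂ I] [IsManifold I ∞ M]

/-- A map to the total space of a Whitney sum is smooth if its two components are. -/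
lemma contMDiff_prodMk_totalSpace {p : N → M} {v : ∀ y, E₁ (p y)} {w : ∀ y, E₂ (p y)} :
    ContMDiff J (I.prod 𝓘(ℝ, F₁ × F₂)) ∞
        (fun y => (⟨p y, (v y, w y)⟩ : TotalSpace (F₁ × F₂) (E₁ ×ᵇ E₂))) ↔
      ContMDiff J (I.prod 𝓘(ℝ, F₁)) ∞ (fun y => (⟨p y, v y⟩ : TotalSpace F₁ E₁)) ∧
      ContMDiff J (I.prod 𝓘(ℝ, F₂)) ∞ (fun y => (⟨p y, w y⟩ : TotalSpace F₂ E₂)) := by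
  constructor
  · refine fun h => ⟨fun y => ?_, fun y => ?_⟩
    · have h1 := contMDiffAt_totalSpace.1 (h y)
      exact contMDiffAt_totalSpace.2 ⟨h1.1,
        (ContinuousLinearMap.fst ℝ F₁ F₂).contMDiff.contMDiffAt.comp y h1.2⟩
    · have h1 := contMDiffAt_totalSpace.1 (h y)
      exact contMDiffAt_totalSpace.2 ⟨h1.1,
        (ContinuousLinearMap.snd ℝ F₁ F₂).contMDiff.contMDiffAt.comp y h1.2⟩
  · refine fun h y => ?_
    have h1 := contMDiffAt_totalSpace.1 (h.1 y)
    have h2 := contMDiffAt_totalSpace.1 (h.2 y)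
    exact contMDiffAt_totalSpace.2 ⟨h1.1, h1.2.prodMk_space h2.2⟩

end Prod

variable {V A C : VB I M} {D : DVB V A C} [FiniteDimensional ℝ EB] [T2Space M] [IsManifold I ∞ M]

namespace DVB.Decomposition

variable (h : D.Decomposition)

/-- The horizontal lift along a map is smooth. -/
lemma contMDiff_lift {p : N → M} {v : ∀ y, V.E (p y)} {a : ∀ y, A.E (p y)}
    (hv : ContMDiff J V.model ∞ fun y => (⟨p y, v y⟩ : V.Tot))
    (ha : ContMDiff J A.model ∞ fun y => (⟨p y, a y⟩ : A.Tot)) :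
    ContMDiff J D.overV.model ∞
      fun y => (⟨⟨p y, v y⟩, h.lift ⟨p y, v y⟩ (a y)⟩ : D.overV.Tot) := by
  have hp : ContMDiff J I ∞ p := (contMDiff_proj V.E).comp hv
  have hc : ContMDiff J C.model ∞ fun y => (⟨p y, 0⟩ : C.Tot) :=
    (contMDiff_zeroSection ℝ C.E).comp hp
  exact h.contMDiff_equiv.comp (contMDiff_prodMk_totalSpace.2
    ⟨hv, contMDiff_prodMk_totalSpace.2 ⟨ha, hc⟩⟩)

lemma contMDiff_corePart : ContMDiff D.overV.model C.model ∞
    fun d : D.overV.Tot => (⟨d.proj.proj, h.corePart d.proj d.2⟩ : C.Tot) :=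
  (contMDiff_prodMk_totalSpace.1 (contMDiff_prodMk_totalSpace.1 h.contMDiff_symm).2).2

/-- The horizontal lift of a section of `A` is a linear section. -/
lemma isLinear_lift {a : ∀ m, A.E m} (ha : A.IsSec a) :
    D.IsLinear fun v => h.lift v (a v.proj) := by
  refine ⟨h.contMDiff_lift contMDiff_id (ha.comp (contMDiff_proj V.E)), a, ha, fun v =>
    h.prA_lift v _, fun m v w => ?_, fun m t v => ?_⟩
  · have := h.add m (a m) v w 0 0
    rwa [add_zero] at this
  · have := h.smul m (a m) t v 0
    rwa [smul_zero] at this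

lemma isCore_equiv {c : ∀ m, C.E m} (hc : C.IsSec c) :
    D.IsCore fun v => h.equiv v (0, c v.proj) :=
  ⟨c, hc, fun v => h.coreLift_equiv v _⟩

lemma isForm_corePart {γ : ∀ m, Module.Dual ℝ (C.E m)} (hγ : C.IsForm γ) :
    D.overV.IsForm fun v => γ v.proj ∘ₗ h.corePart v :=
  hγ.comp_contMDiff h.contMDiff_corePart

end DVB.Decomposition

end Double

/-! ### Fibrewise linear functions on `D` -/

section FibLinear

variable {EB : Type v} [NormedAddCommGroup EB] [NormedSpace ℝ EB] {HB : Type w}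
  [TopologicalSpace HB] {I : ModelWithCorners ℝ EB HB}
  {M : Type u} [TopologicalSpace M] [ChartedSpace HB M] {n : ℕ}
  {V : VB I M} {A C : Fin n → VB I M} {D : ∀ i, DVB V (A i) (C i)}
  (h : ∀ i, (D i).Decomposition)

/-- The pullback of forms along the horizontal lift `A → D` at `v`. -/
noncomputable def liftPull (v : V.Tot) :
    SymFib (fun i => (D i).overV) v →ₐ[ℝ] SymFib A v.proj :=
  GSym.map (fun i => ((h i).lift v).dualMap)

/-- The contraction with the element of `D` over `v` obtained from a core element. -/
noncomputable def coreContract (v : V.Tot) (i : Fin n) (c : (C i).E v.proj) :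
    SymFib (fun i => (D i).overV) v →ₗ[ℝ] SymFib (fun i => (D i).overV) v :=
  GSym.contract i (Module.Dual.eval ℝ _ ((h i).equiv v (0, c)))

/-- Evaluation of the component in `V*` on an element of `V`. -/
noncomputable def ctV (A C : Fin n → VB I M) {m : M} (v : V.E m) :
    ModFib A (gradedDual V C) m →ₗ[ℝ] SymFib A m :=
  ct A (gradedDual V C) (Module.Dual.eval ℝ (V.E m) v ∘ₗ LinearMap.fst ℝ (Module.Dual ℝ (V.E m))
    (∀ i, Module.Dual ℝ ((C i).E m)))

/-- Evaluation of the component in `(C i)*` on an element of `C i`. -/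
noncomputable def ctC (V : VB I M) (A C : Fin n → VB I M) {m : M} (i : Fin n) (c : (C i).E m) :
    ModFib A (gradedDual V C) m →ₗ[ℝ] SymFib A m :=
  ct A (gradedDual V C) (Module.Dual.eval ℝ ((C i).E m) c ∘ₗ LinearMap.proj i ∘ₗ
    LinearMap.snd ℝ (Module.Dual ℝ (V.E m)) (∀ i, Module.Dual ℝ ((C i).E m)))

lemma ctV_tmul {m : M} (v : V.E m) (ξ : SymFib A m) (e : (gradedDual V C).Fib m) :
    ctV A C v (ξ ⊗ₜ[ℝ] e) = e.1 v • ξ := ct_tmul _ _ _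

lemma ctC_tmul {m : M} (i : Fin n) (c : (C i).E m) (ξ : SymFib A m) (e : (gradedDual V C).Fib m) :
    ctC V A C i c (ξ ⊗ₜ[ℝ] e) = e.2 i c • ξ := ct_tmul _ _ _

/-- An element of `S(A*) ⊗ (V* ⊕ C*)` is determined by its evaluations. -/
lemma eq_of_ctV_ctC {m : M} {y z : ModFib A (gradedDual V C) m}
    (hV : ∀ v, ctV A C v y = ctV A C v z) (hC : ∀ i c, ctC V A C i c y = ctC V A C i c z) :
    y = z := by
  let b := Module.finBasis ℝ (V.E m)
  let b' := fun i => Module.finBasis ℝ ((C i).E m)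
  have hb : ∀ w : Module.Dual ℝ (V.E m), w = ∑ j, Module.Dual.eval ℝ _ (b j) w • b.coord j :=
    fun w => (b.ext fun j => by simp)
  have hb' : ∀ i, ∀ w : Module.Dual ℝ ((C i).E m),
      w = ∑ j, Module.Dual.eval ℝ _ (b' i j) w • (b' i).coord j :=
    fun i w => ((b' i).ext fun j => by simp)
  have key := Graded.eq_sum_of_parts (W := gradedDual V C) (x := m) hb hb'
  rw [eq_sum_ct (A := A) (W := gradedDual V C) key y, eq_sum_ct (A := A) (W := gradedDual V C) key z]
  refine Finset.sum_congr rfl fun j _ => ?_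
  rcases j with j | ⟨i, j⟩
  · exact congrArg (· • _) (hV (b j))
  · exact congrArg (· • _) (hC i (b' i j))

lemma liftPull_pull (v : V.Tot) (ξ : SymFib A v.proj) : liftPull h v (pull D v ξ) = ξ := by
  rw [pull, liftPull, GSym.map_map]
  exact GSym.map_id _ (fun i α => LinearMap.ext fun a => congrArg α ((h i).prA_lift v a)) _

lemma coreContract_pull (v : V.Tot) (i : Fin n) (c : (C i).E v.proj) (ξ : SymFib A v.proj) :
    coreContract h v i c (pull D v ξ) = 0 := by
  rw [pull, coreContract, GSym.contract_map]
  have : Module.Dual.eval ℝ _ ((h i).equiv v (0, c)) ∘ₗ ((D i).prA v).dualMap = 0 := by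
    ext α
    change α ((D i).prA v ((h i).equiv v (0, c))) = 0
    rw [(h i).prA_equiv, map_zero]
  rw [this, GSym.contract_zero_left, map_zero]

lemma toFun_tmul (v : V.Tot) (ξ : SymFib A v.proj) (e : (gradedDual V C).Fib v.proj) :
    toFun h v (ξ ⊗ₜ[ℝ] e) = pull D v ξ * (algebraMap ℝ _ (e.1 v.2) +
      ∑ i, GSym.ι i (e.2 i ∘ₗ (h i).corePart v)) := by
  rw [toFun, extendMul_tmul]
  congr 1
  simp only [LinearMap.add_apply, LinearMap.sum_apply]
  rfl

lemma toFun_smul (v : V.Tot) (ξ : SymFib A v.proj) (y : ModFib A (gradedDual V C) v.proj) :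
    toFun h v (ξ • y) = pull D v ξ * toFun h v y := extendMul_smul _ _ _ _

lemma liftPull_toFun (v : V.Tot) (y : ModFib A (gradedDual V C) v.proj) :
    liftPull h v (toFun h v y) = ctV A C v.2 y := by
  induction y using TensorProduct.induction_on with
  | zero => simp
  | add y z hy hz => rw [map_add, map_add, map_add, hy, hz]
  | tmul ξ e =>
    rw [toFun_tmul, map_mul, liftPull_pull, map_add, AlgHom.commutes, map_sum, ctV_tmul]
    have : ∀ i, liftPull h v (GSym.ι i (e.2 i ∘ₗ (h i).corePart v)) = 0 := fun i => by
      rw [liftPull, GSym.map_ι]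
      refine (congrArg (GSym.ι i) (LinearMap.ext fun a => ?_)).trans (map_zero _)
      exact (congrArg (e.2 i) ((h i).corePart_lift v a)).trans (map_zero _)
    rw [Finset.sum_eq_zero fun i _ => this i, add_zero, ← Algebra.commutes, Algebra.smul_def]

/-- The component of a section in `C*` is the contraction of the associated function with core
elements, up to the sign for moving the contraction past the coefficient in `S(A*)`. -/
lemma coreContract_toFun (v : V.Tot) (i : Fin n) (c : (C i).E v.proj)
    (y : ModFib A (gradedDual V C) v.proj) : coreContract h v i c (toFun h v y) =
      pull D v ((GSym.parity ^ (i.val + 1) : SymFib A v.proj →ₐ[ℝ] _) (ctC V A C i c y)) := by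
  induction y using TensorProduct.induction_on with
  | zero => simp
  | add y z hy hz => rw [map_add, map_add, map_add, map_add, map_add, hy, hz]
  | tmul ξ e =>
    rw [toFun_tmul, ctC_tmul, coreContract, GSym.contract_mul]
    have h1 := coreContract_pull h v i c ξ
    rw [coreContract] at h1
    rw [h1, zero_mul, zero_add, map_add, GSym.contract_algebraMap, zero_add, map_sum,
      Finset.sum_eq_single i, GSym.contract_ι_self, map_smul, map_smul]
    · have h2 : Module.Dual.eval ℝ _ ((h i).equiv v (0, c)) (e.2 i ∘ₗ (h i).corePart v) =
          e.2 i c := by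
        change e.2 i ((h i).corePart v ((h i).equiv v (0, c))) = _
        rw [(h i).corePart_equiv]
      rw [h2, ← Algebra.commutes, ← Algebra.smul_def, GSym.scale_apply_pow_parity,
        GSym.scale_apply_pow_parity, pull, GSym.map_scale]
    · exact fun j _ hj => GSym.contract_ι_of_ne hj _ _
    · exact fun hi => absurd (Finset.mem_univ i) hi

/-- The fibres of `D → V` are spanned by horizontal lifts and core elements. -/
lemma span_lift_core (v : V.Tot) (i : Fin n) : Submodule.span ℝ
    ({d : (D i).overV.E v | (∃ a, d = (h i).lift v a) ∨ ∃ c, d = (h i).equiv v (0, c)}) = ⊤ := by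
  refine eq_top_iff.2 fun d _ => ?_
  rw [← (h i).equiv_prA_corePart v d, (h i).equiv_apply]
  exact add_mem (Submodule.subset_span (Or.inl ⟨_, rfl⟩)) (Submodule.subset_span (Or.inr ⟨_, rfl⟩))

/-- A form on `D` is zero if its horizontal part and its contractions with core elements vanish. -/
lemma eq_zero_of_liftPull_coreContract {v : V.Tot} {θ : SymFib (fun i => (D i).overV) v}
    (h1 : liftPull h v θ = 0) (h2 : ∀ i c, coreContract h v i c θ = 0) : θ = 0 := by
  refine GSym.eq_zero_of_contract_stable (fun θ : SymFib (fun i => (D i).overV) v =>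
      liftPull h v θ = 0 ∧ ∀ i c, coreContract h v i c θ = 0)
    (fun i => Module.Dual.eval ℝ _ '' {d : (D i).overV.E v | (∃ a, d = (h i).lift v a) ∨
      ∃ c, d = (h i).equiv v (0, c)}) (fun i => ?_) (fun θ hθ => ?_) ?_ ⟨h1, h2⟩
  · rw [← Submodule.map_span, span_lift_core h v i, Submodule.map_top]
    exact (LinearMap.range_eq_top.2 (Module.evalEquiv ℝ ((D i).overV.E v)).surjective)
  · have := GSym.aug_map (fun i => ((h i).lift v).dualMap) θ
    exact this.symm.trans ((congrArg GSym.aug hθ.1).trans (map_zero _))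
  · rintro θ ⟨h1, h2⟩ i _ ⟨_, ⟨a, rfl⟩ | ⟨c, rfl⟩, rfl⟩
    · refine ⟨?_, fun j c => ?_⟩
      · have := GSym.contract_map (fun i => ((h i).lift v).dualMap) i
          (Module.Dual.eval ℝ ((A i).E v.proj) a) θ
        refine this.symm.trans ?_
        change GSym.contract i _ (liftPull h v θ) = 0
        rw [h1, map_zero]
      · have := h2 j c
        rw [coreContract] at this ⊢
        rw [GSym.contract_contract, this, map_zero, smul_zero]
    · have h3 : GSym.contract i (Module.Dual.eval ℝ _ ((h i).equiv v (0, c))) θ = 0 := h2 i c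
      rw [h3]
      exact ⟨map_zero _, fun _ _ => map_zero _⟩

lemma eq_of_liftPull_coreContract {v : V.Tot} {θ θ' : SymFib (fun i => (D i).overV) v}
    (h1 : liftPull h v θ = liftPull h v θ')
    (h2 : ∀ i c, coreContract h v i c θ = coreContract h v i c θ') : θ = θ' :=
  sub_eq_zero.1 (eq_zero_of_liftPull_coreContract h (by rw [map_sub, h1, sub_self])
    fun i c => by rw [map_sub, h2, sub_self])

/-- An element of `S(A*) ⊗ (V* ⊕ C*)` is determined by the associated function on `D`. -/
lemma eq_of_toFun {m : M} {y z : ModFib A (gradedDual V C) m}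
    (hyz : ∀ v : V.E m, toFun h ⟨m, v⟩ y = toFun h ⟨m, v⟩ z) : y = z := by
  refine eq_of_ctV_ctC (fun v => ?_) fun i c => ?_
  · have h1 := congrArg (liftPull h ⟨m, v⟩) (hyz v)
    rwa [liftPull_toFun, liftPull_toFun] at h1
  · have h1 := congrArg (fun θ => (GSym.parity ^ (i.val + 1) : SymFib A m →ₐ[ℝ] _)
      (liftPull h ⟨m, 0⟩ (coreContract h ⟨m, 0⟩ i c θ))) (hyz 0)
    dsimp only at h1
    rw [coreContract_toFun, coreContract_toFun, liftPull_pull, liftPull_pull] at h1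
    rw [← GSym.parity_pow_parity_pow (i.val + 1) (ctC V A C i c y), h1, GSym.parity_pow_parity_pow]

/-- A function on `D` is fibrewise linear over `A` if its horizontal part is linear along the fibres
of `V`, its contraction with one core element is constant along the fibres of `V`, and its
contraction with two core elements vanishes. -/
structure IsFibLinear (ζ : ∀ v, SymFib (fun i => (D i).overV) v) : Prop where
  add : ∀ m (v w : V.E m), liftPull h ⟨m, v + w⟩ (ζ ⟨m, v + w⟩) =
    liftPull h ⟨m, v⟩ (ζ ⟨m, v⟩) + liftPull h ⟨m, w⟩ (ζ ⟨m, w⟩)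
  smul : ∀ m (t : ℝ) (v : V.E m), liftPull h ⟨m, t • v⟩ (ζ ⟨m, t • v⟩) =
    t • liftPull h ⟨m, v⟩ (ζ ⟨m, v⟩)
  const : ∀ m (v : V.E m) i (c : (C i).E m),
    liftPull h ⟨m, v⟩ (coreContract h ⟨m, v⟩ i c (ζ ⟨m, v⟩)) =
      liftPull h ⟨m, 0⟩ (coreContract h ⟨m, 0⟩ i c (ζ ⟨m, 0⟩))
  core_core : ∀ v i (c : (C i).E v.proj) j (c' : (C j).E v.proj),
    coreContract h v j c' (coreContract h v i c (ζ v)) = 0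

variable {h}

/-- The element of `S(A*) ⊗ (V* ⊕ C*)` from which a fibrewise linear function on `D` arises. -/
lemma IsFibLinear.exists_toFun_of_frame {ζ : ∀ v, SymFib (fun i => (D i).overV) v}
    (hζ : IsFibLinear h ζ) {m : M} {r : ℕ} {s : Fin r → V.E m} {σ : Fin r → Module.Dual ℝ (V.E m)}
    (hs : ∀ v, v = ∑ b, σ b v • s b) {k : Fin n → ℕ} {c : ∀ i, Fin (k i) → (C i).E m}
    {γ : ∀ i, Fin (k i) → Module.Dual ℝ ((C i).E m)} (hc : ∀ i v, v = ∑ b, γ i b v • c i b)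
    (v : V.E m) : ζ ⟨m, v⟩ = toFun h ⟨m, v⟩
      (∑ b, liftPull h ⟨m, s b⟩ (ζ ⟨m, s b⟩) ⊗ₜ[ℝ] ((σ b, 0) : (gradedDual V C).Fib m) +
        ∑ i, ∑ b, (GSym.parity ^ (i.val + 1) : SymFib A m →ₐ[ℝ] _)
          (liftPull h ⟨m, 0⟩ (coreContract h ⟨m, 0⟩ i (c i b) (ζ ⟨m, 0⟩))) ⊗ₜ[ℝ]
            ((0, Pi.single i (γ i b)) : (gradedDual V C).Fib m)) := by
  refine eq_of_liftPull_coreContract h ?_ fun i c₀ => ?_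
  -- The horizontal part is a linear map of `v`, and is expanded in the frame `s`.
  · let L : V.E m →ₗ[ℝ] SymFib A m :=
      { toFun := fun v => liftPull h ⟨m, v⟩ (ζ ⟨m, v⟩)
        map_add' := hζ.add m
        map_smul' := hζ.smul m }
    rw [liftPull_toFun, map_add, map_sum, map_sum]
    rw [Finset.sum_eq_zero (s := Finset.univ) (f := fun i => ctV A C v (∑ b, _ ⊗ₜ[ℝ] _)), add_zero]
    · change L v = _
      conv_lhs => rw [hs v]
      rw [map_sum]
      refine Finset.sum_congr rfl fun b _ => ?_
      rw [map_smul, ctV_tmul]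
      rfl
    · intro i _
      rw [map_sum]
      refine Finset.sum_eq_zero fun b _ => ?_
      rw [ctV_tmul]
      exact zero_smul ℝ _
  -- The contraction with a core element has no further contractions with core elements, hence it is
  -- pulled back from `A`; it does not depend on `v`, and is expanded in the frame `c`.
  · rw [coreContract_toFun]
    have h1 : ctC V A C i c₀ (∑ b, liftPull h ⟨m, s b⟩ (ζ ⟨m, s b⟩) ⊗ₜ[ℝ]
        ((σ b, 0) : (gradedDual V C).Fib m)) = 0 := by
      rw [map_sum]
      refine Finset.sum_eq_zero fun b _ => ?_
      rw [ctC_tmul]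
      exact zero_smul ℝ _
    let K : (C i).E m →ₗ[ℝ] SymFib A m :=
      (liftPull h ⟨m, 0⟩).toLinearMap ∘ₗ (GSym.contractL i).flip (ζ ⟨m, 0⟩) ∘ₗ
        Module.Dual.eval ℝ ((D i).overV.E ⟨m, 0⟩) ∘ₗ ((h i).equiv ⟨m, 0⟩).toLinearMap ∘ₗ
          LinearMap.inr ℝ ((A i).E m) ((C i).E m)
    have hK : ∀ c, K c = liftPull h ⟨m, 0⟩ (coreContract h ⟨m, 0⟩ i c (ζ ⟨m, 0⟩)) := fun _ => rfl
    have h2 : ctC V A C i c₀ (∑ i, ∑ b, (GSym.parity ^ (i.val + 1) : SymFib A m →ₐ[ℝ] _)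
          (liftPull h ⟨m, 0⟩ (coreContract h ⟨m, 0⟩ i (c i b) (ζ ⟨m, 0⟩))) ⊗ₜ[ℝ]
            ((0, Pi.single i (γ i b)) : (gradedDual V C).Fib m)) =
        (GSym.parity ^ (i.val + 1) : SymFib A m →ₐ[ℝ] _) (K c₀) := by
      rw [map_sum, Finset.sum_eq_single i]
      · conv_rhs => rw [hc i c₀]
        rw [map_sum, map_sum, map_sum]
        refine Finset.sum_congr rfl fun b _ => ?_
        rw [ctC_tmul, map_smul, map_smul, hK]
        change (Pi.single i (γ i b) : ∀ i, Module.Dual ℝ ((C i).E m)) i c₀ • _ = _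
        rw [Pi.single_eq_same]
      · intro j _ hj
        rw [map_sum]
        refine Finset.sum_eq_zero fun b _ => ?_
        rw [ctC_tmul]
        change (Pi.single j (γ j b) : ∀ i, Module.Dual ℝ ((C i).E m)) i c₀ • _ = _
        rw [Pi.single_eq_of_ne hj.symm]
        exact zero_smul ℝ _
      · exact fun hi => absurd (Finset.mem_univ i) hi
    have h3 : coreContract h ⟨m, v⟩ i c₀ (ζ ⟨m, v⟩) = pull D ⟨m, v⟩ (K c₀) :=
      eq_of_liftPull_coreContract h ((hζ.const m v i c₀).trans (liftPull_pull h ⟨m, v⟩ _).symm)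
        fun j c' => (hζ.core_core ⟨m, v⟩ i c₀ j c').trans (coreContract_pull h ⟨m, v⟩ j c' _).symm
    rw [h3, map_add, h1, h2, zero_add, GSym.parity_pow_parity_pow]

end FibLinear

section FibLinear

variable {EB : Type v} [NormedAddCommGroup EB] [NormedSpace ℝ EB] {HB : Type w}
  [TopologicalSpace HB] {I : ModelWithCorners ℝ EB HB}
  {M : Type u} [TopologicalSpace M] [ChartedSpace HB M] {n : ℕ}
  {V : VB I M} {A C : Fin n → VB I M} {D : ∀ i, DVB V (A i) (C i)}
  (h : ∀ i, (D i).Decomposition)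
  [FiniteDimensional ℝ EB] [T2Space M] [IsManifold I ∞ M]

/-- The horizontal lift `A → D` along a section of `V`. -/
noncomputable def liftMor {e : ∀ m, V.E m} (he : V.IsSec e) : Mor A (fun i => (D i).overV) where
  base m := ⟨m, e m⟩
  contMDiff_base := he
  fib i m := (h i).lift ⟨m, e m⟩
  contMDiff_fib i := (h i).contMDiff_lift (p := fun a : (A i).Tot => a.proj) (v := fun a => e a.proj)
    (a := fun a => a.2) (ContMDiff.comp (g := fun m => (⟨m, e m⟩ : V.Tot)) he
      (contMDiff_proj (A i).E)) contMDiff_id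

lemma liftMor_pull_apply {e : ∀ m, V.E m} (he : V.IsSec e) (ζ : Fun fun i => (D i).overV) (m : M) :
    ((liftMor h he).pull ζ).1 m = liftPull h ⟨m, e m⟩ (ζ.1 ⟨m, e m⟩) := rfl

lemma isSec_core {i : Fin n} {c : ∀ m, (C i).E m} (hc : (C i).IsSec c) :
    (D i).overV.IsSec fun v => (h i).equiv v (0, c v.proj) :=
  (h i).contMDiff_equiv.comp (contMDiff_prodMk_totalSpace.2 ⟨contMDiff_id,
    contMDiff_prodMk_totalSpace.2 ⟨(contMDiff_zeroSection ℝ (A i).E).comp (contMDiff_proj V.E),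
      hc.comp (contMDiff_proj V.E)⟩⟩)

lemma isSmooth_inl {ψ : ∀ m, Module.Dual ℝ (V.E m)} (hψ : V.IsForm ψ) :
    (gradedDual V C).IsSmooth fun m => (ψ m, 0) := ⟨hψ, fun i => VB.IsForm.zero (C i)⟩

lemma isSmooth_single {i : Fin n} {γ : ∀ m, Module.Dual ℝ ((C i).E m)} (hγ : (C i).IsForm γ) :
    (gradedDual V C).IsSmooth fun m => (0, Pi.single i (γ m)) := by
  refine ⟨VB.IsForm.zero V, fun j => ?_⟩
  by_cases hj : j = i
  · subst hj
    simpa using hγ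
  · simp only [Pi.single_eq_of_ne hj]
    exact VB.IsForm.zero (C j)

/-- Fibrewise linear functions on `D` arise from sections of `S(A*) ⊗ (V* ⊕ C*)`. -/
theorem exists_toFun {ζ : Fun fun i => (D i).overV} (hζ : IsFibLinear h ζ.1) {p : ℤ}
    (hp : HomFun p ζ) : ∃ t : SecMod A (gradedDual V C), HomSec p t ∧
      ∀ m (v : V.E m), ζ.1 ⟨m, v⟩ = toFun h ⟨m, v⟩ (t.1 m) := by
  suffices h1 : ∃ t : SecMod A (gradedDual V C), ∀ m, t.1 m ∈ modPiece A (gradedDual V C) m p ∧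
      ∀ v : V.E m, ζ.1 ⟨m, v⟩ = toFun h ⟨m, v⟩ (t.1 m) from
    h1.elim fun t ht => ⟨t, fun m => (ht m).1, fun m => (ht m).2⟩
  -- The section is unique, so the local formulas in frames agree on overlaps.
  refine exists_secMod_of_local (fun m y => y ∈ modPiece A (gradedDual V C) m p ∧
      ∀ v : V.E m, ζ.1 ⟨m, v⟩ = toFun h ⟨m, v⟩ y)
    (fun m y z hy hz => eq_of_toFun h fun v => (hy.2 v).symm.trans (hz.2 v)) fun m₀ => ?_
  obtain ⟨r, s, σ, hs, hσ, hr⟩ := V.exists_dualBasis m₀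
  choose k c γ hc hγ hk using fun i => (C i).exists_dualBasis m₀
  refine ⟨∑ b, (liftMor h (hs b)).pull ζ • gen A (gradedDual V C) _ (isSmooth_inl (hσ b)) +
    ∑ i, ∑ b, par (i.val + 1) ((liftMor h (VB.IsSec.zero V)).pull
      (contractFun i _ (isSec_core h (hc i b)) ζ)) •
        gen A (gradedDual V C) _ (isSmooth_single (hγ i b)), ?_⟩
  filter_upwards [hr, Filter.eventually_all.2 hk] with m hm hm'
  have e : (∑ b, (liftMor h (hs b)).pull ζ • gen A (gradedDual V C) _ (isSmooth_inl (hσ b)) +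
      ∑ i, ∑ b, par (i.val + 1) ((liftMor h (VB.IsSec.zero V)).pull
        (contractFun i _ (isSec_core h (hc i b)) ζ)) •
          gen A (gradedDual V C) _ (isSmooth_single (hγ i b)) :
            SecMod A (gradedDual V C)).1 m =
      ∑ b, liftPull h ⟨m, s b m⟩ (ζ.1 ⟨m, s b m⟩) ⊗ₜ[ℝ] ((σ b m, 0) : (gradedDual V C).Fib m) +
        ∑ i, ∑ b, (GSym.parity ^ (i.val + 1) : SymFib A m →ₐ[ℝ] _)
          (liftPull h ⟨m, 0⟩ (coreContract h ⟨m, 0⟩ i (c i b m) (ζ.1 ⟨m, 0⟩))) ⊗ₜ[ℝ]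
            ((0, Pi.single i (γ i b m)) : (gradedDual V C).Fib m) := by
    have e1 : ∀ (ξ : Fun A) e he, (ξ • gen A (gradedDual V C) e he).1 m = ξ.1 m ⊗ₜ[ℝ] e m :=
      fun ξ e he => by
        change ξ.1 m • (1 : SymFib A m) ⊗ₜ[ℝ] e m = _
        rw [TensorProduct.smul_tmul', smul_eq_mul, mul_one]
    refine congrArg₂ (· + ·) ((SecMod.sum_apply _ _ _).trans
      (Finset.sum_congr rfl fun b _ => e1 _ _ _)) ((SecMod.sum_apply _ _ _).trans
      (Finset.sum_congr rfl fun i _ => (SecMod.sum_apply _ _ _).trans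
      (Finset.sum_congr rfl fun b _ => (e1 _ _ _).trans ?_)))
    rw [par_apply, liftMor_pull_apply]
    rfl
  rw [e]
  refine ⟨?_, hζ.exists_toFun_of_frame hm fun i => hm' i⟩
  refine add_mem (Submodule.sum_mem _ fun b _ => ?_)
    (Submodule.sum_mem _ fun i _ => Submodule.sum_mem _ fun b _ => ?_)
  · have := tmul_mem_modPiece (A := A) (W := gradedDual V C) (q := none) (e := (σ b m, 0))
      (GSym.map_mem_piece (fun i => ((h i).lift ⟨m, s b m⟩).dualMap) (hp ⟨m, s b m⟩)) ⟨_, rfl⟩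
    rwa [Graded.degree, add_zero] at this
  · have h1 := GSym.contract_mem_piece i
      (Module.Dual.eval ℝ _ ((h i).equiv ⟨m, 0⟩ (0, c i b m))) (hp ⟨m, 0⟩)
    have h2 : liftPull h ⟨m, 0⟩ (coreContract h ⟨m, 0⟩ i (c i b m) (ζ.1 ⟨m, 0⟩)) ∈
        GSym.piece (fun i => Module.Dual ℝ ((A i).E m)) (p - (i.val + 1)) :=
      GSym.map_mem_piece (fun i => ((h i).lift ⟨m, 0⟩).dualMap) h1
    have h3 : (GSym.parity ^ (i.val + 1) : SymFib A m →ₐ[ℝ] _)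
        (liftPull h ⟨m, 0⟩ (coreContract h ⟨m, 0⟩ i (c i b m) (ζ.1 ⟨m, 0⟩))) ∈
        GSym.piece (fun i => Module.Dual ℝ ((A i).E m)) (p - (i.val + 1)) := by
      rw [GSym.parity_pow_of_mem_piece _ h2]
      exact Submodule.smul_mem _ _ h2
    have := tmul_mem_modPiece (A := A) (W := gradedDual V C) (q := some i)
      (e := (0, Pi.single i (γ i b m))) h3 ⟨_, rfl⟩
    rwa [Graded.degree, one_mul, sub_add_cancel] at this

/-- The function on `D` given by a section of `S(A*) ⊗ (V* ⊕ C*)`. -/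
noncomputable def secToFun (s : SecMod A (gradedDual V C)) : Fun fun i => (D i).overV :=
  ⟨fun v => toFun h v (s.1 v.proj), by
    refine mem_Fun_of_secMod TotalSpace.proj (FiberBundle.continuous_proj V.F V.E)
      (fun v => toFun h v) (fun e he => ?_) (fun ξ t ht => ?_) s
    · have h1 : (fun v : V.Tot => toFun h v ((1 : SymFib A v.proj) ⊗ₜ[ℝ] e v.proj)) =
          baseFun (fun i => (D i).overV) (fun v : V.Tot => (e v.proj).1 v.2) +
            ∑ i, formFun (fun i => (D i).overV) i
              (fun v => (e v.proj).2 i ∘ₗ (h i).corePart v) := by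
        ext v
        rw [toFun_tmul, map_one, one_mul, Pi.add_apply, Finset.sum_apply]
        rfl
      rw [h1]
      exact add_mem (baseFun_mem_Fun he.1)
        (sum_mem fun i _ => formFun_mem_Fun ((h i).isForm_corePart (γ := fun m => (e m).2 i) (he.2 i)))
    · simp only [toFun_smul]
      exact mul_mem ((projMor D).pull ξ).2 ht⟩

lemma secToFun_apply (s : SecMod A (gradedDual V C)) (v : V.Tot) :
    (secToFun h s).1 v = toFun h v (s.1 v.proj) := rfl

lemma secToFun_add (s t : SecMod A (gradedDual V C)) :
    secToFun h (s + t) = secToFun h s + secToFun h t := Fun.ext fun v => map_add (toFun h v) _ _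

lemma secToFun_smul (ξ : Fun A) (s : SecMod A (gradedDual V C)) :
    secToFun h (ξ • s) = (projMor D).pull ξ * secToFun h s := Fun.ext fun _ => toFun_smul h _ _ _

end FibLinear

/-! ### The homological vector field on fibrewise linear functions -/

section FibLinear

variable {EB : Type v} [NormedAddCommGroup EB] [NormedSpace ℝ EB] {HB : Type w}
  [TopologicalSpace HB] {I : ModelWithCorners ℝ EB HB}
  {M : Type u} [TopologicalSpace M] [ChartedSpace HB M] {n : ℕ}
  {V : VB I M} {A C : Fin n → VB I M} {D : ∀ i, DVB V (A i) (C i)}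
  (h : ∀ i, (D i).Decomposition)

/-- An element of `D` over `v`, given by its components in `A` and `C`. -/
def splitVec {m : M} (v : V.E m) (p : Σ i, (A i).E m × (C i).E m) :
    Σ i, (D i).overV.E ⟨m, v⟩ := ⟨p.1, (h p.1).equiv ⟨m, v⟩ p.2⟩

lemma evalAt_liftPull {m : M} (v : V.E m) (l : List (Σ i, (A i).E m))
    (θ : SymFib (fun i => (D i).overV) ⟨m, v⟩) : evalAt l (liftPull h ⟨m, v⟩ θ) =
      evalAt ((l.map fun p => (⟨p.1, (p.2, 0)⟩ : Σ i, (A i).E m × (C i).E m)).map (splitVec h v))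
        θ := by
  rw [List.map_map]
  exact evalAt_map (fun i => (h i).lift ⟨m, v⟩) l θ

lemma evalAt_coreContract {m : M} (v : V.E m) (l : List (Σ i, (A i).E m × (C i).E m)) (i : Fin n)
    (c : (C i).E m) (θ : SymFib (fun i => (D i).overV) ⟨m, v⟩) :
    evalAt (l.map (splitVec h v)) (coreContract h ⟨m, v⟩ i c θ) =
      evalAt (((⟨i, (0, c)⟩ : Σ i, (A i).E m × (C i).E m) :: l).map (splitVec h v)) θ := rfl

/-- A form on `D` vanishes if its values on lists of lifts and core elements vanish. -/
lemma eq_zero_of_splitVec {m : M} {v : V.E m} {θ : SymFib (fun i => (D i).overV) ⟨m, v⟩}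
    (hθ : ∀ l : List (Σ i, (A i).E m × (C i).E m), (∀ p ∈ l, p.2.1 = 0 ∨ p.2.2 = 0) →
      evalAt (l.map (splitVec h v)) θ = 0) : θ = 0 := by
  refine eq_zero_of_evalAt _ (span_lift_core h ⟨m, v⟩) fun l hl => ?_
  have : ∃ l' : List (Σ i, (A i).E m × (C i).E m), l'.map (splitVec h v) = l ∧
      ∀ p ∈ l', p.2.1 = 0 ∨ p.2.2 = 0 := by
    clear hθ
    induction l with
    | nil => exact ⟨[], rfl, by simp⟩
    | cons p l ih =>
      obtain ⟨l', h1, h2⟩ := ih fun q hq => hl q (List.mem_cons_of_mem _ hq)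
      obtain ⟨i, d⟩ := p
      rcases hl ⟨i, d⟩ List.mem_cons_self with ⟨a, ha⟩ | ⟨c, hc⟩
      · have ha : d = (h i).equiv ⟨m, v⟩ (a, 0) := ha
        refine ⟨⟨i, (a, 0)⟩ :: l', ?_, ?_⟩
        · rw [List.map_cons, h1, ha]
          rfl
        · simpa using h2
      · have hc : d = (h i).equiv ⟨m, v⟩ (0, c) := hc
        refine ⟨⟨i, (0, c)⟩ :: l', ?_, ?_⟩
        · rw [List.map_cons, h1, hc]
          rfl
        · simpa using h2
  obtain ⟨l', rfl, h2⟩ := this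
  exact hθ l' h2

variable [FiniteDimensional ℝ EB] [T2Space M] [IsManifold I ∞ M]
  {QD : LieStr (fun i => (D i).overV)}

/-- The values of `Q γ` on horizontal lifts and core elements, for a form `γ` on the core, as
functions on the fibre of `V` over `m`. The set `K` consists of the positions of the core elements;
the three cases are the three axioms on brackets. -/
lemma IsVBLie.eval_core (hD : IsVBLie D QD) {k : Fin n} {γ : ∀ m, Module.Dual ℝ ((C k).E m)}
    (hγ : (C k).IsForm γ) {m : M} (l : List (Σ i, (A i).E m × (C i).E m)) (K : Finset (Fin l.length))
    (hK : ∀ p, p ∉ K → (l.get p).2.2 = 0) (hK' : ∀ p ∈ K, (l.get p).2.1 = 0) :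
    (K.card = 0 → ∃ b, (D k).IsLinear b ∧ ∀ v, evalAt (l.map (splitVec h v))
      ((QD.Q (ofForm (fun i => (D i).overV) k _ ((h k).isForm_corePart hγ))).1 ⟨m, v⟩) =
        -γ m ((h k).corePart ⟨m, v⟩ (b ⟨m, v⟩))) ∧
    (K.card = 1 → ∃ t : ℝ, ∀ v, evalAt (l.map (splitVec h v))
      ((QD.Q (ofForm (fun i => (D i).overV) k _ ((h k).isForm_corePart hγ))).1 ⟨m, v⟩) = t) ∧
    (2 ≤ K.card → ∀ v, evalAt (l.map (splitVec h v))
      ((QD.Q (ofForm (fun i => (D i).overV) k _ ((h k).isForm_corePart hγ))).1 ⟨m, v⟩) = 0) := by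
  choose extA hA hA' using fun i => (A i).exists_extend m
  choose extC hC hC' using fun i => (C i).exists_extend m
  -- The elements of the list, for all `v` at once, are the values of linear and core sections `a p`.
  let i : Fin l.length → Fin n := fun p => (l.get p).1
  let a' : ∀ p m', (A (i p)).E m' := fun p => extA _ (l.get p).2.1
  let c : ∀ p m', (C (i p)).E m' := fun p => extC _ (l.get p).2.2
  let a : ∀ p v, (D (i p)).overV.E v := fun p v => (h (i p)).equiv v (a' p v.proj, c p v.proj)
  have ha' : ∀ p v, (D (i p)).prA v (a p v) = a' p v.proj := fun p v => (h (i p)).prA_equiv v _ _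
  have hlin : ∀ p, p ∉ K → (D (i p)).IsLinear (a p) := fun p hp => by
    have h1 := (h (i p)).isLinear_lift (hA (i p) (l.get p).2.1)
    have h2 : ∀ m', c p m' = 0 := fun m' => by
      simp only [c, hK p hp, map_zero, Pi.zero_apply]
    simp only [a, h2]
    exact h1
  have hcore : ∀ p ∈ K, (D (i p)).IsCore (a p) := fun p hp => by
    have h1 := (h (i p)).isCore_equiv (hC (i p) (l.get p).2.2)
    have h2 : ∀ m', a' p m' = 0 := fun m' => by
      simp only [a', hK' p hp, map_zero, Pi.zero_apply]
    simp only [a, h2]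
    exact h1
  have hφ : ∀ p v, evalAt (A := fun i => (D i).overV) [⟨i p, a p v⟩]
      (GSym.ι k (γ v.proj ∘ₗ (h k).corePart v)) =
        evalAt (A := C) [⟨i p, c p v.proj⟩] (GSym.ι k (γ v.proj)) := fun p v => by
    have h1 := evalAt_map (A := C) (B := fun i => (D i).overV) (fun i => (h i).corePart v)
      [⟨i p, a p v⟩] (GSym.ι k (γ v.proj))
    rw [GSym.map_ι] at h1
    refine h1.trans ?_
    rw [List.map_singleton, (h (i p)).corePart_equiv]
  have hl : ∀ v : V.E m, l.map (splitVec h v) =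
      List.ofFn fun p => (⟨i p, a p ⟨m, v⟩⟩ : Σ i, (D i).overV.E ⟨m, v⟩) := fun v => by
    have h1 : ∀ p, a p ⟨m, v⟩ = (h (i p)).equiv ⟨m, v⟩ (l.get p).2 := fun p => by
      simp only [a, a', c, hA', hC']
      rfl
    simp only [h1]
    conv_lhs => rw [← List.ofFn_get l, List.map_ofFn]
    rfl
  have hφ0 : ∀ p, p ∉ K → ∀ m', evalAt (A := C) [⟨i p, c p m'⟩] (GSym.ι k (γ m')) = 0 :=
    fun p hp m' => by
      refine evalAt_eq_zero_of_mem (i := i p) ?_ _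
      simp only [c, hK p hp, map_zero, Pi.zero_apply]
      exact List.mem_singleton_self _
  simp only [hl]
  refine ⟨fun hK0 => ?_, fun hK1 => ?_, fun hK2 v => ?_⟩
  · rw [Finset.card_eq_zero] at hK0
    subst hK0
    rcases Nat.eq_zero_or_pos l.length with hj | hj
    -- There is no bracket without arguments, and the form has no component of degree zero; any linear
    -- section with vanishing core component will do.
    · refine ⟨_, (h k).isLinear_lift (VB.IsSec.zero (A k)), fun v => ?_⟩
      rw [List.eq_nil_of_length_eq_zero (List.length_ofFn.trans hj), (h k).corePart_lift, map_zero,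
        neg_zero]
      refine evalAt_eq_zero_of_mem_piece (QD.isDer.deg _ _ (homFun_ofForm _) _) ?_
      simp
      omega
    · obtain ⟨b, hb, hb'⟩ := hD.bracket_linear _ i a hj (fun p => hlin p (Finset.notMem_empty p)) k
      obtain ⟨t, ht, ht0⟩ := hb'.eval hD ha' ((h k).isForm_corePart hγ)
        (φ := fun p m' => evalAt (A := C) [⟨i p, c p m'⟩] (GSym.ι k (γ m'))) hφ
      refine ⟨b, hb, fun v => ?_⟩
      rw [ht, ht0 (fun p q _ _ => Or.inr (hφ0 q (Finset.notMem_empty q))), zero_sub]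
      rfl
  · obtain ⟨q, rfl⟩ := Finset.card_eq_one.1 hK1
    obtain ⟨b, ⟨c', -, hb⟩, hb'⟩ := hD.bracket_core _ i a q
      (fun p hp => hlin p (by simpa using hp)) (hcore q (Finset.mem_singleton_self q)) k
    obtain ⟨t, ht, -⟩ := hb'.eval hD ha' ((h k).isForm_corePart hγ)
      (φ := fun p m' => evalAt (A := C) [⟨i p, c p m'⟩] (GSym.ι k (γ m'))) hφ
    refine ⟨t m - γ m (c' m), fun v => ?_⟩
    rw [ht, LinearMap.comp_apply, (h k).corePart_of_coreLift (hb ⟨m, v⟩)]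
  · have hb' := hD.bracket_zero _ i a K hK2 hlin hcore k
    obtain ⟨t, ht, ht0⟩ := hb'.eval hD ha' ((h k).isForm_corePart hγ)
      (φ := fun p m' => evalAt (A := C) [⟨i p, c p m'⟩] (GSym.ι k (γ m'))) hφ
    rw [ht, ht0, map_zero, sub_zero]
    -- For `j = 2` both arguments are core elements, and their anchors vanish.
    intro p q hj _
    refine Or.inl fun m' => ?_
    have : K = Finset.univ := (Finset.card_eq_iff_eq_univ K).1
      (le_antisymm (Finset.card_le_univ K) (by rw [Fintype.card_fin]; omega))
    simp only [a', hK' p (this ▸ Finset.mem_univ p), map_zero, Pi.zero_apply]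

/-- The homological vector field maps forms on the core to fibrewise linear functions. -/
lemma IsVBLie.isFibLinear_core (hD : IsVBLie D QD) {k : Fin n}
    {γ : ∀ m, Module.Dual ℝ ((C k).E m)} (hγ : (C k).IsForm γ) : IsFibLinear h
      (QD.Q (ofForm (fun i => (D i).overV) k _ ((h k).isForm_corePart hγ))).1 := by
  have hlift : ∀ m (l : List (Σ i, (A i).E m)), ∃ b, (D k).IsLinear b ∧ ∀ v : V.E m,
      evalAt l (liftPull h ⟨m, v⟩ ((QD.Q (ofForm (fun i => (D i).overV) k _
        ((h k).isForm_corePart hγ))).1 ⟨m, v⟩)) = -γ m ((h k).corePart ⟨m, v⟩ (b ⟨m, v⟩)) := by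
    intro m l
    simp only [evalAt_liftPull]
    refine (hD.eval_core h hγ _ ∅ (fun p _ => ?_) (fun p hp => absurd hp (Finset.notMem_empty p))).1
      rfl
    obtain ⟨q, -, hq⟩ := List.mem_map.1 (List.get_mem _ p)
    rw [← hq]
  refine ⟨fun m v w => ?_, fun m t v => ?_, fun m v i c => ?_, ?_⟩
  · refine eq_of_evalAt (fun _ => Set.univ) (fun _ => Submodule.span_univ) fun l _ => ?_
    obtain ⟨b, hb, hl⟩ := hlift m l
    rw [evalAt_add, hl, hl, hl, (h k).corePart_add hb, map_add, neg_add]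
  · refine eq_of_evalAt (fun _ => Set.univ) (fun _ => Submodule.span_univ) fun l _ => ?_
    obtain ⟨b, hb, hl⟩ := hlift m l
    rw [evalAt_smul, hl, hl, (h k).corePart_smul hb, map_smul, smul_eq_mul, mul_neg]
  · refine eq_of_evalAt (fun _ => Set.univ) (fun _ => Submodule.span_univ) fun l _ => ?_
    rw [evalAt_liftPull, evalAt_liftPull, evalAt_coreContract, evalAt_coreContract]
    let l' : List (Σ i, (A i).E m × (C i).E m) := List.map
      (fun p : Σ i, (A i).E m => (⟨p.1, (p.2, 0)⟩ : Σ i, (A i).E m × (C i).E m)) l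
    have h1 : ∀ p ∈ l', p.2.2 = 0 := fun p hp => by
      obtain ⟨q, -, rfl⟩ := List.mem_map.1 hp
      rfl
    obtain ⟨t, ht⟩ := (hD.eval_core h hγ (⟨i, (0, c)⟩ :: l') {0}
      (fun p hp => by
        obtain ⟨p, rfl⟩ := Fin.exists_succ_eq.2 (by simpa using hp : p ≠ 0)
        exact h1 _ (List.get_mem l' p))
      (fun p hp => by
        rw [Finset.mem_singleton.1 hp]
        rfl)).2.1 rfl
    exact (ht v).trans (ht 0).symm
  · rintro ⟨m, v⟩ i c j c'
    refine eq_zero_of_splitVec h fun l hl => ?_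
    rw [evalAt_coreContract, evalAt_coreContract]
    classical
    -- Two of the arguments are the core elements at the head of the list.
    let L : List (Σ i, (A i).E m × (C i).E m) := ⟨i, (0, c)⟩ :: ⟨j, (0, c')⟩ :: l
    refine (hD.eval_core h hγ L (Finset.univ.filter fun p => (L.get p).2.1 = 0) (fun p hp => ?_)
      (fun p hp => by simpa using hp)).2.2 (Finset.one_lt_card.2 ⟨0, ?_, 1, ?_, ?_⟩) v
    · have h1 : (L.get p).2.1 = 0 ∨ (L.get p).2.2 = 0 := by
        rcases List.mem_cons.1 (List.get_mem L p) with h1 | h1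
        · rw [h1]
          exact Or.inl rfl
        · rcases List.mem_cons.1 h1 with h1 | h1
          · rw [h1]
            exact Or.inl rfl
          · exact hl _ h1
      exact h1.resolve_left (by simpa using hp)
    · exact Finset.mem_filter.2 ⟨Finset.mem_univ _, rfl⟩
    · exact Finset.mem_filter.2 ⟨Finset.mem_univ _, rfl⟩
    · simp [L]

end FibLinear

section Tangent

variable {EB : Type v} [NormedAddCommGroup EB] [NormedSpace ℝ EB] {HB : Type w}
  [TopologicalSpace HB] {I : ModelWithCorners ℝ EB HB}
  {M : Type u} [TopologicalSpace M] [ChartedSpace HB M] {n : ℕ} {V : VB I M}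
  [FiniteDimensional ℝ EB] [T2Space M] [IsManifold I ∞ M]
  {ψ : ∀ m, Module.Dual ℝ (V.E m)}

lemma VB.IsForm.mdifferentiableAt (hψ : V.IsForm ψ) (p : V.Tot) :
    MDifferentiableAt V.model 𝓘(ℝ, ℝ) (fun p : V.Tot => ψ p.proj p.2) p :=
  (ContMDiff.contMDiffAt hψ).mdifferentiableAt (n := ∞) (by simp)

/-- The differential of a fibrewise linear function of `V` is fibrewise linear on `TV → TM`. -/
lemma TangentAdd.mvfderiv_eq (hψ : V.IsForm ψ) {p q r : TangentBundle V.model V.Tot}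
    (h : TangentAdd V p q r) :
    mvfderiv V.model (fun p : V.Tot => ψ p.proj p.2) r.proj r.2 =
      mvfderiv V.model (fun p : V.Tot => ψ p.proj p.2) p.proj p.2 +
        mvfderiv V.model (fun p : V.Tot => ψ p.proj p.2) q.proj q.2 := by
  obtain ⟨z, rfl, rfl, rfl⟩ := h
  have h0 := contMDiff_prodMk_totalSpace (J := I.prod 𝓘(ℝ, V.F × V.F)) (I := I)
    (p := fun y : TotalSpace (V.F × V.F) (V.E ×ᵇ V.E) => y.proj) (v := fun y => y.2.1)
    (w := fun y => y.2.2) |>.1 contMDiff_id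
  have h1 : ContMDiff (I.prod 𝓘(ℝ, V.F × V.F)) V.model ∞
      (fun y : TotalSpace (V.F × V.F) (V.E ×ᵇ V.E) => (⟨y.proj, y.2.1 + y.2.2⟩ : V.Tot)) := by
    intro y
    have := VB.contMDiffAt_sum_along (J := I.prod 𝓘(ℝ, V.F × V.F)) (V := V)
      (p := fun y : TotalSpace (V.F × V.F) (V.E ×ᵇ V.E) => y.proj)
      (f := ![fun y => y.2.1, fun y => y.2.2]) (c := fun _ _ => (1 : ℝ)) (y₀ := y)
      (contMDiff_proj (V.E ×ᵇ V.E) y)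
      (fun j => by fin_cases j; exacts [h0.1 y, h0.2 y]) (fun _ => contMDiffAt_const)
    simpa [Fin.sum_univ_two] using this
  have e : ∀ {f : TotalSpace (V.F × V.F) (V.E ×ᵇ V.E) → V.Tot},
      ContMDiff (I.prod 𝓘(ℝ, V.F × V.F)) V.model ∞ f →
      MDifferentiableAt (I.prod 𝓘(ℝ, V.F × V.F)) V.model f z.proj :=
    fun hf => (hf.contMDiffAt).mdifferentiableAt (n := ∞) (by simp)
  rw [← mvfderiv_comp_tangentMap z (hψ.mdifferentiableAt _) (e h1),
    ← mvfderiv_comp_tangentMap z (hψ.mdifferentiableAt _) (e h0.1),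
    ← mvfderiv_comp_tangentMap z (hψ.mdifferentiableAt _) (e h0.2)]
  have e1 := (((ContMDiff.contMDiffAt hψ).comp z.proj (h0.1 z.proj)).mdifferentiableAt (n := ∞)
    (by simp))
  have e2 := (((ContMDiff.contMDiffAt hψ).comp z.proj (h0.2 z.proj)).mdifferentiableAt (n := ∞)
    (by simp))
  simp only [map_add]
  have := mvfderiv_add e1 e2
  exact DFunLike.congr_fun this z.2

/-- The differential of a fibrewise linear function of `V` is homogeneous for the scalar multiplication
of `TV → TM`. -/
lemma mvfderiv_tangentMap_smulTot (hψ : V.IsForm ψ) (t : ℝ) (p : TangentBundle V.model V.Tot) :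
    mvfderiv V.model (fun p : V.Tot => ψ p.proj p.2) (tangentMap V.model V.model (V.smulTot t) p).proj
        (tangentMap V.model V.model (V.smulTot t) p).2 =
      t * mvfderiv V.model (fun p : V.Tot => ψ p.proj p.2) p.proj p.2 := by
  have h1 : ContMDiff V.model V.model ∞ (V.smulTot t) := fun y => by
    have := VB.contMDiffAt_sum_along (J := V.model) (V := V)
      (p := fun y : V.Tot => y.proj) (r := 1)
      (f := fun _ y => y.2) (c := fun _ _ => t) (y₀ := y)
      (contMDiff_proj V.E y) (fun j => contMDiffAt_id) (fun _ => contMDiffAt_const)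
    simp only [Fin.sum_univ_one] at this
    exact this
  rw [← mvfderiv_comp_tangentMap p (hψ.mdifferentiableAt _)
    ((h1.contMDiffAt).mdifferentiableAt (n := ∞) (by simp))]
  have h2 := mvfderiv_smul (mdifferentiableAt_const (c := t)) (hψ.mdifferentiableAt p.proj)
  have h3 := DFunLike.congr_fun h2 p.2
  have h4 : (fun y : V.Tot => ψ (V.smulTot t y).proj (V.smulTot t y).2) =
      (fun _ : V.Tot => t) • fun p : V.Tot => ψ p.proj p.2 := by
    funext y
    exact map_smul (ψ y.proj) t y.2
  rw [h4, h3, mvfderiv_const]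
  simp

end Tangent

section FibLinear

variable {EB : Type v} [NormedAddCommGroup EB] [NormedSpace ℝ EB] {HB : Type w}
  [TopologicalSpace HB] {I : ModelWithCorners ℝ EB HB}
  {M : Type u} [TopologicalSpace M] [ChartedSpace HB M] {n : ℕ}
  {V : VB I M} {A C : Fin n → VB I M} {D : ∀ i, DVB V (A i) (C i)}
  (h : ∀ i, (D i).Decomposition)
  [FiniteDimensional ℝ EB] [T2Space M] [IsManifold I ∞ M]
  {QD : LieStr (fun i => (D i).overV)} {ψ : ∀ m, Module.Dual ℝ (V.E m)}

/-- The anchor of `D`, applied to a fibrewise linear function of `V`, is fibrewise linear on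
`D → A`. -/
lemma IsVBLie.anchor_linear (hD : IsVBLie D QD) (hψ : V.IsForm ψ) (i : Fin n) :
    ∃ L : ∀ v, (D i).overV.E v → ℝ,
      (∀ v d, evalAt [⟨i, d⟩] ((QD.Q (ofFun (fun i => (D i).overV) _ hψ)).1 v) = L v d) ∧
      (∀ v, L v 0 = 0) ∧
      (∀ p q r, (D i).AddA p q r → L r.proj r.2 = L p.proj p.2 + L q.proj q.2) ∧
      ∀ t p, L ((D i).smulA t p).proj ((D i).smulA t p).2 = t * L p.proj p.2 := by
  by_cases hi : i.val = 0
  · obtain ⟨ρ, ρA, h1, h2⟩ := hD.anchor i hi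
    refine ⟨fun v d => mvfderiv V.model (fun p : V.Tot => ψ p.proj p.2) v (ρ v d),
      fun v d => h1 _ hψ v d, fun v => ?_, fun p q r hr => ?_, fun t p => ?_⟩
    · exact (congrArg _ (map_zero (ρ v))).trans (map_zero _)
    · exact (h2.add p q r hr).mvfderiv_eq hψ
    · refine Eq.trans ?_ (mvfderiv_tangentMap_smulTot hψ t ⟨p.proj, ρ p.proj p.2⟩)
      rw [← h2.smul]
  · refine ⟨fun _ _ => 0, fun v d => ?_, fun _ => rfl, fun _ _ _ _ => (add_zero _).symm,
      fun _ _ => (mul_zero _).symm⟩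
    refine evalAt_eq_zero_of_mem_piece (QD.isDer.deg 0 _ (homFun_ofFun hψ) v) ?_
    simpa using hi

/-- The homological vector field maps linear functions on `V` to fibrewise linear functions. Being of
degree one, these have values on single vectors only, given by the anchor. -/
lemma IsVBLie.isFibLinear_base (hD : IsVBLie D QD) (hψ : V.IsForm ψ) : IsFibLinear h
      (QD.Q (ofFun (fun i => (D i).overV) _ hψ)).1 := by
  have hdeg := QD.isDer.deg 0 _ (homFun_ofFun (A := fun i => (D i).overV) hψ)
  choose L hL hL0 hadd hsmul using hD.anchor_linear hψ
  have hlen : ∀ v (l : List (Σ i, (D i).overV.E v)), l.length ≠ 1 →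
      evalAt l ((QD.Q (ofFun (fun i => (D i).overV) _ hψ)).1 v) = 0 :=
    fun v l hl => evalAt_eq_zero_of_length (hdeg v) l hl
  refine ⟨fun m v w => ?_, fun m t v => ?_, fun m v i c => ?_, ?_⟩
  · refine eq_of_evalAt (fun _ => Set.univ) (fun _ => Submodule.span_univ) fun l _ => ?_
    rw [evalAt_add, evalAt_liftPull, evalAt_liftPull, evalAt_liftPull]
    by_cases hl : l.length = 1
    · obtain ⟨⟨i, a⟩, rfl⟩ := List.length_eq_one_iff.1 hl
      have h1 := hadd i _ _ _ ((h i).add m a v w 0 0)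
      rw [add_zero] at h1
      exact (hL _ _ _).trans (h1.trans (congrArg₂ (· + ·) (hL _ _ _).symm (hL _ _ _).symm))
    · rw [hlen _ _ (by simpa using hl), hlen _ _ (by simpa using hl),
        hlen _ _ (by simpa using hl), add_zero]
  · refine eq_of_evalAt (fun _ => Set.univ) (fun _ => Submodule.span_univ) fun l _ => ?_
    rw [evalAt_smul, evalAt_liftPull, evalAt_liftPull]
    by_cases hl : l.length = 1
    · obtain ⟨⟨i, a⟩, rfl⟩ := List.length_eq_one_iff.1 hl
      have h1 := hsmul i t ⟨⟨m, v⟩, (h i).equiv ⟨m, v⟩ (a, 0)⟩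
      rw [(h i).smul m a t v 0, smul_zero] at h1
      exact (hL _ _ _).trans (h1.trans (congrArg (t * ·) (hL _ _ _).symm))
    · rw [hlen _ _ (by simpa using hl), hlen _ _ (by simpa using hl), mul_zero]
  · refine eq_of_evalAt (fun _ => Set.univ) (fun _ => Submodule.span_univ) fun l _ => ?_
    rw [evalAt_liftPull, evalAt_liftPull, evalAt_coreContract, evalAt_coreContract]
    rcases l with - | ⟨p, l⟩
    · have h1 : ∀ v : V.E m, L i ⟨m, v⟩ ((h i).equiv ⟨m, v⟩ (0, c)) =
          L i ⟨m, 0⟩ ((D i).core m c) := fun v => by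
        have := hadd i _ _ _ ((h i).coreLift_equiv ⟨m, v⟩ c)
        rw [hL0, zero_add] at this
        exact this
      exact (hL _ _ _).trans ((h1 v).trans ((h1 0).symm.trans (hL _ _ _).symm))
    · rw [hlen _ _ (by simp), hlen _ _ (by simp)]
  · rintro ⟨m, v⟩ i c j c'
    refine eq_zero_of_splitVec h fun l hl => ?_
    rw [evalAt_coreContract, evalAt_coreContract]
    exact hlen _ _ (by simp)

end FibLinear

/-! ### The representation on `V* ⊕ C*` -/

section DualRep

variable {EB : Type v} [NormedAddCommGroup EB] [NormedSpace ℝ EB] {HB : Type w}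
  [TopologicalSpace HB] {I : ModelWithCorners ℝ EB HB}
  {M : Type u} [TopologicalSpace M] [ChartedSpace HB M] {n : ℕ}
  {V : VB I M} {A C : Fin n → VB I M} {D : ∀ i, DVB V (A i) (C i)}
  (h : ∀ i, (D i).Decomposition)
  [FiniteDimensional ℝ EB] [T2Space M] [IsManifold I ∞ M]
  {QD : LieStr (fun i => (D i).overV)}

lemma eq_of_secToFun {s t : SecMod A (gradedDual V C)} (hst : secToFun h s = secToFun h t) :
    s = t :=
  SecMod.ext fun m => eq_of_toFun h fun v => congrArg (fun ζ => ζ.1 ⟨m, v⟩) hst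

lemma secToFun_gen_inl {e : ∀ m, (gradedDual V C).Fib m} (he : (gradedDual V C).IsSmooth e)
    (hq : ∀ m, e m ∈ (gradedDual V C).part m none) :
    secToFun h (gen A (gradedDual V C) e he) =
      ofFun (fun i => (D i).overV) (fun v => (e v.proj).1 v.2) he.1 := by
  refine Fun.ext fun v => (toFun_tmul h v 1 (e v.proj)).trans ?_
  obtain ⟨w, hw⟩ := hq v.proj
  have h2 : (e v.proj).2 = 0 := by
    rw [← hw]
    rfl
  rw [map_one, one_mul, h2]
  simp [ofFun, baseFun]

lemma secToFun_gen_single {i : Fin n} {e : ∀ m, (gradedDual V C).Fib m}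
    (he : (gradedDual V C).IsSmooth e) (hq : ∀ m, e m ∈ (gradedDual V C).part m (some i)) :
    secToFun h (gen A (gradedDual V C) e he) = ofForm (fun i => (D i).overV) i _
      ((h i).isForm_corePart (γ := fun m => (e m).2 i) (he.2 i)) := by
  refine Fun.ext fun v => (toFun_tmul h v 1 (e v.proj)).trans ?_
  obtain ⟨w, hw⟩ := hq v.proj
  have h2 : (∑ j, GSym.ι j ((e v.proj).2 j ∘ₗ (h j).corePart v) :
      SymFib (fun i => (D i).overV) v) = GSym.ι i ((e v.proj).2 i ∘ₗ (h i).corePart v) := by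
    refine Finset.sum_eq_single i (fun j _ hj => ?_) (by simp)
    have : (e v.proj).2 j = 0 := by
      rw [← hw]
      exact Pi.single_eq_of_ne hj _
    rw [this, LinearMap.zero_comp, map_zero]
  have h1 : (e v.proj).1 = 0 := by
    rw [← hw]
    rfl
  rw [map_one, one_mul, h1, LinearMap.zero_apply, map_zero, zero_add]
  exact h2

lemma IsVBLie.exists_toFun_base (hD : IsVBLie D QD) {ψ : ∀ m, Module.Dual ℝ (V.E m)}
    (hψ : V.IsForm ψ) : ∃ t : SecMod A (gradedDual V C), HomSec (0 + 1) t ∧ ∀ m (v : V.E m),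
      (QD.Q (ofFun (fun i => (D i).overV) _ hψ)).1 ⟨m, v⟩ = toFun h ⟨m, v⟩ (t.1 m) :=
  exists_toFun h (hD.isFibLinear_base h hψ) (QD.isDer.deg 0 _ (homFun_ofFun hψ))

lemma IsVBLie.exists_toFun_core (hD : IsVBLie D QD) {i : Fin n}
    {γ : ∀ m, Module.Dual ℝ ((C i).E m)} (hγ : (C i).IsForm γ) :
    ∃ t : SecMod A (gradedDual V C), HomSec ((i.val + 1 : ℤ) + 1) t ∧ ∀ m (v : V.E m),
      (QD.Q (ofForm (fun i => (D i).overV) i _ ((h i).isForm_corePart hγ))).1 ⟨m, v⟩ =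
        toFun h ⟨m, v⟩ (t.1 m) :=
  exists_toFun h (hD.isFibLinear_core h hγ) (QD.isDer.deg _ _ (homFun_ofForm _))

/-- The homological vector field of `D`, seen as a differential on `S(A*) ⊗ (V* ⊕ C*)`. -/
theorem IsVBLie.exists_dualRep (hD : IsVBLie D QD) : ∃ R : Rep hD.side (gradedDual V C),
    ∀ s, QD.Q (secToFun h s) = secToFun h (R.D s) := by
  suffices h1 : ∃ R : Rep hD.side (gradedDual V C), ∀ s m, ∀ v : V.E m,
      (QD.Q (secToFun h s)).1 ⟨m, v⟩ = toFun h ⟨m, v⟩ ((R.D s).1 m) from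
    h1.imp fun R hR s => Fun.ext fun v => hR s v.proj v.2
  refine exists_rep (isGood_gradedDual V C) hD.side (fun s m y => ∀ v : V.E m,
      (QD.Q (secToFun h s)).1 ⟨m, v⟩ = toFun h ⟨m, v⟩ y) ?_ ?_ ?_ ?_ ?_ ?_
  · exact fun s m y z hy hz => eq_of_toFun h fun v => (hy v).symm.trans (hz v)
  · intro s t m y hst hy v
    refine (QD.isDer.congr ?_).symm.trans (hy v)
    have : Filter.Tendsto (fun v : V.Tot => v.proj) (𝓝 ⟨m, v⟩) (𝓝 m) :=
      (FiberBundle.continuous_proj V.F V.E).continuousAt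
    filter_upwards [this.eventually hst] with w hw
    exact congrArg (toFun h w) hw
  · intro s t m y z hy hz v
    rw [secToFun_add, map_add, map_add, ← hy v, ← hz v]
    rfl
  · intro ξ s m y hy v
    have h1 : (par 1 ((projMor D).pull ξ)).1 ⟨m, v⟩ = pull D ⟨m, v⟩ ((par 1 ξ).1 m) :=
      (congrArg (fun ζ : Fun (fun i => (D i).overV) => ζ.1 ⟨m, v⟩) (Mor.pull_par (projMor D) ξ)).symm
    rw [secToFun_smul, QD.isDer.leibniz_par, hD.Q_pull, map_add, toFun_smul, toFun_smul, ← hy v]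
    exact congrArg (fun x => _ + x * _) h1
  · rintro (- | i) e he hq
    · obtain ⟨t, ht, ht'⟩ := hD.exists_toFun_base h (ψ := fun m => (e m).1) he.1
      refine ⟨t, ht, fun m v => ?_⟩
      rw [secToFun_gen_inl h he hq]
      exact ht' m v
    · obtain ⟨t, ht, ht'⟩ := hD.exists_toFun_core h (γ := fun m => (e m).2 i) (he.2 i)
      refine ⟨t, ?_, fun m v => ?_⟩
      · rw [Graded.degree, one_mul]
        exact ht
      · rw [secToFun_gen_single h he hq]
        exact ht' m v
  · intro q e he _ t r _ hst htr
    have h1 : QD.Q (secToFun h (gen A _ e he)) = secToFun h t := Fun.ext fun v => hst v.proj v.2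
    have h2 : QD.Q (secToFun h t) = secToFun h r := Fun.ext fun v => htr v.proj v.2
    refine eq_of_secToFun h ?_
    rw [← h2, ← h1, QD.sq]
    exact (Fun.ext fun v => map_zero (toFun h v)).symm

end DualRep

/-! ### The pairing of `S(A*) ⊗ (V ⊕ C)` and `S(A*) ⊗ (V* ⊕ C*)` -/

section Pairing

variable {EB : Type v} [NormedAddCommGroup EB] [NormedSpace ℝ EB] {HB : Type w}
  [TopologicalSpace HB] {I : ModelWithCorners ℝ EB HB}
  {M : Type u} [TopologicalSpace M] [ChartedSpace HB M] {n : ℕ}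
  {V : VB I M} {A C : Fin n → VB I M} {x : M}

/-- The evaluation of elements of `V* ⊕ C*` on an element of `V ⊕ C`. -/
noncomputable def evalD (e : (graded V C).Fib x) : Module.Dual ℝ ((gradedDual V C).Fib x) :=
  Module.Dual.eval ℝ (V.E x) e.1 ∘ₗ
      LinearMap.fst ℝ (Module.Dual ℝ (V.E x)) (∀ i, Module.Dual ℝ ((C i).E x)) +
    ∑ i, Module.Dual.eval ℝ ((C i).E x) (e.2 i) ∘ₗ LinearMap.proj i ∘ₗ
      LinearMap.snd ℝ (Module.Dual ℝ (V.E x)) (∀ i, Module.Dual ℝ ((C i).E x))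

lemma evalD_apply (e : (graded V C).Fib x) (φ : (gradedDual V C).Fib x) :
    evalD e φ = φ.1 e.1 + ∑ i, φ.2 i (e.2 i) := by
  simp [evalD]

/-- A functional on `V ⊕ C` as an element of `V* ⊕ C*`. -/
noncomputable def toDual (φ : Module.Dual ℝ ((graded V C).Fib x)) : (gradedDual V C).Fib x :=
  (φ ∘ₗ LinearMap.inl ℝ (V.E x) (∀ i, (C i).E x), fun i => φ ∘ₗ
    LinearMap.inr ℝ (V.E x) (∀ i, (C i).E x) ∘ₗ LinearMap.single ℝ (fun i => (C i).E x) i)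

lemma evalD_toDual (e : (graded V C).Fib x) (φ : Module.Dual ℝ ((graded V C).Fib x)) :
    evalD e (toDual φ) = φ e := by
  rw [evalD_apply]
  have h : e = LinearMap.inl ℝ (V.E x) (∀ i, (C i).E x) e.1 + ∑ i,
      LinearMap.inr ℝ (V.E x) (∀ i, (C i).E x) (Pi.single i (e.2 i)) := by
    rw [← map_sum, Finset.univ_sum_single]
    ext <;> simp
  conv_rhs => rw [h, map_add, map_sum]
  rfl

/-- The degrees of the parts of `V* ⊕ C*`. -/
def partDegree : Option (Fin n) → ℕ
  | none => 0
  | some i => i.val + 1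

lemma degree_graded (q : Option (Fin n)) : (graded V C).degree q = -(partDegree q : ℤ) := by
  cases q with
  | none => rfl
  | some i =>
    change (-1 : ℤ) * (i.val + 1) = _
    rw [partDegree]
    push_cast
    ring

lemma degree_gradedDual (q : Option (Fin n)) : (gradedDual V C).degree q = partDegree q := by
  cases q with
  | none => rfl
  | some i =>
    change (1 : ℤ) * (i.val + 1) = _
    rw [partDegree]
    push_cast
    ring

/-- The pairing with a homogeneous element `e` is the evaluation at `e`, with the sign for moving `e`
past the coefficients. -/
lemma pairGen_of_mem_part {q : Option (Fin n)} {e : (graded V C).Fib x}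
    (he : e ∈ (graded V C).part x q) (θ : ModFib A (gradedDual V C) x) :
    pairGen x e θ = (GSym.parity ^ partDegree q : SymFib A x →ₐ[ℝ] _)
      (ct A (gradedDual V C) (evalD e) θ) := by
  induction θ using TensorProduct.induction_on with
  | zero => simp
  | add y z hy hz => rw [map_add, map_add, map_add, hy, hz]
  | tmul ζ φ =>
    rw [pairGen_tmul, ct_tmul, evalD_apply, map_smul]
    cases q with
    | none =>
      obtain ⟨v, rfl⟩ := he
      simp [partDegree]
    | some i =>
      obtain ⟨c, rfl⟩ := he
      have h0 : ∀ j, j ≠ i → φ.2 j ((Pi.single i c : ∀ j, (C j).E x) j) = 0 := fun j hj => by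
        rw [Pi.single_eq_of_ne hj, map_zero]
      have h1 : ∑ j, φ.2 j ((Pi.single i c : ∀ j, (C j).E x) j) = φ.2 i c := by
        rw [Finset.sum_eq_single i (fun j _ hj => h0 j hj) (by simp), Pi.single_eq_same]
      have h2 : ∑ j : Fin n, φ.2 j ((Pi.single i c : ∀ j, (C j).E x) j) •
          (GSym.parity ^ (j.val + 1) : SymFib A x →ₐ[ℝ] _) ζ =
            φ.2 i c • (GSym.parity ^ (i.val + 1) : SymFib A x →ₐ[ℝ] _) ζ := by
        rw [Finset.sum_eq_single i (fun j _ hj => by rw [h0 j hj, zero_smul]) (by simp),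
          Pi.single_eq_same]
      change φ.1 0 • ζ + ∑ j : Fin n, φ.2 j ((Pi.single i c : ∀ j, (C j).E x) j) •
        (GSym.parity ^ (j.val + 1) : SymFib A x →ₐ[ℝ] _) ζ =
          (φ.1 0 + ∑ j, φ.2 j ((Pi.single i c : ∀ j, (C j).E x) j)) •
            (GSym.parity ^ (i.val + 1) : SymFib A x →ₐ[ℝ] _) ζ
      rw [h1, h2, map_zero, zero_smul, zero_add, zero_add]

lemma pair_tmul (ξ : SymFib A x) (e : (graded V C).Fib x) (θ : ModFib A (gradedDual V C) x) :
    pair x (ξ ⊗ₜ[ℝ] e) θ = ξ * pairGen x e θ := rfl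

lemma pair_zero_left (θ : ModFib A (gradedDual V C) x) :
    pair x (0 : ModFib A (graded V C) x) θ = 0 := map_zero _

lemma pair_add_left (η η' : ModFib A (graded V C) x) (θ : ModFib A (gradedDual V C) x) :
    pair x (η + η') θ = pair x η θ + pair x η' θ := map_add _ _ _

lemma pair_real_smul_left (t : ℝ) (η : ModFib A (graded V C) x)
    (θ : ModFib A (gradedDual V C) x) : pair x (t • η) θ = t • pair x η θ := map_smul _ _ _

lemma pair_smul_left (ξ : SymFib A x) (η : ModFib A (graded V C) x)
    (θ : ModFib A (gradedDual V C) x) : pair x (ξ • η) θ = ξ * pair x η θ := by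
  induction η using TensorProduct.induction_on with
  | zero => rw [smul_zero, pair_zero_left, mul_zero]
  | add y z hy hz => rw [smul_add, pair_add_left, hy, hz, pair_add_left, mul_add]
  | tmul ζ e => rw [TensorProduct.smul_tmul', smul_eq_mul, pair_tmul, pair_tmul, mul_assoc]

lemma pair_sum_left {ι : Type*} (k : Finset ι) (η : ι → ModFib A (graded V C) x)
    (θ : ModFib A (gradedDual V C) x) : pair x (∑ b ∈ k, η b) θ = ∑ b ∈ k, pair x (η b) θ :=
  map_sum (TensorProduct.lift _) _ _

lemma pair_add_right (η : ModFib A (graded V C) x) (θ θ' : ModFib A (gradedDual V C) x) :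
    pair x η (θ + θ') = pair x η θ + pair x η θ' := by
  induction η using TensorProduct.induction_on with
  | zero => rw [pair_zero_left, pair_zero_left, pair_zero_left, zero_add]
  | add y z hy hz =>
    rw [pair_add_left, hy, hz, pair_add_left, pair_add_left]
    abel
  | tmul ζ e => rw [pair_tmul, pair_tmul, pair_tmul, map_add, mul_add]

lemma pair_zero_right (η : ModFib A (graded V C) x) :
    pair x η (0 : ModFib A (gradedDual V C) x) = 0 := by
  have := pair_add_right η (0 : ModFib A (gradedDual V C) x) 0
  rwa [add_zero, left_eq_add] at this

lemma pair_toDual (y : ModFib A (graded V C) x) (φ : Module.Dual ℝ ((graded V C).Fib x)) :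
    pair x y (1 ⊗ₜ[ℝ] toDual φ) = ct A (graded V C) φ y := by
  induction y using TensorProduct.induction_on with
  | zero => rw [pair_zero_left, map_zero]
  | add y z hy hz => rw [pair_add_left, hy, hz, map_add]
  | tmul ζ e =>
    rw [pair_tmul, pairGen_tmul, ct_tmul, ← evalD_toDual, evalD_apply]
    simp [add_smul, mul_add, Finset.sum_smul, Finset.mul_sum]

/-- The sign `(-1) ^ |e|` on `V ⊕ C`. -/
noncomputable def gradeSign (V : VB I M) (C : Fin n → VB I M) (x : M) :
    (graded V C).Fib x →ₗ[ℝ] (graded V C).Fib x :=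
  LinearMap.prodMap LinearMap.id
    (LinearMap.pi fun i => ((-1 : ℝ) ^ (i.val + 1)) • LinearMap.proj i)

lemma gradeSign_of_mem_part {q : Option (Fin n)} {e : (graded V C).Fib x}
    (he : e ∈ (graded V C).part x q) : gradeSign V C x e = sgn (partDegree q) • e := by
  rw [sgn_natCast]
  cases q with
  | none =>
    obtain ⟨v, rfl⟩ := he
    rw [partDegree, pow_zero, one_smul]
    exact Prod.ext rfl (funext fun i => smul_zero _)
  | some i =>
    obtain ⟨c, rfl⟩ := he
    refine Prod.ext (smul_zero _).symm (funext fun j => ?_)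
    change (-1 : ℝ) ^ (j.val + 1) • (Pi.single i c : ∀ j, (C j).E x) j =
      (-1 : ℝ) ^ (i.val + 1) • (Pi.single i c : ∀ j, (C j).E x) j
    by_cases hj : j = i
    · rw [hj]
    · rw [Pi.single_eq_of_ne hj, smul_zero, smul_zero]

/-- The sign `(-1) ^ |η|` on `S(A*) ⊗ (V ⊕ C)`. -/
noncomputable def modPar (A : Fin n → VB I M) (V : VB I M) (C : Fin n → VB I M) (x : M) :
    ModFib A (graded V C) x →ₗ[ℝ] ModFib A (graded V C) x :=
  TensorProduct.map GSym.parity.toLinearMap (gradeSign V C x)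

lemma modPar_tmul (ξ : SymFib A x) (e : (graded V C).Fib x) :
    modPar A V C x (ξ ⊗ₜ[ℝ] e) = GSym.parity ξ ⊗ₜ[ℝ] gradeSign V C x e := rfl

lemma modPar_smul (ξ : SymFib A x) (η : ModFib A (graded V C) x) :
    modPar A V C x (ξ • η) = GSym.parity ξ • modPar A V C x η := by
  induction η using TensorProduct.induction_on with
  | zero => rw [smul_zero, map_zero, smul_zero]
  | add y z hy hz => rw [smul_add, map_add, hy, hz, map_add, smul_add]
  | tmul ζ e => rw [TensorProduct.smul_tmul', smul_eq_mul, modPar_tmul, modPar_tmul, map_mul,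
      TensorProduct.smul_tmul', smul_eq_mul]

lemma modPar_of_mem_modPiece {p : ℤ} {η : ModFib A (graded V C) x}
    (hη : η ∈ modPiece A (graded V C) x p) : modPar A V C x η = sgn p • η := by
  refine modPiece_induction (W := graded V C) (P := fun η => modPar A V C x η = sgn p • η)
    ?_ ?_ ?_ ?_ hη
  · intro k q ξ e hk hξ he
    rw [modPar_tmul, GSym.parity_of_mem_piece hξ, gradeSign_of_mem_part he,
      TensorProduct.smul_tmul_smul, ← hk, sgn_add, degree_graded, sgn_neg]
  · rw [map_zero, smul_zero]
  · intro y z hy hz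
    rw [map_add, hy, hz, smul_add]
  · intro t y hy
    rw [map_smul, hy, smul_comm]

lemma GSym.parity_pow_congr {W : Fin n → Type*} [∀ i, AddCommGroup (W i)]
    [∀ i, Module ℝ (W i)] {a b : ℕ} (hab : Even (a + b)) (ξ : GSym W) :
    (GSym.parity ^ a : GSym W →ₐ[ℝ] GSym W) ξ = (GSym.parity ^ b : GSym W →ₐ[ℝ] GSym W) ξ := by
  obtain ⟨c, hc⟩ := hab
  have h1 : (GSym.parity ^ (a + b) : GSym W →ₐ[ℝ] GSym W) ((GSym.parity ^ b : GSym W →ₐ[ℝ] GSym W) ξ)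
      = (GSym.parity ^ b : GSym W →ₐ[ℝ] GSym W) ξ := by
    rw [hc, pow_add, AlgHom.mul_apply, GSym.parity_pow_parity_pow]
  rw [← h1, pow_add, AlgHom.mul_apply, GSym.parity_pow_parity_pow]

/-- Graded commutativity, with only one of the factors homogeneous. -/
lemma GSym.mul_parity_pow {W : Fin n → Type*} [∀ i, AddCommGroup (W i)]
    [∀ i, Module ℝ (W i)] {k : ℤ} {ξ : GSym W} (hξ : ξ ∈ GSym.piece W k) {a b : ℕ}
    (hab : Even (k + a + b)) (η : GSym W) : ξ * (GSym.parity ^ a : GSym W →ₐ[ℝ] GSym W) η =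
      (GSym.parity ^ b : GSym W →ₐ[ℝ] GSym W) η * ξ := by
  have := GSym.piece_induction (p := fun k ξ => ∀ a b : ℕ, Even (k + a + b) →
    ξ * (GSym.parity ^ a : GSym W →ₐ[ℝ] GSym W) η =
      (GSym.parity ^ b : GSym W →ₐ[ℝ] GSym W) η * ξ) ?_ ?_ ?_ ?_ ?_ hξ
  · exact this a b hab
  · intro a b hab
    rw [one_mul, mul_one]
    exact GSym.parity_pow_congr (by rw [zero_add] at hab; exact_mod_cast hab) _
  · intro i x k ξ _ ih a b hab
    have h1 : Even (k + a + ((i.val + 1 + b : ℕ) : ℤ)) := by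
      convert hab using 1
      push_cast
      ring
    rw [mul_assoc, ih a _ h1, ← mul_assoc, GSym.ι_mul, pow_add _ (i.val + 1) b,
      AlgHom.mul_apply, GSym.parity_pow_parity_pow, mul_assoc]
  · intro k a b _
    rw [zero_mul, mul_zero]
  · intro k ξ ζ h1 h2 a b hab
    rw [add_mul, mul_add, h1 a b hab, h2 a b hab]
  · intro k t ξ h a b hab
    rw [smul_mul_assoc, mul_smul_comm, h a b hab]

end Pairing

section Pairing

variable {EB : Type v} [NormedAddCommGroup EB] [NormedSpace ℝ EB] {HB : Type w}
  [TopologicalSpace HB] {I : ModelWithCorners ℝ EB HB}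
  {M : Type u} [TopologicalSpace M] [ChartedSpace HB M] {n : ℕ}
  {V : VB I M} {A C : Fin n → VB I M}
  [FiniteDimensional ℝ EB] [T2Space M] [IsManifold I ∞ M]

lemma contMDiff_evalD {e : ∀ x, (graded V C).Fib x} (he : (graded V C).IsSmooth e)
    {φ : ∀ x, (gradedDual V C).Fib x} (hφ : (gradedDual V C).IsSmooth φ) :
    ContMDiff I 𝓘(ℝ, ℝ) ∞ fun x => evalD (e x) (φ x) := by
  have h1 : ContMDiff I 𝓘(ℝ, ℝ) ∞ fun x => (φ x).1 (e x).1 :=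
    VB.IsForm.apply (V := V) (α := fun x => (φ x).1) hφ.1 he.1
  have h2 : ∀ i, ContMDiff I 𝓘(ℝ, ℝ) ∞ fun x => (φ x).2 i ((e x).2 i) := fun i =>
    VB.IsForm.apply (V := C i) (α := fun x => (φ x).2 i) (hφ.2 i) (he.2 i)
  simp only [evalD_apply]
  exact h1.add (contMDiff_finsetSum fun i _ => h2 i)

/-- The coefficient of a section of `S(A*) ⊗ (V* ⊕ C*)` along a section of `V ⊕ C`. -/
noncomputable def evalFun (A : Fin n → VB I M) {e : ∀ x, (graded V C).Fib x}
    (he : (graded V C).IsSmooth e) (θ : SecMod A (gradedDual V C)) : Fun A :=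
  ctFun (fun x => evalD (e x)) (fun _ hφ => contMDiff_evalD he hφ) θ

lemma isSmooth_fst {e : ∀ x, (graded V C).Fib x} (he : (graded V C).IsSmooth e) :
    (graded V C).IsSmooth fun x => ((e x).1, 0) := ⟨he.1, fun i => VB.IsSec.zero (C i)⟩

lemma isSmooth_pi_single {e : ∀ x, (graded V C).Fib x} (he : (graded V C).IsSmooth e) (i : Fin n) :
    (graded V C).IsSmooth fun x => (0, Pi.single i ((e x).2 i)) := by
  refine ⟨VB.IsSec.zero V, fun j => ?_⟩
  by_cases hj : j = i
  · subst hj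
    simpa using he.2 j
  · simp only [Pi.single_eq_of_ne hj]
    exact VB.IsSec.zero (C j)

lemma pair_mem_Fun (η : SecMod A (graded V C)) (θ : SecMod A (gradedDual V C)) :
    (fun x => pair x (η.1 x) (θ.1 x)) ∈ Fun A := by
  let T : ∀ x, ModFib A (graded V C) x →ₗ[ℝ] SymFib A x := fun x =>
    { toFun := fun z => pair x z (θ.1 x)
      map_add' := fun _ _ => pair_add_left _ _ _
      map_smul' := fun _ _ => pair_real_smul_left _ _ _ }
  refine mem_Fun_of_secMod (f := fun x => x) continuous_id T (fun e he => ?_)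
    (fun ξ t ht => ?_) η
  · have h1 : (fun x => T x ((1 : SymFib A x) ⊗ₜ[ℝ] e x)) =
        (evalFun A (isSmooth_fst he) θ).1 +
          ∑ i : Fin n, (par (i.val + 1) (evalFun A (isSmooth_pi_single he i) θ)).1 := by
      funext x
      have h2 : e x = ((e x).1, 0) + ∑ i, (0, Pi.single i ((e x).2 i)) := by
        refine Prod.ext ?_ ?_
        · rw [Prod.fst_add, Prod.fst_sum]
          simp
        · rw [Prod.snd_add, Prod.snd_sum]
          simp [Finset.univ_sum_single]
      have h3 : ∀ e' : (graded V C).Fib x, T x ((1 : SymFib A x) ⊗ₜ[ℝ] e') =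
          pairGen x e' (θ.1 x) := fun e' => (pair_tmul _ _ _).trans (one_mul _)
      conv_lhs => rw [h2, TensorProduct.tmul_add, TensorProduct.tmul_sum, map_add, map_sum]
      rw [Pi.add_apply, Finset.sum_apply]
      refine congrArg₂ (· + ·) ((h3 _).trans (pairGen_of_mem_part (q := none)
        (e := ((e x).1, 0)) ⟨(e x).1, rfl⟩ _)) (Finset.sum_congr rfl fun i _ => ?_)
      rw [par_apply]
      exact (h3 _).trans (pairGen_of_mem_part (q := some i)
        (e := (0, Pi.single i ((e x).2 i))) ⟨(e x).2 i, rfl⟩ _)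
    rw [h1]
    exact add_mem (Subtype.prop _) (sum_mem fun i _ => Subtype.prop _)
  · have h1 : (fun x => T x (ξ.1 x • t x)) = ξ.1 * fun x => T x (t x) :=
      funext fun x => pair_smul_left _ _ _
    rw [h1]
    exact mul_mem ξ.2 ht

/-- The pairing of sections. -/
noncomputable def pairFun (η : SecMod A (graded V C)) (θ : SecMod A (gradedDual V C)) : Fun A :=
  ⟨fun x => pair x (η.1 x) (θ.1 x), pair_mem_Fun η θ⟩

lemma pairFun_apply (η : SecMod A (graded V C)) (θ : SecMod A (gradedDual V C)) (x : M) :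
    (pairFun η θ).1 x = pair x (η.1 x) (θ.1 x) := rfl

lemma pairFun_add (η η' : SecMod A (graded V C)) (θ : SecMod A (gradedDual V C)) :
    pairFun (η + η') θ = pairFun η θ + pairFun η' θ := Fun.ext fun _ => pair_add_left _ _ _

lemma pairFun_smul (ξ : Fun A) (η : SecMod A (graded V C)) (θ : SecMod A (gradedDual V C)) :
    pairFun (ξ • η) θ = ξ * pairFun η θ := Fun.ext fun _ => pair_smul_left _ _ _

lemma pairFun_gen {q : Option (Fin n)} {e : ∀ x, (graded V C).Fib x}
    (he : (graded V C).IsSmooth e) (hq : ∀ x, e x ∈ (graded V C).part x q)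
    (θ : SecMod A (gradedDual V C)) :
    pairFun (gen A (graded V C) e he) θ = par (partDegree q) (evalFun A he θ) := by
  refine Fun.ext fun x => ?_
  rw [par_apply]
  exact ((pair_tmul _ _ _).trans (one_mul _)).trans (pairGen_of_mem_part (hq x) _)

/-- Parts of different degree are orthogonal. -/
lemma evalD_of_mem_part {x : M} {q q' : Option (Fin n)} (hq : q' ≠ q) {e : (graded V C).Fib x}
    (he : e ∈ (graded V C).part x q) {φ : (gradedDual V C).Fib x}
    (hφ : φ ∈ (gradedDual V C).part x q') : evalD e φ = 0 := by
  rw [evalD_apply]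
  cases q with
  | none =>
    obtain ⟨v, rfl⟩ := he
    cases q' with
    | none => exact absurd rfl hq
    | some i =>
      obtain ⟨γ, rfl⟩ := hφ
      refine (add_eq_right.2 ?_).trans (Finset.sum_eq_zero fun j _ => map_zero _)
      rfl
  | some i =>
    obtain ⟨c, rfl⟩ := he
    cases q' with
    | none =>
      obtain ⟨γ, rfl⟩ := hφ
      refine (add_eq_right.2 (map_zero _)).trans (Finset.sum_eq_zero fun j _ => rfl)
    | some i' =>
      obtain ⟨γ, rfl⟩ := hφ
      refine (add_eq_right.2 (map_zero _)).trans (Finset.sum_eq_zero fun j _ => ?_)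
      change (Pi.single i' γ : ∀ j, Module.Dual ℝ ((C j).E x)) j
        ((Pi.single i c : ∀ j, (C j).E x) j) = 0
      by_cases hj : j = i
      · subst hj
        rw [Pi.single_eq_of_ne (fun h => hq (congrArg some h.symm)), LinearMap.zero_apply]
      · rw [Pi.single_eq_of_ne hj, map_zero]

lemma homFun_evalFun {q : Option (Fin n)} {e : ∀ x, (graded V C).Fib x}
    (he : (graded V C).IsSmooth e) (hq : ∀ x, e x ∈ (graded V C).part x q) {p : ℤ}
    {θ : SecMod A (gradedDual V C)} (hθ : HomSec p θ) :
    HomFun (p - partDegree q) (evalFun A he θ) := fun x => by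
  rw [← degree_gradedDual (V := V) (C := C)]
  exact ct_mem_piece (fun q' hq' φ hφ => evalD_of_mem_part hq' (hq x) hφ) (hθ x)

/-- The dual frame. -/
lemma isSmooth_toDual {x₀ : M} (F : Frame I (graded V C) x₀) (b : F.ι) :
    (gradedDual V C).IsSmooth fun x => toDual (F.φ b x) := by
  refine ⟨VB.isForm_of_apply (V := V) (α := fun x => (toDual (F.φ b x)).1) fun s hs =>
    F.smooth_φ b (fun x => (s x, 0))
    ⟨hs, fun i => VB.IsSec.zero (C i)⟩, fun i => VB.isForm_of_apply (V := C i)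
      (α := fun x => (toDual (F.φ b x)).2 i) fun s hs => F.smooth_φ b (fun x => (0, Pi.single i (s x))) ⟨VB.IsSec.zero V, fun j => ?_⟩⟩
  by_cases hj : j = i
  · subst hj
    simpa using hs
  · simp only [Pi.single_eq_of_ne hj]
    exact VB.IsSec.zero (C j)

/-- The frame dual to a homogeneous frame is homogeneous. -/
lemma toDual_mem_part {x₀ : M} (F : Frame I (graded V C) x₀) (b : F.ι) (x : M) :
    toDual (F.φ b x) ∈ (gradedDual V C).part x (F.part b) := by
  have h1 : ∀ v : V.E x, F.part b ≠ none → F.φ b x (v, 0) = 0 := fun v hb =>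
    F.hom_φ b x none hb.symm _ ⟨v, rfl⟩
  have h2 : ∀ i (c : (C i).E x), F.part b ≠ some i → F.φ b x (0, Pi.single i c) = 0 := fun i c hb =>
    F.hom_φ b x (some i) hb.symm _ ⟨c, rfl⟩
  generalize F.part b = q at h1 h2
  cases q with
  | none =>
    exact ⟨(toDual (F.φ b x)).1, Prod.ext rfl (funext fun i => LinearMap.ext fun c =>
      (h2 i c (by simp)).symm)⟩
  | some i =>
    refine ⟨(toDual (F.φ b x)).2 i, Prod.ext (LinearMap.ext fun v => (h1 v (by simp)).symm)
      (funext fun j => LinearMap.ext fun c => ?_)⟩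
    change (Pi.single i ((toDual (F.φ b x)).2 i) : ∀ j, Module.Dual ℝ ((C j).E x)) j c = _
    by_cases hj : j = i
    · subst hj
      rw [Pi.single_eq_same]
    · rw [Pi.single_eq_of_ne hj]
      exact (h2 j c fun h => hj (Option.some.inj h).symm).symm

/-- Sections are locally determined by their coefficients along a frame of `V ⊕ C`. -/
lemma eventually_eq_sum_evalFun {x₀ : M} (F : Frame I (graded V C) x₀) :
    ∀ᶠ x in 𝓝 x₀, ∀ θ : SecMod A (gradedDual V C), θ.1 x =
      (∑ b, evalFun A (F.smooth_e b) θ • gen A (gradedDual V C) _ (isSmooth_toDual F b) :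
        SecMod A (gradedDual V C)).1 x := by
  filter_upwards [F.res] with x hx θ
  have key : ∀ φ : (gradedDual V C).Fib x, φ = ∑ b, evalD (F.e b x) φ • toDual (F.φ b x) := by
    intro φ
    have h1 : ∀ w : (graded V C).Fib x, evalD w φ =
        ∑ b, evalD (F.e b x) φ * F.φ b x w := fun w => by
      have h2 : ∀ b (t : ℝ), evalD (t • F.e b x) φ = t * evalD (F.e b x) φ := fun b t => by
        rw [evalD_apply, evalD_apply]
        simp [mul_add, Finset.mul_sum]
      have h3 : ∀ (k : Finset F.ι), evalD (∑ b ∈ k, F.φ b x w • F.e b x) φ =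
          ∑ b ∈ k, F.φ b x w * evalD (F.e b x) φ := fun k => by
        rw [evalD_apply]
        simp only [Prod.fst_sum, Prod.snd_sum, Finset.sum_apply, map_sum]
        rw [Finset.sum_comm, ← Finset.sum_add_distrib]
        refine Finset.sum_congr rfl fun b _ => ?_
        rw [← h2, evalD_apply]
      conv_lhs => rw [hx w, h3]
      exact Finset.sum_congr rfl fun b _ => mul_comm _ _
    refine Prod.ext (LinearMap.ext fun v => ?_) (funext fun i => LinearMap.ext fun c => ?_)
    · have := h1 (v, 0)
      rw [evalD_apply] at this
      simp only [Prod.fst_sum, LinearMap.sum_apply]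
      refine Eq.trans ?_ this
      simp
    · have := h1 (0, Pi.single i c)
      rw [evalD_apply] at this
      simp only [Prod.snd_sum, Finset.sum_apply, LinearMap.sum_apply]
      refine Eq.trans ?_ this
      have h4 : ∑ j, φ.2 j ((Pi.single i c : ∀ j, (C j).E x) j) = φ.2 i c := by
        rw [Finset.sum_eq_single i (fun j _ hj => by rw [Pi.single_eq_of_ne hj, map_zero]) (by simp),
          Pi.single_eq_same]
      refine Eq.trans ?_ (congrArg (φ.1 0 + ·) h4).symm
      rw [map_zero, zero_add]
  rw [SecMod.sum_apply]
  exact eq_sum_ct key (θ.1 x)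

/-- The pairing is nondegenerate. -/
lemma eq_of_pair_homSec {x : M} {y z : ModFib A (graded V C) x}
    (h : ∀ p (θ : SecMod A (gradedDual V C)), HomSec p θ →
      pair x y (θ.1 x) = pair x z (θ.1 x)) : y = z := by
  obtain ⟨F⟩ := (isGood_graded V C).frame x
  rw [eq_sum_ct (A := A) (W := graded V C) F.res.self_of_nhds y,
    eq_sum_ct (A := A) (W := graded V C) F.res.self_of_nhds z]
  refine Finset.sum_congr rfl fun b _ => congrArg (· • _) ?_
  have := h _ (gen A (gradedDual V C) _ (isSmooth_toDual F b))
    (homSec_gen (isSmooth_toDual F b) (toDual_mem_part F b))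
  rwa [gen_apply, pair_toDual, pair_toDual] at this

lemma eq_of_pair {x : M} {y z : ModFib A (graded V C) x}
    (h : ∀ θ : SecMod A (gradedDual V C), pair x y (θ.1 x) = pair x z (θ.1 x)) : y = z :=
  eq_of_pair_homSec fun _ θ _ => h θ

end Pairing

/-! ### Dual representations -/

section DualRep

variable {EB : Type v} [NormedAddCommGroup EB] [NormedSpace ℝ EB] {HB : Type w}
  [TopologicalSpace HB] {I : ModelWithCorners ℝ EB HB}
  {M : Type u} [TopologicalSpace M] [ChartedSpace HB M] {n : ℕ}
  {V : VB I M} {A C : Fin n → VB I M}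
  [FiniteDimensional ℝ EB] [T2Space M] [IsManifold I ∞ M] {Q : LieStr A}

lemma smul_add_smul_add_smul_add_smul {R N : Type*} [Ring R] [AddCommGroup N] [Module R N]
    (a b c d : R) (s t : N) :
    (a • s + b • t) + (c • s + d • t) = (a + c) • s + (b + d) • t := by
  rw [add_smul, add_smul]
  abel

lemma Rep.leibniz_of_mem_homSpan {W : Graded n M} (R : Rep Q W) {ζ : Fun A} (hζ : ζ ∈ homSpan A)
    (s : SecMod A W) : R.D (ζ • s) = Q.Q ζ • s + par 1 ζ • R.D s := by
  induction hζ using Submodule.closure_induction with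
  | zero =>
    have h0 : R.D ((0 : Fun A) • s) = 0 := by rw [zero_smul, map_zero]
    rw [h0, map_zero, map_zero, zero_smul, zero_smul, add_zero]
  | add a b _ _ ha hb =>
    refine (congrArg R.D (add_smul a b s)).trans ((map_add R.D _ _).trans
      ((congrArg₂ (· + ·) ha hb).trans ?_))
    rw [map_add, map_add]
    exact smul_add_smul_add_smul_add_smul _ _ _ _ _ _
  | smul_mem t a ha =>
    obtain ⟨k, hk⟩ := ha
    have hk' := hk.smul t
    rw [R.leibniz k _ s hk', hk'.par, pow_one]

/-- The Leibniz rule for elements that are not homogeneous. -/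
lemma Rep.leibniz_par {W : Graded n M} (R : Rep Q W) (ξ : Fun A) (s : SecMod A W) :
    R.D (ξ • s) = Q.Q ξ • s + par 1 ξ • R.D s := by
  refine SecMod.ext fun x₀ => ?_
  obtain ⟨ζ, hζ, h⟩ := exists_homSpan ξ x₀
  have h1 : (R.D (ξ • s)).1 x₀ = (R.D (ζ • s)).1 x₀ := by
    refine R.local ?_
    filter_upwards [h] with x hx
    rw [SecMod.smul_apply, SecMod.smul_apply, hx]
  have h2 : (Q.Q ξ).1 x₀ = (Q.Q ζ).1 x₀ := Q.isDer.congr h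
  have h3 : (par 1 ξ).1 x₀ = (par 1 ζ).1 x₀ := by
    rw [par_apply, par_apply, h.self_of_nhds]
  rw [h1, R.leibniz_of_mem_homSpan hζ, SecMod.add_apply, SecMod.add_apply, SecMod.smul_apply, SecMod.smul_apply,
    SecMod.smul_apply, SecMod.smul_apply, h2, h3]

lemma LieStr.Q_par_pow (Q : LieStr A) (k : ℕ) (ξ : Fun A) :
    Q.Q (par k ξ) = sgn k • par k (Q.Q ξ) := by
  have par_succ : ∀ (k : ℕ) (ξ : Fun A), par (k + 1) ξ = par k (par 1 ξ) := fun k ξ =>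
    Fun.ext fun x => by
      rw [par_apply, par_apply, par_one_apply, pow_succ, AlgHom.mul_apply]
  induction k generalizing ξ with
  | zero =>
    have h : ∀ ξ : Fun A, par 0 ξ = ξ := fun ξ => Fun.ext fun x => by
      rw [par_apply, pow_zero]
      rfl
    rw [h, h]
    simp
  | succ k ih =>
    rw [par_succ k ξ, ih, Q.Q_par, par_succ k (Q.Q ξ), map_neg, Nat.cast_succ, sgn_add, sgn_one,
      mul_neg_one, neg_smul, smul_neg]

/-- The contraction with a section `e` of `V ⊕ C` of the differential on `S(A*) ⊗ (V* ⊕ C*)`. It is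
linear over `S(A*)` up to sign. -/
noncomputable def evalComm (R' : Rep Q (gradedDual V C)) {e : ∀ x, (graded V C).Fib x}
    (he : (graded V C).IsSmooth e) (θ : SecMod A (gradedDual V C)) : Fun A :=
  Q.Q (evalFun A he θ) - evalFun A he (R'.D θ)

section

variable (R' : Rep Q (gradedDual V C)) {e : ∀ x, (graded V C).Fib x}
  (he : (graded V C).IsSmooth e)

lemma evalFun_add (θ θ' : SecMod A (gradedDual V C)) :
    evalFun A he (θ + θ') = evalFun A he θ + evalFun A he θ' := Fun.ext fun _ => map_add _ _ _

lemma evalFun_smul (ξ : Fun A) (θ : SecMod A (gradedDual V C)) :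
    evalFun A he (ξ • θ) = ξ * evalFun A he θ := Fun.ext fun _ => ct_smul _ _ _

lemma evalComm_add (θ θ' : SecMod A (gradedDual V C)) :
    evalComm R' he (θ + θ') = evalComm R' he θ + evalComm R' he θ' := by
  rw [evalComm, map_add, evalFun_add, evalFun_add, map_add, evalComm, evalComm]
  abel

lemma evalComm_smul (ξ : Fun A) (θ : SecMod A (gradedDual V C)) :
    evalComm R' he (ξ • θ) = par 1 ξ * evalComm R' he θ := by
  rw [evalComm, R'.leibniz_par, evalFun_smul, evalFun_add, evalFun_smul, evalFun_smul,
    Q.isDer.leibniz_par, evalComm, mul_sub]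
  exact add_sub_add_left_eq_sub _ _ _

lemma evalComm_sum {ι : Type*} (k : Finset ι) (θ : ι → SecMod A (gradedDual V C)) :
    evalComm R' he (∑ b ∈ k, θ b) = ∑ b ∈ k, evalComm R' he (θ b) :=
  map_sum (AddMonoidHom.mk' (evalComm R' he) (evalComm_add R' he)) _ _

lemma evalComm_local {θ θ' : SecMod A (gradedDual V C)} {x : M}
    (h : ∀ᶠ y in 𝓝 x, θ.1 y = θ'.1 y) : (evalComm R' he θ).1 x = (evalComm R' he θ').1 x := by
  have h1 : (Q.Q (evalFun A he θ)).1 x = (Q.Q (evalFun A he θ')).1 x := by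
    refine Q.isDer.congr ?_
    filter_upwards [h] with y hy
    exact congrArg (ct A (gradedDual V C) (evalD (e y))) hy
  have h2 : (R'.D θ).1 x = (R'.D θ').1 x := R'.local h
  exact congrArg₂ (· - ·) h1 (congrArg (ct A (gradedDual V C) (evalD (e x))) h2)

lemma homFun_evalComm {q : Option (Fin n)} (hq : ∀ x, e x ∈ (graded V C).part x q) {p : ℤ}
    {θ : SecMod A (gradedDual V C)} (hθ : HomSec p θ) :
    HomFun (p + 1 - partDegree q) (evalComm R' he θ) := fun x => by
  have h1 := Q.isDer.deg _ _ (homFun_evalFun he hq hθ) x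
  have h2 := homFun_evalFun he hq (R'.deg _ _ hθ) x
  rw [show p - partDegree q + 1 = p + 1 - partDegree q by ring] at h1
  exact sub_mem h1 h2

/-- The value of the dual differential on a homogeneous section of `V ⊕ C`. The defining equation
prescribes its pairing with every `θ`; as this depends on `θ` linearly over `S(A*)`, up to sign, it is
represented by a section. -/
theorem exists_dual_gen {q : Option (Fin n)} (hq : ∀ x, e x ∈ (graded V C).part x q) :
    ∃ t : SecMod A (graded V C), HomSec ((graded V C).degree q + 1) t ∧
      ∀ x (θ : SecMod A (gradedDual V C)), pair x (t.1 x) (θ.1 x) =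
        sgn (partDegree q) • (par (partDegree q) (evalComm R' he θ)).1 x := by
  suffices h1 : ∃ t : SecMod A (graded V C), ∀ x,
      t.1 x ∈ modPiece A (graded V C) x ((graded V C).degree q + 1) ∧
      ∀ (θ : SecMod A (gradedDual V C)), pair x (t.1 x) (θ.1 x) =
        sgn (partDegree q) • (par (partDegree q) (evalComm R' he θ)).1 x from
    h1.imp fun t ht => ⟨fun x => (ht x).1, fun x => (ht x).2⟩
  refine exists_secMod_of_local (fun x y =>
    y ∈ modPiece A (graded V C) x ((graded V C).degree q + 1) ∧
      ∀ (θ : SecMod A (gradedDual V C)), pair x y (θ.1 x) =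
        sgn (partDegree q) • (par (partDegree q) (evalComm R' he θ)).1 x)
    (fun x y z hy hz => eq_of_pair fun θ => (hy.2 θ).trans (hz.2 θ).symm) fun x₀ => ?_
  obtain ⟨F⟩ := (isGood_graded V C).frame x₀
  have hτ : ∀ b, HomFun (partDegree (F.part b) + 1 - partDegree q : ℤ) (par (partDegree q)
      (evalComm R' he (gen A (gradedDual V C) _ (isSmooth_toDual F b)))) := fun b => by
    have h1 := homSec_gen (A := A) (W := gradedDual V C) (isSmooth_toDual F b) (toDual_mem_part F b)
    rw [degree_gradedDual] at h1
    have h2 := homFun_evalComm R' he hq h1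
    rw [h2.par]
    exact h2.smul _
  -- The coefficients along the frame are the prescribed pairings with the dual frame.
  refine ⟨∑ b, (sgn (partDegree q) • par (partDegree q)
    (evalComm R' he (gen A (gradedDual V C) _ (isSmooth_toDual F b)))) •
      gen A (graded V C) _ (F.smooth_e b), ?_⟩
  filter_upwards [(eventually_eq_sum_evalFun (A := A) F).eventually_nhds] with x hx
  refine ⟨HomSec.sum _ (fun b _ => ?_) x, fun θ => ?_⟩
  · have h1 := homSec_gen (A := A) (W := graded V C) (F.smooth_e b) (F.hom_e b)
    have h2 := HomSec.smul ((hτ b).smul (sgn (partDegree q))) h1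
    rw [degree_graded] at h2 ⊢
    convert h2 using 1
    ring
  · have h1 : (evalComm R' he θ).1 x = ∑ b, GSym.parity ((evalFun A (F.smooth_e b) θ).1 x) *
        (evalComm R' he (gen A (gradedDual V C) _ (isSmooth_toDual F b))).1 x := by
      rw [evalComm_local R' he (hx.mono fun y hy => hy θ), evalComm_sum, Fun.sum_apply]
      refine Finset.sum_congr rfl fun b _ => ?_
      rw [evalComm_smul, ← par_one_apply]
      rfl
    rw [SecMod.sum_apply, pair_sum_left, par_apply, h1, map_sum, Finset.smul_sum]
    refine Finset.sum_congr rfl fun b _ => ?_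
    have h2 : pair x ((gen A (graded V C) _ (F.smooth_e b)).1 x) (θ.1 x) =
        (GSym.parity ^ partDegree (F.part b) : SymFib A x →ₐ[ℝ] _)
          ((evalFun A (F.smooth_e b) θ).1 x) := by
      rw [← par_apply, ← pairFun_gen (F.smooth_e b) (F.hom_e b)]
      rfl
    have h3 := GSym.mul_parity_pow (hτ b x) (a := partDegree (F.part b)) (b := partDegree q + 1)
      ⟨partDegree (F.part b) + 1, by push_cast; ring⟩ ((evalFun A (F.smooth_e b) θ).1 x)
    rw [SecMod.smul_apply, pair_smul_left, h2, map_mul]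
    refine (smul_mul_assoc (sgn (partDegree q)) ((par (partDegree q)
      (evalComm R' he (gen A (gradedDual V C) _ (isSmooth_toDual F b)))).1 x) _).trans ?_
    rw [h3, par_apply, pow_succ, AlgHom.mul_apply]

/-- The relation between a section `η` of `S(A*) ⊗ (V ⊕ C)` and the value `y` of its differential
at `x`, for the differential dual to `R'`. It makes sense also if `η` is not homogeneous. -/
def DualRel (η : SecMod A (graded V C)) (x : M) (y : ModFib A (graded V C) x) : Prop :=
  ∀ θ : SecMod A (gradedDual V C), pair x y (θ.1 x) = (Q.Q (pairFun η θ)).1 x -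
    pair x (modPar A V C x (η.1 x)) ((R'.D θ).1 x)

variable {R'}

lemma DualRel.congr {η η' : SecMod A (graded V C)} {x : M} {y : ModFib A (graded V C) x}
    (h : ∀ᶠ x' in 𝓝 x, η.1 x' = η'.1 x') (hy : DualRel R' η x y) : DualRel R' η' x y := fun θ => by
  have h1 : (Q.Q (pairFun η θ)).1 x = (Q.Q (pairFun η' θ)).1 x := by
    refine Q.isDer.congr ?_
    filter_upwards [h] with x' hx'
    rw [pairFun_apply, pairFun_apply, hx']
  rw [hy θ, h1, h.self_of_nhds]

lemma DualRel.add {η η' : SecMod A (graded V C)} {x : M} {y z : ModFib A (graded V C) x}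
    (hy : DualRel R' η x y) (hz : DualRel R' η' x z) : DualRel R' (η + η') x (y + z) := fun θ => by
  have h1 : (Q.Q (pairFun (η + η') θ)).1 x =
      (Q.Q (pairFun η θ)).1 x + (Q.Q (pairFun η' θ)).1 x := by
    rw [pairFun_add, map_add]
    rfl
  rw [pair_add_left, hy θ, hz θ, h1, SecMod.add_apply, map_add, pair_add_left]
  abel

lemma DualRel.smul (ξ : Fun A) {η : SecMod A (graded V C)} {x : M} {y : ModFib A (graded V C) x}
    (hy : DualRel R' η x y) :
    DualRel R' (ξ • η) x ((Q.Q ξ).1 x • η.1 x + (par 1 ξ).1 x • y) := fun θ => by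
  have h1 : (Q.Q (pairFun (ξ • η) θ)).1 x = (Q.Q ξ).1 x * pair x (η.1 x) (θ.1 x) +
      (par 1 ξ).1 x * (Q.Q (pairFun η θ)).1 x := by
    rw [pairFun_smul, Q.isDer.leibniz_par]
    rfl
  have h2 : pair x (modPar A V C x ((ξ • η).1 x)) ((R'.D θ).1 x) =
      (par 1 ξ).1 x * pair x (modPar A V C x (η.1 x)) ((R'.D θ).1 x) := by
    rw [SecMod.smul_apply, modPar_smul, pair_smul_left, par_one_apply]
  rw [pair_add_left, pair_smul_left, pair_smul_left, hy θ, h1, h2, mul_sub, add_sub_assoc]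

lemma dualRel_iff_of_homSec {p : ℤ} {η : SecMod A (graded V C)} (hη : HomSec p η) (x : M)
    (y : ModFib A (graded V C) x) : DualRel R' η x y ↔
      ∀ θ : SecMod A (gradedDual V C), pair x y (θ.1 x) = (Q.Q (pairFun η θ)).1 x -
        sgn p • (pairFun η (R'.D θ)).1 x := by
  refine forall_congr' fun θ => ?_
  rw [modPar_of_mem_modPiece (hη x), pair_real_smul_left, pairFun_apply]

lemma exists_dualRel_gen {q : Option (Fin n)} (hq : ∀ x, e x ∈ (graded V C).part x q) :
    ∃ t : SecMod A (graded V C), HomSec ((graded V C).degree q + 1) t ∧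
      ∀ x, DualRel R' (gen A (graded V C) e he) x (t.1 x) := by
  obtain ⟨t, ht, ht'⟩ := exists_dual_gen R' he hq
  refine ⟨t, ht, fun x => (dualRel_iff_of_homSec (homSec_gen he hq) x _).2 fun θ => ?_⟩
  have h1 : Q.Q (pairFun (gen A (graded V C) e he) θ) - sgn (partDegree q) •
      pairFun (gen A (graded V C) e he) (R'.D θ) =
        sgn (partDegree q) • par (partDegree q) (evalComm R' he θ) := by
    rw [pairFun_gen he hq, pairFun_gen he hq, Q.Q_par_pow, evalComm, map_sub, smul_sub]
  rw [ht', degree_graded, sgn_neg]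
  exact congrArg (fun ζ : Fun A => ζ.1 x) h1.symm

/-- The dual differential squares to zero because `Q` and the given differential do. The mixed terms
cancel, as the degree of `η` changes by one. -/
lemma DualRel.sq {p : ℤ} {η t u : SecMod A (graded V C)} (hη : HomSec p η)
    (ht : HomSec (p + 1) t) (h1 : ∀ x, DualRel R' η x (t.1 x))
    (h2 : ∀ x, DualRel R' t x (u.1 x)) : u = 0 := by
  have h3 : ∀ θ, pairFun t θ = Q.Q (pairFun η θ) - sgn p • pairFun η (R'.D θ) := fun θ =>
    Fun.ext fun x => (dualRel_iff_of_homSec hη x _).1 (h1 x) θ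
  have h4 : ∀ θ, pairFun u θ = Q.Q (pairFun t θ) - sgn (p + 1) • pairFun t (R'.D θ) := fun θ =>
    Fun.ext fun x => (dualRel_iff_of_homSec ht x _).1 (h2 x) θ
  have h5 : pairFun η 0 = 0 := Fun.ext fun x => pair_zero_right _
  have h6 : ∀ θ, pairFun u θ = 0 := fun θ => by
    rw [h4, h3, h3, R'.sq, h5, map_sub, Q.sq, map_smul, sgn_add, sgn_one]
    simp
  exact SecMod.ext fun x => eq_of_pair fun θ =>
    (congrArg (fun ζ : Fun A => ζ.1 x) (h6 θ)).trans (pair_zero_left _).symm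

variable (R')

/-- Every representation on `V* ⊕ C*` has a dual representation on `V ⊕ C`. -/
theorem Rep.exists_isDual : ∃ R : Rep Q (graded V C), IsDual R R' := by
  obtain ⟨R, hR⟩ := exists_rep (isGood_graded V C) Q (DualRel R')
    (fun η x y z hy hz => eq_of_pair fun θ => (hy θ).trans (hz θ).symm)
    (fun η η' x y h hy => hy.congr h) (fun η η' x y z hy hz => hy.add hz)
    (fun ξ η x y hy => hy.smul ξ) (fun q e he hq => exists_dualRel_gen he hq)
    fun q e he hq t u ht h1 h2 => DualRel.sq (homSec_gen he hq) ht h1 h2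
  refine ⟨R, fun p η θ hη => ⟨pairFun η θ, fun x => rfl, fun x => ?_⟩⟩
  have := (dualRel_iff_of_homSec hη x _).1 (hR η x) θ
  rw [this]
  exact (sub_add_cancel _ _).symm

variable {R'} in
/-- The dual representation is unique. -/
theorem IsDual.unique {R S : Rep Q (graded V C)} (hR : IsDual R R') (hS : IsDual S R') : S = R := by
  have h : S.D = R.D := eq_of_homogeneous (W := graded V C) (W' := graded V C) (D := S.D)
    (D' := R.D) (isGood_graded V C) (fun _ _ _ => S.local) (fun _ _ _ => R.local)
    fun p η hη => SecMod.ext fun x => eq_of_pair fun θ => by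
      obtain ⟨ξ, hξ, h1⟩ := hR p η θ hη
      obtain ⟨ξ', hξ', h2⟩ := hS p η θ hη
      obtain rfl : ξ = ξ' := Fun.ext fun x => (hξ x).trans (hξ' x).symm
      exact add_right_cancel ((h2 x).symm.trans (h1 x))
  exact Rep.ext h

end

end DualRep

/-! ### The representation of a decomposed VB-Lie `n`-algebroid -/

section Corresponds

variable {EB : Type v} [NormedAddCommGroup EB] [NormedSpace ℝ EB] {HB : Type w}
  [TopologicalSpace HB] {I : ModelWithCorners ℝ EB HB}
  {M : Type u} [TopologicalSpace M] [ChartedSpace HB M] {n : ℕ}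
  {V : VB I M} {A C : Fin n → VB I M} {D : ∀ i, DVB V (A i) (C i)}
  [FiniteDimensional ℝ EB] [T2Space M] [IsManifold I ∞ M]

/-- A representation is determined by its values on the sections of `W`. -/
lemma Rep.ext_gen {W : Graded n M} (hW : W.IsGood I) {Q : LieStr A} {R S : Rep Q W}
    (h : ∀ e he, R.D (gen A W e he) = S.D (gen A W e he)) : R = S := by
  have : R.D = S.D := by
    refine AddMonoidHom.ext fun s => SecMod.ext fun x₀ => ?_
    obtain ⟨F⟩ := hW.frame x₀
    rw [(eventually_apply_eq (fun _ _ _ => R.local) F s).self_of_nhds,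
      (eventually_apply_eq (fun _ _ _ => S.local) F s).self_of_nhds, map_sum, map_sum]
    refine congrArg (fun s : SecMod A W => s.1 x₀) (Finset.sum_congr rfl fun b _ => ?_)
    rw [R.leibniz_par, S.leibniz_par, h]
  exact Rep.ext this

variable {QD : LieStr (fun i => (D i).overV)} {QA : LieStr A} {h : ∀ i, (D i).Decomposition}

lemma IsDual.corresponds {R : Rep QA (graded V C)} {R' : Rep QA (gradedDual V C)}
    (hR : IsDual R R') (hR' : ∀ s, QD.Q (secToFun h s) = secToFun h (R'.D s)) :
    Corresponds QD h R :=
  ⟨R', fun e he => ⟨secToFun h (gen A (gradedDual V C) e he), fun _ => rfl,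
    fun v => congrArg (fun ζ : Fun (fun i => (D i).overV) => ζ.1 v) (hR' _)⟩, hR⟩

/-- The dual representation is fixed by its values on generators, which determine `R`. -/
lemma Corresponds.unique {R S : Rep QA (graded V C)} {R' : Rep QA (gradedDual V C)}
    (hR : IsDual R R') (hR' : ∀ s, QD.Q (secToFun h s) = secToFun h (R'.D s))
    (hS : Corresponds QD h S) : S = R := by
  obtain ⟨S', hS', hS⟩ := hS
  obtain rfl : S' = R' := Rep.ext_gen (isGood_gradedDual V C) fun e he => by
    obtain ⟨ζ, hζ, hζ'⟩ := hS' e he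
    obtain rfl : ζ = secToFun h (gen A (gradedDual V C) e he) := Fun.ext hζ
    rw [hR'] at hζ'
    exact eq_of_secToFun h (Fun.ext fun v => (hζ' v).symm)
  exact hR.unique hS

end Corresponds

/-! ### The difference of two decompositions -/

section Difference

variable {EB : Type v} [NormedAddCommGroup EB] [NormedSpace ℝ EB] {HB : Type w}
  [TopologicalSpace HB] {I : ModelWithCorners ℝ EB HB}
  {M : Type u} [TopologicalSpace M] [ChartedSpace HB M]
  {V A C : VB I M} {D : DVB V A C}
  [FiniteDimensional ℝ EB] [T2Space M] [IsManifold I ∞ M]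

namespace DVB.Decomposition

/-- The difference `h - h'` of two horizontal lifts: the core component with respect to `h'` of the
lift with respect to `h`. -/
noncomputable def diff (h h' : D.Decomposition) (m : M) : V.E m →ₗ[ℝ] A.E m →ₗ[ℝ] C.E m :=
  LinearMap.mk₂ ℝ (fun v a => h'.corePart ⟨m, v⟩ (h.lift ⟨m, v⟩ a))
    (fun v w a => by
      obtain ⟨ext, hext, ha⟩ := A.exists_extend m
      have := h'.corePart_add (h.isLinear_lift (hext a)) m v w
      simp only [ha] at this
      exact this)
    (fun t v a => by
      obtain ⟨ext, hext, ha⟩ := A.exists_extend m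
      have := h'.corePart_smul (h.isLinear_lift (hext a)) m t v
      simp only [ha] at this
      exact this)
    (fun v a b => by rw [map_add, map_add])
    (fun t v a => by rw [map_smul, map_smul])

lemma isDifference_diff (h h' : D.Decomposition) : IsDifference h h' (diff h h') := by
  rintro ⟨m, v⟩ a
  have h1 := h'.equiv_prA_corePart ⟨m, v⟩ (h.lift ⟨m, v⟩ a)
  rw [h.prA_lift, h'.equiv_apply] at h1
  rw [← h1, add_sub_cancel_left]
  exact h'.coreLift_equiv _ _

end DVB.Decomposition

lemma DVB.IsDifference.unique {h h' : D.Decomposition} {Δ : ∀ m, V.E m →ₗ[ℝ] A.E m →ₗ[ℝ] C.E m}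
    (hΔ : IsDifference h h' Δ) : Δ = Decomposition.diff h h' := by
  funext m
  refine LinearMap.ext fun v => LinearMap.ext fun a => ?_
  have := h'.corePart_of_coreLift (hΔ ⟨m, v⟩ a)
  rw [map_sub, h'.corePart_lift, sub_zero] at this
  exact this.symm

end Difference

section Shear

variable {EB : Type v} [NormedAddCommGroup EB] [NormedSpace ℝ EB] {HB : Type w}
  [TopologicalSpace HB] {I : ModelWithCorners ℝ EB HB}
  {M : Type u} [TopologicalSpace M] [ChartedSpace HB M] {n : ℕ}
  {V : VB I M} {A C : Fin n → VB I M}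

lemma pairGen_eq {x : M} (e : (graded V C).Fib x) (θ : ModFib A (gradedDual V C) x) :
    pairGen x e θ = ctV A C e.1 θ + ∑ i : Fin n,
      (GSym.parity ^ (i.val + 1) : SymFib A x →ₐ[ℝ] _) (ctC V A C i (e.2 i) θ) := by
  induction θ using TensorProduct.induction_on with
  | zero => simp
  | add y z hy hz =>
    simp only [map_add, hy, hz, Finset.sum_add_distrib]
    abel
  | tmul ζ φ => simp only [pairGen_tmul, ctV_tmul, ctC_tmul, map_smul]

/-- Pairing the tensor of `L : A i → C i` with a form on `C i` gives the transpose of `L` on that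
form. -/
lemma pair_homTensor {x : M} (i : Fin n) (L : (A i).E x →ₗ[ℝ] (C i).E x) (ζ : SymFib A x)
    (φ : (gradedDual V C).Fib x) : pair x (homTensor A (graded V C) x i L) (ζ ⊗ₜ[ℝ] φ) =
      ζ * GSym.ι i (φ.2 i ∘ₗ L) := by
  let b := Module.finBasis ℝ ((A i).E x)
  have h1 : φ.2 i ∘ₗ L = ∑ c, φ.2 i (L (b c)) • b.coord c := by
    refine LinearMap.ext fun v => ?_
    conv_lhs => rw [← b.sum_repr v]
    rw [LinearMap.comp_apply, map_sum, map_sum, LinearMap.sum_apply]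
    refine Finset.sum_congr rfl fun c _ => ?_
    rw [map_smul, map_smul, LinearMap.smul_apply, smul_eq_mul, smul_eq_mul, mul_comm]
    rfl
  rw [homTensor_eq_sum (W := graded V C) (s := b) (σ := b.coord) i fun v => (b.sum_repr v).symm,
    pair_sum_left, h1, map_sum, Finset.mul_sum]
  refine Finset.sum_congr rfl fun c _ => ?_
  have h2 : evalD ((0, Pi.single i (L (b c))) : (graded V C).Fib x) φ = φ.2 i (L (b c)) := by
    rw [evalD_apply]
    refine (congrArg (· + _) (map_zero (φ.1))).trans ((zero_add _).trans ?_)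
    rw [Finset.sum_eq_single i (fun j _ hj => ?_) (by simp)]
    · have h4 : ((0, Pi.single i (L (b c))) : (graded V C).Fib x).2 i = L (b c) :=
        Pi.single_eq_same (M := fun i => (C i).E x) i (L (b c))
      exact congrArg (φ.2 i) h4
    · exact (congrArg _ (Pi.single_eq_of_ne hj _)).trans (map_zero _)
  have h3 := pairGen_of_mem_part (A := A) (q := some i)
    (e := ((0, Pi.single i (L (b c))) : (graded V C).Fib x)) ⟨L (b c), rfl⟩ (ζ ⊗ₜ[ℝ] φ)
  rw [pair_tmul, h3, ct_tmul, h2, map_smul,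
    mul_smul_comm, map_smul, mul_smul_comm]
  exact congrArg _ (GSym.ι_mul_parity i _ ζ)

lemma ctV_add {x : M} (v w : V.E x) (θ : ModFib A (gradedDual V C) x) :
    ctV A C (v + w) θ = ctV A C v θ + ctV A C w θ := by
  induction θ using TensorProduct.induction_on with
  | zero => simp
  | add y z hy hz =>
    simp only [map_add, hy, hz]
    abel
  | tmul ζ φ => simp only [ctV_tmul, map_add, add_smul]

lemma ctV_smul {x : M} (t : ℝ) (v : V.E x) (θ : ModFib A (gradedDual V C) x) :
    ctV A C (t • v) θ = t • ctV A C v θ := by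
  induction θ using TensorProduct.induction_on with
  | zero => simp
  | add y z hy hz => simp only [map_add, hy, hz, smul_add]
  | tmul ζ φ => simp only [ctV_tmul, map_smul, smul_assoc]

/-- The pairing with a shear, in terms of a dual shear of the second argument. -/
lemma pair_shear {x : M} {Δ : ∀ i, V.E x →ₗ[ℝ] (A i).E x →ₗ[ℝ] (C i).E x}
    {θ θ' : ModFib A (gradedDual V C) x}
    (h1 : ∀ v, ctV A C v θ' = ctV A C v θ +
      ∑ i, pair x (homTensor A (graded V C) x i (Δ i v)) θ)
    (h2 : ∀ i c, ctC V A C i c θ' = ctC V A C i c θ) (z : ModFib A (graded V C) x) :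
    pair x (shear A (graded V C) x Δ z) θ = pair x z θ' := by
  induction z using TensorProduct.induction_on with
  | zero => rw [map_zero, pair_zero_left, pair_zero_left]
  | add y z hy hz => rw [map_add, pair_add_left, hy, hz, pair_add_left]
  | tmul ξ e =>
    rw [shear_tmul, pair_add_left, pair_tmul, pair_tmul, pair_sum_left, pairGen_eq e θ',
      pairGen_eq e θ, h1]
    simp only [h2, pair_smul_left, ← Finset.mul_sum]
    rw [← mul_add]
    congr 1
    abel

variable {D : ∀ i, DVB V (A i) (C i)} [FiniteDimensional ℝ EB] [T2Space M] [IsManifold I ∞ M]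
  (h h' : ∀ i, (D i).Decomposition)

/-- The embedding of the core in `D` does not depend on the decomposition. -/
lemma coreContract_eq (v : V.Tot) (i : Fin n) (c : (C i).E v.proj) :
    coreContract h v i c = coreContract h' v i c := by
  rw [coreContract, coreContract, (h i).eq_of_coreLift ((h' i).coreLift_equiv v c)]

/-- The horizontal part with respect to `h` of a function that is given in terms of `h'`. -/
lemma liftPull_toFun_of_decomposition {m : M} (v : V.E m) (θ : ModFib A (gradedDual V C) m) :
    liftPull h ⟨m, v⟩ (toFun h' ⟨m, v⟩ θ) = ctV A C v θ +
      ∑ i, pair m (homTensor A (graded V C) m i ((h i).diff (h' i) m v)) θ := by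
  induction θ using TensorProduct.induction_on with
  | zero => simp [pair_zero_right]
  | add y z hy hz =>
    simp only [map_add, hy, hz, pair_add_right, Finset.sum_add_distrib]
    abel
  | tmul ζ φ =>
    rw [toFun_tmul, map_mul, liftPull_pull, map_add, AlgHom.commutes, map_sum, ctV_tmul, mul_add,
      ← Algebra.commutes, ← Algebra.smul_def, Finset.mul_sum]
    refine congrArg (_ + ·) (Finset.sum_congr rfl fun i _ => ?_)
    rw [pair_homTensor, liftPull, GSym.map_ι]
    rfl

/-- The space of fibrewise linear functions does not depend on the decomposition. -/
lemma isFibLinear_toFun (θ : SecMod A (gradedDual V C)) :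
    IsFibLinear h (secToFun h' θ).1 where
  add m v w := by
    simp only [secToFun_apply]
    rw [liftPull_toFun_of_decomposition, liftPull_toFun_of_decomposition,
      liftPull_toFun_of_decomposition]
    simp only [ctV_add, map_add, pair_add_left, Finset.sum_add_distrib]
    abel
  smul m t v := by
    simp only [secToFun_apply]
    rw [liftPull_toFun_of_decomposition, liftPull_toFun_of_decomposition]
    simp only [ctV_smul, map_smul, pair_real_smul_left, smul_add, Finset.smul_sum]
  const m v i c := by
    simp only [secToFun_apply]
    rw [coreContract_eq h h', coreContract_eq h h', coreContract_toFun, coreContract_toFun,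
      liftPull_pull, liftPull_pull]
  core_core v i c j c' := by
    rw [secToFun_apply, coreContract_eq h h' v i c, coreContract_eq h h' v j c',
      coreContract_toFun, coreContract_pull]

end Shear

/-! ### Change of decomposition -/

section Change

variable {EB : Type v} [NormedAddCommGroup EB] [NormedSpace ℝ EB] {HB : Type w}
  [TopologicalSpace HB] {I : ModelWithCorners ℝ EB HB}
  {M : Type u} [TopologicalSpace M] [ChartedSpace HB M] {n : ℕ}
  {V : VB I M} {A C : Fin n → VB I M} {D : ∀ i, DVB V (A i) (C i)}
  [FiniteDimensional ℝ EB] [T2Space M] [IsManifold I ∞ M]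

/-- The identification of sections with functions on `D` preserves degrees. -/
lemma toFun_mem_piece (h : ∀ i, (D i).Decomposition) (v : V.Tot) {p : ℤ}
    {z : ModFib A (gradedDual V C) v.proj} (hz : z ∈ modPiece A (gradedDual V C) v.proj p) :
    toFun h v z ∈ GSym.piece (fun i => Module.Dual ℝ ((D i).overV.E v)) p := by
  refine modPiece_induction (W := gradedDual V C) (P := fun z => toFun h v z ∈
    GSym.piece (fun i => Module.Dual ℝ ((D i).overV.E v)) p) ?_ ?_ ?_ ?_ hz
  · intro k q ξ e hk hξ he
    have h1 : pull D v ξ ∈ GSym.piece (fun i => Module.Dual ℝ ((D i).overV.E v)) k :=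
      GSym.map_mem_piece (fun i => ((D i).prA v).dualMap) hξ
    rw [toFun_tmul, ← hk]
    refine GSym.mul_mem_piece h1 ?_
    cases q with
    | none =>
      obtain ⟨w, rfl⟩ := he
      refine add_mem ?_ (sum_mem fun i _ => ?_)
      · exact GSym.algebraMap_mem_piece _
      · have h2 : GSym.ι (W := fun i => Module.Dual ℝ ((D i).overV.E v)) i
            ((0 : Module.Dual ℝ ((C i).E v.proj)) ∘ₗ (h i).corePart v) = 0 := by
          rw [LinearMap.zero_comp, map_zero]
        exact h2 ▸ zero_mem _
    | some j =>
      obtain ⟨w, rfl⟩ := he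
      refine add_mem ?_ (sum_mem fun i _ => ?_)
      · have h2 : algebraMap ℝ (SymFib (fun i => (D i).overV) v)
            ((0 : Module.Dual ℝ (V.E v.proj)) v.2) = 0 := by
          rw [LinearMap.zero_apply, map_zero]
        exact h2 ▸ zero_mem _
      · by_cases hi : i = j
        · subst hi
          have h2 := GSym.ι_mem_piece (W := fun i => Module.Dual ℝ ((D i).overV.E v)) i
            ((Pi.single i w : ∀ i, Module.Dual ℝ ((C i).E v.proj)) i ∘ₗ (h i).corePart v)
          rwa [← one_mul ((i.val : ℤ) + 1)] at h2
        · have h2 : GSym.ι (W := fun i => Module.Dual ℝ ((D i).overV.E v)) i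
              ((Pi.single j w : ∀ i, Module.Dual ℝ ((C i).E v.proj)) i ∘ₗ (h i).corePart v) = 0 := by
            rw [Pi.single_eq_of_ne hi, LinearMap.zero_comp, map_zero]
          exact h2 ▸ zero_mem _
  · rw [map_zero]
    exact zero_mem _
  · intro y z hy hz
    rw [map_add]
    exact add_mem hy hz
  · intro t z hz
    rw [map_smul]
    exact Submodule.smul_mem _ _ hz

variable (h h' : ∀ i, (D i).Decomposition)

/-- The difference of two families of decompositions. -/
noncomputable abbrev diffs (i : Fin n) (m : M) : V.E m →ₗ[ℝ] (A i).E m →ₗ[ℝ] (C i).E m :=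
  (h i).diff (h' i) m

/-- The linear functions on `D` can be written with respect to either of two decompositions. -/
lemma exists_secToFun_eq {p : ℤ} {θ : SecMod A (gradedDual V C)} (hθ : HomSec p θ) :
    ∃ θ' : SecMod A (gradedDual V C), HomSec p θ' ∧ secToFun h θ' = secToFun h' θ := by
  obtain ⟨θ', h1, h2⟩ := exists_toFun h (isFibLinear_toFun h h' θ)
    (fun v => toFun_mem_piece h' v (hθ v.proj))
  exact ⟨θ', h1, Fun.ext fun v => (h2 v.proj v.2).symm⟩

/-- The shear by the difference of two decompositions is dual to the change of decomposition of the
linear functions on `D`. -/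
lemma pair_shear_diffs {θ θ' : SecMod A (gradedDual V C)} (hθ : secToFun h θ' = secToFun h' θ)
    (m : M) (z : ModFib A (graded V C) m) :
    pair m (shear A (graded V C) m (fun i => diffs h h' i m) z) (θ.1 m) = pair m z (θ'.1 m) := by
  have h0 : ∀ v : V.E m, toFun h ⟨m, v⟩ (θ'.1 m) = toFun h' ⟨m, v⟩ (θ.1 m) := fun v =>
    congrArg (fun ζ : Fun fun i => (D i).overV => ζ.1 ⟨m, v⟩) hθ
  refine pair_shear (fun v => ?_) (fun i c => ?_) z
  · rw [← liftPull_toFun_of_decomposition h h' v (θ.1 m), ← h0 v, liftPull_toFun]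
  · have h1 := congrArg (fun ζ => liftPull h ⟨m, 0⟩ (coreContract h ⟨m, 0⟩ i c ζ)) (h0 0)
    simp only at h1
    rw [coreContract_toFun, coreContract_eq h h', coreContract_toFun, liftPull_pull,
      liftPull_pull] at h1
    rw [← GSym.parity_pow_parity_pow (i.val + 1) (ctC V A C i c (θ'.1 m)), h1,
      GSym.parity_pow_parity_pow]

lemma smoothShear_diffs : SmoothShear A (graded V C) (diffs h h') := fun i _ _ he ha =>
  (h' i).contMDiff_corePart.comp ((h i).contMDiff_lift he ha)

lemma smoothShear_neg_diffs : SmoothShear A (graded V C) fun i m => -diffs h h' i m :=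
  fun i e a he ha => by
    have := VB.IsSec.const_smul (-1) (smoothShear_diffs h h' i e a he ha)
    simpa using this

/-- The automorphism of `V ⊕ C` given by the difference of two families of decompositions. -/
noncomputable def decShear : SecMod A (graded V C) ≃ₗ[Fun A] SecMod A (graded V C) :=
  shearEquiv (isGood_graded V C) (diffs h h') (smoothShear_diffs h h') (smoothShear_neg_diffs h h')

variable {h h'}

lemma pairFun_decShear {θ θ' : SecMod A (gradedDual V C)} (hθ : secToFun h θ' = secToFun h' θ)
    (η : SecMod A (graded V C)) : pairFun (decShear h h' η) θ = pairFun η θ' :=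
  Fun.ext fun m => pair_shear_diffs h h' hθ m (η.1 m)

lemma IsDual.Q_pairFun {Q : LieStr A} {R : Rep Q (graded V C)} {R' : Rep Q (gradedDual V C)}
    (hR : IsDual R R') {p : ℤ} {η : SecMod A (graded V C)} (hη : HomSec p η)
    (θ : SecMod A (gradedDual V C)) :
    Q.Q (pairFun η θ) = pairFun (R.D η) θ + sgn p • pairFun η (R'.D θ) := by
  obtain ⟨ξ, h1, h2⟩ := hR p η θ hη
  obtain rfl : ξ = pairFun η θ := Fun.ext h1
  exact Fun.ext h2

variable {QD : LieStr (fun i => (D i).overV)} {QA : LieStr A}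

/-- The shear intertwines the differentials of two decompositions: paired with any `θ`, both sides
are computed from `Q` on the function on `D` that `θ` defines by means of `h'`. -/
lemma decShear_comm {R R' : Rep QA (graded V C)} {S S' : Rep QA (gradedDual V C)}
    (hR : IsDual R S) (hR' : IsDual R' S') (hS : ∀ s, QD.Q (secToFun h s) = secToFun h (S.D s))
    (hS' : ∀ s, QD.Q (secToFun h' s) = secToFun h' (S'.D s)) (s : SecMod A (graded V C)) :
    decShear h h' (R.D s) = R'.D (decShear h h' s) := by
  let μ : SecMod A (graded V C) →+ SecMod A (graded V C) :=
    (decShear h h').toAddEquiv.toAddMonoidHom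
  have key : μ.comp R.D = R'.D.comp μ := by
    refine eq_of_homogeneous (W := graded V C) (W' := graded V C) (D := μ.comp R.D)
      (D' := R'.D.comp μ) (isGood_graded V C) ?_ ?_ fun p η hη => ?_
    · intro s t x hst
      exact congrArg (shear A (graded V C) x fun i => diffs h h' i x) (R.local hst)
    · intro s t x hst
      refine R'.local ?_
      filter_upwards [hst] with x' hx'
      exact congrArg (shear A (graded V C) x' fun i => diffs h h' i x') hx'
    · refine SecMod.ext fun x => eq_of_pair_homSec fun q θ hθ => ?_
      obtain ⟨θ', -, h1⟩ := exists_secToFun_eq h h' hθ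
      have h2 : secToFun h (S.D θ') = secToFun h' (S'.D θ) := by rw [← hS, ← hS', h1]
      have hη' : HomSec p (decShear h h' η) := fun x => shear_mem_modPiece rfl _ (hη x)
      have h3 := hR.Q_pairFun hη θ'
      have h4 := hR'.Q_pairFun hη' θ
      rw [pairFun_decShear h1, pairFun_decShear h2, h3] at h4
      have h5 : pairFun (decShear h h' (R.D η)) θ = pairFun (R'.D (decShear h h' η)) θ :=
        (pairFun_decShear h1 _).trans (add_right_cancel h4)
      exact congrArg (fun ξ : Fun A => ξ.1 x) h5
  exact DFunLike.congr_fun key s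

/-- The representations of two decompositions are isomorphic by means of the shear by the
difference of the decompositions. -/
theorem IsVBLie.exists_decomposition_iso (hD : IsVBLie D QD) (h h' : ∀ i, (D i).Decomposition) :
    ∃ R R' : Rep hD.side (graded V C),
      (Corresponds QD h R ∧ ∀ S, Corresponds QD h S → S = R) ∧
      (Corresponds QD h' R' ∧ ∀ S, Corresponds QD h' S → S = R') ∧
      ∃ Δ : ∀ i m, V.E m →ₗ[ℝ] (A i).E m →ₗ[ℝ] (C i).E m,
        ((∀ i, DVB.IsDifference (h i) (h' i) (Δ i)) ∧
          ∀ Δ' : ∀ i m, V.E m →ₗ[ℝ] (A i).E m →ₗ[ℝ] (C i).E m,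
            (∀ i, DVB.IsDifference (h i) (h' i) (Δ' i)) → Δ' = Δ) ∧
        ∃ iso : RepIso R R', ∀ s m,
          (iso.μ s).1 m = shear A (graded V C) m (fun i => Δ i m) (s.1 m) ∧
          (iso.μ.symm s).1 m = shear A (graded V C) m (fun i => -Δ i m) (s.1 m) := by
  obtain ⟨S, hS⟩ := hD.exists_dualRep h
  obtain ⟨S', hS'⟩ := hD.exists_dualRep h'
  obtain ⟨R, hR⟩ := Rep.exists_isDual S
  obtain ⟨R', hR'⟩ := Rep.exists_isDual S'
  refine ⟨R, R', ⟨hR.corresponds hS, fun _ => Corresponds.unique hR hS⟩,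
    ⟨hR'.corresponds hS', fun _ => Corresponds.unique hR' hS'⟩, diffs h h',
    ⟨fun i => (h i).isDifference_diff (h' i), fun Δ' hΔ' => funext fun i => (hΔ' i).unique⟩,
    shearIso (isGood_graded V C) rfl (diffs h h') (smoothShear_diffs h h')
      (smoothShear_neg_diffs h h') (decShear_comm hR hR' hS hS'), fun s m =>
      ⟨shearIso_apply _ _ _ _ _ _ s m, shearIso_symm_apply _ _ _ _ _ _ s m⟩⟩

end Change

end VBLie

theorem mainTheorem11 {d n : ℕ} {M : Type*} [TopologicalSpace M] [T2Space M]
    [SecondCountableTopology M] [ChartedSpace (EuclideanSpace ℝ (Fin d)) M]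
    [IsManifold (𝓡 d) ∞ M] :
    (∀ (V : VBLie.VB (𝓡 d) M) (A C : Fin n → VBLie.VB (𝓡 d) M)
        (D : ∀ i, VBLie.DVB V (A i) (C i)) (QD : VBLie.LieStr (fun i => (D i).overV)),
      VBLie.IsVBLie D QD →
      ∃ QA : VBLie.LieStr A, VBLie.IsSide D QD QA ∧ (∀ QA', VBLie.IsSide D QD QA' → QA' = QA) ∧
        ∀ h h' : ∀ i, (D i).Decomposition,
          ∃ R R' : VBLie.Rep QA (VBLie.graded V C),
            (VBLie.Corresponds QD h R ∧ ∀ S, VBLie.Corresponds QD h S → S = R) ∧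
            (VBLie.Corresponds QD h' R' ∧ ∀ S, VBLie.Corresponds QD h' S → S = R') ∧
            ∃ Δ : ∀ i m, V.E m →ₗ[ℝ] (A i).E m →ₗ[ℝ] (C i).E m,
              ((∀ i, VBLie.DVB.IsDifference (h i) (h' i) (Δ i)) ∧
                ∀ Δ' : ∀ i m, V.E m →ₗ[ℝ] (A i).E m →ₗ[ℝ] (C i).E m,
                  (∀ i, VBLie.DVB.IsDifference (h i) (h' i) (Δ' i)) → Δ' = Δ) ∧
              ∃ iso : VBLie.RepIso R R', ∀ s m,
                (iso.μ s).1 m =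
                  VBLie.shear A (VBLie.graded V C) m (fun i => Δ i m) (s.1 m) ∧
                (iso.μ.symm s).1 m =
                  VBLie.shear A (VBLie.graded V C) m (fun i => -Δ i m) (s.1 m)) ∧
    (∀ (A : Fin n → VBLie.VB (𝓡 d) M) (Q : VBLie.LieStr A)
        (cov cov' : ∀ i, CovariantDerivative (𝓡 d) (A i).F (A i).E),
      (∀ i, CovariantDerivative.ContMDiffCovariantDerivative (cov i) ∞) →
      (∀ i, CovariantDerivative.ContMDiffCovariantDerivative (cov' i) ∞) →
      ∃ R R' : VBLie.Rep Q (VBLie.adjointBundle A),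
        (VBLie.IsAdjoint cov R ∧ ∀ S, VBLie.IsAdjoint cov S → S = R) ∧
        (VBLie.IsAdjoint cov' R' ∧ ∀ S, VBLie.IsAdjoint cov' S → S = R') ∧
        ∃ iso : VBLie.RepIso R R', ∀ s m,
          (iso.μ s).1 m = VBLie.shear A (VBLie.adjointBundle A) m
            (fun i => ((cov' i).difference (cov i) m).toLinearMap₁₂.flip) (s.1 m) ∧
          (iso.μ.symm s).1 m = VBLie.shear A (VBLie.adjointBundle A) m
            (fun i => ((cov i).difference (cov' i) m).toLinearMap₁₂.flip) (s.1 m)) := by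
  refine ⟨fun V A C D QD hD => ⟨hD.side, hD.isSide, fun QA' hQ => hD.eq_side hQ, fun h h' =>
    hD.exists_decomposition_iso h h'⟩,
    fun A Q cov cov' hcov hcov' => VBLie.exists_adjoint_iso Q hcov hcov'⟩
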